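/- **Setting.** Let $M$ be a 4-dimensional complex manifold, or a 4-dimensional real-analytic manifold; all fields are complex valued and analytic (holomorphic, respectively real-analytic; in the real case vectors are complexified). Let $g_{ab}$ be a metric (any signature). All considerations are local, on an open set $U\subseteq M$ with a spin frame, i.e. a null tetrad $e_{AA'}$ with $g(e_{AA'},e_{BB'})=\epsilon_{AB}\epsilon_{A'B'}$; spinor indices are moved with $\epsilon_{AB},\epsilon_{A'B'}$ as usual ($\xi_B=\xi^A\epsilon_{AB}$, $\xi^A=\epsilon^{AB}\xi_B$). Let $\nabla_a$ be the Levi-Civita connection. For a 1-form $\mathrm w_a$, the Weyl connection $\nabla^{\mathrm w}_a$ is the torsion-free connection with $\nabla^{\mathrm w}_ag_{bc}=-2\mathrm w_ag_{bc}$, extended to spinors by $\nabla^{\mathrm w}_a\epsilon_{BC}=-\mathrm w_a\epsilon_{BC}$, $\nabla^{\mathrm w}_a\epsilon_{B'C'}=-\mathrm w_a\epsilon_{B'C'}$; its curvature is given by $[\nabla^{\mathrm w}_a,\nabla^{\mathrm w}_b]v^d=R^{\mathrm w}_{abc}{}^dv^c$. The ASD and SD Weyl spinors $\Psi_{ABCD}$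 and $\tilde\Psi_{A'B'C'D'}$ are the totally symmetric parts of $\tfrac14\epsilon^{A'B'}\epsilon^{C'D'}R_{abcd}$ and $\tfrac14\epsilon^{AB}\epsilon^{CD}R_{abcd}$, where $R_{abcd}=R_{abc}{}^eg_{ed}$ is the Riemann tensor of $g$. Let $o^A,\iota^A$ be spinor fields on $U$ with $o_A\iota^A=1$, let $J^a{}_b=i(o^A\iota_B+\iota^Ao_B)\delta^{A'}{}_{B'}$ be the corresponding almost-complex structure and $f_a=-\tfrac12J^b{}_c\nabla_bJ^c{}_a$ its Lee form. Put $P_a=\iota_B\nabla^{\mathrm f}_ao^B$. On a spinor field $\varphi$ of weights $(p,w)$, i.e. one which becomes $\lambda^p\Omega^w\varphi$ under the change of gauge $g\to\Omega^2g$, $o^A\to\lambda o^A$, $\iota^A\to\lambda^{-1}\Omega^{-1}\iota^A$, set $$\mathcal C_a\varphi=\nabla^{\mathrm f}_a\varphi+(wf_a+pP_a)\varphi,\qquad \tilde{\mathcal C}_{A'}=o^A\mathcal C_{AA'},\qquad \Box^{\mathcal C}=g^{ab}\mathcal C_a\mathcal C_b ;$$ $\tilde{\mathcal C}_{A'}$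 raises $p$ by one. Let $\mathcal R=g^{ac}R^{\mathrm f}_{abc}{}^b$ be the scalar curvature of $\nabla^{\mathrm f}$. **Theorem.** Let $\mathrm w_a$ be a closed Weyl 1-form, written on $U$ as $\mathrm w_a=-\partial_a\log\mathring\Omega$ with an analytic nowhere vanishing function $\mathring\Omega$, of weights $(0,1)$ (such $\mathring\Omega$ exists locally), and assume on $U$: 1. the Einstein–Weyl equations: the symmetric part of $R^{\mathrm w}_{abc}{}^b$ is a function times $g_{ac}$; 2. $o^A$ is shear-free: $o^Ao^B\nabla_{AA'}o_B=0$; 3. $o^A$ is a repeated principal spinor: $\Psi_{ABCD}o^Bo^Co^D=0$; 4. the Lee form is a gradient, $f_a=\partial_a\log\phi$ for some analytic nowhere vanishing function $\phi$ on $U$. Then every point of $U$ has an open neighbourhood $V\subseteq U$ with analytic scalar fields $\Phi$ of weights $(p,w)=(-4,-1)$ and $K$ of weights $(-4,-3)$ on $V$ such that $$\tilde\Psi_{A'B'C'D'}=\mathring\Omega\,\tilde{\mathcal C}_{A'}\tilde{\mathcal C}_{B'}\tilde{\mathcal C}_{C'}\tilde{\mathcal C}_{D'}\Phi,$$ $$\big(\Box^{\mathcal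 C}+\tfrac32\mathcal R\big)\Phi+\mathring\Omega\,(\tilde{\mathcal C}_{A'}\tilde{\mathcal C}_{B'}\Phi)(\tilde{\mathcal C}^{A'}\tilde{\mathcal C}^{B'}\Phi)-4(\tilde{\mathcal C}^{A'}\mathring\Omega)(\tilde{\mathcal C}^{B'}\Phi)(\tilde{\mathcal C}_{A'}\tilde{\mathcal C}_{B'}\Phi)=2K,$$ $$\tilde{\mathcal C}_{A'}\tilde{\mathcal C}_{B'}\tilde{\mathcal C}_{C'}K=0 .$$ These equations are gauge and conformally invariant: for all analytic nowhere vanishing $\lambda$ and $\Omega=s^2$ on $V$ they also hold for $\Omega^2g$, $\lambda o^A$, $\lambda^{-1}\Omega^{-1}\iota^A$ with $\Omega\mathring\Omega$, $\lambda^{-4}\Omega^{-1}\Phi$, $\lambda^{-4}\Omega^{-3}K$ in place of $g$, $o^A$, $\iota^A$, $\mathring\Omega$, $\Phi$, $K$. -/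

import Mathlib

open scoped Manifold ContDiff TensorProduct

noncomputable section

namespace ConformalHH

/-! ### Complex-valued calculus on a real-analytic or complex 4-manifold

`𝕜` is `ℝ` (real-analytic manifolds, any signature) or `ℂ` (complex manifolds). All fields are
complex valued; `C^ω` over `𝕜` means real-analytic if `𝕜 = ℝ` and holomorphic if `𝕜 = ℂ`. -/

/-- The tangent space at a point of a manifold modelled on `𝕜⁴`. -/
abbrev T (𝕜 : Type*) [RCLike 𝕜] {M : Type*} [TopologicalSpace M]
    [ChartedSpace (Fin 4 → 𝕜) M] (x : M) : Type _ :=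
  TangentSpace 𝓘(𝕜, Fin 4 → 𝕜) x

/-- The complexified tangent space `ℂ ⊗ T_x M` (canonically `T_x M` itself if `𝕜 = ℂ`). -/
abbrev CT (𝕜 : Type*) [RCLike 𝕜] [NormedAlgebra 𝕜 ℂ] {M : Type*} [TopologicalSpace M]
    [ChartedSpace (Fin 4 → 𝕜) M] (x : M) : Type _ :=
  ℂ ⊗[𝕜] T 𝕜 x

section Calculus

variable {𝕜 : Type*} [RCLike 𝕜] [NormedAlgebra 𝕜 ℂ] {M : Type*} [TopologicalSpace M]
  [ChartedSpace (Fin 4 → 𝕜) M]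

variable (𝕜) in
/-- The differential of a complex-valued function, as a complex-valued covector. -/
def diff (f : M → ℂ) (x : M) : T 𝕜 x →ₗ[𝕜] ℂ :=
  (mfderiv 𝓘(𝕜, Fin 4 → 𝕜) 𝓘(𝕜, ℂ) f x).toLinearMap

/-- The function `V f = df(V)`, for a complex vector field `V`. -/
def dirDeriv (V : ∀ x : M, CT 𝕜 x) (f : M → ℂ) (x : M) : ℂ :=
  (diff 𝕜 f x).liftBaseChange ℂ (V x)

variable (𝕜) in
/-- The `i`-th coordinate function of the preferred chart at `x₀`, as a complex-valued function. -/
def coord (x₀ : M) (i : Fin 4) (y : M) : ℂ :=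
  algebraMap 𝕜 ℂ (extChartAt 𝓘(𝕜, Fin 4 → 𝕜) x₀ y i)

/-- The coordinate vector `∂_i` at `x`, for the preferred chart at `x`
(through which Mathlib identifies `T_x M` with `𝕜⁴`). -/
def coordVec (x : M) (i : Fin 4) : T 𝕜 x := (Pi.single i 1 : Fin 4 → 𝕜)

/-- The Lie bracket `[V, W]` of complex vector fields, computed at each point `x` in the preferred
chart at `x`: the sum of `(V (W ξⁱ) - W (V ξⁱ)) ∂_i`. -/
def lieBracket (V W : ∀ x : M, CT 𝕜 x) (x : M) : CT 𝕜 x :=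
  ∑ i : Fin 4, (dirDeriv V (dirDeriv W (coord 𝕜 x i)) x
    - dirDeriv W (dirDeriv V (coord 𝕜 x i)) x) ⊗ₜ[𝕜] coordVec x i

/-- `V` is a `C^ω` vector field on `U`: its chart components are `C^ω`. -/
def IsAnalyticVectorField (V : ∀ x : M, CT 𝕜 x) (U : Set M) : Prop :=
  ∀ x ∈ U, ∀ i : Fin 4,
    ContMDiffAt 𝓘(𝕜, Fin 4 → 𝕜) 𝓘(𝕜, ℂ) ω (dirDeriv V (coord 𝕜 x i)) x

end Calculus

/-! ### Spinor algebra -/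

/-- The components of `ε_{AB}`, `ε^{AB}`, `ε_{A'B'}`, `ε^{A'B'}` in a normalised spin frame. -/
def eps (A B : Fin 2) : ℂ := !![0, 1; -1, 0] A B

/-- A spacetime frame index `a = AA'`. -/
abbrev Idx : Type := Fin 2 × Fin 2

/-- `g_{ab} = ε_{AB} ε_{A'B'}`; the same array represents `g^{ab} = ε^{AB} ε^{A'B'}`. -/
def eta (a b : Idx) : ℂ := eps a.1 b.1 * eps a.2 b.2

/-- The Kronecker delta. -/
def delta {I : Type} [DecidableEq I] (i j : I) : ℂ := if i = j then 1 else 0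

/-- Spinor fields with `m` lower unprimed and `n` lower primed indices, by their components. -/
abbrev Spinor (M : Type*) (m n : ℕ) : Type _ := (Fin m → Fin 2) → (Fin n → Fin 2) → M → ℂ

/-- A scalar field as a spinor field without indices. -/
def scalar {M : Type*} (f : M → ℂ) : Spinor M 0 0 := fun _ _ => f

/-- The data: a metric, a spin frame (given through the associated null tetrad `e_{AA'}`), and the
components `o^A`, `ι^A` in that frame of the two spinor fields which represent the almost-complex
structure. The laws are in `SpinGeometry.IsRegularOn`. -/
structure SpinGeometry (𝕜 : Type*) [RCLike 𝕜] [NormedAlgebra 𝕜 ℂ] (M : Type*)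
    [TopologicalSpace M] [ChartedSpace (Fin 4 → 𝕜) M] where
  /-- the (complex-valued) metric `g_{ab}` -/
  metric : ∀ x : M, T 𝕜 x →ₗ[𝕜] T 𝕜 x →ₗ[𝕜] ℂ
  /-- the null tetrad `e_{AA'}` -/
  frame : Idx → ∀ x : M, CT 𝕜 x
  /-- the components `o^A` -/
  o : Fin 2 → M → ℂ
  /-- the components `ι^A` -/
  iota : Fin 2 → M → ℂ

namespace SpinGeometry

variable {𝕜 : Type*} [RCLike 𝕜] [NormedAlgebra 𝕜 ℂ] {M : Type*} [TopologicalSpace M]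
  [ChartedSpace (Fin 4 → 𝕜) M]

/-- The complex-bilinear extension of the metric to `ℂ ⊗ T_x M`. -/
def metricC (D : SpinGeometry 𝕜 M) (x : M) : CT 𝕜 x →ₗ[ℂ] CT 𝕜 x →ₗ[ℂ] ℂ :=
  ((((LinearMap.liftBaseChangeEquiv (R := 𝕜) (M := T 𝕜 x) (N := ℂ) ℂ).toLinearMap).restrictScalars 𝕜)
    ∘ₗ (D.metric x)).liftBaseChange ℂ

/-- On `U`, the frame is analytic and is a null tetrad, `g(e_{AA'}, e_{BB'}) = ε_{AB} ε_{A'B'}`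
(so that `g` is symmetric, nondegenerate and analytic there), and the spinor fields `o`, `ι` are
analytic and normalised by `o_A ι^A = 1`. -/
structure IsRegularOn (D : SpinGeometry 𝕜 M) (U : Set M) : Prop where
  analytic_frame : ∀ a, IsAnalyticVectorField (D.frame a) U
  null_tetrad : ∀ x ∈ U, ∀ a b, D.metricC x (D.frame a x) (D.frame b x) = eta a b
  analytic_o : ∀ A, ContMDiffOn 𝓘(𝕜, Fin 4 → 𝕜) 𝓘(𝕜, ℂ) ω (D.o A) U
  analytic_iota : ∀ A, ContMDiffOn 𝓘(𝕜, Fin 4 → 𝕜) 𝓘(𝕜, ℂ) ω (D.iota A) U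
  normalised : ∀ x ∈ U, ∑ A, ∑ B, D.o B x * eps B A * D.iota A x = 1

variable (D : SpinGeometry 𝕜 M)

/-- The frame derivative `e_a f`. -/
def der (a : Idx) (f : M → ℂ) : M → ℂ := dirDeriv (D.frame a) f

/-- The frame components `w_a` of a 1-form. -/
def comp (w : ∀ x : M, T 𝕜 x →ₗ[𝕜] ℂ) (a : Idx) (x : M) : ℂ :=
  (w x).liftBaseChange ℂ (D.frame a x)

/-- The lowered components `o_B = o^A ε_{AB}`. -/
def oLow (B : Fin 2) (x : M) : ℂ := ∑ A, D.o A x * eps A B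

/-- The lowered components `ι_B = ι^A ε_{AB}`. -/
def iotaLow (B : Fin 2) (x : M) : ℂ := ∑ A, D.iota A x * eps A B

/-! #### Levi-Civita and Weyl connections, curvature -/

/-- `g([e_a, e_b], e_c)`. -/
def structLow (a b c : Idx) (x : M) : ℂ :=
  D.metricC x (lieBracket (D.frame a) (D.frame b) x) (D.frame c x)

/-- The structure functions: `[e_a, e_b] = c_{ab}^c e_c`. -/
def struct (a b c : Idx) (x : M) : ℂ := ∑ d, eta c d * D.structLow a b d x

/-- The Levi-Civita connection coefficients `∇_{e_a} e_b = Γ_{ab}^c e_c` (Koszul formula in a frame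
with constant metric components). -/
def leviCivita (a b c : Idx) (x : M) : ℂ :=
  ∑ d, eta c d * ((1 / 2) * (D.structLow a b d x - D.structLow b d a x + D.structLow d a b x))

/-- The coefficients of the Weyl connection with Weyl 1-form `w` (characterised by being torsion-free
with `∇_a g_{bc} = -2 w_a g_{bc}`): `Γ_{ab}^c + w_a δ_b^c + w_b δ_a^c - w^c g_{ab}`. -/
def weylConn (w : Idx → M → ℂ) (a b c : Idx) (x : M) : ℂ :=
  D.leviCivita a b c x + w a x * delta b c + w b x * delta a c
    - (∑ d, eta c d * w d x) * eta a b

/-- The curvature tensor `R_{abc}^d` of a Weyl connection,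
`[∇_a, ∇_b] v^d = R_{abc}^d v^c`. -/
def curv (w : Idx → M → ℂ) (a b c d : Idx) (x : M) : ℂ :=
  D.der a (D.weylConn w b c d) x - D.der b (D.weylConn w a c d) x
    + ∑ e, (D.weylConn w a e d x * D.weylConn w b c e x
      - D.weylConn w b e d x * D.weylConn w a c e x
      - D.struct a b e x * D.weylConn w e c d x)

/-- The Ricci tensor `R_{ac} = R_{abc}^b` of a Weyl connection. -/
def ricci (w : Idx → M → ℂ) (a c : Idx) (x : M) : ℂ := ∑ b, D.curv w a b c b x

/-- The scalar curvature `g^{ac} R_{ac}` of a Weyl connection. -/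
def scalarCurv (w : Idx → M → ℂ) (x : M) : ℂ := ∑ a, ∑ c, eta a c * D.ricci w a c x

/-- The Riemann tensor `R_{abcd} = R_{abc}^e g_{ed}` of the metric. -/
def riemann (a b c d : Idx) (x : M) : ℂ := ∑ e, D.curv (fun _ _ => 0) a b c e x * eta e d

/-- The ASD Weyl spinor `Ψ_{ABCD}`: the totally symmetric part of
`X_{ABCD} = ¼ ε^{A'B'} ε^{C'D'} R_{abcd}`. -/
def weylASD (I : Fin 4 → Fin 2) (x : M) : ℂ :=
  (1 / 24) * ∑ σ : Equiv.Perm (Fin 4), (1 / 4) * ∑ A' : Fin 2, ∑ B' : Fin 2, ∑ C' : Fin 2,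
    ∑ D' : Fin 2, eps A' B' * eps C' D'
      * D.riemann (I (σ 0), A') (I (σ 1), B') (I (σ 2), C') (I (σ 3), D') x

/-- The SD Weyl spinor `Ψ̃_{A'B'C'D'}`: the totally symmetric part of
`X̃_{A'B'C'D'} = ¼ ε^{AB} ε^{CD} R_{abcd}`. -/
def weylSD (I : Fin 4 → Fin 2) (x : M) : ℂ :=
  (1 / 24) * ∑ σ : Equiv.Perm (Fin 4), (1 / 4) * ∑ A : Fin 2, ∑ B : Fin 2, ∑ C : Fin 2,
    ∑ E : Fin 2, eps A B * eps C E
      * D.riemann (A, I (σ 0)) (B, I (σ 1)) (C, I (σ 2)) (E, I (σ 3)) x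

/-! #### Derivatives of spinors -/

/-- Spin coefficients `γ_{aB}^C` on unprimed spinors of the Weyl connection with Weyl 1-form `w`. The
tensor coefficients split as `γ_{aB}^C δ_{B'}^{C'} + γ'_{aB'}^{C'} δ_B^C`, uniquely so if
`γ_{aB}^B = γ'_{aB'}^{B'} = w_a`, that is `∇_a ε_{BC} = -w_a ε_{BC}`, `∇_a ε_{B'C'} = -w_a ε_{B'C'}`. -/
def spinConn (w : Idx → M → ℂ) (a : Idx) (B C : Fin 2) (x : M) : ℂ :=
  (1 / 2) * ((∑ B' : Fin 2, D.weylConn w a (B, B') (C, B') x) - w a x * delta B C)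

/-- Spin coefficients `γ'_{aB'}^{C'}` on primed spinors of the Weyl connection with 1-form `w`. -/
def spinConn' (w : Idx → M → ℂ) (a : Idx) (B' C' : Fin 2) (x : M) : ℂ :=
  (1 / 2) * ((∑ B : Fin 2, D.weylConn w a (B, B') (B, C') x) - w a x * delta B' C')

/-- The covariant derivative `∇_a ψ` of a spinor field for the Weyl connection with 1-form `w`
(the Levi-Civita one if `w = 0`). -/
def nabla (w : Idx → M → ℂ) {m n : ℕ} (a : Idx) (ψ : Spinor M m n) : Spinor M m n :=
  fun I J x => D.der a (ψ I J) x
    - (∑ k, ∑ B, D.spinConn w a (I k) B x * ψ (Function.update I k B) J x)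
    - (∑ k, ∑ B', D.spinConn' w a (J k) B' x * ψ I (Function.update J k B') x)

/-! #### The almost-complex structure, its Lee form, and the connection `𝒞` -/

/-- `J^a_b = i (o^A ι_B + ι^A o_B) δ^{A'}_{B'}`. -/
def J (a b : Idx) (x : M) : ℂ :=
  Complex.I * (D.o a.1 x * D.iotaLow b.1 x + D.iota a.1 x * D.oLow b.1 x) * delta a.2 b.2

/-- `∇_b J^c_a`, for the Levi-Civita connection. -/
def nablaJ (b c a : Idx) (x : M) : ℂ :=
  D.der b (D.J c a) x
    + ∑ d, (D.leviCivita b d c x * D.J d a x - D.leviCivita b a d x * D.J c d x)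

/-- The Lee form `f_a = -½ J^b_c ∇_b J^c_a`. -/
def lee (a : Idx) (x : M) : ℂ := -(1 / 2) * ∑ b, ∑ c, D.J b c x * D.nablaJ b c a x

/-- `P_a = ι_B ∇^f_a o^B`, with `∇^f` the Weyl connection of the Lee form. -/
def P (a : Idx) (x : M) : ℂ :=
  ∑ B, D.iotaLow B x * (D.der a (D.o B) x + ∑ C, D.spinConn D.lee a C B x * D.o C x)

/-- The complex-conformal connection on fields of weights `(p, w)`:
`𝒞_a ψ = ∇^f_a ψ + (w f_a + p P_a) ψ`. -/
def conn (p w : ℤ) {m n : ℕ} (a : Idx) (ψ : Spinor M m n) : Spinor M m n :=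
  fun I J x => D.nabla D.lee a ψ I J x + ((w : ℂ) * D.lee a x + (p : ℂ) * D.P a x) * ψ I J x

/-- `𝒞̃_{A'} = o^A 𝒞_{AA'}` on fields of weights `(p, w)` with `n` primed indices: the field
`𝒞̃_{A'} ψ_{B'…}`, with `A'` as its first index; it has weights `(p + 1, w)`. -/
def connT (p w : ℤ) {n : ℕ} (ψ : Spinor M 0 n) : Spinor M 0 (n + 1) :=
  fun I J x => ∑ A, D.o A x * D.conn p w (A, J 0) ψ I (Fin.tail J) x

/-- `𝒞̃_{A'} f` for a scalar `f` of weights `(p, w)`. -/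
def connT1 (p w : ℤ) (f : M → ℂ) : Spinor M 0 1 := D.connT p w (scalar f)

/-- `𝒞̃_{A'} 𝒞̃_{B'} f` for a scalar `f` of weights `(p, w)`. -/
def connT2 (p w : ℤ) (f : M → ℂ) : Spinor M 0 2 := D.connT (p + 1) w (D.connT1 p w f)

/-- `𝒞̃_{A'} 𝒞̃_{B'} 𝒞̃_{C'} f` for a scalar `f` of weights `(p, w)`. -/
def connT3 (p w : ℤ) (f : M → ℂ) : Spinor M 0 3 := D.connT (p + 2) w (D.connT2 p w f)

/-- `𝒞̃_{A'} 𝒞̃_{B'} 𝒞̃_{C'} 𝒞̃_{D'} f` for a scalar `f` of weights `(p, w)`. -/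
def connT4 (p w : ℤ) (f : M → ℂ) : Spinor M 0 4 := D.connT (p + 3) w (D.connT3 p w f)

/-- The wave operator `□^𝒞 f = g^{ab} 𝒞_a 𝒞_b f` on scalars of weights `(p, w)`. -/
def box (p w : ℤ) (f : M → ℂ) (x : M) : ℂ :=
  ∑ a : Idx, ∑ b : Idx, eta a b *
    D.conn p w a (fun (I : Fin 1 → Fin 2) (J : Fin 1 → Fin 2) =>
      D.conn p w (I 0, J 0) (scalar f) ![] ![]) ![b.1] ![b.2] x

/-- Raised components `ψ^{A'} = ε^{A'B'} ψ_{B'}`. -/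
def raise1 (ψ : Spinor M 0 1) (A' : Fin 2) (x : M) : ℂ := ∑ B', eps A' B' * ψ ![] ![B'] x

/-- Raised components `ψ^{A'B'} = ε^{A'C'} ε^{B'D'} ψ_{C'D'}`. -/
def raise2 (ψ : Spinor M 0 2) (A' B' : Fin 2) (x : M) : ℂ :=
  ∑ C', ∑ D', eps A' C' * eps B' D' * ψ ![] ![C', D'] x

/-! #### The hypotheses and the conclusion -/

/-- `o^A` is shear-free: `o^A o^B ∇_{AA'} o_B = 0`, with the Levi-Civita connection. -/
def IsShearFreeOn (U : Set M) : Prop :=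
  ∀ x ∈ U, ∀ A' : Fin 2, ∑ A, ∑ B, D.o A x * D.o B x *
    D.nabla (fun _ _ => 0) (A, A')
      (fun (I : Fin 1 → Fin 2) (_ : Fin 0 → Fin 2) => D.oLow (I 0)) ![B] ![] x = 0

/-- `o^A` is a repeated principal spinor of the ASD Weyl spinor: `Ψ_{ABCD} o^B o^C o^D = 0`. -/
def IsRepeatedPrincipalOn (U : Set M) : Prop :=
  ∀ x ∈ U, ∀ A : Fin 2, ∑ B, ∑ C, ∑ E,
    D.weylASD ![A, B, C, E] x * D.o B x * D.o C x * D.o E x = 0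

/-- The Lee form is a logarithmic gradient, `f_a = ∂_a log φ`. -/
def HasGradientLeeFormOn (U : Set M) : Prop :=
  ∃ φ : M → ℂ, ContMDiffOn 𝓘(𝕜, Fin 4 → 𝕜) 𝓘(𝕜, ℂ) ω φ U ∧
    ∀ x ∈ U, φ x ≠ 0 ∧ ∀ a, φ x * D.lee a x = D.der a φ x

/-- The Einstein–Weyl equations for the Weyl connection with 1-form `w`: the symmetrised Ricci tensor
is proportional to the metric. -/
def IsEinsteinWeylOn (w : ∀ x : M, T 𝕜 x →ₗ[𝕜] ℂ) (U : Set M) : Prop :=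
  ∃ Λ : M → ℂ, ∀ x ∈ U, ∀ a c,
    D.ricci (D.comp w) a c x + D.ricci (D.comp w) c a x = Λ x * eta a c

/-- On `V`, with `Ω` of weights `(0, 1)`, `Φ` of weights `(-4, -1)` and `K` of weights `(-4, -3)`:
`Ψ̃_{A'B'C'D'} = Ω 𝒞̃_{A'} 𝒞̃_{B'} 𝒞̃_{C'} 𝒞̃_{D'} Φ`, the conformally invariant hyper-heavenly equation
with right-hand side `2K`, and `𝒞̃_{A'} 𝒞̃_{B'} 𝒞̃_{C'} K = 0`. Here `D.scalarCurv D.lee` is the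
scalar curvature `ℛ` of `𝒞`. -/
structure IsHHPotentialOn (Ω Φ K : M → ℂ) (V : Set M) : Prop where
  weyl_eq : ∀ x ∈ V, ∀ I : Fin 4 → Fin 2, D.weylSD I x = Ω x * D.connT4 (-4) (-1) Φ ![] I x
  hh_eq : ∀ x ∈ V,
    D.box (-4) (-1) Φ x + 3 * D.scalarCurv D.lee x / 2 * Φ x
      + Ω x * (∑ A', ∑ B', D.connT2 (-4) (-1) Φ ![] ![A', B'] x
          * raise2 (D.connT2 (-4) (-1) Φ) A' B' x)
      - 4 * (∑ A', ∑ B', raise1 (D.connT1 0 1 Ω) A' x * raise1 (D.connT1 (-4) (-1) Φ) B' x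
          * D.connT2 (-4) (-1) Φ ![] ![A', B'] x)
      = 2 * K x
  const_eq : ∀ x ∈ V, ∀ I : Fin 3 → Fin 2, D.connT3 (-4) (-3) K ![] I x = 0

/-- The same conformal and almost-complex structure in another gauge: with `Ω = s²`, the metric becomes
`Ω² g`, the spinors become `λ o^A` and `λ⁻¹ Ω⁻¹ ι^A` (so that `o_A ι^A = 1` is kept). The normalised
spin frames are rescaled by `Ω^{-1/2} = s⁻¹`, which multiplies components with an upper index by `s`. -/
def gauge (lam s : M → ℂ) : SpinGeometry 𝕜 M where
  metric x := (s x ^ 4) • D.metric x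
  frame a x := ((s x ^ 2)⁻¹) • D.frame a x
  o A x := lam x * s x * D.o A x
  iota A x := (lam x)⁻¹ * (s x ^ 2)⁻¹ * s x * D.iota A x

end SpinGeometry

/-- The transformation `f ↦ λ^p Ω^w f` of a scalar field of weights `(p, w)`, with `Ω = s²`. -/
def rescale {M : Type*} (lam s : M → ℂ) (p w : ℤ) (f : M → ℂ) (x : M) : ℂ :=
  lam x ^ p * (s x ^ 2) ^ w * f x

end ConformalHH

end

/-!
The idea is to reduce the geometry to one normal form, in which the theorem is a statement about
polynomial differential identities.

*Normal form.* As `o` is shear-free, the fields `o^A e_{AA'}` span an involutive distribution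
(`strR_eq_zero_of_shearFree`), whose leaves are the level sets of two functions `q^0`, `q^1`. The Lee
form is `d log φ`, so it vanishes for the metric `φ² g`; this is what allows one to choose, for `φ² g`,
a null tetrad made of leaf fields `X_A = ∂/∂p^A` and of `Y_A = ∂/∂q^A + Q_A^B ∂/∂p^B` with a trace-free
matrix `Q` (`strR_of_leeR_eq`, `exists_normalCoords`). All that remains of the geometry is the three
functions in `Q` and `O = Ω₀ φ`.

*Field equations.* In the normal tetrad the Einstein–Weyl equations of `-d log Ω₀` become the equations
of `IsEWJet` (`isEWJet_of_ricci`). The `XX` part says that `O` is affine along the leaves. The SD Weyl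
spinor of the tetrad is the symmetric part of `X_A X_B Q_CD`, and the leaf derivatives of the `XY` part
are the integrability conditions for writing it as `O X_A X_B X_C X_D F` (`IsEWJet.compat0` to
`IsEWJet.compat3`, `IsEWJet.exists_potential`, `weyl_nfS`). With such a potential `F`, the `YY` part
implies that the left-hand side of the hyper-heavenly equation is annihilated by all third leaf
derivatives (`IsJet.der_hhExpr`); half of it is `K`.

*Covariance.* `𝒞̃_{A'}` acts in the normal tetrad as `X_A`, on fields multiplied by a suitable weight
factor. The transformation laws of Weyl connections, spinor connections, curvature and `𝒞` under a change
of spin frame with a conformal rescaling (`FrameChange`, `SpinChange`, `NormalChange`) therefore carry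
`F` and `K` to fields of weights `(-4, -1)` and `(-4, -3)` for the original tetrad
(`NormalChange.isHHPotentialR`). The normal tetrad is also one for every other gauge, with another weight
factor (`adE_gauge`), so the same computation gives the equations in all gauges.

*From algebra to analysis.* These steps are carried out for a `ℂ`-algebra `R` with derivations, and
applied to rings of germs of analytic functions (`AnR`, along the neighbourhoods of a point or along an
open set). Existence of coordinates and potential needs the Frobenius theorem with complex-valued vector
fields on a real or complex space; for analytic data it follows from the convergence of the Lie series
solving `Z u = h` (`exists_lieSeries`, `LocalModel`, `LocalModel.exists_primitive_of_involutive`). The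
finitely many equations which make up the normal form hold as germs at a point, hence in a neighbourhood
(`jetDefect`, `SpinGeometry.exists_isJet_nhds`).
-/

open scoped Manifold ContDiff TensorProduct

noncomputable section

namespace ConformalHH

/-! ### Monomial series on polydiscs -/

section Majorant

open Finset

variable {𝕜 : Type*} [RCLike 𝕜] [NormedAlgebra 𝕜 ℂ]

variable (𝕜) in
/-- The `i`-th coordinate on `𝕜⁴`, as a continuous `𝕜`-linear map to `ℂ`. -/
def cproj (i : Fin 4) : (Fin 4 → 𝕜) →L[𝕜] ℂ :=
  (Algebra.ofId 𝕜 ℂ).toLinearMap.mkContinuous 1 (fun z => by simp [Algebra.ofId_apply]) ∘L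
    ContinuousLinearMap.proj i

lemma cproj_apply (i : Fin 4) (y : Fin 4 → 𝕜) : cproj 𝕜 i y = algebraMap 𝕜 ℂ (y i) := rfl

lemma norm_cproj_apply_le (i : Fin 4) (y : Fin 4 → 𝕜) : ‖cproj 𝕜 i y‖ ≤ ‖y‖ := by
  simpa [cproj_apply] using norm_le_pi_norm y i

lemma norm_cproj_le (i : Fin 4) : ‖cproj 𝕜 i‖ ≤ 1 :=
  ContinuousLinearMap.opNorm_le_bound _ zero_le_one fun y => by
    simpa using norm_cproj_apply_le i y

/-- The monomial `y ^ α`, as a complex-valued function on `𝕜⁴`. -/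
def mono (α : Fin 4 → ℕ) (y : Fin 4 → 𝕜) : ℂ := ∏ i, cproj 𝕜 i y ^ α i

lemma mono_add (α β : Fin 4 → ℕ) (y : Fin 4 → 𝕜) : mono (α + β) y = mono α y * mono β y := by
  simp [mono, pow_add, prod_mul_distrib]

lemma norm_mono_le (α : Fin 4 → ℕ) {y : Fin 4 → 𝕜} {r : ℝ} (hy : ‖y‖ ≤ r) :
    ‖mono α y‖ ≤ r ^ (∑ i, α i) := by
  rw [mono, norm_prod, ← prod_pow_eq_pow_sum]
  refine prod_le_prod (fun _ _ => norm_nonneg _) fun i _ => ?_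
  rw [norm_pow]
  exact pow_le_pow_left₀ (norm_nonneg _) ((norm_cproj_apply_le i y).trans hy) _

/-- `f` is, on the open polydisc of radius `r` about the origin, the sum of a family of monomial terms
whose majorant series at `r` has sum at most `N`. The index type is arbitrary: a monomial may occur
several times, so that sums, products and derivatives need no rearrangement. -/
def Maj (r N : ℝ) (f : (Fin 4 → 𝕜) → ℂ) : Prop :=
  ∃ (J : Type) (c : J → ℂ) (α : J → Fin 4 → ℕ),
    (Summable fun j => ‖c j‖ * r ^ (∑ i, α j i)) ∧ (∑' j, ‖c j‖ * r ^ (∑ i, α j i)) ≤ N ∧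
    ∀ y : Fin 4 → 𝕜, ‖y‖ < r → HasSum (fun j => c j * mono (α j) y) (f y)

lemma _root_.HasSum.congr_fun' {J : Type*} {f g : J → ℂ} {a : ℂ} (h : HasSum f a)
    (hfg : ∀ j, g j = f j) : HasSum g a := by
  rwa [funext hfg]

variable {r s N N' : ℝ} {f g : (Fin 4 → 𝕜) → ℂ}

lemma Maj.congr (h : Maj r N f) (hfg : ∀ y, ‖y‖ < r → f y = g y) : Maj r N g := by
  obtain ⟨J, c, α, h1, h2, h3⟩ := h
  exact ⟨J, c, α, h1, h2, fun y hy => hfg y hy ▸ h3 y hy⟩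

lemma Maj.mono_bound (h : Maj r N f) (hN : N ≤ N') : Maj r N' f := by
  obtain ⟨J, c, α, h1, h2, h3⟩ := h
  exact ⟨J, c, α, h1, h2.trans hN, h3⟩

lemma Maj.nonneg (hr : 0 ≤ r) (h : Maj r N f) : 0 ≤ N := by
  obtain ⟨J, c, α, h1, h2, h3⟩ := h
  exact (tsum_nonneg fun j => by positivity).trans h2

lemma Maj.mono_radius (h : Maj r N f) (hs : 0 ≤ s) (hsr : s ≤ r) : Maj s N f := by
  obtain ⟨J, c, α, h1, h2, h3⟩ := h
  have hle : ∀ j, ‖c j‖ * s ^ (∑ i, α j i) ≤ ‖c j‖ * r ^ (∑ i, α j i) := fun j => by gcongr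
  have hsum := h1.of_nonneg_of_le (fun j => by positivity) hle
  exact ⟨J, c, α, hsum, (hsum.tsum_le_tsum hle h1).trans h2, fun y hy => h3 y (hy.trans_le hsr)⟩

lemma Maj.tsum {F : ℕ → (Fin 4 → 𝕜) → ℂ} {B : ℕ → ℝ} (hr : 0 ≤ r) (h : ∀ k, Maj r (B k) (F k))
    (hB : Summable B) : Maj r (∑' k, B k) (fun y => ∑' k, F k y) := by
  choose J c α h1 h2 h3 using h
  have hs : Summable fun p : Σ k, J k => ‖c p.1 p.2‖ * r ^ (∑ i, α p.1 p.2 i) := by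
    rw [summable_sigma_of_nonneg fun p => by positivity]
    exact ⟨h1, hB.of_nonneg_of_le (fun k => tsum_nonneg fun j => by positivity) h2⟩
  refine ⟨Σ k, J k, fun p => c p.1 p.2, fun p => α p.1 p.2, hs, ?_, fun y hy => ?_⟩
  · rw [hs.tsum_sigma]
    exact hs.sigma.tsum_le_tsum h2 hB
  · have hs' : Summable fun p : Σ k, J k => c p.1 p.2 * mono (α p.1 p.2) y := by
      refine Summable.of_norm_bounded hs fun p => ?_
      rw [norm_mul]
      gcongr
      exact norm_mono_le _ hy.le
    have := hs'.hasSum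
    rwa [hs'.tsum_sigma, tsum_congr fun k => (h3 k y hy).tsum_eq] at this

lemma Maj.mul (hr : 0 ≤ r) (hf : Maj r N f) (hg : Maj r N' g) :
    Maj r (N * N') (fun y => f y * g y) := by
  have hN := hf.nonneg hr
  obtain ⟨J, c, α, h1, h2, h3⟩ := hf
  obtain ⟨J', c', α', h1', h2', h3'⟩ := hg
  have e : ∀ p : J × J', ‖c p.1 * c' p.2‖ * r ^ (∑ i, (α p.1 + α' p.2) i)
      = (‖c p.1‖ * r ^ (∑ i, α p.1 i)) * (‖c' p.2‖ * r ^ (∑ i, α' p.2 i)) := fun p => by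
    simp only [norm_mul, Pi.add_apply, sum_add_distrib, pow_add]; ring
  have hs := h1.mul_of_nonneg h1' (fun j => by positivity) (fun j => by positivity)
  refine ⟨J × J', fun p => c p.1 * c' p.2, fun p => α p.1 + α' p.2, ?_, ?_, fun y hy => ?_⟩
  · simpa only [e] using hs
  · simp only [e]
    rw [← h1.tsum_mul_tsum h1' hs]
    exact mul_le_mul h2 h2' (tsum_nonneg fun j => by positivity) hN
  · have hn : ∀ {J : Type} (c : J → ℂ) (α : J → Fin 4 → ℕ),
        (Summable fun j => ‖c j‖ * r ^ (∑ i, α j i)) → Summable fun j => ‖c j * mono (α j) y‖ :=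
      fun c α h => h.of_nonneg_of_le (fun _ => norm_nonneg _) fun j => by
        rw [norm_mul]; gcongr; exact norm_mono_le _ hy.le
    have e2 : (fun p : J × J' => c p.1 * c' p.2 * mono (α p.1 + α' p.2) y)
        = fun p : J × J' => (c p.1 * mono (α p.1) y) * (c' p.2 * mono (α' p.2) y) :=
      funext fun p => by rw [mono_add]; ring
    have hm := summable_mul_of_summable_norm (f := fun j => c j * mono (α j) y)
      (g := fun j => c' j * mono (α' j) y) (hn c α h1) (hn c' α' h1')
    have key := HasSum.mul (f := fun j => c j * mono (α j) y)
      (g := fun j => c' j * mono (α' j) y) (h3 y hy) (h3' y hy) hm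
    rw [← e2] at key
    exact key

lemma Maj.const (c : ℂ) : Maj (𝕜 := 𝕜) r ‖c‖ (fun _ => c) :=
  ⟨Unit, fun _ => c, fun _ => 0, Summable.of_finite, by simp, fun y _ => by
    simp [mono]⟩

lemma Maj.add (hf : Maj r N f) (hg : Maj r N' g) : Maj r (N + N') (fun y => f y + g y) := by
  obtain ⟨J, c, α, h1, h2, h3⟩ := hf
  obtain ⟨J', c', α', h1', h2', h3'⟩ := hg
  have key := HasSum.sum (f := fun p : J ⊕ J' => ‖Sum.elim c c' p‖ * r ^ (∑ i, Sum.elim α α' p i))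
    h1.hasSum h1'.hasSum
  refine ⟨J ⊕ J', Sum.elim c c', Sum.elim α α', key.summable, ?_, fun y hy => ?_⟩
  · rw [key.tsum_eq]; exact add_le_add h2 h2'
  · exact HasSum.sum (f := fun p : J ⊕ J' => Sum.elim c c' p * mono (Sum.elim α α' p) y)
      (h3 y hy) (h3' y hy)

lemma Maj.finsetSum {ι : Type*} (t : Finset ι) {F : ι → (Fin 4 → 𝕜) → ℂ} {B : ι → ℝ}
    (h : ∀ i ∈ t, Maj r (B i) (F i)) : Maj r (∑ i ∈ t, B i) (fun y => ∑ i ∈ t, F i y) := by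
  classical
  induction t using Finset.induction_on with
  | empty => simpa using Maj.const (𝕜 := 𝕜) (r := r) 0
  | insert a t ha ih =>
    simp only [sum_insert ha]
    exact (h a (mem_insert_self _ _)).add (ih fun i hi => h i (mem_insert_of_mem hi))

/-! ### Derivatives and analyticity of monomial series -/

/-- The `i`-th partial derivative of the monomial `y ^ α` is `α i • y ^ (α - e i)`. -/
lemma hasFDerivAt_mono (α : Fin 4 → ℕ) (y : Fin 4 → 𝕜) :
    HasFDerivAt (mono (𝕜 := 𝕜) α)
      (∑ i, ((α i : ℂ) * mono (Function.update α i (α i - 1)) y) • cproj 𝕜 i) y := by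
  have h := HasFDerivAt.finsetProd (u := univ) (g := fun i (y : Fin 4 → 𝕜) => cproj 𝕜 i y ^ α i)
    (g' := fun i => ((α i : ℂ) * cproj 𝕜 i y ^ (α i - 1)) • cproj 𝕜 i) (x := y) fun i _ => by
      have := (cproj 𝕜 i).hasFDerivAt (x := y) |>.pow (α i)
      simpa [smul_smul] using this
  refine h.congr_fderiv (sum_congr rfl fun i _ => ?_)
  rw [smul_smul]
  congr 1
  have e : ∏ j ∈ univ.erase i, cproj 𝕜 j y ^ α j
      = ∏ j ∈ univ.erase i, cproj 𝕜 j y ^ Function.update α i (α i - 1) j :=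
    prod_congr rfl fun j hj => by rw [Function.update_of_ne (ne_of_mem_erase hj)]
  rw [e, mono, ← mul_prod_erase univ _ (mem_univ i), Function.update_self]
  ring

lemma sum_update_sub_one {α : Fin 4 → ℕ} {i : Fin 4} (h : α i ≠ 0) :
    (∑ j, Function.update α i (α i - 1) j) + 1 = ∑ j, α j := by
  rw [sum_update_of_mem (mem_univ i), ← add_sum_erase univ α (mem_univ i), sdiff_singleton_eq_erase]
  omega

lemma nat_mul_pow_le {r' : ℝ} (hr' : 0 < r') (hr : r' < r) (n : ℕ) :
    (n + 1 : ℝ) * r' ^ n ≤ r ^ (n + 1) / (r - r') := by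
  rw [le_div_iff₀ (sub_pos.2 hr)]
  have := Commute.all r r' |>.geom_sum₂_mul (n + 1)
  have h2 : (∑ i ∈ range (n + 1), r' ^ n) ≤ ∑ i ∈ range (n + 1), r ^ i * r' ^ (n + 1 - 1 - i) := by
    refine sum_le_sum fun i hi => ?_
    rw [Nat.add_sub_cancel]
    calc r' ^ n = r' ^ i * r' ^ (n - i) := by
          rw [← pow_add, Nat.add_sub_cancel' (Nat.lt_succ_iff.1 (mem_range.1 hi))]
      _ ≤ _ := by gcongr
  have h3 : (∑ i ∈ range (n + 1), r' ^ n) = (n + 1 : ℝ) * r' ^ n := by simp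
  rw [h3] at h2
  calc (n + 1 : ℝ) * r' ^ n * (r - r') ≤ _ :=
        mul_le_mul_of_nonneg_right h2 (sub_pos.2 hr).le
    _ = r ^ (n + 1) - r' ^ (n + 1) := this
    _ ≤ _ := sub_le_self _ (by positivity)

lemma coef_pow_le {r' : ℝ} (hr' : 0 < r') (hr : r' < r) (α : Fin 4 → ℕ) (i : Fin 4) :
    (α i : ℝ) * r' ^ (∑ j, Function.update α i (α i - 1) j) ≤ r ^ (∑ j, α j) / (r - r') := by
  by_cases h : α i = 0
  · rw [h]
    simp only [Nat.cast_zero, zero_mul]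
    have := sub_pos.2 hr
    have := hr'.trans hr
    positivity
  · have e := sum_update_sub_one h
    rw [← e]
    refine le_trans ?_ (nat_mul_pow_le hr' hr _)
    have : α i ≤ ∑ j, α j := single_le_sum (f := α) (fun _ _ => Nat.zero_le _) (mem_univ i)
    gcongr
    exact_mod_cast this.trans e.ge

/-- Cauchy estimate for majorants, with differentiability of the series. -/
lemma Maj.deriv {r' : ℝ} (hr' : 0 < r') (hr : r' < r) (hf : Maj r N f) (i : Fin 4) :
    Maj r' (N / (r - r')) (fun y => fderiv 𝕜 f y (Pi.single i 1)) := by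
  obtain ⟨J, c, α, h1, h2, h3⟩ := hf
  have hr0 : 0 < r := hr'.trans hr
  have hd : 0 < r - r' := sub_pos.2 hr
  have hb : ∀ (j : J) (i : Fin 4),
      ‖c j * (α j i : ℂ)‖ * r' ^ (∑ l, Function.update (α j) i (α j i - 1) l)
        ≤ (‖c j‖ * r ^ (∑ l, α j l)) / (r - r') := fun j i => by
    rw [norm_mul, Complex.norm_natCast, mul_assoc, mul_div_assoc]
    exact mul_le_mul_of_nonneg_left (coef_pow_le hr' hr _ _) (norm_nonneg _)
  have hsum : Summable fun j => ‖c j * (α j i : ℂ)‖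
      * r' ^ (∑ l, Function.update (α j) i (α j i - 1) l) :=
    (h1.div_const _).of_nonneg_of_le (fun j => by positivity) fun j => hb j i
  let f' : J → (Fin 4 → 𝕜) → ((Fin 4 → 𝕜) →L[𝕜] ℂ) := fun j y =>
    c j • ∑ i, ((α j i : ℂ) * mono (Function.update (α j) i (α j i - 1)) y) • cproj 𝕜 i
  have hf' : ∀ j y, ‖y‖ < r' → ‖f' j y‖ ≤ 4 * ((‖c j‖ * r ^ (∑ l, α j l)) / (r - r')) :=
    fun j y hy => by
      simp only [f', smul_sum, smul_smul]
      refine (norm_sum_le _ _).trans ((sum_le_card_nsmul _ _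
        ((‖c j‖ * r ^ (∑ l, α j l)) / (r - r')) fun i _ => ?_).trans (by simp [nsmul_eq_mul]))
      rw [norm_smul, ← mul_assoc, norm_mul]
      calc _ ≤ ‖c j * (α j i : ℂ)‖ * r' ^ (∑ l, Function.update (α j) i (α j i - 1) l) * 1 := by
            gcongr
            · exact norm_mono_le _ hy.le
            · exact norm_cproj_le i
        _ ≤ _ := by rw [mul_one]; exact hb j i
  have hder : ∀ y : Fin 4 → 𝕜, ‖y‖ < r' → HasFDerivAt f (∑' j, f' j y) y := fun y hy => by
    have key := hasFDerivAt_tsum_of_isPreconnected (𝕜 := 𝕜) (f := fun j y => c j * mono (α j) y)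
      (f' := f') (u := fun j => 4 * ((‖c j‖ * r ^ (∑ l, α j l)) / (r - r'))) (x₀ := y) (x := y)
      ((h1.div_const _).mul_left 4) (s := Metric.ball 0 r') Metric.isOpen_ball
      (Metric.isPreconnected_ball)
      (fun j y _ => (hasFDerivAt_mono (α j) y).const_mul (c j))
      (fun j y hy => hf' j y (by simpa using hy)) (by simpa using hy)
      (h3 y (hy.trans hr)).summable (by simpa using hy)
    refine key.congr_of_eventuallyEq ?_
    filter_upwards [Metric.isOpen_ball.mem_nhds (show y ∈ Metric.ball 0 r by
      simpa using hy.trans hr)] with z hz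
    exact (h3 z (by simpa using hz)).tsum_eq.symm
  refine ⟨J, fun j => c j * α j i, fun j => Function.update (α j) i (α j i - 1), hsum, ?_, ?_⟩
  · refine (hsum.tsum_le_tsum (fun j => hb j i) (h1.div_const _)).trans ?_
    rw [tsum_div_const]
    gcongr
  · intro y hy
    have hs : Summable fun j => f' j y :=
      Summable.of_norm_bounded ((h1.div_const _).mul_left 4) fun j => hf' j y hy
    have := (ContinuousLinearMap.apply 𝕜 ℂ (Pi.single i (1 : 𝕜) : Fin 4 → 𝕜)).hasSum hs.hasSum
    rw [← (hder y hy).fderiv] at this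
    refine this.congr_fun' fun j => ?_
    simp [f', cproj_apply, Pi.single_apply, apply_ite, mul_assoc]

/-- The value of the multilinear form attached to a monomial. -/
lemma exists_multilinear (α : Fin 4 → ℕ) : ∃ m : ContinuousMultilinearMap 𝕜
    (fun _ : Fin (∑ i, α i) => Fin 4 → 𝕜) ℂ, ‖m‖ ≤ 1 ∧ ∀ y, m (fun _ => y) = mono α y := by
  obtain ⟨w, hw⟩ : ∃ w : Fin (∑ i, α i) → Fin 4, ∀ i, (univ.filter fun k => w k = i).card = α i := by
    refine ⟨fun k => (finSigmaFinEquiv.symm k).1, fun i => ?_⟩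
    have : (univ.filter fun k => (finSigmaFinEquiv (m := 4) (n := α).symm k).1 = i)
        = (univ.filter fun p : Σ i : Fin 4, Fin (α i) => p.1 = i).map
            finSigmaFinEquiv.toEmbedding := by
      ext k; simp
    rw [this, card_map]
    have : (univ.filter fun p : Σ i : Fin 4, Fin (α i) => p.1 = i)
        = (univ : Finset (Fin (α i))).map (Function.Embedding.sigmaMk i) := by
      ext ⟨a, b⟩
      simp only [mem_filter, mem_univ, true_and, mem_map, Function.Embedding.sigmaMk_apply]
      constructor
      · rintro rfl; exact ⟨b, rfl⟩
      · rintro ⟨c, hc⟩; exact (congrArg Sigma.fst hc).symm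
    rw [this]; simp
  refine ⟨(ContinuousMultilinearMap.mkPiAlgebra 𝕜 (Fin (∑ i, α i)) ℂ).compContinuousLinearMap
    fun k => cproj 𝕜 (w k), ?_, fun y => ?_⟩
  · refine (ContinuousMultilinearMap.norm_compContinuousLinearMap_le _ _).trans ?_
    rw [ContinuousMultilinearMap.norm_mkPiAlgebra, one_mul]
    exact prod_le_one (fun _ _ => norm_nonneg _) fun k _ => norm_cproj_le _
  · simp only [ContinuousMultilinearMap.compContinuousLinearMap_apply,
      ContinuousMultilinearMap.mkPiAlgebra_apply, mono]
    rw [← prod_fiberwise_of_maps_to (s := univ) (t := univ) (g := w) (fun _ _ => mem_univ _)]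
    refine prod_congr rfl fun i _ => ?_
    rw [prod_congr rfl (g := fun _ => cproj 𝕜 i y) (fun k hk => by rw [(mem_filter.1 hk).2]),
      prod_const, hw]

lemma Maj.analyticOnNhd (hr : 0 < r) (hf : Maj r N f) :
    AnalyticOnNhd 𝕜 f (Metric.ball 0 r) := by
  obtain ⟨J, c, α, h1, h2, h3⟩ := hf
  choose m hm hm' using fun j => exists_multilinear (𝕜 := 𝕜) (α j)
  let q : ∀ n, {j : J // ∑ i, α j i = n} → ContinuousMultilinearMap 𝕜 (fun _ : Fin n => Fin 4 → 𝕜) ℂ :=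
    fun n j => c j.1 • (j.2 ▸ m j.1)
  have hq : ∀ n j, ‖q n j‖ ≤ ‖c j.1‖ := by
    rintro _ ⟨j, rfl⟩
    simpa [q, norm_smul] using mul_le_mul_of_nonneg_left (hm j) (norm_nonneg (c j))
  have hq' : ∀ n j y, q n j (fun _ => y) = c j.1 * mono (α j.1) y := by
    rintro _ ⟨j, rfl⟩ y
    simp [q, hm']
  have e : Summable fun p : Σ n, {j : J // ∑ i, α j i = n} => ‖c p.2.1‖ * r ^ p.1 := by
    have := (Equiv.sigmaFiberEquiv fun j => ∑ i, α j i).summable_iff.2 h1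
    refine this.congr fun p => ?_
    obtain ⟨n, j, rfl⟩ := p
    rfl
  have hcn : ∀ n, Summable fun j : {j : J // ∑ i, α j i = n} => ‖c j.1‖ := fun n =>
    (summable_mul_right_iff (pow_pos hr n).ne').1 (e.sigma_factor n)
  have hqs : ∀ n, Summable (q n) := fun n => Summable.of_norm_bounded (hcn n) (hq n)
  let p : FormalMultilinearSeries 𝕜 (Fin 4 → 𝕜) ℂ := fun n => ∑' j, q n j
  have hp : HasFPowerSeriesOnBall f p 0 (ENNReal.ofReal r) := by
    refine ⟨?_, by simpa using hr, fun {y} hy => ?_⟩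
    · have := p.le_radius_of_bound (r := r.toNNReal) (∑' p : Σ n, {j : J // ∑ i, α j i = n},
        ‖c p.2.1‖ * r ^ p.1) fun n => ?_
      · exact this
      · rw [Real.coe_toNNReal _ hr.le]
        calc ‖p n‖ * r ^ n ≤ (∑' j : {j : J // ∑ i, α j i = n}, ‖c j.1‖) * r ^ n := by
              gcongr
              exact tsum_of_norm_bounded (hcn n).hasSum (hq n)
          _ = ∑' j : {j : J // ∑ i, α j i = n}, ‖c j.1‖ * r ^ n := tsum_mul_right.symm
          _ ≤ _ := by
            rw [e.tsum_sigma]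
            exact e.sigma.le_tsum n fun k _ => tsum_nonneg fun j => by positivity
    · have hy' : ‖y‖ < r := by
        rw [Metric.mem_eball, edist_zero_right, ← ofReal_norm, ENNReal.ofReal_lt_ofReal_iff hr] at hy
        exact hy
      rw [zero_add]
      have hs := (Equiv.sigmaFiberEquiv fun j => ∑ i, α j i).hasSum_iff.2 (h3 y hy')
      refine hs.sigma fun n => ?_
      have := ((ContinuousMultilinearMap.apply 𝕜 (fun _ : Fin n => Fin 4 → 𝕜) ℂ
        (fun _ => y)).hasSum (hqs n).hasSum)
      refine this.congr_fun' fun j => ?_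
      exact (hq' n j y).symm
  have := hp.analyticOnNhd
  rwa [Metric.eball_ofReal] at this

/-- A function analytic at the origin has a majorant on some polydisc. -/
lemma exists_maj (hf : AnalyticAt 𝕜 f 0) : ∃ R > 0, ∃ N, Maj R N f := by
  obtain ⟨p, ρ, hp⟩ := hf
  obtain ⟨ρ', hρ', hlt⟩ := ENNReal.lt_iff_exists_nnreal_btwn.1 (hp.r_pos)
  have hρ0 : (0 : ℝ) < ρ' := by exact_mod_cast hρ'
  have hs : Summable fun n => ‖p n‖ * (ρ' : ℝ) ^ n := p.summable_norm_mul_pow (hlt.trans_le hp.r_le)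
  set R : ℝ := ρ' / 4 with hR
  have hR0 : 0 < R := by positivity
  let α : (Σ n : ℕ, (Fin n → Fin 4)) → Fin 4 → ℕ := fun w i => (univ.filter fun k => w.2 k = i).card
  let c : (Σ n : ℕ, (Fin n → Fin 4)) → ℂ := fun w => p w.1 fun k => Pi.single (w.2 k) 1
  have hα : ∀ w, ∑ i, α w i = w.1 := fun w => by
    have := card_eq_sum_card_fiberwise (s := (univ : Finset (Fin w.1))) (t := univ) (f := w.2)
      (fun _ _ => mem_coe.2 (mem_univ _))
    simpa only [card_univ, Fintype.card_fin] using this.symm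
  have hmono : ∀ w y, mono (α w) y = ∏ k, cproj 𝕜 (w.2 k) y := fun w y => by
    rw [← prod_fiberwise_of_maps_to (s := univ) (t := univ) (g := w.2) (fun _ _ => mem_univ _), mono]
    refine prod_congr rfl fun i _ => ?_
    rw [prod_congr rfl (g := fun _ => cproj 𝕜 i y) (fun k hk => by rw [(mem_filter.1 hk).2]),
      prod_const]
  have hc : ∀ w, ‖c w‖ ≤ ‖p w.1‖ := fun w => by
    refine ((p w.1).le_opNorm _).trans (mul_le_of_le_one_right (norm_nonneg _) ?_)
    exact prod_le_one (fun _ _ => norm_nonneg _) fun k _ =>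
      (pi_norm_le_iff_of_nonneg zero_le_one).2 fun i => by
        rw [Pi.single_apply]; split_ifs <;> simp
  have hsum : Summable fun w => ‖c w‖ * R ^ (∑ i, α w i) := by
    rw [summable_sigma_of_nonneg fun w => by positivity]
    refine ⟨fun n => Summable.of_finite, hs.of_nonneg_of_le (fun n => tsum_nonneg fun _ => by
      positivity) fun n => ?_⟩
    rw [tsum_fintype]
    refine (sum_le_card_nsmul _ _ (‖p n‖ * R ^ n) fun w _ => ?_).trans ?_
    · rw [hα]; exact mul_le_mul_of_nonneg_right (hc ⟨n, w⟩) (by positivity)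
    · simp only [card_univ, Fintype.card_fun, Fintype.card_fin, nsmul_eq_mul, Nat.cast_pow, hR, div_pow]
      apply le_of_eq
      push_cast
      field_simp
  refine ⟨R, hR0, _, _, c, α, hsum, le_rfl, fun y hy => ?_⟩
  have hs' : Summable fun w => c w * mono (α w) y := by
    refine Summable.of_norm_bounded hsum fun w => ?_
    rw [norm_mul]; gcongr; exact norm_mono_le _ hy.le
  have hy' : y ∈ Metric.eball (0 : Fin 4 → 𝕜) ρ := by
    rw [Metric.mem_eball, edist_zero_right]
    refine lt_trans ?_ hlt
    rw [← ofReal_norm, ENNReal.ofReal_lt_coe_iff (by positivity)]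
    refine hy.trans ?_
    rw [hR]; linarith
  have h1 := hs'.hasSum
  have h2 : HasSum (fun n => p n fun _ => y) (∑' w, c w * mono (α w) y) := by
    refine h1.sigma fun n => ?_
    have e : (p n fun _ => y) = ∑ w : Fin n → Fin 4, c ⟨n, w⟩ * mono (α ⟨n, w⟩) y := by
      have hy2 : y = ∑ i, y i • (Pi.single i 1 : Fin 4 → 𝕜) := by
        ext j; simp [Finset.sum_apply, Pi.single_apply]
      conv_lhs => rw [hy2]
      rw [(p n).map_sum]
      refine sum_congr rfl fun w _ => ?_
      rw [(p n).map_smul_univ, hmono, Algebra.smul_def, map_prod, mul_comm]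
      rfl
    rw [e]
    exact hasSum_fintype _
  have h3 := hp.hasSum hy'
  rw [zero_add] at h3
  rw [h3.unique h2]
  exact h1

end Majorant
end ConformalHH

namespace ConformalHH

/-! ### Complex vector fields on `𝕜⁴` and the Lie series -/

section LieSeries

open Finset Filter Topology

variable {𝕜 : Type*} [RCLike 𝕜] [NormedAlgebra 𝕜 ℂ]

/-- The derivative of `f` along the complex vector field `∑ a i ∂_i` on `𝕜⁴`. -/
def vf (a : Fin 4 → (Fin 4 → 𝕜) → ℂ) (f : (Fin 4 → 𝕜) → ℂ) (y : Fin 4 → 𝕜) : ℂ :=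
  ∑ i, a i y * fderiv 𝕜 f y (Pi.single i 1)

variable {a a' : Fin 4 → (Fin 4 → 𝕜) → ℂ} {f g h : (Fin 4 → 𝕜) → ℂ} {y : Fin 4 → 𝕜}

lemma vf_congr (hfg : f =ᶠ[𝓝 y] g) : vf a f y = vf a g y := by
  simp only [vf, hfg.fderiv_eq]

lemma vf_add (hf : DifferentiableAt 𝕜 f y) (hg : DifferentiableAt 𝕜 g y) :
    vf a (fun z => f z + g z) y = vf a f y + vf a g y := by
  simp only [vf, fderiv_fun_add hf hg, add_apply, mul_add, sum_add_distrib]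

lemma vf_mul (hf : DifferentiableAt 𝕜 f y) (hg : DifferentiableAt 𝕜 g y) :
    vf a (fun z => f z * g z) y = vf a f y * g y + f y * vf a g y := by
  simp only [vf, fderiv_fun_mul hf hg, add_apply, smul_apply,
    smul_eq_mul, sum_mul, mul_sum, ← sum_add_distrib]
  exact sum_congr rfl fun i _ => by ring

@[simp] lemma vf_const (c : ℂ) : vf a (fun _ => c) y = 0 := by simp [vf]

lemma vf_sum {ι : Type*} {t : Finset ι} {F : ι → (Fin 4 → 𝕜) → ℂ}
    (hF : ∀ i ∈ t, DifferentiableAt 𝕜 (F i) y) :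
    vf a (fun z => ∑ i ∈ t, F i z) y = ∑ i ∈ t, vf a (F i) y := by
  simp only [vf, fderiv_fun_sum hF, _root_.sum_apply, mul_sum]
  exact sum_comm

@[simp] lemma vf_cproj (i : Fin 4) : vf a (fun z => cproj 𝕜 i z) y = a i y := by
  have : fderiv 𝕜 (fun z => cproj 𝕜 i z) y = cproj 𝕜 i := (cproj 𝕜 i).fderiv
  rw [vf, this]
  simp [cproj_apply, Pi.single_apply, apply_ite]

lemma vf_pow (n : ℕ) (hf : DifferentiableAt 𝕜 f y) :
    vf a (fun z => f z ^ (n + 1)) y = (n + 1) * f y ^ n * vf a f y := by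
  induction n with
  | zero => simp
  | succ n ih =>
    have : (fun z => f z ^ (n + 1 + 1)) = fun z => f z ^ (n + 1) * f z := funext fun z => pow_succ _ _
    rw [this, vf_mul (hf.fun_pow _) hf, ih]
    push_cast
    ring

lemma vf_single (i : Fin 4) :
    vf (fun j _ => if j = i then 1 else 0) f y = fderiv 𝕜 f y (Pi.single i 1) := by
  simp [vf]

/-- The commutator of two vector fields is a vector field: second derivatives cancel. -/
lemma vf_comm (ha : ∀ i, DifferentiableAt 𝕜 (a i) y) (ha' : ∀ i, DifferentiableAt 𝕜 (a' i) y)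
    (hf : AnalyticAt 𝕜 f y) : vf a (vf a' f) y - vf a' (vf a f) y
      = ∑ i, (vf a (a' i) y - vf a' (a i) y) * fderiv 𝕜 f y (Pi.single i 1) := by
  have hd : DifferentiableAt 𝕜 (fderiv 𝕜 f) y := hf.fderiv.differentiableAt
  have hdi : ∀ i, DifferentiableAt 𝕜 (fun z => fderiv 𝕜 f z (Pi.single i 1)) y := fun i =>
    hd.clm_apply (differentiableAt_const _)
  have hsymm : IsSymmSndFDerivAt 𝕜 f y :=
    hf.contDiffAt.isSymmSndFDerivAt (n := ω) (by simp)
  have e : ∀ b b' : Fin 4 → (Fin 4 → 𝕜) → ℂ, (∀ i, DifferentiableAt 𝕜 (b' i) y) →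
      vf b (vf b' f) y = ∑ i, vf b (b' i) y * fderiv 𝕜 f y (Pi.single i 1)
        + ∑ i, ∑ j, b' i y * (b j y * fderiv 𝕜 (fderiv 𝕜 f) y (Pi.single j 1) (Pi.single i 1)) := by
    intro b b' hb'
    have : vf b' f = fun z => ∑ i, b' i z * fderiv 𝕜 f z (Pi.single i 1) := rfl
    rw [this, vf_sum fun i _ => (hb' i).fun_mul (hdi i), ← sum_add_distrib]
    refine sum_congr rfl fun i _ => ?_
    rw [vf_mul (hb' i) (hdi i)]
    congr 1
    rw [vf, mul_sum]
    refine sum_congr rfl fun j _ => ?_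
    rw [fderiv_clm_apply hd (differentiableAt_const _)]
    simp
  rw [e a a' ha', e a' a ha]
  have : ∑ i, ∑ j, a' i y * (a j y * fderiv 𝕜 (fderiv 𝕜 f) y (Pi.single j 1) (Pi.single i 1))
      = ∑ i, ∑ j, a i y * (a' j y * fderiv 𝕜 (fderiv 𝕜 f) y (Pi.single j 1) (Pi.single i 1)) := by
    rw [sum_comm]
    refine sum_congr rfl fun i _ => sum_congr rfl fun j _ => ?_
    rw [hsymm.eq (Pi.single i 1)]
    ring
  rw [this, add_sub_add_right_eq_sub, ← sum_sub_distrib]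
  exact sum_congr rfl fun i _ => by ring

lemma Maj.norm_le {r N : ℝ} (hf : Maj r N f) (hy : ‖y‖ < r) : ‖f y‖ ≤ N := by
  obtain ⟨J, c, α, h1, h2, h3⟩ := hf
  rw [← (h3 y hy).tsum_eq]
  refine (tsum_of_norm_bounded h1.hasSum fun j => ?_).trans h2
  rw [norm_mul]; gcongr; exact norm_mono_le _ hy.le

lemma Maj.vf {r r' A N : ℝ} (hr' : 0 < r') (hr : r' < r) (ha : ∀ i, Maj r A (a i)) (hf : Maj r N f) :
    Maj r' (4 * A * N / (r - r')) (vf a f) := by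
  have := Maj.finsetSum (r := r') univ (F := fun i y => a i y * fderiv 𝕜 f y (Pi.single i 1))
    (B := fun _ => A * (N / (r - r'))) fun i _ =>
      ((ha i).mono_radius hr'.le hr.le).mul hr'.le (hf.deriv hr' hr i)
  refine this.mono_bound (le_of_eq ?_)
  simp; ring

/-- Iterated Cauchy estimates: `k` derivatives, each on a polydisc smaller by `r / (2 k)`. -/
lemma Maj.iterate_vf {r A N : ℝ} (hr : 0 < r) (ha : ∀ i, Maj r A (a i)) (hh : Maj r N h) (k : ℕ) :
    Maj (r / 2) (N * (8 * A * k / r) ^ k) ((ConformalHH.vf a)^[k] h) := by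
  rcases Nat.eq_zero_or_pos k with rfl | hk
  · simpa using hh.mono_radius (by positivity) (by linarith)
  have hk' : (0 : ℝ) < k := by exact_mod_cast hk
  set δ : ℝ := r / (2 * k) with hδ
  have hδ0 : 0 < δ := by positivity
  have key : ∀ j ≤ k, Maj (r - j * δ) (N * (4 * A / δ) ^ j) ((ConformalHH.vf a)^[j] h) := by
    intro j
    induction j with
    | zero => intro _; simpa using hh
    | succ j ih =>
      intro hj
      have hjk : ((j : ℝ) + 1) ≤ k := by exact_mod_cast hj
      have hpos : 0 < r - (j + 1) * δ := by
        have : (j + 1) * δ ≤ k * δ := by gcongr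
        have : k * δ = r / 2 := by rw [hδ]; field_simp
        linarith
      rw [Function.iterate_succ_apply']
      have := Maj.vf (r := r - j * δ) (r' := r - (j + 1) * δ) hpos (by linarith)
        (fun i => (ha i).mono_radius (by linarith) (by
          have : 0 ≤ j * δ := by positivity
          linarith)) (ih (by omega))
      push_cast
      refine this.mono_bound (le_of_eq ?_)
      rw [pow_succ]
      have : r - j * δ - (r - (j + 1) * δ) = δ := by ring
      rw [this]
      ring
  have := key k le_rfl
  have e1 : r - k * δ = r / 2 := by rw [hδ]; field_simp; ring
  have e2 : 4 * A / δ = 8 * A * k / r := by rw [hδ]; field_simp; ring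
  rwa [e1, e2] at this

lemma self_pow_le_factorial_mul_exp (k : ℕ) : (k : ℝ) ^ k ≤ k.factorial * Real.exp 1 ^ k := by
  have := Real.pow_div_factorial_le_exp (k : ℝ) (by positivity) k
  rw [div_le_iff₀ (by positivity)] at this
  rw [← Real.exp_nat_mul, mul_one, mul_comm]
  exact this

/-- The Lie series `u = -∑ (-t) ^ (k + 1) / (k + 1)! Z ^ k h` of a vector field `Z` and a linear function
`t` with `Z t = 1` converges to an analytic solution of `Z u = h`. Vector fields that commute with `Z`
and annihilate `t` and `h` annihilate `u`. -/
theorem exists_lieSeries (ha : ∀ i, AnalyticAt 𝕜 (a i) 0) (hh : AnalyticAt 𝕜 h 0) (c : Fin 4 → ℂ)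
    (hc : ∀ᶠ y in 𝓝 0, ∑ i, a i y * c i = 1) :
    ∃ u, AnalyticAt 𝕜 u 0 ∧ (∀ᶠ y in 𝓝 0, vf a u y = h y) ∧
      (∀ a' : Fin 4 → (Fin 4 → 𝕜) → ℂ, vf a' u 0 = h 0 * ∑ i, a' i 0 * c i) ∧
      ∀ a' : Fin 4 → (Fin 4 → 𝕜) → ℂ, (∀ i, AnalyticAt 𝕜 (a' i) 0) →
        (∀ i, ∀ᶠ y in 𝓝 0, vf a (a' i) y = vf a' (a i) y) →
        (∀ᶠ y in 𝓝 0, ∑ i, a' i y * c i = 0) → (∀ᶠ y in 𝓝 0, vf a' h y = 0) →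
        ∀ᶠ y in 𝓝 0, vf a' u y = 0 := by
  obtain ⟨r, hr, A, N, hA0, haM, hhM, hcr⟩ : ∃ r > 0, ∃ A N : ℝ, 0 < A ∧ (∀ i, Maj r A (a i)) ∧
      Maj r N h ∧ ∀ y : Fin 4 → 𝕜, ‖y‖ < r → ∑ i, a i y * c i = 1 := by
    choose R hR A hA using fun i => exists_maj (ha i)
    obtain ⟨R', hR', N, hN⟩ := exists_maj hh
    obtain ⟨R'', hR'', hc⟩ := Metric.eventually_nhds_iff_ball.1 hc
    obtain ⟨R₀, hR₀, hle⟩ : ∃ R₀ > 0, ∀ i, R₀ ≤ R i :=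
      ⟨univ.inf' univ_nonempty R, by simpa using hR, fun i => inf'_le _ (mem_univ i)⟩
    refine ⟨min R₀ (min R' R''), by positivity, 1 + ∑ i, |A i|, N, by positivity, fun i => ?_, ?_, ?_⟩
    · refine ((hA i).mono_radius (by positivity) ((min_le_left _ _).trans (hle i))).mono_bound ?_
      have := single_le_sum (f := fun i => |A i|) (fun _ _ => abs_nonneg _) (mem_univ i)
      linarith [le_abs_self (A i)]
    · exact hN.mono_radius (by positivity) ((min_le_right _ _).trans (min_le_left _ _))
    · intro y hy
      exact hc y (by simpa using hy.trans_le ((min_le_right _ _).trans (min_le_right _ _)))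
  have hN0 : 0 ≤ N := hhM.nonneg hr.le
  set C : ℝ := 1 + ∑ i, ‖c i‖ with hC
  have hC0 : 0 < C := by positivity
  let t : (Fin 4 → 𝕜) → ℂ := fun y => ∑ i, c i * cproj 𝕜 i y
  have htd : ∀ y, DifferentiableAt 𝕜 t y := fun y =>
    DifferentiableAt.fun_sum fun i _ =>
      (differentiableAt_const (c i)).fun_mul (cproj 𝕜 i).differentiableAt
  have hvt : ∀ (b : Fin 4 → (Fin 4 → 𝕜) → ℂ) y, vf b t y = ∑ i, b i y * c i := fun b y => by
    rw [vf_sum fun i _ => (differentiableAt_const (c i)).fun_mul (cproj 𝕜 i).differentiableAt]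
    refine sum_congr rfl fun i _ => ?_
    rw [vf_mul (differentiableAt_const _) (cproj 𝕜 i).differentiableAt]
    simp [mul_comm]
  have htM : ∀ ρ : ℝ, 0 ≤ ρ → Maj (𝕜 := 𝕜) ρ (C * ρ) t := fun ρ hρ => by
    refine (Maj.finsetSum univ (B := fun i => ‖c i‖ * ρ) fun i _ => (Maj.const (c i)).mul hρ
      (N' := ρ) ?_).mono_bound ?_
    · refine ⟨Unit, fun _ => 1, fun _ => Pi.single i 1, Summable.of_finite, by simp, fun y _ => ?_⟩
      have : mono (Pi.single i 1) y = cproj 𝕜 i y := by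
        rw [mono, prod_eq_single i (fun j _ hj => by simp [hj]) (by simp)]; simp
      simp [this]
    · rw [← sum_mul, hC]; gcongr; linarith
  -- `q ρ ≤ 1 / 2` makes the series converge geometrically on the polydisc of radius `ρ`
  set q : ℝ := C * (8 * A * Real.exp 1 / r) with hq
  have hq0 : 0 < q := by positivity
  set ρ : ℝ := min (r / 2) (1 / (2 * q)) with hρ
  have hρ0 : 0 < ρ := by positivity
  have hρr : ρ ≤ r / 2 := min_le_left _ _
  have hqρ : q * ρ ≤ 1 / 2 := by
    calc q * ρ ≤ q * (1 / (2 * q)) := by gcongr; exact min_le_right _ _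
      _ = 1 / 2 := by field_simp
  let G : ℕ → (Fin 4 → 𝕜) → ℂ := fun k => (ConformalHH.vf a)^[k] h
  have hGs : ∀ k, G (k + 1) = vf a (G k) := fun k => Function.iterate_succ_apply' _ _ _
  have hGM : ∀ k : ℕ, Maj ρ (N * (8 * A * k / r) ^ k) (G k) := fun k =>
    (hhM.iterate_vf hr haM k).mono_radius hρ0.le hρr
  -- the common estimate behind the terms and the remainders of the series
  have hest : ∀ (k : ℕ) {m : ℕ}, k ≤ m →
      (C * ρ) ^ k / m.factorial * (N * (8 * A * k / r) ^ k) ≤ N * (1 / 2) ^ k := fun k m hkm => by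
    have h1 : (8 * A * k / r) ^ k = (8 * A / r) ^ k * (k : ℝ) ^ k := by rw [← mul_pow]; ring
    have hf : (k.factorial : ℝ) ≤ m.factorial := by exact_mod_cast Nat.factorial_le hkm
    have h0 : (0 : ℝ) < k.factorial := by positivity
    calc _ ≤ (C * ρ) ^ k / k.factorial
          * (N * ((8 * A / r) ^ k * (k.factorial * Real.exp 1 ^ k))) := by
          rw [h1]; gcongr; exact self_pow_le_factorial_mul_exp k
      _ = N * (q * ρ) ^ k := by
        rw [hq]
        have : (C * (8 * A * Real.exp 1 / r) * ρ) ^ k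
            = (C * ρ) ^ k * (8 * A / r) ^ k * Real.exp 1 ^ k := by
          rw [← mul_pow, ← mul_pow]; ring
        rw [this]; field_simp
      _ ≤ _ := by gcongr
  let T : ℕ → (Fin 4 → 𝕜) → ℂ := fun k y => -((-t y) ^ (k + 1) / (k + 1).factorial) * G k y
  have hnegpow : ∀ n, Maj (𝕜 := 𝕜) ρ ((C * ρ) ^ n) fun y => (-t y) ^ n := fun n => by
    induction n with
    | zero => simpa using Maj.const (𝕜 := 𝕜) (r := ρ) 1
    | succ n ih =>
      have := ((Maj.const (-1)).mul hρ0.le (htM ρ hρ0.le)).mul hρ0.le ih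
      refine (this.congr fun y _ => by ring).mono_bound (le_of_eq ?_)
      simp; ring
  have hTM : ∀ k, Maj ρ (C * ρ * N * (1 / 2) ^ k) (T k) := fun k => by
    have := ((Maj.const (-(1 / ((k + 1).factorial : ℂ)))).mul hρ0.le (hnegpow (k + 1))).mul hρ0.le
      (hGM k)
    refine (this.congr fun y _ => by simp only [T]; ring).mono_bound ?_
    rw [norm_neg, norm_div, norm_one, Complex.norm_natCast]
    calc _ = C * ρ * ((C * ρ) ^ k / (k + 1).factorial * (N * (8 * A * k / r) ^ k)) := by ring
      _ ≤ C * ρ * (N * (1 / 2) ^ k) := by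
        exact mul_le_mul_of_nonneg_left (hest k (Nat.le_succ k)) (by positivity)
      _ = _ := by ring
  have hBs : Summable fun k => C * ρ * N * (1 / 2 : ℝ) ^ k :=
    (summable_geometric_of_lt_one (by norm_num) (by norm_num)).mul_left _
  let u : (Fin 4 → 𝕜) → ℂ := fun y => ∑' k, T k y
  have huM : Maj ρ (∑' k, C * ρ * N * (1 / 2 : ℝ) ^ k) u := Maj.tsum hρ0.le hTM hBs
  have hTd : ∀ k (y : Fin 4 → 𝕜), ‖y‖ < ρ → DifferentiableAt 𝕜 (T k) y := fun k y hy =>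
    ((hTM k).analyticOnNhd hρ0 y (by simpa using hy)).differentiableAt
  have hGd : ∀ k (y : Fin 4 → 𝕜), ‖y‖ < ρ → DifferentiableAt 𝕜 (G k) y := fun k y hy =>
    ((hGM k).analyticOnNhd hρ0 y (by simpa using hy)).differentiableAt
  -- the series can be differentiated term by term
  have hlim : ∀ (b : Fin 4 → (Fin 4 → 𝕜) → ℂ) (y : Fin 4 → 𝕜), ‖y‖ < ρ →
      Tendsto (fun n => ∑ k ∈ range n, vf b (T k) y) atTop (𝓝 (vf b u y)) := by
    intro b y hy
    obtain ⟨ρ', hyρ', hρ'⟩ := exists_between hy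
    have hρ'0 : 0 < ρ' := (norm_nonneg _).trans_lt hyρ'
    set ε : ℕ → ℝ := fun n => ∑' k, C * ρ * N * (1 / 2 : ℝ) ^ (k + n) with hε
    have hε0 : Tendsto ε atTop (𝓝 0) :=
      tendsto_sum_nat_add fun k => C * ρ * N * (1 / 2 : ℝ) ^ k
    have hrest : ∀ n, Maj ρ (ε n) fun y => ∑' k, T (k + n) y := fun n =>
      Maj.tsum hρ0.le (fun k => hTM (k + n)) ((summable_nat_add_iff n).2 hBs)
    have hsum : ∀ z : Fin 4 → 𝕜, ‖z‖ < ρ → Summable fun k => T k z := fun z hz =>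
      Summable.of_norm_bounded hBs fun k => (hTM k).norm_le hz
    have hb : ∀ n, ‖vf b u y - ∑ k ∈ range n, vf b (T k) y‖
        ≤ ∑ i, ‖b i y‖ * (ε n / (ρ - ρ')) := fun n => by
      have e : u =ᶠ[𝓝 y] fun z => ∑ k ∈ range n, T k z + ∑' k, T (k + n) z := by
        filter_upwards [Metric.isOpen_ball.mem_nhds (show y ∈ Metric.ball 0 ρ by simpa using hy)]
          with z hz
        exact ((hsum z (by simpa using hz)).sum_add_tsum_nat_add n).symm
      rw [vf_congr e, vf_add (DifferentiableAt.fun_sum fun k _ => hTd k y hy)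
        ((hrest n).analyticOnNhd hρ0 y (by simpa using hy)).differentiableAt,
        vf_sum fun k _ => hTd k y hy, add_sub_cancel_left, vf]
      refine norm_sum_le_of_le _ fun i _ => ?_
      rw [norm_mul]
      gcongr
      exact ((hrest n).deriv hρ'0 hρ' i).norm_le hyρ'
    rw [tendsto_iff_norm_sub_tendsto_zero]
    refine squeeze_zero (g := fun n => ∑ i, ‖b i y‖ * (ε n / (ρ - ρ'))) (fun _ => norm_nonneg _)
      (fun n => (norm_sub_rev _ _).trans_le (hb n)) ?_
    have : Tendsto (fun n => ∑ i, ‖b i y‖ * (ε n / (ρ - ρ'))) atTop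
        (𝓝 (∑ i, ‖b i y‖ * (0 / (ρ - ρ')))) :=
      tendsto_finsetSum _ fun i _ => (hε0.div_const _).const_mul _
    simpa using this
  have hball : ∀ᶠ y : Fin 4 → 𝕜 in 𝓝 0, ‖y‖ < ρ := by
    filter_upwards [Metric.ball_mem_nhds (0 : Fin 4 → 𝕜) hρ0] with y hy
    simpa using hy
  have hfac : ∀ k : ℕ, ((k + 1).factorial : ℂ) = (k + 1) * k.factorial := fun k => by
    push_cast [Nat.factorial_succ]; ring
  have hf0 : ∀ k : ℕ, (k.factorial : ℂ) ≠ 0 := fun k => by exact_mod_cast k.factorial_ne_zero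
  have hvT : ∀ (b : Fin 4 → (Fin 4 → 𝕜) → ℂ) k (y : Fin 4 → 𝕜), ‖y‖ < ρ → vf b (T k) y
      = (-t y) ^ k / k.factorial * vf b t y * G k y
        - (-t y) ^ (k + 1) / (k + 1).factorial * vf b (G k) y := fun b k y hy => by
    have e : T k = fun z => (-(1 / ((k + 1).factorial : ℂ)) * (-1 * t z) ^ (k + 1)) * G k z :=
      funext fun z => by simp only [T]; ring
    have hd := (differentiableAt_const (𝕜 := 𝕜) (x := y) (-1 : ℂ)).fun_mul (htd y)
    rw [e, vf_mul (((differentiableAt_const _).fun_mul (hd.fun_pow _))) (hGd k y hy),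
      vf_mul (differentiableAt_const _) (hd.fun_pow _), vf_pow k hd,
      vf_mul (differentiableAt_const _) (htd y), vf_const, vf_const, hfac]
    have := hf0 k
    have h2 : (k : ℂ) + 1 ≠ 0 := by exact_mod_cast k.succ_ne_zero
    field_simp
    ring
  refine ⟨u, huM.analyticOnNhd hρ0 0 (by simpa using hρ0), ?_, fun a' => ?_, ?_⟩
  · filter_upwards [hball] with y hy
    refine tendsto_nhds_unique (hlim a y hy) ?_
    have hpart : ∀ n, ∑ k ∈ range n, vf a (T k) y = h y - (-t y) ^ n / n.factorial * G n y := by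
      intro n
      induction n with
      | zero => simp [G]
      | succ n ih =>
        rw [sum_range_succ, ih, hvT a n y hy, hvt, hcr y (by linarith), hGs]
        ring
    simp only [hpart]
    have h0 : Tendsto (fun n : ℕ => (-t y) ^ n / n.factorial * G n y) atTop (𝓝 0) := by
      refine squeeze_zero_norm (a := fun n => N * (1 / 2 : ℝ) ^ n) (fun n => ?_) ?_
      · refine le_trans ?_ (hest n le_rfl)
        rw [norm_mul, norm_div, Complex.norm_natCast]
        gcongr
        · exact (hnegpow n).norm_le hy
        · exact (hGM n).norm_le hy
      · simpa using (tendsto_pow_atTop_nhds_zero_of_lt_one (by norm_num : (0 : ℝ) ≤ 1 / 2)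
          (by norm_num)).const_mul N
    simpa using h0.const_sub (h y)
  · have h0 : ‖(0 : Fin 4 → 𝕜)‖ < ρ := by simpa using hρ0
    refine tendsto_nhds_unique (hlim a' 0 h0) (tendsto_const_nhds.congr' ?_)
    filter_upwards [eventually_ge_atTop 1] with n hn
    have ht0 : t 0 = 0 := by simp [t]
    obtain ⟨m, rfl⟩ := Nat.exists_eq_add_of_le' hn
    have hz : ∀ k ∈ range m, vf a' (T (k + 1)) 0 = 0 := fun k _ => by
      rw [hvT a' _ 0 h0, ht0]; simp
    rw [sum_range_succ', sum_eq_zero hz, hvT a' 0 0 h0, ht0, hvt]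
    simp [G, mul_comm]
  · intro a' ha' hcomm hc' hh'
    obtain ⟨ρ₁, hρ₁, hB⟩ := Metric.eventually_nhds_iff_ball.1
      (((eventually_all.2 fun i => (ha' i).eventually_analyticAt).and (eventually_all.2 hcomm)).and
        ((hc'.and hh').and ((eventually_all.2 fun i => (ha i).eventually_analyticAt).and hball)))
    have hG0 : ∀ k, ∀ y ∈ Metric.ball (0 : Fin 4 → 𝕜) ρ₁, vf a' (G k) y = 0 := by
      intro k
      induction k with
      | zero => exact fun y hy => (hB y hy).2.1.2
      | succ k ih =>
        intro y hy
        obtain ⟨⟨h1, h2⟩, ⟨-, -⟩, h5, h6⟩ := hB y hy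
        have := vf_comm (a := a) (a' := a') (fun i => (h5 i).differentiableAt)
          (fun i => (h1 i).differentiableAt) ((hGM k).analyticOnNhd hρ0 y (by simpa using h6))
        have hz : vf a (vf a' (G k)) y = 0 := by
          rw [vf_congr (g := fun _ => 0)
            (by filter_upwards [Metric.isOpen_ball.mem_nhds hy] with z hz using ih z hz), vf_const]
        rw [hz, sum_eq_zero fun i _ => by rw [h2 i, sub_self, zero_mul], zero_sub, neg_eq_zero] at this
        rw [hGs, this]
    filter_upwards [Metric.ball_mem_nhds (0 : Fin 4 → 𝕜) hρ₁] with y hy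
    obtain ⟨⟨h1, h2⟩, ⟨h3, -⟩, h5, h6⟩ := hB y hy
    refine tendsto_nhds_unique (hlim a' y h6) (tendsto_const_nhds.congr fun n => ?_)
    exact (sum_eq_zero fun k _ => by rw [hvT a' k y h6, hvt, h3, hG0 k y hy]; ring).symm

end LieSeries
end ConformalHH

namespace ConformalHH

/-! ### Weyl connections in an abstract frame -/

section FrameAlgebra

variable {R : Type*} [CommRing R] [Algebra ℂ R]

/-- `ε_{AB}` as constants of the `ℂ`-algebra `R`. -/
def epsR (R : Type*) [CommRing R] [Algebra ℂ R] (A B : Fin 2) : R := algebraMap ℂ R (eps A B)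

/-- `η_{ab}` as constants of the `ℂ`-algebra `R`. -/
def etaR (R : Type*) [CommRing R] [Algebra ℂ R] : Matrix Idx Idx R :=
  fun a b => algebraMap ℂ R (eta a b)

/-- The constant `1/2`. -/
def half (R : Type*) [CommRing R] [Algebra ℂ R] : R := algebraMap ℂ R (1 / 2)

theorem two_mul_half : 2 * half R = 1 := by
  have : (2 : R) = algebraMap ℂ R 2 := (map_ofNat _ 2).symm
  rw [half, this, ← map_mul]; norm_num

@[simp] theorem epsR_00 : epsR R 0 0 = 0 := by simp [epsR, eps]
@[simp] theorem epsR_01 : epsR R 0 1 = 1 := by simp [epsR, eps]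
@[simp] theorem epsR_10 : epsR R 1 0 = -1 := by simp [epsR, eps]
@[simp] theorem epsR_11 : epsR R 1 1 = 0 := by simp [epsR, eps]

theorem etaR_apply (a b : Idx) : etaR R a b = epsR R a.1 b.1 * epsR R a.2 b.2 := by
  simp [etaR, epsR, eta]

theorem sum_idx {N : Type*} [AddCommMonoid N] (f : Idx → N) :
    ∑ a, f a = f (0, 0) + f (0, 1) + (f (1, 0) + f (1, 1)) := by
  simp [Fintype.sum_prod_type]

theorem forall_idx {p : Idx → Prop} :
    (∀ a, p a) ↔ (p (0, 0) ∧ p (0, 1)) ∧ (p (1, 0) ∧ p (1, 1)) := by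
  simp [Prod.forall]

theorem epsR_swap (A B : Fin 2) : epsR R A B = -epsR R B A := by
  fin_cases A <;> fin_cases B <;> simp

theorem etaR_symm (a b : Idx) : etaR R a b = etaR R b a := by
  rw [etaR_apply, etaR_apply, epsR_swap a.1, epsR_swap a.2]; ring

theorem etaR_transpose : (etaR R).transpose = etaR R := by
  ext a b; exact etaR_symm b a

theorem etaR_mul_self : etaR R * etaR R = 1 := by
  ext ⟨A, A'⟩ ⟨B, B'⟩
  fin_cases A <;> fin_cases A' <;> fin_cases B <;> fin_cases B' <;>
    simp [Matrix.mul_apply, sum_idx, etaR_apply]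

theorem map_etaR (d : Derivation ℂ R R) : (etaR R).map d = 0 := by
  ext a b; simp [etaR]

theorem map_der_mul (d : Derivation ℂ R R) {l m n : Type*} [Fintype m]
    (A : Matrix l m R) (B : Matrix m n R) :
    (A * B).map d = A.map d * B + A * B.map d := by
  ext i j
  simp only [Matrix.map_apply, Matrix.mul_apply, map_sum, Derivation.leibniz, smul_eq_mul,
    Matrix.add_apply, ← Finset.sum_add_distrib]
  exact Finset.sum_congr rfl fun k _ => by ring

/-- The structure functions `c_{ab}^c` from their lowered version `s_{abc}`. -/
def strR (s : Idx → Idx → Idx → R) (a b c : Idx) : R := ∑ d, etaR R c d * s a b d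

/-- The Levi-Civita connection coefficients by the Koszul formula. -/
def lcR (s : Idx → Idx → Idx → R) (a b c : Idx) : R :=
  ∑ d, etaR R c d * (half R * (s a b d - s b d a + s d a b))

/-- The matrices `(G_a)_b^c` of the coefficients of the Weyl connection with 1-form `w`. -/
def wcR (s : Idx → Idx → Idx → R) (w : Idx → R) (a : Idx) : Matrix Idx Idx R :=
  fun b c => lcR s a b c + w a * (1 : Matrix Idx Idx R) b c + w b * (1 : Matrix Idx Idx R) a c
    - (∑ d, etaR R c d * w d) * etaR R a b

theorem sum_eta_eta (f : Idx → R) (c : Idx) :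
    ∑ e, (∑ d, etaR R e d * f d) * etaR R e c = f c := by
  have h : ((etaR R).mulVec ((etaR R).mulVec f)) c = f c := by
    rw [Matrix.mulVec_mulVec, etaR_mul_self, Matrix.one_mulVec]
  rw [← h]
  simp only [Matrix.mulVec, dotProduct]
  exact Finset.sum_congr rfl fun e _ => by rw [etaR_symm e c]; ring

/-- Lowering the last index of the Weyl connection. -/
theorem wcR_mul_eta (s : Idx → Idx → Idx → R) (w : Idx → R) (a b c : Idx) :
    (wcR s w a * etaR R) b c = half R * (s a b c - s b c a + s c a b)
      + w a * etaR R b c + w b * etaR R a c - w c * etaR R a b := by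
  have h1 : ∑ e, lcR s a b e * etaR R e c = half R * (s a b c - s b c a + s c a b) :=
    sum_eta_eta (fun d => half R * (s a b d - s b d a + s d a b)) c
  have h2 := sum_eta_eta w c
  simp only [Matrix.mul_apply, wcR, sub_mul, add_mul, Finset.sum_sub_distrib,
    Finset.sum_add_distrib, h1]
  congr 1
  · simp [Matrix.one_apply]
  · rw [← h2, Finset.sum_mul]
    exact Finset.sum_congr rfl fun e _ => by ring

theorem strR_mul_eta (s : Idx → Idx → Idx → R) (a b c : Idx) :
    ∑ e, strR s a b e * etaR R e c = s a b c := sum_eta_eta (fun d => s a b d) c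

theorem eta_cancel {G G' : Matrix Idx Idx R} (h : G * etaR R = G' * etaR R) : G = G' := by
  have := congrArg (· * etaR R) h
  simpa [Matrix.mul_assoc, etaR_mul_self] using this

/-- The Weyl connection is torsion-free. -/
theorem wcR_torsion {s : Idx → Idx → Idx → R} (hs : ∀ a b c, s a b c = -s b a c) (w : Idx → R)
    (a b c : Idx) : wcR s w a b c - wcR s w b a c = strR s a b c := by
  have key : Matrix.of (fun (_ : Unit) e => wcR s w a b e - wcR s w b a e) * etaR R
      = Matrix.of (fun (_ : Unit) e => strR s a b e) * etaR R := by
    ext _ c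
    have h1 := wcR_mul_eta s w a b c
    have h2 := wcR_mul_eta s w b a c
    simp only [Matrix.mul_apply, Matrix.of_apply, sub_mul, Finset.sum_sub_distrib] at h1 h2 ⊢
    rw [h1, h2, strR_mul_eta, etaR_symm b a]
    linear_combination (s a b c) * two_mul_half (R := R) - half R * (hs b c a) + half R * hs c a b
      - half R * hs b a c
  have := congrArg (· * etaR R) key
  simp only [Matrix.mul_assoc, etaR_mul_self, Matrix.mul_one] at this
  exact congrFun (congrFun this ()) c

/-- The Weyl connection satisfies `∇_a g_{bc} = -2 w_a g_{bc}`. -/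
theorem wcR_metric {s : Idx → Idx → Idx → R} (hs : ∀ a b c, s a b c = -s b a c) (w : Idx → R)
    (a : Idx) : wcR s w a * etaR R + (wcR s w a * etaR R).transpose = (2 * w a) • etaR R := by
  ext b c
  simp only [Matrix.add_apply, Matrix.transpose_apply, wcR_mul_eta, Matrix.smul_apply, smul_eq_mul]
  rw [etaR_symm c b]
  linear_combination half R * (hs a b c - hs b c a + hs c a b)

/-- A torsion-free connection with `∇_a g_{bc} = -2 w_a g_{bc}` is the Weyl connection. -/
theorem eq_wcR {s : Idx → Idx → Idx → R} {w : Idx → R} {G : Idx → Matrix Idx Idx R}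
    (hT : ∀ a b c, G a b c - G b a c = strR s a b c)
    (hM : ∀ a, G a * etaR R + (G a * etaR R).transpose = (2 * w a) • etaR R) (a : Idx) :
    G a = wcR s w a := by
  refine eta_cancel ?_
  ext b c
  rw [wcR_mul_eta]
  have hT' : ∀ a b c, (G a * etaR R) b c - (G b * etaR R) a c = s a b c := fun a b c => by
    rw [← strR_mul_eta s a b c]
    simp only [Matrix.mul_apply, ← Finset.sum_sub_distrib, ← hT, sub_mul]
  have hM' : ∀ a b c, (G a * etaR R) b c + (G a * etaR R) c b = 2 * w a * etaR R b c :=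
    fun a b c => by
      simpa [-Matrix.transpose_mul] using congrFun (congrFun (hM a) b) c
  have h1 := hT' a b c
  have h2 := hT' b c a
  have h3 := hT' c a b
  have h4 := hM' a b c
  have h5 := hM' b c a
  have h6 := hM' c a b
  rw [etaR_symm c a] at h5
  generalize (G a * etaR R) b c = gabc at *
  generalize (G a * etaR R) c b = gacb at *
  generalize (G b * etaR R) c a = gbca at *
  generalize (G b * etaR R) a c = gbac at *
  generalize (G c * etaR R) a b = gcab at *
  generalize (G c * etaR R) b a = gcba at *
  linear_combination half R * (h1 - h2 + h3 + h4 + h5 - h6)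
    - (gabc - w a * etaR R b c - w b * etaR R a c + w c * etaR R a b) * two_mul_half (R := R)

end FrameAlgebra
end ConformalHH

namespace ConformalHH

/-! ### Change of frame and conformal rescaling -/

section FrameChange

variable {R : Type*} [CommRing R] [Algebra ℂ R]

/-- A frame `e_a = A_a^b E_b` of the derivations of `R`, which is a null tetrad for a metric `g` if
`E_a` is one for `Ω² g`; `s` and `s₀` are the lowered structure functions of `e` and `E`. -/
structure FrameChange (e E : Idx → Derivation ℂ R R) (s s₀ : Idx → Idx → Idx → R)
    (A : Matrix Idx Idx R) (Ω : Rˣ) : Prop where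
  der : ∀ a f, e a f = ∑ b, A a b * E b f
  conf : A * etaR R * A.transpose = (Ω : R) ^ 2 • etaR R
  anti : ∀ a b c, s a b c = -s b a c
  anti₀ : ∀ a b c, s₀ a b c = -s₀ b a c
  bracket : ∀ a b f, e a (A b f) - e b (A a f) + ∑ d, ∑ g, A a d * A b g * strR s₀ d g f
    = ∑ c, strR s a b c * A c f

/-- The logarithmic derivative of a unit. -/
def ld (d : Derivation ℂ R R) (u : Rˣ) : R := ↑u⁻¹ * d ↑u

theorem ld_mul (d : Derivation ℂ R R) (u v : Rˣ) : ld d (u * v) = ld d u + ld d v := by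
  simp only [ld, mul_inv, Units.val_mul, Derivation.leibniz, smul_eq_mul]
  linear_combination (↑u⁻¹ * d ↑u) * v.inv_mul + (↑v⁻¹ * d ↑v) * u.inv_mul

@[simp] theorem ld_one (d : Derivation ℂ R R) : ld d 1 = 0 := by simp [ld]

theorem ld_inv (d : Derivation ℂ R R) (u : Rˣ) : ld d u⁻¹ = -ld d u := by
  have := ld_mul d u u⁻¹
  rw [mul_inv_cancel, ld_one] at this
  linear_combination -this

theorem ld_pow (d : Derivation ℂ R R) (u : Rˣ) (n : ℕ) : ld d (u ^ n) = n * ld d u := by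
  induction n with
  | zero => simp
  | succ n ih => rw [pow_succ, ld_mul, ih]; push_cast; ring

theorem der_unit (d : Derivation ℂ R R) (u : Rˣ) : d (u : R) = ld d u * u := by
  simp only [ld]; linear_combination - (d (u : R)) * u.inv_mul

namespace FrameChange

variable {e E : Idx → Derivation ℂ R R} {s s₀ : Idx → Idx → Idx → R} {A : Matrix Idx Idx R} {Ω : Rˣ}

theorem exists_inv (h : FrameChange e E s s₀ A Ω) : ∃ B : Matrix Idx Idx R, A * B = 1 ∧ B * A = 1 := by
  have : A * ((↑Ω⁻¹ : R) ^ 2 • (etaR R * A.transpose * etaR R)) = 1 := by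
    rw [Matrix.mul_smul, ← Matrix.mul_assoc, ← Matrix.mul_assoc, h.conf, Matrix.smul_mul,
      etaR_mul_self, smul_smul, ← mul_pow, Units.inv_mul, one_pow, one_smul]
  exact ⟨_, this, mul_eq_one_comm.1 this⟩

theorem cancel (h : FrameChange e E s s₀ A Ω) {l : Type*} {M N : Matrix l Idx R}
    (hMN : M * A = N * A) : M = N := by
  obtain ⟨B, hB, -⟩ := h.exists_inv
  simpa [Matrix.mul_assoc, hB] using congrArg (· * B) hMN

/-- Weyl connections transform as connections do. -/
theorem wcR_mul (h : FrameChange e E s s₀ A Ω) {w w₀ : Idx → R}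
    (hw : ∀ a, w a = ∑ d, A a d * w₀ d + ld (e a) Ω) (a : Idx) :
    wcR s w a * A = A.map (e a) + A * ∑ d, A a d • wcR s₀ w₀ d := by
  obtain ⟨B, hAB, hBA⟩ := h.exists_inv
  set Γ : Idx → Matrix Idx Idx R := fun a => ∑ d, A a d • wcR s₀ w₀ d with hΓ
  set G : Idx → Matrix Idx Idx R := fun a => (A.map (e a) + A * Γ a) * B with hG
  have hGA : ∀ a, G a * A = A.map (e a) + A * Γ a := fun a => by
    simp only [hG]; rw [Matrix.mul_assoc, hBA, Matrix.mul_one]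
  rw [← hGA a]
  congr 1
  refine (eq_wcR ?_ ?_ a).symm
  · intro a b c
    have key : Matrix.of (fun (_ : Unit) c => G a b c - G b a c)
        = Matrix.of (fun (_ : Unit) c => strR s a b c) := by
      refine h.cancel ?_
      ext _ f
      have h1 := congrFun (congrFun (hGA a) b) f
      have h2 := congrFun (congrFun (hGA b) a) f
      have h3 : (A * Γ a) b f - (A * Γ b) a f = ∑ d, ∑ g, A a d * A b g * strR s₀ d g f := by
        simp only [hΓ, Matrix.mul_apply, Matrix.sum_apply, Matrix.smul_apply, smul_eq_mul,
          ← wcR_torsion h.anti₀ w₀, mul_sub, Finset.sum_sub_distrib, Finset.mul_sum]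
        congr 1
        rw [Finset.sum_comm]
        · exact Finset.sum_congr rfl fun d _ => Finset.sum_congr rfl fun g _ => by ring
        · exact Finset.sum_congr rfl fun d _ => Finset.sum_congr rfl fun g _ => by ring
      simp only [Matrix.mul_apply, Matrix.of_apply, sub_mul, Finset.sum_sub_distrib,
        Matrix.add_apply, Matrix.map_apply] at h1 h2 h3 ⊢
      rw [h1, h2, ← h.bracket a b f, ← h3]
      ring
    exact congrFun (congrFun key ()) c
  · intro a
    have h1 : etaR R = (↑Ω⁻¹ : R) ^ 2 • (A * etaR R * A.transpose) := by
      rw [h.conf, smul_smul, ← mul_pow, Units.inv_mul, one_pow, one_smul]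
    have hΓη : Γ a * etaR R + (Γ a * etaR R).transpose = (2 * ∑ d, A a d * w₀ d) • etaR R := by
      simp only [hΓ, Matrix.sum_mul, Matrix.transpose_sum, Matrix.smul_mul, Matrix.transpose_smul]
      rw [← Finset.sum_add_distrib, Finset.mul_sum, Finset.sum_smul]
      refine Finset.sum_congr rfl fun d _ => ?_
      rw [← smul_add, wcR_metric h.anti₀ w₀ d, smul_smul]
      congr 1; ring
    have h2 : A.map (e a) * etaR R * A.transpose + A * etaR R * (A.map (e a)).transpose
        = (e a ((Ω : R) ^ 2)) • etaR R := by
      have := congrArg (fun M : Matrix Idx Idx R => M.map (e a)) h.conf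
      simp only [map_der_mul, map_etaR, Matrix.transpose_map, Matrix.mul_zero, add_zero] at this
      rw [this]
      ext b c
      simp [etaR]
      ring
    have h3 : G a * etaR R = (↑Ω⁻¹ : R) ^ 2 • ((A.map (e a) + A * Γ a) * etaR R * A.transpose) := by
      conv_lhs => rw [h1]
      rw [Matrix.mul_smul, ← Matrix.mul_assoc, ← Matrix.mul_assoc, hGA]
    have h4 : (A.map (e a) + A * Γ a) * etaR R * A.transpose
        + ((A.map (e a) + A * Γ a) * etaR R * A.transpose).transpose
        = (e a ((Ω : R) ^ 2) + (2 * ∑ d, A a d * w₀ d) * (Ω : R) ^ 2) • etaR R := by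
      have h5 : A * (Γ a * etaR R) * A.transpose + A * (Γ a * etaR R).transpose * A.transpose
          = ((2 * ∑ d, A a d * w₀ d) * (Ω : R) ^ 2) • etaR R := by
        rw [← Matrix.add_mul, ← Matrix.mul_add, hΓη, Matrix.mul_smul, Matrix.smul_mul, h.conf,
          smul_smul]
      rw [add_smul, ← h2, ← h5]
      simp only [Matrix.transpose_mul, Matrix.transpose_transpose, etaR_transpose,
        Matrix.transpose_add, Matrix.add_mul, Matrix.mul_assoc]
      abel
    rw [h3, Matrix.transpose_smul, ← smul_add, h4, smul_smul, hw a]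
    congr 1
    simp only [pow_two, Derivation.leibniz, smul_eq_mul, der_unit]
    linear_combination (2 * ∑ d, A a d * w₀ d + 2 * ld (e a) Ω) * (1 + ↑Ω⁻¹ * (Ω : R)) * Ω.inv_mul

end FrameChange

/-- The curvature `R_{ab}` of a connection, as matrices `(R_{ab})_c^d`. -/
def curvR (e : Idx → Derivation ℂ R R) (c : Idx → Idx → Idx → R) (G : Idx → Matrix Idx Idx R)
    (a b : Idx) : Matrix Idx Idx R :=
  (G b).map (e a) - (G a).map (e b) + G b * G a - G a * G b - ∑ k, c a b k • G k

namespace FrameChange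

variable {e E : Idx → Derivation ℂ R R} {s s₀ : Idx → Idx → Idx → R} {A : Matrix Idx Idx R} {Ω : Rˣ}

/-- The curvature of a connection is a tensor. -/
theorem curvR_mul (h : FrameChange e E s s₀ A Ω) (hee : ∀ a b f, e a (e b f) - e b (e a f) =
      ∑ c, strR s a b c * e c f)
    {G G₀ : Idx → Matrix Idx Idx R}
    (hG : ∀ a, G a * A = A.map (e a) + A * ∑ d, A a d • G₀ d) (a b : Idx) :
    curvR e (strR s) G a b * A = A * ∑ d, ∑ f, (A a d * A b f) • curvR E (strR s₀) G₀ d f := by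
  set Γ : Idx → Matrix Idx Idx R := fun a => ∑ d, A a d • G₀ d with hΓ
  have h1 : ∀ a b, ((G b).map (e a) + G b * G a) * A = (A.map (e b)).map (e a)
      + A.map (e a) * Γ b + A.map (e b) * Γ a + A * ((Γ b).map (e a) + Γ b * Γ a) := by
    intro a b
    have := congrArg (fun M : Matrix Idx Idx R => M.map (e a)) (hG b)
    simp only [map_der_mul] at this
    have h2 : (A.map (e b) + A * Γ b).map (e a) = (A.map (e b)).map (e a)
      + (A.map (e a) * Γ b + A * (Γ b).map (e a)) := by
      rw [← map_der_mul]; ext; simp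
    rw [h2] at this
    rw [Matrix.add_mul, eq_sub_of_add_eq this, Matrix.mul_assoc, hG a, Matrix.mul_add,
      ← Matrix.mul_assoc, hG b]
    simp only [Matrix.mul_add, Matrix.add_mul, Matrix.mul_assoc]
    abel
  have h2 : (A.map (e b)).map (e a) - (A.map (e a)).map (e b) = ∑ k, strR s a b k • A.map (e k) := by
    ext i j
    simp [hee, Matrix.sum_apply]
  have h3 : (∑ k, strR s a b k • G k) * A = ∑ k, strR s a b k • A.map (e k)
      + A * ∑ k, strR s a b k • Γ k := by
    rw [Matrix.sum_mul, Matrix.mul_sum, ← Finset.sum_add_distrib]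
    exact Finset.sum_congr rfl fun k _ => by
      rw [Matrix.smul_mul, Matrix.mul_smul, hG, smul_add]
  have h4 : curvR e (strR s) G a b * A
      = A * ((Γ b).map (e a) - (Γ a).map (e b) + Γ b * Γ a - Γ a * Γ b - ∑ k, strR s a b k • Γ k) := by
    have e1 : curvR e (strR s) G a b = ((G b).map (e a) + G b * G a) - ((G a).map (e b) + G a * G b)
      - ∑ k, strR s a b k • G k := by simp only [curvR]; abel
    rw [e1, Matrix.sub_mul, Matrix.sub_mul, h1, h1, h3, ← h2]
    simp only [Matrix.mul_add, Matrix.mul_sub]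
    abel
  rw [h4]
  congr 1
  have h5 : ∀ a b, (Γ b).map (e a) = ∑ f, e a (A b f) • G₀ f
      + ∑ d, ∑ f, (A a d * A b f) • (G₀ f).map (E d) := by
    intro a b
    ext i j
    simp only [hΓ, Matrix.map_apply, Matrix.sum_apply, Matrix.smul_apply, map_sum,
      Derivation.leibniz, smul_eq_mul, Matrix.add_apply, Finset.sum_add_distrib, h.der a (G₀ _ i j)]
    rw [add_comm]
    congr 1
    · exact Finset.sum_congr rfl fun _ _ => mul_comm _ _
    · simp only [Finset.mul_sum]
      rw [Finset.sum_comm]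
      exact Finset.sum_congr rfl fun d _ => Finset.sum_congr rfl fun g _ => by ring
  have h6 : ∀ a b, Γ b * Γ a = ∑ d, ∑ f, (A a d * A b f) • (G₀ f * G₀ d) := by
    intro a b
    simp only [hΓ, Matrix.sum_mul, Matrix.mul_sum, Matrix.smul_mul, Matrix.mul_smul, smul_smul,
      Finset.smul_sum]
  have h7 : ∑ k, strR s a b k • Γ k = ∑ f, (e a (A b f) - e b (A a f)) • G₀ f
      + ∑ d, ∑ f, (A a d * A b f) • ∑ k, strR s₀ d f k • G₀ k := by
    simp only [hΓ, Finset.smul_sum, smul_smul]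
    rw [Finset.sum_comm]
    simp only [← Finset.sum_smul, ← h.bracket a b, add_smul, Finset.sum_add_distrib]
    congr 1
    simp only [Finset.sum_smul]
    rw [Finset.sum_comm]
    refine Finset.sum_congr rfl fun d _ => ?_
    rw [Finset.sum_comm]
  rw [h7, h5 a b, h5 b a, h6 a b, h6 b a]
  have sw : ∀ F : Idx → Idx → Matrix Idx Idx R, ∑ d, ∑ f, (A b d * A a f) • F d f
      = ∑ d, ∑ f, (A a d * A b f) • F f d := fun F => by
    rw [Finset.sum_comm]; simp only [mul_comm]
  rw [sw, sw]
  simp only [curvR, smul_sub, smul_add, sub_smul, Finset.sum_sub_distrib, Finset.sum_add_distrib]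
  abel

end FrameChange
end FrameChange
end ConformalHH

namespace ConformalHH

/-! ### Spinors in an abstract frame -/

section SpinChange

variable {R : Type*} [CommRing R]

/-- The tensor product of two matrices of spinor components. -/
def tens (a b : Matrix (Fin 2) (Fin 2) R) : Matrix Idx Idx R := fun x y => a x.1 y.1 * b x.2 y.2

theorem tens_mul (a a' b b' : Matrix (Fin 2) (Fin 2) R) :
    tens a b * tens a' b' = tens (a * a') (b * b') := by
  ext x y
  simp only [tens, Matrix.mul_apply, Fintype.sum_prod_type, Finset.sum_mul_sum]
  exact Finset.sum_congr rfl fun i _ => Finset.sum_congr rfl fun j _ => by ring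

theorem tens_add_left (a a' b : Matrix (Fin 2) (Fin 2) R) :
    tens (a + a') b = tens a b + tens a' b := by ext; simp [tens, add_mul]

theorem tens_add_right (a b b' : Matrix (Fin 2) (Fin 2) R) :
    tens a (b + b') = tens a b + tens a b' := by ext; simp [tens, mul_add]

theorem tens_one_one : tens (1 : Matrix (Fin 2) (Fin 2) R) 1 = 1 := by
  ext ⟨A, A'⟩ ⟨B, B'⟩
  fin_cases A <;> fin_cases A' <;> fin_cases B <;> fin_cases B' <;> simp [tens]

variable [Algebra ℂ R]

/-- The coefficients of a connection on unprimed spinors; see `SpinGeometry.spinConn`. -/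
def spinR (G : Idx → Matrix Idx Idx R) (w : Idx → R) (a : Idx) : Matrix (Fin 2) (Fin 2) R :=
  fun B C => half R * ((∑ B' : Fin 2, G a (B, B') (C, B')) - w a * (1 : Matrix _ _ R) B C)

/-- The coefficients of a connection on primed spinors; see `SpinGeometry.spinConn'`. -/
def spinR' (G : Idx → Matrix Idx Idx R) (w : Idx → R) (a : Idx) : Matrix (Fin 2) (Fin 2) R :=
  fun B' C' => half R * ((∑ B : Fin 2, G a (B, B') (B, C')) - w a * (1 : Matrix _ _ R) B' C')

theorem tens_map (d : Derivation ℂ R R) (a b : Matrix (Fin 2) (Fin 2) R) :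
    (tens a b).map d = tens (a.map d) b + tens a (b.map d) := by
  ext; simp [tens]; ring

theorem double_cancel {x y : R} (h : 2 * x = 2 * y) : x = y := by
  linear_combination half R * h - (x - y) * two_mul_half (R := R)

/-- A matrix in the conformal Lie algebra of the metric splits into its two spinor parts. -/
theorem conformal_split {M : Matrix Idx Idx R} {w : R}
    (hM : M * etaR R + (M * etaR R).transpose = (2 * w) • etaR R) :
    M = tens (spinR (fun _ => M) (fun _ => w) (0, 0)) 1
      + tens 1 (spinR' (fun _ => M) (fun _ => w) (0, 0)) := by
  have h := fun x y => congrFun (congrFun hM x) y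
  simp only [Matrix.add_apply, Matrix.transpose_apply, Matrix.smul_apply, Matrix.mul_apply,
    sum_idx, etaR_apply, smul_eq_mul] at h
  have h1 := h (0, 0) (0, 0)
  have h2 := h (0, 0) (0, 1)
  have h3 := h (0, 0) (1, 0)
  have h4 := h (0, 0) (1, 1)
  have h5 := h (0, 1) (0, 1)
  have h6 := h (0, 1) (1, 0)
  have h7 := h (0, 1) (1, 1)
  have h8 := h (1, 0) (1, 0)
  have h9 := h (1, 0) (1, 1)
  have h10 := h (1, 1) (1, 1)
  clear h hM
  have hh := two_mul_half (R := R)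
  simp at h1 h2 h3 h4 h5 h6 h7 h8 h9 h10
  ext ⟨A, A'⟩ ⟨B, B'⟩
  fin_cases A <;> fin_cases A' <;> fin_cases B <;> fin_cases B' <;>
    simp [tens, spinR, spinR'] <;> apply double_cancel <;> grind

theorem spinR_trace {M : Matrix Idx Idx R} {w : R}
    (hM : M * etaR R + (M * etaR R).transpose = (2 * w) • etaR R) :
    (spinR (fun _ => M) (fun _ => w) (0, 0)).trace = w ∧
      (spinR' (fun _ => M) (fun _ => w) (0, 0)).trace = w := by
  have h := fun x y => congrFun (congrFun hM x) y
  simp only [Matrix.add_apply, Matrix.transpose_apply, Matrix.smul_apply, Matrix.mul_apply,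
    sum_idx, etaR_apply, smul_eq_mul] at h
  have h4 := h (0, 0) (1, 1)
  have h6 := h (0, 1) (1, 0)
  clear h hM
  have hh := two_mul_half (R := R)
  simp at h4 h6
  simp only [Matrix.trace, spinR, spinR', Fin.sum_univ_two, Matrix.diag]
  constructor <;> simp <;> apply double_cancel <;> grind

end SpinChange
end ConformalHH

namespace ConformalHH

/-! ### Change of spin frame -/

section SpinChange

variable {R : Type*} [CommRing R]

/-- The matrix `a_A^B` for which `o^A a_A^B = α δ_0^B` and `ι^A a_A^B = β δ_1^B`, provided that
`o_A ι^A = 1`. -/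
def spinMat (o ι : Fin 2 → R) (α β : R) : Matrix (Fin 2) (Fin 2) R :=
  !![α * ι 1, -(β * o 1); -(α * ι 0), β * o 0]

variable [Algebra ℂ R]

/-- The change from the frame `E` to the frame `e = (a ⊗ b) E`, where the unprimed part `a` is adapted
to the spinors `o`, `ι`, see `spinMat`. -/
structure SpinChange (e E : Idx → Derivation ℂ R R) (s s₀ : Idx → Idx → Idx → R)
    (o ι : Fin 2 → R) (b : Matrix (Fin 2) (Fin 2) R) (α β Ω : Rˣ) : Prop where
  der : ∀ a f, e a f = ∑ c, tens (spinMat o ι α β) b a c * E c f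
  anti : ∀ a b c, s a b c = -s b a c
  anti₀ : ∀ a b c, s₀ a b c = -s₀ b a c
  bracket : ∀ a c f, e a (tens (spinMat o ι α β) b c f) - e c (tens (spinMat o ι α β) b a f)
    + ∑ d, ∑ g, tens (spinMat o ι α β) b a d * tens (spinMat o ι α β) b c g * strR s₀ d g f
    = ∑ k, strR s a c k * tens (spinMat o ι α β) b k f
  comm : ∀ a b f, e a (e b f) - e b (e a f) = ∑ c, strR s a b c * e c f
  norm : o 0 * ι 1 - o 1 * ι 0 = 1
  det_b : (α * β : R) * b.det = Ω ^ 2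

/-- Half the logarithmic derivative of `det b / Ω`. -/
def traceShift (d : Derivation ℂ R R) (α β Ω : Rˣ) : R := half R * (ld d Ω - ld d α - ld d β)

theorem der_det (d : Derivation ℂ R R) (b : Matrix (Fin 2) (Fin 2) R) :
    d b.det = (b.map d * b.adjugate).trace := by
  simp [Matrix.det_fin_two, Matrix.adjugate_fin_two, Matrix.trace, Matrix.mul_apply]
  ring

/-- The splitting of a matrix `X ⊗ 1 + 1 ⊗ X'` is unique up to multiples of the identity. -/
theorem eq_smul_of_tens_add_eq_zero {X X' : Matrix (Fin 2) (Fin 2) R}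
    (h : tens X 1 + tens 1 X' = 0) :
    X = (-(half R * X'.trace)) • 1 ∧ X' = (-(half R * X.trace)) • 1 := by
  have h0 := fun x y => congrFun (congrFun h x) y
  simp only [tens, Matrix.add_apply, Matrix.zero_apply] at h0
  have h1 := fun B C => congrArg₂ (· + ·) (h0 (B, 0) (C, 0)) (h0 (B, 1) (C, 1))
  have h2 := fun B C => congrArg₂ (· + ·) (h0 (0, B) (0, C)) (h0 (1, B) (1, C))
  simp only [Matrix.one_apply_eq, mul_one, one_mul, add_zero] at h1 h2
  constructor
  · ext B C
    simp only [Matrix.trace_fin_two, Matrix.smul_apply, smul_eq_mul]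
    linear_combination half R * h1 B C - X B C * two_mul_half (R := R)
  · ext B C
    simp only [Matrix.trace_fin_two, Matrix.smul_apply, smul_eq_mul]
    linear_combination half R * h2 B C - X' B C * two_mul_half (R := R)

namespace SpinChange

variable {e E : Idx → Derivation ℂ R R} {s s₀ : Idx → Idx → Idx → R} {o ι : Fin 2 → R}
  {b : Matrix (Fin 2) (Fin 2) R} {α β Ω : Rˣ}

theorem det_spinMat (h : SpinChange e E s s₀ o ι b α β Ω) : (spinMat o ι α β).det = α * β := by
  simp only [spinMat, Matrix.det_fin_two_of]
  linear_combination (α * β : R) * h.norm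

theorem tens_conf (a b : Matrix (Fin 2) (Fin 2) R) :
    tens a b * etaR R * (tens a b).transpose = (a.det * b.det) • etaR R := by
  ext ⟨A, A'⟩ ⟨B, B'⟩
  simp only [Matrix.mul_apply, sum_idx, Matrix.transpose_apply, Matrix.smul_apply, etaR_apply,
    tens, Matrix.det_fin_two, smul_eq_mul]
  fin_cases A <;> fin_cases A' <;> fin_cases B <;> fin_cases B' <;> simp <;> ring

theorem frameChange (h : SpinChange e E s s₀ o ι b α β Ω) :
    FrameChange e E s s₀ (tens (spinMat o ι α β) b) Ω :=
  ⟨h.der, by rw [tens_conf, h.det_spinMat, h.det_b], h.anti, h.anti₀, h.bracket⟩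

theorem exists_inv_a (h : SpinChange e E s s₀ o ι b α β Ω) :
    ∃ a', spinMat o ι α β * a' = 1 ∧ a' * spinMat o ι α β = 1 := by
  have : spinMat o ι α β * ((↑α⁻¹ * ↑β⁻¹ : R) • (spinMat o ι α β).adjugate) = 1 := by
    rw [Matrix.mul_smul, Matrix.mul_adjugate, h.det_spinMat, smul_smul]
    have : (↑α⁻¹ * ↑β⁻¹ * (↑α * ↑β) : R) = 1 := by
      linear_combination (↑β⁻¹ * ↑β : R) * α.inv_mul + β.inv_mul
    rw [this, one_smul]
  exact ⟨_, this, mul_eq_one_comm.1 this⟩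

theorem inv_b (h : SpinChange e E s s₀ o ι b α β Ω) :
    b * (((α * β * Ω⁻¹ ^ 2 : Rˣ) : R) • b.adjugate) = 1 := by
  rw [Matrix.mul_smul, Matrix.mul_adjugate, smul_smul]
  have : ((α * β * Ω⁻¹ ^ 2 : Rˣ) : R) * b.det = 1 := by
    have h1 := h.det_b
    push_cast
    linear_combination (↑Ω⁻¹ : R) ^ 2 * h1 + (1 + ↑Ω⁻¹ * (Ω : R)) * Ω.inv_mul
  rw [this, one_smul]

/-- The spinor parts of a Weyl connection transform as connections do, up to a trace which enforces
the normalisation of the traces. -/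
theorem spinR_mul (h : SpinChange e E s s₀ o ι b α β Ω) {w w₀ : Idx → R}
    (hw : ∀ a, w a = ∑ d, tens (spinMat o ι α β) b a d * w₀ d + ld (e a) Ω) (a : Idx) :
    spinR (wcR s w) w a * spinMat o ι α β = (spinMat o ι α β).map (e a)
        + spinMat o ι α β * (∑ d, tens (spinMat o ι α β) b a d • spinR (wcR s₀ w₀) w₀ d)
        + traceShift (e a) α β Ω • spinMat o ι α β ∧
      spinR' (wcR s w) w a * b = b.map (e a)
        + b * (∑ d, tens (spinMat o ι α β) b a d • spinR' (wcR s₀ w₀) w₀ d)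
        - traceShift (e a) α β Ω • b := by
  have hF := h.frameChange
  have hM := hF.wcR_mul hw a
  obtain ⟨a', haa', ha'a⟩ := h.exists_inv_a
  set A := spinMat o ι α β with hA
  have hbb' := h.inv_b
  have hb'b := mul_eq_one_comm.1 hbb'
  set b' := ((α * β * Ω⁻¹ ^ 2 : Rˣ) : R) • b.adjugate with hb'
  set g := ∑ d, tens A b a d • spinR (wcR s₀ w₀) w₀ d with hg
  set g' := ∑ d, tens A b a d • spinR' (wcR s₀ w₀) w₀ d with hg'
  have hΓ : ∑ d, tens A b a d • wcR s₀ w₀ d = tens g 1 + tens 1 g' := by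
    have h1 : ∀ d, wcR s₀ w₀ d = tens (spinR (wcR s₀ w₀) w₀ d) 1
        + tens 1 (spinR' (wcR s₀ w₀) w₀ d) := fun d => conformal_split (wcR_metric h.anti₀ w₀ d)
    ext x y
    simp only [hg, hg', tens, Matrix.sum_apply, Matrix.add_apply, Matrix.smul_apply, smul_eq_mul,
      Finset.sum_mul, Finset.mul_sum, ← Finset.sum_add_distrib]
    refine Finset.sum_congr rfl fun d _ => ?_
    have := congrFun (congrFun (h1 d) x) y
    simp only [tens, Matrix.add_apply] at this
    rw [this]; ring
  have hg'tr : g'.trace = ∑ d, tens A b a d * w₀ d := by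
    simp only [hg', Matrix.trace_sum, Matrix.trace_smul, smul_eq_mul]
    exact Finset.sum_congr rfl fun d _ => by
      rw [show (spinR' (wcR s₀ w₀) w₀ d).trace = w₀ d from (spinR_trace (wcR_metric h.anti₀ w₀ d)).2]
  have hsplit : wcR s w a = tens (spinR (wcR s w) w a) 1 + tens 1 (spinR' (wcR s w) w a) :=
    conformal_split (wcR_metric h.anti w a)
  have htr : (spinR' (wcR s w) w a).trace = w a := (spinR_trace (wcR_metric h.anti w a)).2
  have hX : tens (spinR (wcR s w) w a - (A.map (e a) + A * g) * a') 1
      + tens 1 (spinR' (wcR s w) w a - (b.map (e a) + b * g') * b') = 0 := by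
    have h1 := congrArg (· * tens a' b') hM
    simp only [Matrix.mul_assoc, tens_mul, haa', hbb', tens_one_one, Matrix.mul_one] at h1
    rw [hΓ, hsplit, tens_map, Matrix.mul_add, tens_mul, tens_mul, Matrix.mul_one, Matrix.mul_one] at h1
    simp only [Matrix.add_mul, tens_mul, haa', hbb'] at h1
    simp only [sub_eq_add_neg, tens_add_left, tens_add_right, Matrix.add_mul, neg_add]
    have hn1 : ∀ X : Matrix (Fin 2) (Fin 2) R, tens (-X) 1 = -tens X 1 := fun X => by
      ext; simp [tens]
    have hn2 : ∀ X : Matrix (Fin 2) (Fin 2) R, tens 1 (-X) = -tens 1 X := fun X => by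
      ext; simp [tens]
    simp only [hn1, hn2]
    rw [← sub_eq_zero] at h1
    rw [← h1]
    abel
  have hdet : (b.map (e a) * b').trace = 2 * ld (e a) Ω - ld (e a) α - ld (e a) β := by
    have h1 : b.det = ((Ω ^ 2 * α⁻¹ * β⁻¹ : Rˣ) : R) := by
      have h1 := h.det_b
      push_cast
      rw [← h1]
      linear_combination (-b.det * (β * ↑β⁻¹)) * α.mul_inv - b.det * β.mul_inv
    rw [hb', Matrix.mul_smul, Matrix.trace_smul, ← der_det, h1]
    have h2 : α * β * Ω⁻¹ ^ 2 = (Ω ^ 2 * α⁻¹ * β⁻¹)⁻¹ := by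
      rw [mul_inv, mul_inv, inv_inv, inv_inv, inv_pow]; ac_rfl
    rw [h2, smul_eq_mul]
    change ld (e a) _ = _
    rw [ld_mul, ld_mul, ld_inv, ld_inv, ld_pow]
    push_cast; ring
  have hX'tr : (spinR' (wcR s w) w a - (b.map (e a) + b * g') * b').trace
      = -(ld (e a) Ω - ld (e a) α - ld (e a) β) := by
    have h1 : (b * g' * b').trace = g'.trace := by
      rw [Matrix.trace_mul_comm, ← Matrix.mul_assoc, hb'b, Matrix.one_mul]
    rw [Matrix.trace_sub, htr, Matrix.add_mul, Matrix.trace_add, hdet, h1, hg'tr, hw a]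
    ring
  obtain ⟨h1, h2⟩ := eq_smul_of_tens_add_eq_zero hX
  have h3 : spinR (wcR s w) w a - (A.map (e a) + A * g) * a' = traceShift (e a) α β Ω • 1 := by
    rw [h1, hX'tr, traceShift]; congr 1; ring
  have h4 : spinR' (wcR s w) w a - (b.map (e a) + b * g') * b' = (-traceShift (e a) α β Ω) • 1 := by
    rw [h2, h3, Matrix.trace_smul, Matrix.trace_one]
    congr 1
    simp only [Fintype.card_fin, smul_eq_mul]
    push_cast
    linear_combination - traceShift (e a) α β Ω * two_mul_half (R := R)
  constructor
  · rw [sub_eq_iff_eq_add.1 h3, Matrix.add_mul, Matrix.mul_assoc, ha'a]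
    simp [add_comm]
  · rw [sub_eq_iff_eq_add.1 h4, Matrix.add_mul, Matrix.mul_assoc, hb'b]
    simp [add_comm, sub_eq_add_neg]

end SpinChange

/-- The component `P_a = ι_B ∇_a o^B`, for a connection with coefficients `γ` on spinors. -/
def pR (e : Idx → Derivation ℂ R R) (γ : Idx → Matrix (Fin 2) (Fin 2) R) (o ι : Fin 2 → R)
    (a : Idx) : R :=
  ∑ B, (∑ A, ι A * epsR R A B) * (e a (o B) + ∑ C, γ a C B * o C)

/-- The endomorphism `i (o^C ι_A + ι^C o_A)` of spinors (row `A`, column `C`). -/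
def jS (o ι : Fin 2 → R) : Matrix (Fin 2) (Fin 2) R := fun A C =>
  algebraMap ℂ R Complex.I * (o C * (∑ B, ι B * epsR R B A) + ι C * (∑ B, o B * epsR R B A))

/-- The matrix `J^c_a` (row `a`, column `c`) of the almost-complex structure. -/
def jR (o ι : Fin 2 → R) : Matrix Idx Idx R := tens (jS o ι) 1

/-- The Lee form `-½ J^b_c ∇_b J^c_a`, for a connection with coefficients `G`. -/
def leeR (e : Idx → Derivation ℂ R R) (G : Idx → Matrix Idx Idx R) (o ι : Fin 2 → R) (a : Idx) : R :=
  -half R * ∑ b, ∑ c, jR o ι c b *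
    (e b (jR o ι a c) + ∑ d, (G b d c * jR o ι a d - G b a d * jR o ι d c))

namespace SpinChange

variable {e E : Idx → Derivation ℂ R R} {s s₀ : Idx → Idx → Idx → R} {o ι : Fin 2 → R}
  {b : Matrix (Fin 2) (Fin 2) R} {α β Ω : Rˣ}

/-- Transformation of the 1-form `P = ι_B ∇o^B`. -/
theorem pR_eq (h : SpinChange e E s s₀ o ι b α β Ω) {w w₀ : Idx → R}
    (hw : ∀ a, w a = ∑ d, tens (spinMat o ι α β) b a d * w₀ d + ld (e a) Ω) (a : Idx) :
    pR e (spinR (wcR s w) w) o ι a = half R * (ld (e a) β - ld (e a) α - ld (e a) Ω)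
      - ∑ d, tens (spinMat o ι α β) b a d * spinR (wcR s₀ w₀) w₀ d 0 0 := by
  have h1 := (h.spinR_mul hw a).1
  set g := ∑ d, tens (spinMat o ι α β) b a d • spinR (wcR s₀ w₀) w₀ d with hg
  have hg0 : ∑ d, tens (spinMat o ι α β) b a d * spinR (wcR s₀ w₀) w₀ d 0 0 = g 0 0 := by
    simp [hg, Matrix.sum_apply]
  rw [hg0]
  generalize spinR (wcR s w) w = γ at *
  have e1 := congrFun (congrFun h1 0) 0
  have e2 := congrFun (congrFun h1 1) 0
  clear h1 hg hg0
  have hn := congrArg (e a) h.norm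
  have hn' := h.norm
  simp [Matrix.mul_apply, spinMat, Fin.sum_univ_two, der_unit, Matrix.vecMul, dotProduct]
    at e1 e2 hn
  simp only [pR, traceShift, Fin.sum_univ_two, epsR_00, epsR_01, epsR_10, epsR_11] at *
  refine α.isUnit.mul_left_cancel ?_
  linear_combination -o 0 * e1 - o 1 * e2 - (α : R) * hn
    - ((ld (e a) α + g 0 0 + half R * (ld (e a) Ω - ld (e a) α - ld (e a) β)) * α) * hn'
    + (α : R) * ld (e a) α * two_mul_half (R := R)

theorem jR_mul (h : SpinChange e E s s₀ o ι b α β Ω) :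
    jR o ι * tens (spinMat o ι α β) b = tens (spinMat o ι α β) b * jR ![1, 0] ![0, 1] := by
  rw [jR, jR, tens_mul, tens_mul, Matrix.one_mul, Matrix.mul_one]
  congr 1
  have hn := h.norm
  ext A C
  fin_cases A <;> fin_cases C <;> simp [Matrix.mul_apply, jS, spinMat]
  · linear_combination (-algebraMap ℂ R Complex.I * α * ι 1) * hn
  · linear_combination (-algebraMap ℂ R Complex.I * β * o 1) * hn
  · linear_combination (algebraMap ℂ R Complex.I * α * ι 0) * hn
  · linear_combination (algebraMap ℂ R Complex.I * β * o 0) * hn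

theorem leeR_eq_trace (G : Idx → Matrix Idx Idx R) (a : Idx) :
    leeR e G o ι a = -half R * ∑ b, (((jR o ι).map (e b) + jR o ι * G b - G b * jR o ι)
      * jR o ι) a b := by
  simp only [leeR, Matrix.mul_apply, Matrix.add_apply, Matrix.sub_apply, Matrix.map_apply]
  congr 1
  refine Finset.sum_congr rfl fun b _ => Finset.sum_congr rfl fun c _ => ?_
  rw [mul_comm, Finset.sum_sub_distrib, add_sub_assoc]
  congr 3
  exact Finset.sum_congr rfl fun c _ => by ring

theorem map_jR (d : Derivation ℂ R R) : (jR (R := R) ![1, 0] ![0, 1]).map d = 0 := by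
  ext ⟨A, A'⟩ ⟨B, B'⟩
  fin_cases A <;> fin_cases A' <;> fin_cases B <;> fin_cases B' <;> simp [jR, jS, tens]

/-- The Lee form in terms of the connection coefficients of a frame adapted to `o` and `ι`. -/
theorem leeR_adapted (e : Idx → Derivation ℂ R R) (G : Idx → Matrix Idx Idx R) (a : Idx) :
    leeR e G ![1, 0] ![0, 1] a = -∑ B', G (1 - a.1, B') a (1 - a.1, B') := by
  have hI : algebraMap ℂ R Complex.I * algebraMap ℂ R Complex.I = -1 := by
    rw [← map_mul, Complex.I_mul_I]; simp
  rw [leeR_eq_trace]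
  simp only [map_jR]
  obtain ⟨A, A'⟩ := a
  fin_cases A <;> fin_cases A' <;>
    simp [sum_idx, Matrix.mul_apply, jR, jS, tens]
  · linear_combination (2 * half R * (G (1, 0) (0, 0) (1, 0) + G (1, 1) (0, 0) (1, 1))) * hI
      - (G (1, 0) (0, 0) (1, 0) + G (1, 1) (0, 0) (1, 1)) * two_mul_half (R := R)
  · linear_combination (2 * half R * (G (1, 0) (0, 1) (1, 0) + G (1, 1) (0, 1) (1, 1))) * hI
      - (G (1, 0) (0, 1) (1, 0) + G (1, 1) (0, 1) (1, 1)) * two_mul_half (R := R)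
  · linear_combination (2 * half R * (G (0, 0) (1, 0) (0, 0) + G (0, 1) (1, 0) (0, 1))) * hI
      - (G (0, 0) (1, 0) (0, 0) + G (0, 1) (1, 0) (0, 1)) * two_mul_half (R := R)
  · linear_combination (2 * half R * (G (0, 0) (1, 1) (0, 0) + G (0, 1) (1, 1) (0, 1))) * hI
      - (G (0, 0) (1, 1) (0, 0) + G (0, 1) (1, 1) (0, 1)) * two_mul_half (R := R)

/-- The Lee form of the Levi-Civita connection in the frame `e`, by that of a Weyl connection in the
frame `E`. -/
theorem leeR_eq (h : SpinChange e E s s₀ o ι b α β Ω) {w w₀ : Idx → R}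
    (hw : ∀ a, w a = ∑ d, tens (spinMat o ι α β) b a d * w₀ d + ld (e a) Ω) (a : Idx) :
    leeR e (wcR s w) o ι a
      = ∑ d, tens (spinMat o ι α β) b a d * leeR E (wcR s₀ w₀) ![1, 0] ![0, 1] d := by
  obtain ⟨B, hAB, hBA⟩ := h.frameChange.exists_inv
  have hM := fun a => h.frameChange.wcR_mul hw a
  have hJ := h.jR_mul
  set A := tens (spinMat o ι α β) b with hA
  set J := jR o ι with hJdef
  set J₀ := jR (R := R) ![1, 0] ![0, 1] with hJ₀
  have hN : ∀ c, (J.map (e c) + J * wcR s w c - wcR s w c * J) * J * A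
      = A * (∑ d, A c d • (J₀ * wcR s₀ w₀ d - wcR s₀ w₀ d * J₀)) * J₀ := by
    intro c
    have h1 := congrArg (fun M : Matrix Idx Idx R => M.map (e c)) hJ
    simp only [map_der_mul, hJ₀, map_jR, Matrix.mul_zero, add_zero] at h1
    rw [← hJ₀] at h1
    have h2 : ∑ d, A c d • (J₀ * wcR s₀ w₀ d - wcR s₀ w₀ d * J₀)
        = J₀ * (∑ d, A c d • wcR s₀ w₀ d) - (∑ d, A c d • wcR s₀ w₀ d) * J₀ := by
      simp only [smul_sub, Finset.sum_sub_distrib, Matrix.mul_sum, Matrix.sum_mul, Matrix.mul_smul,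
        Matrix.smul_mul]
    rw [Matrix.mul_assoc, hJ, ← Matrix.mul_assoc, h2]
    congr 1
    rw [Matrix.sub_mul, Matrix.add_mul, eq_sub_of_add_eq h1, Matrix.mul_assoc J, hM,
      Matrix.mul_assoc (wcR s w c), hJ, ← Matrix.mul_assoc (wcR s w c), hM]
    simp only [Matrix.mul_add, Matrix.add_mul, Matrix.mul_sub, ← Matrix.mul_assoc, hJ]
    abel
  rw [leeR_eq_trace, ← hJdef]
  simp only [leeR_eq_trace, ← hJ₀]
  have hN' : ∀ c, (J.map (e c) + J * wcR s w c - wcR s w c * J) * J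
      = A * (∑ d, A c d • (J₀ * wcR s₀ w₀ d - wcR s₀ w₀ d * J₀)) * J₀ * B := fun c => by
    rw [← hN, Matrix.mul_assoc _ A B, hAB, Matrix.mul_one]
  have hS : ∀ M : Idx → Matrix Idx Idx R,
      ∑ c, (A * (∑ d, A c d • M d) * J₀ * B) a c = ∑ d, ∑ f, A a d * (M f * J₀) d f := by
    intro M
    have h1 : ∀ c, (A * (∑ d, A c d • M d) * J₀ * B) a c
        = ∑ d, (A * (M d * J₀) * B) a c * A c d := fun c => by
      simp only [Matrix.mul_sum, Matrix.sum_mul, Matrix.mul_smul, Matrix.smul_mul,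
        Matrix.sum_apply, Matrix.smul_apply, smul_eq_mul, Matrix.mul_assoc]
      exact Finset.sum_congr rfl fun d _ => mul_comm _ _
    simp only [h1]
    rw [Finset.sum_comm]
    have h2 : ∀ d, ∑ c, (A * (M d * J₀) * B) a c * A c d = (A * (M d * J₀)) a d := fun d => by
      rw [← Matrix.mul_apply, Matrix.mul_assoc _ B A, hBA, Matrix.mul_one]
    simp only [h2]
    simp only [Matrix.mul_apply (M := A)]
    rw [Finset.sum_comm]
  simp only [hN']
  rw [hS]
  simp only [hJ₀, map_jR, zero_add, Finset.mul_sum]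
  exact Finset.sum_congr rfl fun d _ => Finset.sum_congr rfl fun f _ => by ring

end SpinChange
end SpinChange
end ConformalHH

namespace ConformalHH

/-! ### Curvature under a change of spin frame -/

section CurvatureChange

variable {R : Type*} [CommRing R]

/-- Action of a matrix on all the indices of an array. -/
def actR (b : Matrix (Fin 2) (Fin 2) R) {n : ℕ} (T : (Fin n → Fin 2) → R) (J : Fin n → Fin 2) : R :=
  ∑ K, (∏ i, b (J i) (K i)) * T K

theorem sum_fin_succ_arrow {n : ℕ} (f : (Fin (n + 1) → Fin 2) → R) :
    ∑ K, f K = ∑ i, ∑ K, f (Fin.cons i K) := by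
  rw [← Fintype.sum_prod_type']
  exact (Fintype.sum_equiv (Fin.consEquiv fun _ : Fin (n + 1) => Fin 2) _ _ fun _ => rfl).symm

theorem actR_succ (b : Matrix (Fin 2) (Fin 2) R) {n : ℕ} (T : (Fin (n + 1) → Fin 2) → R)
    (J : Fin (n + 1) → Fin 2) :
    actR b T J = ∑ i, b (J 0) i * actR b (fun K => T (Fin.cons i K)) (Fin.tail J) := by
  rw [actR, sum_fin_succ_arrow]
  refine Finset.sum_congr rfl fun i _ => ?_
  simp only [actR, Finset.mul_sum, Fin.prod_univ_succ, Fin.cons_zero, Fin.cons_succ, Fin.tail,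
    mul_assoc]

theorem actR_zero (b : Matrix (Fin 2) (Fin 2) R) (T : (Fin 0 → Fin 2) → R) (J : Fin 0 → Fin 2) :
    actR b T J = T J := by
  simp only [actR, Finset.univ_unique, Finset.sum_singleton, Finset.univ_eq_empty,
    Finset.prod_empty, one_mul]
  exact congrArg T (Subsingleton.elim _ _)

theorem actR_four (b : Matrix (Fin 2) (Fin 2) R) (T : (Fin 4 → Fin 2) → R)
    (J : Fin 4 → Fin 2) : actR b T J = ∑ i, ∑ j, ∑ k, ∑ l,
      b (J 0) i * b (J 1) j * b (J 2) k * b (J 3) l * T ![i, j, k, l] := by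
  simp only [actR_succ, actR_zero, Finset.mul_sum]
  refine Finset.sum_congr rfl fun i _ => Finset.sum_congr rfl fun j _ =>
    Finset.sum_congr rfl fun k _ => Finset.sum_congr rfl fun l _ => ?_
  have : (Fin.cons i (Fin.cons j (Fin.cons k (Fin.cons l (Fin.tail (Fin.tail (Fin.tail
      (Fin.tail J))))))) : Fin 4 → Fin 2) = ![i, j, k, l] := by
    ext m; fin_cases m <;> rfl
  rw [this]
  simp only [mul_assoc]
  rfl

theorem sum_mul_sum_swap {X Y : Type*} [Fintype X] [Fintype Y] (c : X → X → R) (m : Y → Y → R)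
    (G : Y → Y → X → X → R) :
    ∑ C, ∑ E, c C E * ∑ d, ∑ f, m d f * G d f C E
      = ∑ d, ∑ f, m d f * ∑ C, ∑ E, c C E * G d f C E := by
  calc _ = ∑ p : X × X, ∑ q : Y × Y, c p.1 p.2 * (m q.1 q.2 * G q.1 q.2 p.1 p.2) := by
        simp only [Fintype.sum_prod_type, Finset.mul_sum]
    _ = ∑ q : Y × Y, ∑ p : X × X, c p.1 p.2 * (m q.1 q.2 * G q.1 q.2 p.1 p.2) := Finset.sum_comm
    _ = _ := by
        simp only [Fintype.sum_prod_type, Finset.mul_sum]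
        refine Finset.sum_congr rfl fun i _ => Finset.sum_congr rfl fun j _ =>
          Finset.sum_congr rfl fun k _ => Finset.sum_congr rfl fun l _ => by ring

variable [Algebra ℂ R]

/-- The Ricci tensor `R_{ac} = R_{abc}^b`. -/
def ricciR (Rm : Idx → Idx → Matrix Idx Idx R) : Matrix Idx Idx R := fun a c => ∑ b, Rm a b c b

/-- The scalar curvature `g^{ac} R_{ac}`. -/
def scalR (Rm : Idx → Idx → Matrix Idx Idx R) : R := ∑ a, ∑ c, etaR R a c * ricciR Rm a c

/-- `¼ ε^{AB} ε^{CE} R_{abce}` with primed indices `J`. -/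
def sdPartR (Rm : Idx → Idx → Matrix Idx Idx R) (J : Fin 4 → Fin 2) : R :=
  algebraMap ℂ R (1 / 4) * ∑ A, ∑ B, ∑ C, ∑ E, epsR R A B * epsR R C E *
    (Rm (A, J 0) (B, J 1) * etaR R) (C, J 2) (E, J 3)

/-- Total symmetrisation of an array with four indices. -/
def symR (T : (Fin 4 → Fin 2) → R) (I : Fin 4 → Fin 2) : R :=
  algebraMap ℂ R (1 / 24) * ∑ σ : Equiv.Perm (Fin 4), T (I ∘ σ)

theorem symR_actR (b : Matrix (Fin 2) (Fin 2) R) (T : (Fin 4 → Fin 2) → R) :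
    symR (actR b T) = actR b (symR T) := by
  ext I
  simp only [symR, actR, Finset.mul_sum]
  rw [Finset.sum_comm]
  conv_rhs => rw [Finset.sum_comm]
  rw [Finset.sum_comm]
  refine Finset.sum_congr rfl fun σ _ => ?_
  refine Fintype.sum_equiv (Equiv.arrowCongr σ (Equiv.refl _)) _ _ fun K => ?_
  have h1 : ∏ i, b ((I ∘ σ) i) (K i)
      = ∏ i, b (I i) ((Equiv.arrowCongr σ (Equiv.refl (Fin 2))) K i) := by
    refine Fintype.prod_equiv σ _ _ fun i => by simp [Equiv.arrowCongr]
  have h2 : (Equiv.arrowCongr σ (Equiv.refl (Fin 2))) K ∘ σ = K := by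
    ext i; simp [Equiv.arrowCongr]
  rw [h1, h2]; ring

/-- Contraction of the unprimed parts of two indices transformed by `a ⊗ b`. -/
theorem sum_eps_tens (a b : Matrix (Fin 2) (Fin 2) R) (p q : Fin 2) (F : Idx → Idx → R) :
    ∑ A, ∑ B, epsR R A B * ∑ d, ∑ f, tens a b (A, p) d * tens a b (B, q) f * F d f
      = a.det * ∑ p', ∑ q', b p p' * b q q' * ∑ A, ∑ B, epsR R A B * F (A, p') (B, q') := by
  simp only [Fin.sum_univ_two, sum_idx, tens, epsR_00, epsR_01, epsR_10, epsR_11,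
    Matrix.det_fin_two]
  ring

/-- The SD part of the curvature scales by the squared determinant of the unprimed matrix and is acted on by
the primed one. -/
theorem sdPartR_tens {Rm Rm₀ : Idx → Idx → Matrix Idx Idx R} (a b : Matrix (Fin 2) (Fin 2) R) (k : R)
    (h : ∀ x y, Rm x y * etaR R = k • (tens a b * (∑ d, ∑ f, (tens a b x d * tens a b y f)
      • (Rm₀ d f * etaR R)) * (tens a b).transpose)) :
    sdPartR Rm = (k * a.det ^ 2) • actR b (sdPartR Rm₀) := by
  ext J
  set S : Idx → Idx → Idx → Idx → R := fun d f u v => (Rm₀ d f * etaR R) u v with hS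
  have h1 : ∀ x y u v, (Rm x y * etaR R) u v = k * ∑ d, ∑ f, tens a b x d * tens a b y f *
      ∑ u', ∑ v', tens a b u u' * tens a b v v' * S d f u' v' := by
    intro x y u v
    rw [h, Matrix.smul_apply, smul_eq_mul]
    congr 1
    simp only [Matrix.mul_sum, Matrix.sum_mul, Matrix.sum_apply, Matrix.mul_smul, Matrix.smul_mul,
      Matrix.smul_apply, smul_eq_mul]
    refine Finset.sum_congr rfl fun d _ => Finset.sum_congr rfl fun f _ => ?_
    congr 1
    change _ = ∑ u', ∑ v', tens a b u u' * tens a b v v' * (Rm₀ d f * etaR R) u' v'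
    generalize Rm₀ d f * etaR R = M
    simp only [Matrix.mul_apply, Matrix.transpose_apply, Finset.sum_mul]
    rw [Finset.sum_comm]
    refine Finset.sum_congr rfl fun d _ => Finset.sum_congr rfl fun f _ => ?_
    ring
  have h2 : ∀ A B : Fin 2, ∑ C, ∑ E, epsR R A B * epsR R C E * (Rm (A, J 0) (B, J 1) * etaR R)
      (C, J 2) (E, J 3) = k * (epsR R A B * ∑ d, ∑ f, tens a b (A, J 0) d * tens a b (B, J 1) f *
        (a.det * ∑ p', ∑ q', b (J 2) p' * b (J 3) q' * ∑ C, ∑ E, epsR R C E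
          * S d f (C, p') (E, q'))) := by
    intro A B
    simp only [← sum_eps_tens]
    rw [← sum_mul_sum_swap]
    simp only [Finset.mul_sum, h1]
    refine Finset.sum_congr rfl fun i _ => Finset.sum_congr rfl fun j _ =>
      Finset.sum_congr rfl fun k _ => Finset.sum_congr rfl fun l _ =>
      Finset.sum_congr rfl fun m _ => Finset.sum_congr rfl fun n _ => by ring
  have h3 : ∀ A B : Fin 2, ∀ i j k l, ∑ C, ∑ E, epsR R A B * epsR R C E * S (A, i) (B, j) (C, k) (E, l)
      = epsR R A B * ∑ C, ∑ E, epsR R C E * S (A, i) (B, j) (C, k) (E, l) := fun A B i j k l => by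
    simp only [Finset.mul_sum, mul_assoc]
  rw [Pi.smul_apply, actR_four, smul_eq_mul]
  simp only [sdPartR, h2]
  simp only [← Finset.mul_sum, sum_eps_tens]
  simp only [Matrix.cons_val]
  change _ = k * a.det ^ 2 * ∑ i, ∑ j, ∑ k, ∑ l, b (J 0) i * b (J 1) j * b (J 2) k * b (J 3) l *
    (algebraMap ℂ R (1 / 4) * ∑ A, ∑ B, ∑ C, ∑ E, epsR R A B * epsR R C E
      * S (A, i) (B, j) (C, k) (E, l))
  simp only [h3]
  have h4 : ∀ i j, ∑ A, ∑ B, epsR R A B * (a.det * ∑ p', ∑ q', b (J 2) p' * b (J 3) q'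
      * ∑ C, ∑ E, epsR R C E * S (A, i) (B, j) (C, p') (E, q'))
      = a.det * ∑ p', ∑ q', b (J 2) p' * b (J 3) q' * ∑ A, ∑ B, epsR R A B *
        ∑ C, ∑ E, epsR R C E * S (A, i) (B, j) (C, p') (E, q') := by
    intro i j
    rw [← sum_mul_sum_swap]
    simp only [Finset.mul_sum]
    refine Finset.sum_congr rfl fun i _ => Finset.sum_congr rfl fun j _ =>
      Finset.sum_congr rfl fun k _ => Finset.sum_congr rfl fun l _ =>
      Finset.sum_congr rfl fun m _ => Finset.sum_congr rfl fun n _ => by ring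
  simp only [h4]
  simp only [Finset.mul_sum]
  refine Finset.sum_congr rfl fun i _ => Finset.sum_congr rfl fun j _ =>
    Finset.sum_congr rfl fun k _ => Finset.sum_congr rfl fun l _ =>
    Finset.sum_congr rfl fun i _ => Finset.sum_congr rfl fun j _ =>
    Finset.sum_congr rfl fun k _ => Finset.sum_congr rfl fun l _ => ?_
  ring

namespace SpinChange

variable {e E : Idx → Derivation ℂ R R} {s s₀ : Idx → Idx → Idx → R} {o ι : Fin 2 → R}
  {b : Matrix (Fin 2) (Fin 2) R} {α β Ω : Rˣ}

/-- The Ricci tensor of a Weyl connection is unchanged by a conformal rescaling which is compensated in the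
Weyl 1-form. -/
theorem ricciR_eq (h : SpinChange e E s s₀ o ι b α β Ω) {w w₀ : Idx → R}
    (hw : ∀ a, w a = ∑ d, tens (spinMat o ι α β) b a d * w₀ d + ld (e a) Ω) :
    ricciR (curvR e (strR s) (wcR s w)) = tens (spinMat o ι α β) b
      * ricciR (curvR E (strR s₀) (wcR s₀ w₀)) * (tens (spinMat o ι α β) b).transpose := by
  obtain ⟨B, hAB, hBA⟩ := h.frameChange.exists_inv
  have hC := h.frameChange.curvR_mul h.comm (h.frameChange.wcR_mul hw)
  set A := tens (spinMat o ι α β) b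
  ext a c
  have h1 : ∀ x, curvR e (strR s) (wcR s w) a x
      = A * (∑ d, ∑ f, (A a d * A x f) • curvR E (strR s₀) (wcR s₀ w₀) d f) * B := fun x => by
    rw [← hC, Matrix.mul_assoc, hAB, Matrix.mul_one]
  simp only [ricciR, h1]
  generalize curvR E (strR s₀) (wcR s₀ w₀) = C
  calc _ = ∑ x, ∑ d, ∑ f, ∑ g, (A a d * A c g * (C d f * B) g x) * A x f := by
        refine Finset.sum_congr rfl fun x _ => ?_
        simp only [Matrix.mul_sum, Matrix.sum_mul, Matrix.sum_apply, Matrix.mul_smul,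
          Matrix.smul_mul, Matrix.smul_apply, Matrix.mul_assoc, smul_eq_mul]
        refine Finset.sum_congr rfl fun d _ => Finset.sum_congr rfl fun f _ => ?_
        rw [Matrix.mul_apply, Finset.mul_sum]
        exact Finset.sum_congr rfl fun g _ => by ring
    _ = ∑ d, ∑ f, ∑ g, A a d * A c g * C d f g f := by
        rw [Finset.sum_comm]
        refine Finset.sum_congr rfl fun d _ => ?_
        rw [Finset.sum_comm]
        refine Finset.sum_congr rfl fun f _ => ?_
        rw [Finset.sum_comm]
        refine Finset.sum_congr rfl fun g _ => ?_
        simp only [mul_assoc, ← Finset.mul_sum]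
        rw [← Matrix.mul_apply (M := C d f * B), Matrix.mul_assoc, hBA, Matrix.mul_one]
    _ = _ := by
        simp only [Matrix.mul_apply, Matrix.transpose_apply, ricciR, Finset.sum_mul,
          Finset.mul_sum]
        conv_rhs => rw [Finset.sum_comm]
        refine Finset.sum_congr rfl fun d _ => ?_
        rw [Finset.sum_comm]
        exact Finset.sum_congr rfl fun g _ => Finset.sum_congr rfl fun f _ => by ring

theorem transpose_conf (h : SpinChange e E s s₀ o ι b α β Ω) :
    (tens (spinMat o ι α β) b).transpose * etaR R * tens (spinMat o ι α β) b
      = (Ω : R) ^ 2 • etaR R := by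
  have hc := h.frameChange.conf
  set A := tens (spinMat o ι α β) b
  have h1 : A * ((↑Ω⁻¹ : R) ^ 2 • (etaR R * A.transpose * etaR R)) = 1 := by
    rw [Matrix.mul_smul, ← Matrix.mul_assoc, ← Matrix.mul_assoc, hc, Matrix.smul_mul,
      etaR_mul_self, smul_smul, ← mul_pow, Units.inv_mul, one_pow, one_smul]
  have h2 := congrArg (fun M => (Ω : R) ^ 2 • (etaR R * M)) (mul_eq_one_comm.1 h1)
  simp only [Matrix.smul_mul, Matrix.mul_smul, smul_smul, ← mul_pow, Units.mul_inv, one_pow,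
    one_smul, Matrix.mul_one, ← Matrix.mul_assoc, etaR_mul_self, Matrix.one_mul] at h2
  exact h2

/-- The trace with `η` of a transformed array. -/
theorem sum_eta_mul (h : SpinChange e E s s₀ o ι b α β Ω) (M : Matrix Idx Idx R) :
    ∑ a, ∑ c, etaR R a c * (tens (spinMat o ι α β) b * M * (tens (spinMat o ι α β) b).transpose) a c
      = (Ω : R) ^ 2 * ∑ a, ∑ c, etaR R a c * M a c := by
  have hs : ∀ N : Matrix Idx Idx R, ∑ a, ∑ c, etaR R a c * N a c = (etaR R * N).trace := fun N => by
    simp only [Matrix.trace, Matrix.diag, Matrix.mul_apply]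
    rw [Finset.sum_comm]
    exact Finset.sum_congr rfl fun c _ => Finset.sum_congr rfl fun a _ => by rw [etaR_symm]
  rw [hs, hs, ← Matrix.mul_assoc, Matrix.trace_mul_comm, ← Matrix.mul_assoc, ← Matrix.mul_assoc,
    h.transpose_conf, Matrix.smul_mul, Matrix.trace_smul, smul_eq_mul]

theorem scalR_eq (h : SpinChange e E s s₀ o ι b α β Ω) {w w₀ : Idx → R}
    (hw : ∀ a, w a = ∑ d, tens (spinMat o ι α β) b a d * w₀ d + ld (e a) Ω) :
    scalR (curvR e (strR s) (wcR s w))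
      = (Ω : R) ^ 2 * scalR (curvR E (strR s₀) (wcR s₀ w₀)) := by
  simp only [scalR, h.ricciR_eq hw]
  exact h.sum_eta_mul _

/-- The SD Weyl spinor is conformally covariant. -/
theorem weylR_eq (h : SpinChange e E s s₀ o ι b α β Ω) {w w₀ : Idx → R}
    (hw : ∀ a, w a = ∑ d, tens (spinMat o ι α β) b a d * w₀ d + ld (e a) Ω) :
    symR (sdPartR (curvR e (strR s) (wcR s w)))
      = ((↑Ω⁻¹ : R) ^ 2 * (α * β) ^ 2) •
        actR b (symR (sdPartR (curvR E (strR s₀) (wcR s₀ w₀)))) := by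
  have hC := h.frameChange.curvR_mul h.comm (h.frameChange.wcR_mul hw)
  have h1 : etaR R = (↑Ω⁻¹ : R) ^ 2 • (tens (spinMat o ι α β) b * etaR R
      * (tens (spinMat o ι α β) b).transpose) := by
    rw [h.frameChange.conf, smul_smul, ← mul_pow, Units.inv_mul, one_pow, one_smul]
  rw [sdPartR_tens (Rm₀ := curvR E (strR s₀) (wcR s₀ w₀)) (spinMat o ι α β) b ((↑Ω⁻¹ : R) ^ 2),
    h.det_spinMat, ← symR_actR]
  · ext I
    simp only [symR, Pi.smul_apply, smul_eq_mul, Finset.mul_sum]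
    exact Finset.sum_congr rfl fun _ _ => by ring
  · intro x y
    conv_lhs => rw [h1]
    rw [Matrix.mul_smul, ← Matrix.mul_assoc, ← Matrix.mul_assoc, hC]
    simp only [Matrix.mul_assoc, Matrix.sum_mul, Matrix.smul_mul]

end SpinChange

end CurvatureChange
end ConformalHH

namespace ConformalHH

/-! ### The operators of `𝒞` under a change of spin frame -/

section ConnChange

variable {R : Type*} [CommRing R] [Algebra ℂ R]

/-- The covariant derivative along `d` of a field with `n` primed indices, where `S` is the matrix of
connection coefficients along `d`. -/
def nabR (d : Derivation ℂ R R) (S : Matrix (Fin 2) (Fin 2) R) {n : ℕ} (ψ : (Fin n → Fin 2) → R)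
    (J : Fin n → Fin 2) : R :=
  d (ψ J) - ∑ k, ∑ B', S (J k) B' * ψ (Function.update J k B')

/-- The operator `𝒞̃_{A'}`, see `SpinGeometry.connT`. -/
def connTR (e : Idx → Derivation ℂ R R) (S : Idx → Matrix (Fin 2) (Fin 2) R) (lee P : Idx → R)
    (o : Fin 2 → R) (p w : ℤ) {n : ℕ} (ψ : (Fin n → Fin 2) → R) (J : Fin (n + 1) → Fin 2) : R :=
  ∑ A, o A * (nabR (e (A, J 0)) (S (A, J 0)) ψ (Fin.tail J)
    + ((w : R) * lee (A, J 0) + (p : R) * P (A, J 0)) * ψ (Fin.tail J))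

/-- The wave operator, see `SpinGeometry.box`. -/
def boxR (e : Idx → Derivation ℂ R R) (S S' : Idx → Matrix (Fin 2) (Fin 2) R) (lee P : Idx → R)
    (p w : ℤ) (f : R) : R :=
  ∑ a, ∑ b, etaR R a b * (e a (e b f + ((w : R) * lee b + (p : R) * P b) * f)
    - (∑ B, S a b.1 B * (e (B, b.2) f + ((w : R) * lee (B, b.2) + (p : R) * P (B, b.2)) * f))
    - (∑ B', S' a b.2 B' * (e (b.1, B') f + ((w : R) * lee (b.1, B') + (p : R) * P (b.1, B')) * f))
    + ((w : R) * lee a + (p : R) * P a) * (e b f + ((w : R) * lee b + (p : R) * P b) * f))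

theorem der_prod (d : Derivation ℂ R R) {n : ℕ} (f : Fin n → R) :
    d (∏ i, f i) = ∑ k, ∏ i, Function.update f k (d (f k)) i := by
  induction n with
  | zero => simp
  | succ n ih =>
    rw [Fin.prod_univ_succ, Derivation.leibniz, ih, Fin.sum_univ_succ]
    simp only [smul_eq_mul, Fin.prod_univ_succ, Function.update_self, Finset.mul_sum]
    rw [add_comm]
    congr 1
    · rw [mul_comm]
      congr 1
    · refine Finset.sum_congr rfl fun k _ => ?_
      rw [Function.update_of_ne (Fin.succ_ne_zero k).symm]
      congr 1
      refine Finset.prod_congr rfl fun i _ => ?_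
      by_cases h : i = k
      · subst h; simp
      · rw [Function.update_of_ne h, Function.update_of_ne (by simpa using h)]

/-- A connection on primed spinors whose coefficients along `d` are, in the frame transformed by `b`,
the constant `-σ`. -/
theorem nabR_actR (d : Derivation ℂ R R) {S b : Matrix (Fin 2) (Fin 2) R} {σ : R}
    (hS : S * b = b.map d - σ • b) {n : ℕ} (κ : R) (ψ : (Fin n → Fin 2) → R) (J : Fin n → Fin 2) :
    nabR d S (κ • actR b ψ) J
      = (d κ + n * σ * κ) * actR b ψ J + κ * actR b (fun K => d (ψ K)) J := by
  have h1 : ∀ K : Fin n → Fin 2, ∑ k, ∑ B', S (J k) B' * ∏ i, b (Function.update J k B' i) (K i)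
      = d (∏ i, b (J i) (K i)) - n * σ * ∏ i, b (J i) (K i) := by
    intro K
    rw [der_prod]
    have h2 : ∀ k, ∑ B', S (J k) B' * ∏ i, b (Function.update J k B' i) (K i)
        = (∏ i, Function.update (fun i => b (J i) (K i)) k (d (b (J k) (K k))) i)
          - σ * ∏ i, b (J i) (K i) := by
      intro k
      have h3 : ∀ x : R, ∏ i, Function.update (fun i => b (J i) (K i)) k x i
          = x * ∏ i ∈ Finset.univ \ {k}, b (J i) (K i) := fun x =>
        Finset.prod_update_of_mem (Finset.mem_univ k) _ _
      have h4 : ∏ i, b (J i) (K i) = b (J k) (K k) * ∏ i ∈ Finset.univ \ {k}, b (J i) (K i) := by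
        rw [← h3, Function.update_eq_self k (fun i => b (J i) (K i))]
      have h5 : ∀ B', ∏ i, b (Function.update J k B' i) (K i)
          = b B' (K k) * ∏ i ∈ Finset.univ \ {k}, b (J i) (K i) := fun B' => by
        rw [← h3]
        refine Finset.prod_congr rfl fun i _ => ?_
        by_cases h : i = k
        · subst h; simp
        · simp [Function.update_of_ne h]
      have h6 := congrFun (congrFun hS (J k)) (K k)
      simp only [Matrix.mul_apply, Matrix.sub_apply, Matrix.map_apply, Matrix.smul_apply,
        smul_eq_mul] at h6
      simp only [h5, h3, h4, ← mul_assoc]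
      rw [← Finset.sum_mul, h6]
      ring
    simp only [h2, Finset.sum_sub_distrib, Finset.sum_const, Finset.card_univ, Fintype.card_fin,
      nsmul_eq_mul, mul_assoc]
  have h7 : ∑ k, ∑ B', S (J k) B' * (κ • actR b ψ) (Function.update J k B')
      = κ * ∑ K, (d (∏ i, b (J i) (K i)) - n * σ * ∏ i, b (J i) (K i)) * ψ K := by
    simp only [← h1, actR, Pi.smul_apply, smul_eq_mul, Finset.mul_sum, Finset.sum_mul]
    conv_rhs => rw [Finset.sum_comm]
    refine Finset.sum_congr rfl fun k _ => ?_
    conv_rhs => rw [Finset.sum_comm]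
    exact Finset.sum_congr rfl fun B' _ => Finset.sum_congr rfl fun K _ => by ring
  rw [nabR, h7]
  simp only [Pi.smul_apply, smul_eq_mul, actR, Derivation.leibniz, map_sum, Finset.sum_add_distrib,
    sub_mul, Finset.sum_sub_distrib, mul_sub, mul_assoc, ← Finset.mul_sum]
  have h8 : ∑ x, ψ x * d (∏ i, b (J i) (x i)) = ∑ x, d (∏ i, b (J i) (x i)) * ψ x :=
    Finset.sum_congr rfl fun _ _ => mul_comm _ _
  rw [h8]
  ring

namespace SpinChange

variable {e E : Idx → Derivation ℂ R R} {s s₀ : Idx → Idx → Idx → R} {o ι : Fin 2 → R}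
  {b : Matrix (Fin 2) (Fin 2) R} {α β Ω : Rˣ}

theorem sum_o_tens (h : SpinChange e E s s₀ o ι b α β Ω) (A' : Fin 2) (F : Idx → R) :
    ∑ A, o A * ∑ d, tens (spinMat o ι α β) b (A, A') d * F d = α * ∑ B', b A' B' * F (0, B') := by
  have hn := h.norm
  simp only [Fin.sum_univ_two, sum_idx, tens, spinMat, Matrix.of_apply, Matrix.cons_val]
  linear_combination (α : R) * (b A' 0 * F (0, 0) + b A' 1 * F (0, 1)) * hn

/-- The operator `𝒞̃_{A'}` in the frame `E`. -/
theorem connTR_actR (h : SpinChange e E s s₀ o ι b α β Ω) {lee P : Idx → R}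
    (hl : ∀ a, lee a = ld (e a) Ω)
    (hX : ∀ B', spinR' (wcR s₀ 0) 0 (0, B') = 0) {n : ℕ} {κ : R} {p w : ℤ}
    (hκ : ∀ A', ∑ A, o A * (e (A, A') κ + ((w : R) * lee (A, A') + p * P (A, A')) * κ
      + n * traceShift (e (A, A')) α β Ω * κ) = 0) (ψ : (Fin n → Fin 2) → R) :
    connTR e (spinR' (wcR s lee) lee) lee P o p w (κ • actR b ψ)
      = (κ * α) • actR b (fun K => E (0, K 0) (ψ (Fin.tail K))) := by
  ext J
  set Z : Derivation ℂ R R := ∑ A, o A • e (A, J 0) with hZ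
  have hZ' : ∀ f, Z f = ∑ A, o A * e (A, J 0) f := fun f => by
    simp [hZ]
  set Sz := ∑ A, o A • spinR' (wcR s lee) lee (A, J 0) with hSz
  set σ := ∑ A, o A * traceShift (e (A, J 0)) α β Ω with hσ
  have hS : Sz * b = b.map Z - σ • b := by
    have h1 := fun a => (h.spinR_mul (w := lee) (w₀ := 0) (fun a => by simp [hl]) a).2
    ext i j
    have h2 := fun A => congrFun (congrFun (h1 (A, J 0)) i) j
    have h3 := h.sum_o_tens (J 0) (fun d => (b * spinR' (wcR s₀ 0) 0 d) i j)
    simp only [hX, Matrix.zero_apply, mul_zero, Finset.sum_const_zero] at h3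
    simp only [hSz, Matrix.sum_mul, Matrix.smul_mul, Matrix.sum_apply, Matrix.smul_apply, smul_eq_mul,
      h2, Matrix.sub_apply, Matrix.add_apply, Matrix.map_apply, hZ', hσ, Matrix.mul_sum,
      Matrix.mul_smul, mul_add, mul_sub, Finset.sum_add_distrib, Finset.sum_sub_distrib]
    rw [h3, Finset.sum_mul, add_zero]
    simp only [mul_assoc]
  have h4 := nabR_actR Z hS κ ψ (Fin.tail J)
  have h5 : connTR e (spinR' (wcR s lee) lee) lee P o p w (κ • actR b ψ) J
      = nabR Z Sz (κ • actR b ψ) (Fin.tail J)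
        + (∑ A, o A * (w * lee (A, J 0) + p * P (A, J 0))) * (κ * actR b ψ (Fin.tail J)) := by
    simp only [connTR, nabR, hZ', hSz, Matrix.sum_apply, Matrix.smul_apply, smul_eq_mul, mul_add,
      mul_sub, Finset.sum_add_distrib, Finset.sum_sub_distrib, Finset.sum_mul, Finset.mul_sum,
      Pi.smul_apply]
    have hc : ∀ F : Fin 2 → Fin n → Fin 2 → R,
        ∑ A, ∑ k, ∑ B', F A k B' = ∑ k, ∑ B', ∑ A, F A k B' := fun F => by
      rw [Finset.sum_comm]
      exact Finset.sum_congr rfl fun k _ => Finset.sum_comm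
    rw [hc]
    simp only [mul_assoc, add_mul, mul_add, Finset.sum_add_distrib, Finset.sum_mul]
  have h6 : Z κ + n * σ * κ + (∑ A, o A * (w * lee (A, J 0) + p * P (A, J 0))) * κ = 0 := by
    rw [← hκ (J 0), hZ', hσ]
    simp only [Finset.sum_mul, Finset.mul_sum, mul_add, Finset.sum_add_distrib]
    simp only [Fin.sum_univ_two]
    ring
  have h7 : actR b (fun K => Z (ψ K)) (Fin.tail J)
      = α * actR b (fun K => E (0, K 0) (ψ (Fin.tail K))) J := by
    have h8 : ∀ f, Z f = α * ∑ B', b (J 0) B' * E (0, B') f := fun f => by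
      simp only [hZ', h.der]
      exact h.sum_o_tens (J 0) (fun d => E d f)
    rw [actR_succ]
    simp only [h8, actR, Fin.cons_zero, Fin.tail_cons, Finset.mul_sum]
    rw [Finset.sum_comm]
    exact Finset.sum_congr rfl fun _ _ => Finset.sum_congr rfl fun _ _ => by ring
  rw [h5, h4, h7, Pi.smul_apply, smul_eq_mul]
  linear_combination (actR b ψ (Fin.tail J)) * h6

/-- The wave operator in the frame `E`. -/
theorem boxR_eq (h : SpinChange e E s s₀ o ι b α β Ω) {lee P P₀ : Idx → R} {p w : ℤ} {κ : R}
    (hl : ∀ a, lee a = ld (e a) Ω) (hκ : ∀ a, e a κ + ((w : R) * lee a + p * P a) * κ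
      = κ * ∑ d, tens (spinMat o ι α β) b a d * (p * P₀ d)) (f : R) :
    boxR e (spinR (wcR s lee) lee) (spinR' (wcR s lee) lee) lee P p w (κ * f)
      = κ * (Ω : R) ^ 2 * ∑ a, ∑ c, etaR R a c * (E a (E c f + p * P₀ c * f)
        - (∑ d, wcR s₀ 0 a c d * (E d f + p * P₀ d * f)) + p * P₀ a * (E c f + p * P₀ c * f)) := by
  set A := tens (spinMat o ι α β) b with hA
  set ψ₀ : Idx → R := fun c => E c f + p * P₀ c * f with hψ₀
  have h1 : ∀ a, e a (κ * f) + ((w : R) * lee a + p * P a) * (κ * f) = κ * ∑ d, A a d * ψ₀ d := by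
    intro a
    have h2 := hκ a
    simp only [Derivation.leibniz, smul_eq_mul, hψ₀, mul_add, Finset.sum_add_distrib]
    have h3 : e a f = ∑ d, A a d * E d f := h.der a f
    have h4 : ∑ d, A a d * (p * P₀ d * f) = (∑ d, A a d * (p * P₀ d)) * f := by
      rw [Finset.sum_mul]; simp only [mul_assoc]
    rw [← h3, h4]
    linear_combination f * h2
  have h5 := fun a => conformal_split (wcR_metric h.anti lee a)
  have h6 : ∀ a c (ψ : Idx → R), (∑ B, spinR (wcR s lee) lee a c.1 B * ψ (B, c.2))
      + (∑ B', spinR' (wcR s lee) lee a c.2 B' * ψ (c.1, B')) = ∑ d, wcR s lee a c d * ψ d := by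
    intro a c ψ
    have h7 : ∀ d, wcR s lee a c d = spinR (wcR s lee) lee a c.1 d.1 * (1 : Matrix _ _ R) c.2 d.2
        + (1 : Matrix _ _ R) c.1 d.1 * spinR' (wcR s lee) lee a c.2 d.2 := fun d =>
      congrFun (congrFun (h5 a) c) d
    simp only [h7, Fintype.sum_prod_type, add_mul, Finset.sum_add_distrib]
    congr 1
    · refine Finset.sum_congr rfl fun B _ => ?_
      simp [Matrix.one_apply]
    · simp [Matrix.one_apply]
  have h8 := fun a => h.frameChange.wcR_mul (w := lee) (w₀ := 0) (fun a => by simp [hl]) a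
  have h9 : ∀ a c, e a (κ * ∑ d, A c d * ψ₀ d) - (∑ g, wcR s lee a c g * (κ * ∑ d, A g d * ψ₀ d))
      + ((w : R) * lee a + p * P a) * (κ * ∑ d, A c d * ψ₀ d)
      = κ * (A * Matrix.of (fun d g => E d (ψ₀ g) - (∑ k, wcR s₀ 0 d g k * ψ₀ k) + p * P₀ d * ψ₀ g)
        * A.transpose) a c := by
    intro a c
    have k1 : ∑ g, wcR s lee a c g * ∑ d, A g d * ψ₀ d = ∑ d, e a (A c d) * ψ₀ d
        + ∑ d, ∑ g, A a d * A c g * ∑ k, wcR s₀ 0 d g k * ψ₀ k := by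
      have k2 := congrFun (congrArg (fun M : Matrix Idx Idx R => M.mulVec ψ₀) (h8 a)) c
      simp only [Matrix.add_mulVec, ← Matrix.mulVec_mulVec, Matrix.sum_mulVec,
        Matrix.smul_mulVec] at k2
      simp only [Matrix.mulVec, dotProduct, Pi.add_apply, Finset.sum_apply,
        Pi.smul_apply, smul_eq_mul, Matrix.map_apply] at k2
      rw [k2]
      congr 1
      simp only [Finset.mul_sum]
      rw [Finset.sum_comm]
      exact Finset.sum_congr rfl fun _ _ => Finset.sum_congr rfl fun _ _ =>
        Finset.sum_congr rfl fun _ _ => by ring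
    have k3 : ∑ g, wcR s lee a c g * (κ * ∑ d, A g d * ψ₀ d)
        = κ * ∑ g, wcR s lee a c g * ∑ d, A g d * ψ₀ d := by
      rw [Finset.mul_sum]; exact Finset.sum_congr rfl fun _ _ => by ring
    have k4 : e a (∑ d, A c d * ψ₀ d) = ∑ d, e a (A c d) * ψ₀ d
        + ∑ d, ∑ g, A a d * A c g * E d (ψ₀ g) := by
      simp only [map_sum, Derivation.leibniz, smul_eq_mul, Finset.sum_add_distrib]
      rw [add_comm]
      congr 1
      · exact Finset.sum_congr rfl fun _ _ => mul_comm _ _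
      · rw [Finset.sum_comm]
        refine Finset.sum_congr rfl fun g _ => ?_
        rw [h.der a, Finset.mul_sum]
        exact Finset.sum_congr rfl fun _ _ => by ring
    have k5 : (A * Matrix.of (fun d g => E d (ψ₀ g) - (∑ k, wcR s₀ 0 d g k * ψ₀ k)
        + p * P₀ d * ψ₀ g) * A.transpose) a c = ∑ d, ∑ g, A a d * A c g * E d (ψ₀ g)
          - ∑ d, ∑ g, A a d * A c g * ∑ k, wcR s₀ 0 d g k * ψ₀ k
          + (∑ d, A a d * (p * P₀ d)) * ∑ d, A c d * ψ₀ d := by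
      simp only [Matrix.mul_apply, Matrix.of_apply, Matrix.transpose_apply,
        ← Finset.sum_sub_distrib, ← Finset.sum_add_distrib, Finset.sum_mul]
      rw [Finset.sum_comm]
      refine Finset.sum_congr rfl fun _ _ => ?_
      rw [Finset.mul_sum, ← Finset.sum_add_distrib]
      exact Finset.sum_congr rfl fun _ _ => by ring
    rw [k5, k3, k1, Derivation.leibniz, k4]
    simp only [smul_eq_mul]
    linear_combination (∑ d, A c d * ψ₀ d) * hκ a
  have h10 : _ = _ := h.sum_eta_mul
    (Matrix.of (fun d g => E d (ψ₀ g) - (∑ k, wcR s₀ 0 d g k * ψ₀ k) + p * P₀ d * ψ₀ g))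
  rw [boxR]
  simp only [h1]
  have h11 : ∀ x y z t : R, x - y - z + t = x - (y + z) + t := fun _ _ _ _ => by ring
  simp only [h11]
  simp only [h6 _ _ (fun d => κ * ∑ k, A d k * ψ₀ k), h9]
  simp only [Matrix.of_apply] at h10
  rw [mul_assoc κ]
  change _ = κ * ((Ω : R) ^ 2 * ∑ a, ∑ c, etaR R a c * (E a (ψ₀ c)
    - (∑ d, wcR s₀ 0 a c d * ψ₀ d) + p * P₀ a * ψ₀ c))
  rw [← h10, Finset.mul_sum]
  refine Finset.sum_congr rfl fun _ _ => ?_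
  rw [Finset.mul_sum]
  exact Finset.sum_congr rfl fun _ _ => by ring

end SpinChange
end ConnChange
end ConformalHH

namespace ConformalHH

/-! ### The field equations in normal form -/

section Jets

set_option linter.unusedSimpArgs false

variable {R : Type*} [CommRing R] [Algebra ℂ R]

theorem der_ofNat (d : Derivation ℂ R R) (n : ℕ) [n.AtLeastTwo] :
    d (ofNat(n) : R) = 0 := by
  have := d.map_natCast n
  rwa [← Nat.cast_ofNat] 

/-- The field equations of a frame `X = (x, y)`, `Y_A = D_A + Q_A^B X_B` with commuting derivations `x`,
`y`, `D = (u, v)` and `Q = !![a, b; c, -a]`: the trace-free symmetric part of the Ricci tensor of the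
Weyl connection with 1-form `-d log O` vanishes. The equations are named after the frame vectors which
they are contracted with: `O_xx`, `O_xy`, `O_yy` for `XX`, `M0`, `M1`, `M2` for `XY`, and `E0`, `E1`,
`E2` for `YY`. -/
structure IsEWJet (x y u v : Derivation ℂ R R) (a b c O : R) : Prop where
  comm_yx : ∀ f, y (x f) = x (y f)
  comm_ux : ∀ f, u (x f) = x (u f)
  comm_uy : ∀ f, u (y f) = y (u f)
  comm_vx : ∀ f, v (x f) = x (v f)
  comm_vy : ∀ f, v (y f) = y (v f)
  comm_vu : ∀ f, v (u f) = u (v f)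
  O_xx :
    x (x O) = 0
  O_xy :
    x (y O) = 0
  O_yy :
    y (y O) = 0
  M0 :
    O * x (x a) + O * x (y b) - 2 * y O * x b - 2 * x O * x a - 2 * x (u O) - 2 * x (y O) * b
      - 2 * x (x O) * a = 0
  M1 :
    O * y (y b) + O * x (x c) + 2 * y O * x a - 2 * y O * y b - 2 * y (u O) - 2 * y (y O) * b
      - 2 * x O * y a - 2 * x O * x c - 2 * x (v O) - 2 * x (x O) * c = 0
  M2 :
    - O * y (y a) + O * x (y c) + 2 * y O * y a - 2 * y (v O) + 2 * y (y O) * a - 2 * x O * y c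
      - 2 * x (y O) * c = 0
  E0 :
    2 * O * a * x (x a) - 2 * O * a * x (y b) + 2 * O * y a * x b + 2 * O * x a * x a
      - 2 * O * x a * y b + 2 * O * x (u a) + 2 * O * x (y a) * b + 2 * O * x b * x c
      + 2 * O * x (v b) + 2 * O * x (x b) * c - 2 * v O * x b + 2 * u O * y b - 2 * u (u O)
      - 2 * y O * u b - 4 * y (u O) * b - 2 * y (y O) * b * b - 4 * x O * a * x a
      + 4 * x O * a * y b - 4 * x O * u a - 4 * x O * y a * b - 2 * x O * v b - 4 * x O * x b * c
      - 4 * x (u O) * a - 4 * x (y O) * a * b - 2 * x (x O) * a * a = 0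
  E1 :
    2 * O * a * x (y a) - O * a * y (y b) + O * a * x (x c) + 2 * O * y a * x a + O * y (u a)
      + O * y (y a) * b - O * x (v a) - O * x (x a) * c + O * b * x (y c) + O * y (v b)
      + 2 * O * x b * y c + O * x (y b) * c + O * x (u c) + 2 * v O * x a - 2 * u O * y a
      - 2 * u (v O) - 2 * y O * a * x a + 2 * y O * a * y b - 2 * y O * y a * b - 2 * y O * v b
      - 2 * y O * x b * c - 2 * y (v O) * b + 2 * y (u O) * a + 2 * y (y O) * a * b
      - 2 * x O * a * y a - 2 * x O * a * x c + 2 * x O * x a * c - 2 * x O * b * y c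
      - 2 * x O * u c - 2 * x (v O) * a - 2 * x (u O) * c + 2 * x (y O) * a * a
      - 2 * x (y O) * b * c - 2 * x (x O) * a * c = 0
  E2 :
    2 * O * a * y (y a) + 2 * O * a * x (y c) + 2 * O * y a * y a + 2 * O * y a * x c
      - 2 * O * y (v a) - 2 * O * x a * y c - 2 * O * x (y a) * c + 2 * O * b * y (y c)
      + 2 * O * y b * y c + 2 * O * y (u c) + 2 * v O * x c - 2 * v (v O) - 2 * u O * y c
      - 4 * y O * a * y a - 4 * y O * a * x c + 4 * y O * v a + 4 * y O * x a * c
      - 4 * y O * b * y c - 2 * y O * u c + 4 * y (v O) * a - 2 * y (y O) * a * a - 2 * x O * v c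
      - 4 * x (v O) * c + 4 * x (y O) * a * c - 2 * x (x O) * c * c = 0

/-- `F` is a potential for the SD Weyl spinor `W_{ABCD}` of the frame of `IsEWJet`:
`W_{ABCD} = O X_A X_B X_C X_D F`. -/
structure IsJet (x y u v : Derivation ℂ R R) (a b c F O : R) : Prop
    extends IsEWJet x y u v a b c O where
  W0 :
    - x (x (x (x F))) * O + x (x b) = 0
  W1 :
    - 2 * x (x (x (y F))) * O - x (x a) + x (y b) = 0
  W2 :
    - 6 * x (x (y (y F))) * O - 4 * x (y a) + y (y b) - x (x c) = 0
  W3 :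
    2 * x (y (y (y F))) * O + y (y a) + x (y c) = 0
  W4 :
    y (y (y (y F))) * O + y (y c) = 0

/-- The left-hand side of the hyper-heavenly equation in the frame of `IsEWJet`. -/
def hhExpr (x y u v : Derivation ℂ R R) (a b c F O : R) : R :=
  - 2 * F * x (y a) - F * y (y b) + F * x (x c) + 4 * y F * x (y F) * x O
    - 4 * y F * x (x F) * y O + 2 * y F * x a + 2 * y F * y b - 2 * y (u F)
    - 4 * y (y F) * x F * x O + 2 * y (y F) * x (x F) * O - 2 * y (y F) * b
    + 4 * x F * x (y F) * y O + 2 * x F * y a - 2 * x F * x c + 2 * x (v F)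
    - 2 * x (y F) * x (y F) * O - 4 * x (y F) * a + 2 * x (x F) * c

variable {x y u v : Derivation ℂ R R} {a b c F O : R}

/-- The compatibility `[X_0, X_1] F = 0` of the equations for the fourth derivatives of `F`. Here and below
`p_E_xy` is the equation `E` differentiated along `x` and `y`. -/
theorem IsJet.A3 (h : IsJet x y u v a b c F O) :
    2 * x (x (x (y F))) * x O - x (x (x (x F))) * y O + x (x (x (x (y F)))) * O
      + x (x (x a)) = 0 := by
  have p_W0_y := congrArg y (h.W0)
  have p_W1_x := congrArg x (h.W1)
  simp only [map_add, map_sub, map_neg, map_zero, Derivation.leibniz, smul_eq_mul, der_ofNat, mul_zero,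
    zero_mul, add_zero, zero_add, h.comm_yx, h.comm_ux, h.comm_uy, h.comm_vx, h.comm_vy, h.comm_vu] at p_W0_y p_W1_x
  linear_combination (1) * p_W0_y + (- 1) * p_W1_x

theorem IsJet.C3 (h : IsJet x y u v a b c F O) :
    6 * x (x (y (y F))) * x O - 2 * x (x (x (y F))) * y O + 4 * x (x (x (y (y F)))) * O
      + 3 * x (x (y a)) + x (x (x c)) = 0 := by
  have p_W1_y := congrArg y (h.W1)
  have p_W2_x := congrArg x (h.W2)
  simp only [map_add, map_sub, map_neg, map_zero, Derivation.leibniz, smul_eq_mul, der_ofNat, mul_zero,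
    zero_mul, add_zero, zero_add, h.comm_yx, h.comm_ux, h.comm_uy, h.comm_vx, h.comm_vy, h.comm_vu] at p_W1_y p_W2_x
  linear_combination (1) * p_W1_y + (- 1) * p_W2_x

/-- The `y` derivative of `M0`, simplified by means of `W1` and of the equations for `O`. -/
theorem IsJet.A2 (h : IsJet x y u v a b c F O) :
    x (x (x (y (y F)))) * O * O + O * x (x (y a)) - x O * x (y a) = 0 := by
  have p_M0_y := congrArg y (h.M0)
  have p_W1_y := congrArg y (h.W1)
  have p_xx_y := congrArg y (h.O_xx)
  have p_xy_y := congrArg y (h.O_xy)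
  have p_xy_u := congrArg u (h.O_xy)
  have p_W1 := h.W1
  have p_xx := h.O_xx
  have p_xy := h.O_xy
  have p_yy := h.O_yy
  simp only [map_add, map_sub, map_neg, map_zero, Derivation.leibniz, smul_eq_mul, der_ofNat, mul_zero,
    zero_mul, add_zero, zero_add, h.comm_yx, h.comm_ux, h.comm_uy, h.comm_vx, h.comm_vy, h.comm_vu] at p_M0_y p_W1_y p_xx_y p_xy_y p_xy_u p_W1 p_xx p_xy p_yy
  apply double_cancel
  linear_combination (1) * p_M0_y + (- O) * p_W1_y + (2 * a) * p_xx_y + (2 * b) * p_xy_y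
    + (2) * p_xy_u + (y O) * p_W1 + (2 * y a) * p_xx + (2 * x a + 2 * y b) * p_xy
    + (2 * x b) * p_yy

/-- The `x` derivative of `M2`, simplified by means of `W3` and of the equations for `O`. -/
theorem IsJet.A1 (h : IsJet x y u v a b c F O) :
    - x (x (y (y (y F)))) * O * O - O * x (y (y a)) + y O * x (y a) = 0 := by
  have p_M2_x := congrArg x (h.M2)
  have p_W3_x := congrArg x (h.W3)
  have p_xx_y := congrArg y (h.O_xx)
  have p_xy_y := congrArg y (h.O_xy)
  have p_xy_v := congrArg v (h.O_xy)
  have p_W3 := h.W3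
  have p_xx := h.O_xx
  have p_xy := h.O_xy
  have p_yy := h.O_yy
  simp only [map_add, map_sub, map_neg, map_zero, Derivation.leibniz, smul_eq_mul, der_ofNat, mul_zero,
    zero_mul, add_zero, zero_add, h.comm_yx, h.comm_ux, h.comm_uy, h.comm_vx, h.comm_vy, h.comm_vu] at p_M2_x p_W3_x p_xx_y p_xy_y p_xy_v p_W3 p_xx p_xy p_yy
  apply double_cancel
  linear_combination (1) * p_M2_x + (- O) * p_W3_x + (2 * c) * p_xx_y + (- 2 * a) * p_xy_y
    + (2) * p_xy_v + (x O) * p_W3 + (2 * y c) * p_xx + (- 2 * y a + 2 * x c) * p_xy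
    + (- 2 * x a) * p_yy

/-- The third derivative of the hyper-heavenly expression is a combination of the field equations and of
their derivatives, with the coefficients given in the proof. -/
theorem IsJet.der_000 (h : IsJet x y u v a b c F O) :
    O ^ 2 * x (x (x (hhExpr x y u v a b c F O))) = 0 := by
  have p_C3_xx := congrArg x (congrArg x (h.C3))
  have p_W0_xyy := congrArg x (congrArg y (congrArg y (h.W0)))
  have p_A2_xx := congrArg x (congrArg x (h.A2))
  have p_C3_x := congrArg x (h.C3)
  have p_W0_xy := congrArg x (congrArg y (h.W0))
  have p_W0_yy := congrArg y (congrArg y (h.W0))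
  have p_A3_x := congrArg x (h.A3)
  have p_A2_x := congrArg x (h.A2)
  have p_xx_xx := congrArg x (congrArg x (h.O_xx))
  have p_xx_xy := congrArg x (congrArg y (h.O_xx))
  have p_C3 := h.C3
  have p_W0_x := congrArg x (h.W0)
  have p_W0_y := congrArg y (h.W0)
  have p_W0_v := congrArg v (h.W0)
  have p_W1_y := congrArg y (h.W1)
  have p_A3 := h.A3
  have p_A2 := h.A2
  have p_xx_x := congrArg x (h.O_xx)
  have p_xx_y := congrArg y (h.O_xx)
  have p_xx_u := congrArg u (h.O_xx)
  have p_xy_y := congrArg y (h.O_xy)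
  have p_xy_u := congrArg u (h.O_xy)
  have p_M0_u := congrArg u (h.M0)
  have p_W1_u := congrArg u (h.W1)
  have p_W0 := h.W0
  have p_W1 := h.W1
  have p_W2 := h.W2
  have p_xx := h.O_xx
  have p_xy := h.O_xy
  have p_M0 := h.M0
  have p_yy := h.O_yy
  have p_M1 := h.M1
  have p_E0_x := congrArg x (h.E0)
  simp only [hhExpr, map_add, map_sub, map_neg, map_zero, Derivation.leibniz, smul_eq_mul, der_ofNat, mul_zero,
    zero_mul, add_zero, zero_add, h.comm_yx, h.comm_ux, h.comm_uy, h.comm_vx, h.comm_vy, h.comm_vu] at p_C3_xx p_W0_xyy p_A2_xx p_C3_x p_W0_xy p_W0_yy p_A3_x p_A2_x p_xx_xx p_xx_xy p_C3 p_W0_x p_W0_y p_W0_v p_W1_y p_A3 p_A2 p_xx_x p_xx_y p_xx_u p_xy_y p_xy_u p_M0_u p_W1_u p_W0 p_W1 p_W2 p_xx p_xy p_M0 p_yy p_M1 p_E0_x ⊢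
  linear_combination (F * O ^ 2) * p_C3_xx + (- F * O ^ 2) * p_W0_xyy + (- 5 * F * O) * p_A2_xx
    + (x F * O ^ 2) * p_C3_x + (2 * y F * O ^ 2) * p_W0_xy + (- 3 * x F * O ^ 2) * p_W0_yy
    + (2 * y F * O ^ 2) * p_A3_x + (5 * F * x O - 7 * x F * O) * p_A2_x
    + (4 * y F * x (y F) * O ^ 2 - 4 * y (y F) * x F * O ^ 2) * p_xx_xx
    + (- 4 * y F * x (x F) * O ^ 2 + 4 * x F * x (y F) * O ^ 2) * p_xx_xy
    + (- x (x F) * O ^ 2) * p_C3 + (- 2 * y (y F) * O ^ 2 - 2 * O * c) * p_W0_x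
    + (6 * x (y F) * O ^ 2 + 2 * O * a) * p_W0_y + (- 2 * O) * p_W0_v
    + (- 3 * x (x F) * O ^ 2) * p_W1_y + (2 * x (y F) * O ^ 2 - 2 * O * a) * p_A3
    + (- 5 * F * x (x O) - 2 * b) * p_A2 + (- 6 * F * x (x (y (y F))) * O ^ 2
    - 5 * F * O * x (y a) + 12 * y F * x (x (y F)) * O ^ 2 - 10 * y (y F) * x (x F) * O ^ 2
    - 12 * x F * x (y (y F)) * O ^ 2 + 10 * (x (y F)) ^ 2 * O ^ 2 + 2 * a ^ 2) * p_xx_x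
    + (2 * F * x (x (x (y F))) * O ^ 2 - 12 * y F * x (x (x F)) * O ^ 2
    + 12 * x F * x (x (y F)) * O ^ 2 + 4 * a * b) * p_xx_y + (2 * a) * p_xx_u
    + (- F * x (x (x (x F))) * O ^ 2 + 2 * b ^ 2) * p_xy_y + (2 * b) * p_xy_u + (- 1) * p_M0_u
    + (O) * p_W1_u + (- 6 * x (y (y F)) * O ^ 2 - 2 * O * y a - 4 * O * x c + 2 * v O
    + 2 * x O * c) * p_W0 + (6 * x (x (y F)) * O ^ 2 + 5 * O * x a - O * y b - u O
    - 2 * x O * a) * p_W1 + (- x (x (x F)) * O ^ 2 + O * x b) * p_W2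
    + (- F * x (x (x (y (y F)))) * O ^ 2 + 8 * y F * x (x (x (y F))) * O ^ 2
    - 6 * y (y F) * x (x (x F)) * O ^ 2 - 18 * x F * x (x (y (y F))) * O ^ 2
    - 7 * x F * O * x (y a) + 24 * x (y F) * x (x (y F)) * O ^ 2
    - 18 * x (y (y F)) * x (x F) * O ^ 2 + 6 * a * x a - 2 * a * y b + 2 * u a + 4 * y a * b
    + 2 * v b + 2 * x b * c) * p_xx + (2 * F * x (x (x (x (y F)))) * O ^ 2
    - 8 * y F * x (x (x (x F))) * O ^ 2 + 14 * x F * x (x (x (y F))) * O ^ 2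
    - 12 * x (y F) * x (x (x F)) * O ^ 2 + 12 * x (x F) * x (x (y F)) * O ^ 2 + 4 * a * x b
    + 2 * x a * b + 2 * b * y b) * p_xy + (- x a + y b) * p_M0
    + (- F * x (x (x (x (x F)))) * O ^ 2 - 3 * x F * x (x (x (x F))) * O ^ 2
    + 2 * b * x b) * p_yy + (- x b) * p_M1 + (1) * p_E0_x

set_option maxHeartbeats 1000000 in
/-- As `IsJet.der_000`, for the mixed derivative. The other two third derivatives follow by
`IsJet.swap`. -/
theorem IsJet.der_001 (h : IsJet x y u v a b c F O) :
    3 * O ^ 3 * x (x (y (hhExpr x y u v a b c F O))) = 0 := by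
  have p_C3_xy := congrArg x (congrArg y (h.C3))
  have p_W0_yyy := congrArg y (congrArg y (congrArg y (h.W0)))
  have p_A1_xx := congrArg x (congrArg x (h.A1))
  have p_C3_x := congrArg x (h.C3)
  have p_W0_yy := congrArg y (congrArg y (h.W0))
  have p_W1_yy := congrArg y (congrArg y (h.W1))
  have p_A2_x := congrArg x (h.A2)
  have p_A1_x := congrArg x (h.A1)
  have p_xx_xy := congrArg x (congrArg y (h.O_xx))
  have p_xx_yy := congrArg y (congrArg y (h.O_xx))
  have p_C3 := h.C3
  have p_W3_x := congrArg x (h.W3)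
  have p_W0_y := congrArg y (h.W0)
  have p_W1_y := congrArg y (h.W1)
  have p_W1_v := congrArg v (h.W1)
  have p_W2_y := congrArg y (h.W2)
  have p_A3 := h.A3
  have p_A2 := h.A2
  have p_A1 := h.A1
  have p_xx_x := congrArg x (h.O_xx)
  have p_xx_y := congrArg y (h.O_xx)
  have p_xx_u := congrArg u (h.O_xx)
  have p_xx_v := congrArg v (h.O_xx)
  have p_xy_y := congrArg y (h.O_xy)
  have p_xy_v := congrArg v (h.O_xy)
  have p_M0_v := congrArg v (h.M0)
  have p_yy_y := congrArg y (h.O_yy)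
  have p_yy_u := congrArg u (h.O_yy)
  have p_M1_u := congrArg u (h.M1)
  have p_W2_u := congrArg u (h.W2)
  have p_W3 := h.W3
  have p_W0 := h.W0
  have p_W1 := h.W1
  have p_W2 := h.W2
  have p_xx := h.O_xx
  have p_xy := h.O_xy
  have p_M0 := h.M0
  have p_yy := h.O_yy
  have p_M1 := h.M1
  have p_M2 := h.M2
  have p_E0_y := congrArg y (h.E0)
  have p_E1_x := congrArg x (h.E1)
  simp only [hhExpr, map_add, map_sub, map_neg, map_zero, Derivation.leibniz, smul_eq_mul, der_ofNat, mul_zero,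
    zero_mul, add_zero, zero_add, h.comm_yx, h.comm_ux, h.comm_uy, h.comm_vx, h.comm_vy, h.comm_vu] at p_C3_xy p_W0_yyy p_A1_xx p_C3_x p_W0_yy p_W1_yy p_A2_x p_A1_x p_xx_xy p_xx_yy p_C3 p_W3_x p_W0_y p_W1_y p_W1_v p_W2_y p_A3 p_A2 p_A1 p_xx_x p_xx_y p_xx_u p_xx_v p_xy_y p_xy_v p_M0_v p_yy_y p_yy_u p_M1_u p_W2_u p_W3 p_W0 p_W1 p_W2 p_xx p_xy p_M0 p_yy p_M1 p_M2 p_E0_y p_E1_x ⊢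
  linear_combination (3 * F * O ^ 3) * p_C3_xy + (- 3 * F * O ^ 3) * p_W0_yyy
    + (15 * F * O ^ 2) * p_A1_xx + (3 * y F * O ^ 3) * p_C3_x + (3 * y F * O ^ 3) * p_W0_yy
    + (- 6 * x F * O ^ 3) * p_W1_yy + (- 15 * F * O * y O - 9 * y F * O ^ 2) * p_A2_x
    + (- 30 * F * O * x O + 12 * x F * O ^ 2) * p_A1_x + (12 * y F * x (y F) * O ^ 3
    - 12 * y (y F) * x F * O ^ 3) * p_xx_xy + (- 12 * y F * x (x F) * O ^ 3
    + 12 * x F * x (y F) * O ^ 3) * p_xx_yy + (- 2 * O ^ 2 * a) * p_C3 + (- 6 * x (x F) * O ^ 3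
    - 2 * O ^ 2 * b) * p_W3_x + (- 4 * O ^ 2 * c) * p_W0_y + (6 * x (y F) * O ^ 3
    + 4 * O ^ 2 * a) * p_W1_y + (- 3 * O ^ 2) * p_W1_v + (- 3 * x (x F) * O ^ 3) * p_W2_y
    + (6 * y (y F) * O ^ 3 + 2 * O ^ 2 * c) * p_A3 + (- 30 * F * O * x (y O) + 30 * F * y O * x O
    - 12 * x F * O * y O + 4 * O * a) * p_A2 + (- 15 * F * O * x (x O) + 30 * F * (x O) ^ 2
    - 12 * x F * O * x O + 2 * O * b) * p_A1 + (12 * y F * x (y (y F)) * O ^ 3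
    - 12 * y (y (y F)) * x F * O ^ 3 + 4 * O * a * c) * p_xx_x
    + (- 18 * F * x (x (y (y F))) * O ^ 3 - 15 * F * O ^ 2 * x (y a)
    + 12 * y F * x (x (y F)) * O ^ 3 - 30 * y (y F) * x (x F) * O ^ 3
    - 12 * x F * x (y (y F)) * O ^ 3 + 30 * (x (y F)) ^ 2 * O ^ 3 - 2 * O * a ^ 2
    + 4 * O * b * c) * p_xx_y + (2 * O * c) * p_xx_u + (2 * O * a) * p_xx_v
    + (6 * F * x (x (x (y F))) * O ^ 3 - 24 * y F * x (x (x F)) * O ^ 3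
    + 24 * x F * x (x (y F)) * O ^ 3) * p_xy_y + (2 * O * b) * p_xy_v + (- O) * p_M0_v
    + (- 3 * F * x (x (x (x F))) * O ^ 3 + 2 * O * b ^ 2) * p_yy_y + (2 * O * b) * p_yy_u
    + (- O) * p_M1_u + (O ^ 2) * p_W2_u + (6 * x (x (x F)) * O ^ 3 - 6 * O ^ 2 * x b
    + 2 * O * x O * b) * p_W3 + (- 6 * y (y (y F)) * O ^ 3 - 6 * O ^ 2 * y c
    + 2 * O * y O * c) * p_W0 + (3 * O ^ 2 * y a - 3 * O ^ 2 * x c + 3 * O * v O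
    - 2 * O * y O * a + 2 * O * x O * c) * p_W1 + (3 * x (x (y F)) * O ^ 3 + 3 * O ^ 2 * x a
    - O * u O - 2 * O * x O * a) * p_W2 + (- 3 * F * x (x (y (y (y F)))) * O ^ 3
    + 6 * y F * x (x (y (y F))) * O ^ 3 - 9 * y F * O ^ 2 * x (y a)
    + 6 * y (y F) * x (x (y F)) * O ^ 3 - 18 * y (y (y F)) * x (x F) * O ^ 3
    - 24 * x F * x (y (y (y F))) * O ^ 3 + 12 * x (y F) * x (y (y F)) * O ^ 3 + 2 * O * a * y a
    + 6 * O * a * x c - 2 * O * v a + 2 * O * x a * c + 4 * O * b * y c + 2 * O * u c) * p_xx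
    + (6 * F * x (x (x (y (y F)))) * O ^ 3 - 6 * y F * x (x (x (y F))) * O ^ 3
    - 24 * y (y F) * x (x (x F)) * O ^ 3 + 12 * x F * x (x (y (y F))) * O ^ 3
    - 12 * x F * O ^ 2 * x (y a) + 36 * x (y F) * x (x (y F)) * O ^ 3
    - 12 * x (y (y F)) * x (x F) * O ^ 3 - 4 * O * a * y b + 4 * O * u a + 6 * O * y a * b
    + 2 * O * b * x c + 4 * O * v b + 8 * O * x b * c) * p_xy + (- 3 * O * y a - O * x c) * p_M0
    + (- 3 * F * x (x (x (x (y F)))) * O ^ 3 - 9 * y F * x (x (x (x F))) * O ^ 3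
    - 12 * x (y F) * x (x (x F)) * O ^ 3 + 12 * x (x F) * x (x (y F)) * O ^ 3 - 2 * O * x a * b
    + 4 * O * b * y b) * p_yy + (O * x a) * p_M1 + (- 2 * O * x b) * p_M2 + (O) * p_E0_y
    + (2 * O) * p_E1_x

/-- The first integrability condition for a potential. Let `w_k` be the function to which `k` derivatives
along `y` and `4 - k` along `x` of a potential are equated by `IsJet`: then `y w_0 = x w_1` follows from
the `XY` part of the field equations, differentiated along the leaves. The conditions
`y w_k = x w_{k+1}` for `k = 1, 2, 3` are the next three lemmas. -/
theorem IsEWJet.compat0 (h : IsEWJet x y u v a b c O) :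
    2 * (O * y (x (x b)) - y O * x (x b))
      = (O * x (x (y b) - x (x a)) - x O * (x (y b) - x (x a))) := by
  have p_M0_x := congrArg x (h.M0)
  have p_xx_x := congrArg x (h.O_xx)
  have p_xx_y := congrArg y (h.O_xx)
  have p_xx_u := congrArg u (h.O_xx)
  have p_xx := h.O_xx
  have p_xy := h.O_xy
  simp only [map_add, map_sub, map_neg, map_zero, Derivation.leibniz, smul_eq_mul, der_ofNat, mul_zero,
    zero_mul, add_zero, zero_add, h.comm_yx, h.comm_ux, h.comm_uy, h.comm_vx, h.comm_vy, h.comm_vu]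
    at p_M0_x p_xx_x p_xx_y p_xx_u p_xx p_xy ⊢
  linear_combination (1) * p_M0_x + (2 * a) * p_xx_x + (2 * b) * p_xx_y + (2) * p_xx_u
    + (4 * x a) * p_xx + (4 * x b) * p_xy

theorem IsEWJet.compat1 (h : IsEWJet x y u v a b c O) :
    3 * (O * y (x (y b) - x (x a)) - y O * (x (y b) - x (x a)))
      = (O * x (y (y b) - x (x c) - 4 * x (y a)) - x O * (y (y b) - x (x c) - 4 * x (y a))) := by
  have p_M0_y := congrArg y (h.M0)
  have p_M1_x := congrArg x (h.M1)
  have p_xx_x := congrArg x (h.O_xx)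
  have p_xx_y := congrArg y (h.O_xx)
  have p_xx_v := congrArg v (h.O_xx)
  have p_xy_y := congrArg y (h.O_xy)
  have p_xy_u := congrArg u (h.O_xy)
  have p_xx := h.O_xx
  have p_xy := h.O_xy
  have p_yy := h.O_yy
  simp only [map_add, map_sub, map_neg, map_zero, Derivation.leibniz, smul_eq_mul, der_ofNat, mul_zero,
    zero_mul, add_zero, zero_add, h.comm_yx, h.comm_ux, h.comm_uy, h.comm_vx, h.comm_vy, h.comm_vu]
    at p_M0_y p_M1_x p_xx_x p_xx_y p_xx_v p_xy_y p_xy_u p_xx p_xy p_yy ⊢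
  linear_combination (1) * p_M0_y + (1) * p_M1_x + (2 * c) * p_xx_x + (2 * a) * p_xx_y
    + (2) * p_xx_v + (4 * b) * p_xy_y + (4) * p_xy_u + (4 * y a + 4 * x c) * p_xx
    + (4 * y b) * p_xy + (4 * x b) * p_yy

theorem IsEWJet.compat2 (h : IsEWJet x y u v a b c O) :
    (O * y (y (y b) - x (x c) - 4 * x (y a)) - y O * (y (y b) - x (x c) - 4 * x (y a)))
      = 3 * (O * x (-y (y a) - x (y c)) - x O * (-y (y a) - x (y c))) := by
  have p_M1_y := congrArg y (h.M1)
  have p_M2_x := congrArg x (h.M2)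
  have p_xx_y := congrArg y (h.O_xx)
  have p_xy_y := congrArg y (h.O_xy)
  have p_xy_v := congrArg v (h.O_xy)
  have p_yy_y := congrArg y (h.O_yy)
  have p_yy_u := congrArg u (h.O_yy)
  have p_xx := h.O_xx
  have p_xy := h.O_xy
  have p_yy := h.O_yy
  simp only [map_add, map_sub, map_neg, map_zero, Derivation.leibniz, smul_eq_mul, der_ofNat, mul_zero,
    zero_mul, add_zero, zero_add, h.comm_yx, h.comm_ux, h.comm_uy, h.comm_vx, h.comm_vy, h.comm_vu]
    at p_M1_y p_M2_x p_xx_y p_xy_y p_xy_v p_yy_y p_yy_u p_xx p_xy p_yy ⊢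
  linear_combination (1) * p_M1_y + (1) * p_M2_x + (4 * c) * p_xx_y + (- 2 * a) * p_xy_y
    + (4) * p_xy_v + (2 * b) * p_yy_y + (2) * p_yy_u + (4 * y c) * p_xx + (4 * x c) * p_xy
    + (- 4 * x a + 4 * y b) * p_yy

theorem IsEWJet.compat3 (h : IsEWJet x y u v a b c O) :
    (O * y (-y (y a) - x (y c)) - y O * (-y (y a) - x (y c)))
      = 2 * (O * x (-y (y c)) - x O * (-y (y c))) := by
  have p_M2_y := congrArg y (h.M2)
  have p_xy_y := congrArg y (h.O_xy)
  have p_yy_y := congrArg y (h.O_yy)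
  have p_yy_v := congrArg v (h.O_yy)
  have p_xy := h.O_xy
  have p_yy := h.O_yy
  simp only [map_add, map_sub, map_neg, map_zero, Derivation.leibniz, smul_eq_mul, der_ofNat, mul_zero,
    zero_mul, add_zero, zero_add, h.comm_yx, h.comm_ux, h.comm_uy, h.comm_vx, h.comm_vy, h.comm_vu]
    at p_M2_y p_xy_y p_yy_y p_yy_v p_xy p_yy ⊢
  linear_combination (1) * p_M2_y + (2 * c) * p_xy_y + (- 2 * a) * p_yy_y + (2) * p_yy_v
    + (4 * y c) * p_xy + (- 4 * y a) * p_yy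

/-- Rotation of the frame by `X_0 ↦ X_1`, `X_1 ↦ -X_0`, `D_0 ↦ D_1`, `D_1 ↦ -D_0`. -/
theorem IsJet.swap (h : IsJet x y u v a b c F O) : IsJet y (-x) v (-u) (-a) (-c) (-b) F O := by
  refine ⟨⟨?_, ?_, ?_, ?_, ?_, ?_, ?_, ?_, ?_, ?_, ?_, ?_, ?_, ?_, ?_⟩, ?_, ?_, ?_, ?_, ?_⟩
  · intro f; simp [h.comm_yx, h.comm_ux, h.comm_uy, h.comm_vx, h.comm_vy, h.comm_vu]
  · intro f; simp [h.comm_yx, h.comm_ux, h.comm_uy, h.comm_vx, h.comm_vy, h.comm_vu]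
  · intro f; simp [h.comm_yx, h.comm_ux, h.comm_uy, h.comm_vx, h.comm_vy, h.comm_vu]
  · intro f; simp [h.comm_yx, h.comm_ux, h.comm_uy, h.comm_vx, h.comm_vy, h.comm_vu]
  · intro f; simp [h.comm_yx, h.comm_ux, h.comm_uy, h.comm_vx, h.comm_vy, h.comm_vu]
  · intro f; simp [h.comm_yx, h.comm_ux, h.comm_uy, h.comm_vx, h.comm_vy, h.comm_vu]
  · exact h.O_yy
  · have := h.O_xy
    simp only [Derivation.neg_apply, map_add, map_sub, map_neg, map_zero, Derivation.leibniz, smul_eq_mul, der_ofNat, mul_zero,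
    zero_mul, add_zero, zero_add, h.comm_yx, h.comm_ux, h.comm_uy, h.comm_vx, h.comm_vy, h.comm_vu] at this ⊢
    linear_combination -this
  · have := h.O_xx
    simp only [Derivation.neg_apply, map_add, map_sub, map_neg, map_zero, Derivation.leibniz, smul_eq_mul, der_ofNat, mul_zero,
    zero_mul, add_zero, zero_add, h.comm_yx, h.comm_ux, h.comm_uy, h.comm_vx, h.comm_vy, h.comm_vu] at this ⊢
    linear_combination this
  · have := h.M2
    simp only [Derivation.neg_apply, map_add, map_sub, map_neg, map_zero, Derivation.leibniz, smul_eq_mul, der_ofNat, mul_zero,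
    zero_mul, add_zero, zero_add, h.comm_yx, h.comm_ux, h.comm_uy, h.comm_vx, h.comm_vy, h.comm_vu] at this ⊢
    linear_combination this
  · have := h.M1
    simp only [Derivation.neg_apply, map_add, map_sub, map_neg, map_zero, Derivation.leibniz, smul_eq_mul, der_ofNat, mul_zero,
    zero_mul, add_zero, zero_add, h.comm_yx, h.comm_ux, h.comm_uy, h.comm_vx, h.comm_vy, h.comm_vu] at this ⊢
    linear_combination -this
  · have := h.M0
    simp only [Derivation.neg_apply, map_add, map_sub, map_neg, map_zero, Derivation.leibniz, smul_eq_mul, der_ofNat, mul_zero,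
    zero_mul, add_zero, zero_add, h.comm_yx, h.comm_ux, h.comm_uy, h.comm_vx, h.comm_vy, h.comm_vu] at this ⊢
    linear_combination this
  · have := h.E2
    simp only [Derivation.neg_apply, map_add, map_sub, map_neg, map_zero, Derivation.leibniz, smul_eq_mul, der_ofNat, mul_zero,
    zero_mul, add_zero, zero_add, h.comm_yx, h.comm_ux, h.comm_uy, h.comm_vx, h.comm_vy, h.comm_vu] at this ⊢
    linear_combination this
  · have := h.E1
    simp only [Derivation.neg_apply, map_add, map_sub, map_neg, map_zero, Derivation.leibniz, smul_eq_mul, der_ofNat, mul_zero,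
    zero_mul, add_zero, zero_add, h.comm_yx, h.comm_ux, h.comm_uy, h.comm_vx, h.comm_vy, h.comm_vu] at this ⊢
    linear_combination -this
  · have := h.E0
    simp only [Derivation.neg_apply, map_add, map_sub, map_neg, map_zero, Derivation.leibniz, smul_eq_mul, der_ofNat, mul_zero,
    zero_mul, add_zero, zero_add, h.comm_yx, h.comm_ux, h.comm_uy, h.comm_vx, h.comm_vy, h.comm_vu] at this ⊢
    linear_combination this
  · have := h.W4
    simp only [Derivation.neg_apply, map_add, map_sub, map_neg, map_zero, Derivation.leibniz, smul_eq_mul, der_ofNat, mul_zero,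
    zero_mul, add_zero, zero_add, h.comm_yx, h.comm_ux, h.comm_uy, h.comm_vx, h.comm_vy, h.comm_vu] at this ⊢
    linear_combination -this
  · have := h.W3
    simp only [Derivation.neg_apply, map_add, map_sub, map_neg, map_zero, Derivation.leibniz, smul_eq_mul, der_ofNat, mul_zero,
    zero_mul, add_zero, zero_add, h.comm_yx, h.comm_ux, h.comm_uy, h.comm_vx, h.comm_vy, h.comm_vu] at this ⊢
    linear_combination this
  · have := h.W2
    simp only [Derivation.neg_apply, map_add, map_sub, map_neg, map_zero, Derivation.leibniz, smul_eq_mul, der_ofNat, mul_zero,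
    zero_mul, add_zero, zero_add, h.comm_yx, h.comm_ux, h.comm_uy, h.comm_vx, h.comm_vy, h.comm_vu] at this ⊢
    linear_combination this
  · have := h.W1
    simp only [Derivation.neg_apply, map_add, map_sub, map_neg, map_zero, Derivation.leibniz, smul_eq_mul, der_ofNat, mul_zero,
    zero_mul, add_zero, zero_add, h.comm_yx, h.comm_ux, h.comm_uy, h.comm_vx, h.comm_vy, h.comm_vu] at this ⊢
    linear_combination this
  · have := h.W0
    simp only [Derivation.neg_apply, map_add, map_sub, map_neg, map_zero, Derivation.leibniz, smul_eq_mul, der_ofNat, mul_zero,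
    zero_mul, add_zero, zero_add, h.comm_yx, h.comm_ux, h.comm_uy, h.comm_vx, h.comm_vy, h.comm_vu] at this ⊢
    linear_combination -this

/-- Under the equations of `IsJet`, the left-hand side of the hyper-heavenly equation is annihilated by
all third derivatives along the leaves. -/
theorem IsJet.der_hhExpr (h : IsJet x y u v a b c F O) (hO : IsUnit O) :
    x (x (x (hhExpr x y u v a b c F O))) = 0 ∧ x (x (y (hhExpr x y u v a b c F O))) = 0 ∧
      x (y (y (hhExpr x y u v a b c F O))) = 0 ∧ y (y (y (hhExpr x y u v a b c F O))) = 0 := by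
  have key : ∀ {x y u v : Derivation ℂ R R} {a b c : R}, IsJet x y u v a b c F O →
      x (x (x (hhExpr x y u v a b c F O))) = 0 ∧ x (x (y (hhExpr x y u v a b c F O))) = 0 := by
    intro x y u v a b c h
    refine ⟨(hO.pow 2).mul_right_eq_zero.1 h.der_000, ?_⟩
    have h3 : IsUnit (3 : R) := by
      have := (Units.mk0 (3 : ℂ) (by norm_num)).isUnit.map (algebraMap ℂ R)
      rwa [Units.val_mk0, map_ofNat] at this
    exact (h3.mul (hO.pow 3)).mul_right_eq_zero.1 h.der_001
  have h1 := key h.swap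
  have h2 : hhExpr y (-x) v (-u) (-a) (-c) (-b) F O = hhExpr x y u v a b c F O := by
    simp only [hhExpr, Derivation.neg_apply, map_add, map_sub, map_neg, map_zero, Derivation.leibniz, smul_eq_mul, der_ofNat, mul_zero,
    zero_mul, add_zero, zero_add, h.comm_yx, h.comm_ux, h.comm_uy, h.comm_vx, h.comm_vy, h.comm_vu]
    ring
  rw [h2] at h1
  simp only [Derivation.neg_apply, map_add, map_sub, map_neg, map_zero, Derivation.leibniz, smul_eq_mul, der_ofNat, mul_zero,
    zero_mul, add_zero, zero_add, h.comm_yx, h.comm_ux, h.comm_uy, h.comm_vx, h.comm_vy, h.comm_vu] at h1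
  refine ⟨(key h).1, (key h).2, ?_, h1.1⟩
  simpa using h1.2

end Jets
end ConformalHH

namespace ConformalHH

/-! ### The normal frame -/

section NormalFrame

variable {R : Type*} [CommRing R] [Algebra ℂ R]

/-- The frame `X_0 = x`, `X_1 = y`, `Y_0 = u + a x + b y`, `Y_1 = v + c x - a y`. -/
def nfE (x y u v : Derivation ℂ R R) (a b c : R) (p : Idx) : Derivation ℂ R R :=
  ![![x, y], ![u + a • x + b • y, v + c • x - a • y]] p.1 p.2

/-- The matrix `Q_A^B`, with rows `(a, b)` and `(c, -a)`. -/
def nfQ (a b c : R) : Fin 2 → Fin 2 → R := ![![a, b], ![c, -a]]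

/-- The structure functions of the frame `nfE`, provided that `x`, `y`, `u`, `v` commute. -/
def nfStr (E : Idx → Derivation ℂ R R) (Q : Fin 2 → Fin 2 → R) (p q r : Idx) : R :=
  if r.1 = 0 then ![![0, E (0, p.2) (Q q.2 r.2)],
    ![-E (0, q.2) (Q p.2 r.2), E (1, p.2) (Q q.2 r.2) - E (1, q.2) (Q p.2 r.2)]] p.1 q.1 else 0

/-- The lowered structure functions of the frame `nfE`. -/
def nfS (E : Idx → Derivation ℂ R R) (Q : Fin 2 → Fin 2 → R) (p q r : Idx) : R :=
  ∑ k, nfStr E Q p q k * etaR R k r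

theorem strR_lower (C : Idx → Idx → Idx → R) (p q r : Idx) :
    strR (fun p q r => ∑ k, C p q k * etaR R k r) p q r = C p q r := by
  have h : (((etaR R).mulVec ((etaR R).mulVec (fun k => C p q k))) r) = C p q r := by
    rw [Matrix.mulVec_mulVec, etaR_mul_self, Matrix.one_mulVec]
  rw [← h]
  simp only [strR, Matrix.mulVec, dotProduct]
  exact Finset.sum_congr rfl fun e _ => by
    congr 1
    exact Finset.sum_congr rfl fun k _ => by rw [etaR_symm k e, mul_comm]

theorem strR_nfS (E : Idx → Derivation ℂ R R) (Q : Fin 2 → Fin 2 → R) :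
    strR (nfS E Q) = nfStr E Q := by
  funext p q r; exact strR_lower _ p q r

/-- `P_B = -½ X_C Q_B^C`. -/
def nfP (E : Idx → Derivation ℂ R R) (Q : Fin 2 → Fin 2 → R) (B : Fin 2) : R :=
  -half R * (E (0, 0) (Q B 0) + E (0, 1) (Q B 1))

/-- The coefficients on unprimed spinors of the Weyl connection with 1-form `w`. -/
def nfSpin (E : Idx → Derivation ℂ R R) (Q : Fin 2 → Fin 2 → R) (w : Idx → R) (p : Idx) :
    Matrix (Fin 2) (Fin 2) R :=
  ![![!![w (0, 0), 0; w (1, 0), 0], !![w (0, 1), 0; w (1, 1), 0]],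
    ![!![nfP E Q 0, w (0, 0); E (1, 0) (Q 1 1) - E (1, 1) (Q 0 1), w (1, 0) - nfP E Q 0],
      !![nfP E Q 1, w (0, 1); E (1, 1) (Q 0 0) - E (1, 0) (Q 1 0), w (1, 1) - nfP E Q 1]]] p.1 p.2

/-- The coefficients on primed spinors of the Weyl connection with 1-form `w`. -/
def nfSpin' (E : Idx → Derivation ℂ R R) (Q : Fin 2 → Fin 2 → R) (w : Idx → R) (p : Idx) :
    Matrix (Fin 2) (Fin 2) R :=
  ![![!![w (0, 0), 0; w (0, 1), 0], !![0, w (0, 0); 0, w (0, 1)]],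
    ![!![w (1, 0) - E (0, 0) (Q 0 0) - nfP E Q 0, -E (0, 0) (Q 0 1);
        w (1, 1) - E (0, 1) (Q 0 0), -E (0, 1) (Q 0 1) - nfP E Q 0],
      !![-E (0, 0) (Q 1 0) - nfP E Q 1, w (1, 0) - E (0, 0) (Q 1 1);
        -E (0, 1) (Q 1 0), w (1, 1) - E (0, 1) (Q 1 1) - nfP E Q 1]]] p.1 p.2

theorem metric_of_trace {M M' : Matrix (Fin 2) (Fin 2) R} {w : R} (h : M.trace = w)
    (h' : M'.trace = w) : (tens M 1 + tens 1 M') * etaR R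
      + ((tens M 1 + tens 1 M') * etaR R).transpose = (2 * w) • etaR R := by
  rw [Matrix.trace_fin_two] at h h'
  have key : ∀ p q, ((tens M 1 + tens 1 M') * etaR R
      + ((tens M 1 + tens 1 M') * etaR R).transpose) p q = ((2 * w) • etaR R) p q := by
    simp only [Matrix.mul_apply, sum_idx, Matrix.transpose_apply, Matrix.smul_apply, etaR_apply,
      tens, smul_eq_mul, Matrix.add_apply]
    rw [forall_idx]
    simp only [forall_idx, epsR_00, epsR_01, epsR_10, epsR_11, Matrix.one_apply]
    simp only [mul_zero, zero_mul, mul_one, mul_neg, neg_neg, add_zero, zero_add, Fin.isValue,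
      if_true, zero_ne_one, one_ne_zero, if_false, neg_zero]
    constructorm* _ ∧ _ <;> grind
  exact Matrix.ext key

/-- The Weyl connections of the normal frame, split into their actions on unprimed and on primed spinors. -/
theorem wcR_nfS (x y u v : Derivation ℂ R R) (a b c : R) (w : Idx → R) (p : Idx) :
    wcR (nfS (nfE x y u v a b c) (nfQ a b c)) w p
      = tens (nfSpin (nfE x y u v a b c) (nfQ a b c) w p) 1
        + tens 1 (nfSpin' (nfE x y u v a b c) (nfQ a b c) w p) := by
  have hh := two_mul_half (R := R)
  have htr : ∀ p, (nfSpin (nfE x y u v a b c) (nfQ a b c) w p).trace = w p := by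
    simp only [Prod.forall, Fin.forall_fin_two]
    constructorm* _ ∧ _ <;> simp [Matrix.trace_fin_two, nfSpin]
  have htr' : ∀ p, (nfSpin' (nfE x y u v a b c) (nfQ a b c) w p).trace = w p := by
    simp only [Prod.forall, Fin.forall_fin_two]
    constructorm* _ ∧ _ <;> simp [Matrix.trace_fin_two, nfSpin', nfP, nfQ] <;> grind
  refine (eq_wcR (G := fun p => tens (nfSpin (nfE x y u v a b c) (nfQ a b c) w p) 1
    + tens 1 (nfSpin' (nfE x y u v a b c) (nfQ a b c) w p)) ?_
    (fun p => metric_of_trace (htr p) (htr' p)) p).symm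
  rw [strR_nfS]
  simp only [Matrix.add_apply, tens, nfStr]
  simp only [Prod.forall, Fin.forall_fin_two]
  constructorm* _ ∧ _ <;> simp [nfSpin, nfSpin', nfQ, nfP] <;> grind

/-- The curvature of a connection on spinors. -/
def spinCurvR (e : Idx → Derivation ℂ R R) (c : Idx → Idx → Idx → R)
    (γ : Idx → Matrix (Fin 2) (Fin 2) R) (a b : Idx) : Matrix (Fin 2) (Fin 2) R :=
  (γ b).map (e a) - (γ a).map (e b) + γ b * γ a - γ a * γ b - ∑ k, c a b k • γ k

/-- The curvature of a connection induced from two spinor connections. -/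
theorem curvR_tens (e : Idx → Derivation ℂ R R) (c : Idx → Idx → Idx → R)
    {G : Idx → Matrix Idx Idx R} {γ γ' : Idx → Matrix (Fin 2) (Fin 2) R}
    (hG : ∀ a, G a = tens (γ a) 1 + tens 1 (γ' a)) (a b : Idx) :
    curvR e c G a b = tens (spinCurvR e c γ a b) 1 + tens 1 (spinCurvR e c γ' a b) := by
  ext ⟨A, A'⟩ ⟨B, B'⟩
  simp only [curvR, hG, spinCurvR, Matrix.add_mul, Matrix.mul_add, tens_mul, Matrix.one_mul,
    Matrix.mul_one]
  simp only [tens, Matrix.add_apply, Matrix.sub_apply, Matrix.map_apply, Matrix.sum_apply,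
    Matrix.smul_apply, smul_eq_mul, map_add, Derivation.leibniz, mul_add, Finset.sum_add_distrib,
    ← mul_assoc, add_mul, sub_mul, mul_sub, Finset.sum_mul, Finset.mul_sum]
  have h1 : ∀ (d : Derivation ℂ R R) (i j : Fin 2), d ((1 : Matrix (Fin 2) (Fin 2) R) i j) = 0 := by
    intro d i j
    rw [Matrix.one_apply]; split_ifs <;> simp
  simp only [h1, mul_zero, zero_add, add_zero, mul_right_comm _ (γ _ _ _)]
  ring_nf

theorem ricciR_tens (F F' : Idx → Idx → Matrix (Fin 2) (Fin 2) R) (a c : Idx) :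
    ricciR (fun a b => tens (F a b) 1 + tens 1 (F' a b)) a c
      = F a (0, c.2) c.1 0 + F a (1, c.2) c.1 1 + (F' a (c.1, 0) c.2 0 + F' a (c.1, 1) c.2 1) := by
  obtain ⟨C, C'⟩ := c
  simp only [ricciR, sum_idx, Matrix.add_apply, tens]
  revert C C'
  simp only [Fin.forall_fin_two]
  constructorm* _ ∧ _ <;> simp <;> ring

end NormalFrame
end ConformalHH

namespace ConformalHH

/-! ### Ricci tensor, Lee form and hyper-heavenly equation of the normal frame -/

section NormalFrame

variable {R : Type*} [CommRing R] [Algebra ℂ R]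

/-- The Ricci tensor of the Weyl connection with 1-form `w` of the normal frame. -/
def ricNF (x y u v : Derivation ℂ R R) (a b c : R) (w : Idx → R) (p q : Idx) : R :=
  ricciR (curvR (nfE x y u v a b c) (nfStr (nfE x y u v a b c) (nfQ a b c))
    (wcR (nfS (nfE x y u v a b c) (nfQ a b c)) w)) p q

theorem der_half (d : Derivation ℂ R R) : d (half R) = 0 := d.map_algebraMap _

theorem ricNF_eq (x y u v : Derivation ℂ R R) (a b c : R) (w : Idx → R) (p q : Idx) :
    ricNF x y u v a b c w p q =
      spinCurvR (nfE x y u v a b c) (nfStr (nfE x y u v a b c) (nfQ a b c))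
        (nfSpin (nfE x y u v a b c) (nfQ a b c) w) p (0, q.2) q.1 0
      + spinCurvR (nfE x y u v a b c) (nfStr (nfE x y u v a b c) (nfQ a b c))
        (nfSpin (nfE x y u v a b c) (nfQ a b c) w) p (1, q.2) q.1 1
      + (spinCurvR (nfE x y u v a b c) (nfStr (nfE x y u v a b c) (nfQ a b c))
        (nfSpin' (nfE x y u v a b c) (nfQ a b c) w) p (q.1, 0) q.2 0
      + spinCurvR (nfE x y u v a b c) (nfStr (nfE x y u v a b c) (nfQ a b c))
        (nfSpin' (nfE x y u v a b c) (nfQ a b c) w) p (q.1, 1) q.2 1) := by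
  rw [ricNF, ← ricciR_tens]
  simp only [ricciR, curvR_tens _ _ (wcR_nfS x y u v a b c w)]

/-- The components in the normal frame of the 1-form with the values `wx`, `wy`, `wu`, `wv` on `x`, `y`,
`u`, `v`. -/
def nfW (a b c wx wy wu wv : R) (p : Idx) : R :=
  ![![wx, wy], ![wu + a * wx + b * wy, wv + c * wx - a * wy]] p.1 p.2

variable (x y u v : Derivation ℂ R R) (a b c wx wy wu wv : R)

set_option linter.unusedSimpArgs false in
set_option maxHeartbeats 2000000 in
/-- The Einstein–Weyl equations of the closed 1-form `w = -d log O` in the normal frame. -/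
theorem isEWJet_of_ricci {x y u v : Derivation ℂ R R} {a b c : R} {O wx wy wu wv : R}
    (comm_yx : ∀ f, y (x f) = x (y f)) (comm_ux : ∀ f, u (x f) = x (u f))
    (comm_uy : ∀ f, u (y f) = y (u f)) (comm_vx : ∀ f, v (x f) = x (v f))
    (comm_vy : ∀ f, v (y f) = y (v f)) (comm_vu : ∀ f, v (u f) = u (v f))
    (hO : IsUnit O)
    (hx : x O = -(O * wx)) (hy : y O = -(O * wy)) (hu : u O = -(O * wu)) (hv : v O = -(O * wv))
    {Λ : R} (hR : ∀ p q, ricNF x y u v a b c (nfW a b c wx wy wu wv) p q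
      + ricNF x y u v a b c (nfW a b c wx wy wu wv) q p = Λ * etaR R p q) :
    IsEWJet x y u v a b c O := by
  have hh := two_mul_half (R := R)
  have closed : ∀ {d d' : Derivation ℂ R R} {w w' : R}, (∀ f, d (d' f) = d' (d f)) →
      d O = -(O * w) → d' O = -(O * w') → d w' = d' w := by
    intro d d' w w' h1 h2 h3
    have h4 := h1 O
    simp only [h2, h3, map_neg, Derivation.leibniz, smul_eq_mul] at h4
    exact hO.mul_left_cancel (by linear_combination -h4)
  have c1 := closed comm_yx hy hx
  have c2 := closed comm_ux hu hx
  have c3 := closed comm_uy hu hy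
  have c4 := closed comm_vx hv hx
  have c5 := closed comm_vy hv hy
  have c6 := closed comm_vu hv hu
  have e_xx := hR (0, 0) (0, 0)
  simp only [ricNF_eq] at e_xx
  simp [spinCurvR, Matrix.mul_apply, Matrix.sum_apply, sum_idx, nfSpin, nfSpin', nfStr, nfQ, nfP,
    nfE, nfW, der_half, etaR_apply, comm_yx, comm_ux, comm_uy, comm_vx, comm_vy, comm_vu, c1, c2, c3,
    c4, c5, c6] at e_xx
  have e_xy := hR (0, 0) (0, 1)
  simp only [ricNF_eq] at e_xy
  simp [spinCurvR, Matrix.mul_apply, Matrix.sum_apply, sum_idx, nfSpin, nfSpin', nfStr, nfQ, nfP,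
    nfE, nfW, der_half, etaR_apply, comm_yx, comm_ux, comm_uy, comm_vx, comm_vy, comm_vu, c1, c2, c3,
    c4, c5, c6] at e_xy
  have e_yy := hR (0, 1) (0, 1)
  simp only [ricNF_eq] at e_yy
  simp [spinCurvR, Matrix.mul_apply, Matrix.sum_apply, sum_idx, nfSpin, nfSpin', nfStr, nfQ, nfP,
    nfE, nfW, der_half, etaR_apply, comm_yx, comm_ux, comm_uy, comm_vx, comm_vy, comm_vu, c1, c2, c3,
    c4, c5, c6] at e_yy
  have e_M0 := hR (0, 0) (1, 0)
  simp only [ricNF_eq] at e_M0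
  simp [spinCurvR, Matrix.mul_apply, Matrix.sum_apply, sum_idx, nfSpin, nfSpin', nfStr, nfQ, nfP,
    nfE, nfW, der_half, etaR_apply, comm_yx, comm_ux, comm_uy, comm_vx, comm_vy, comm_vu, c1, c2, c3,
    c4, c5, c6] at e_M0
  have e_M1 := hR (0, 0) (1, 1)
  simp only [ricNF_eq] at e_M1
  simp [spinCurvR, Matrix.mul_apply, Matrix.sum_apply, sum_idx, nfSpin, nfSpin', nfStr, nfQ, nfP,
    nfE, nfW, der_half, etaR_apply, comm_yx, comm_ux, comm_uy, comm_vx, comm_vy, comm_vu, c1, c2, c3,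
    c4, c5, c6] at e_M1
  have e_M1b := hR (0, 1) (1, 0)
  simp only [ricNF_eq] at e_M1b
  simp [spinCurvR, Matrix.mul_apply, Matrix.sum_apply, sum_idx, nfSpin, nfSpin', nfStr, nfQ, nfP,
    nfE, nfW, der_half, etaR_apply, comm_yx, comm_ux, comm_uy, comm_vx, comm_vy, comm_vu, c1, c2, c3,
    c4, c5, c6] at e_M1b
  have e_M2 := hR (0, 1) (1, 1)
  simp only [ricNF_eq] at e_M2
  simp [spinCurvR, Matrix.mul_apply, Matrix.sum_apply, sum_idx, nfSpin, nfSpin', nfStr, nfQ, nfP,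
    nfE, nfW, der_half, etaR_apply, comm_yx, comm_ux, comm_uy, comm_vx, comm_vy, comm_vu, c1, c2, c3,
    c4, c5, c6] at e_M2
  have e_E0 := hR (1, 0) (1, 0)
  simp only [ricNF_eq] at e_E0
  simp [spinCurvR, Matrix.mul_apply, Matrix.sum_apply, sum_idx, nfSpin, nfSpin', nfStr, nfQ, nfP,
    nfE, nfW, der_half, etaR_apply, comm_yx, comm_ux, comm_uy, comm_vx, comm_vy, comm_vu, c1, c2, c3,
    c4, c5, c6] at e_E0
  have e_E1 := hR (1, 0) (1, 1)
  simp only [ricNF_eq] at e_E1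
  simp [spinCurvR, Matrix.mul_apply, Matrix.sum_apply, sum_idx, nfSpin, nfSpin', nfStr, nfQ, nfP,
    nfE, nfW, der_half, etaR_apply, comm_yx, comm_ux, comm_uy, comm_vx, comm_vy, comm_vu, c1, c2, c3,
    c4, c5, c6] at e_E1
  have e_E2 := hR (1, 1) (1, 1)
  simp only [ricNF_eq] at e_E2
  simp [spinCurvR, Matrix.mul_apply, Matrix.sum_apply, sum_idx, nfSpin, nfSpin', nfStr, nfQ, nfP,
    nfE, nfW, der_half, etaR_apply, comm_yx, comm_ux, comm_uy, comm_vx, comm_vy, comm_vu, c1, c2, c3,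
    c4, c5, c6] at e_E2
  refine ⟨comm_yx, comm_ux, comm_uy, comm_vx, comm_vy, comm_vu, ?_, ?_, ?_, ?_, ?_, ?_, ?_, ?_, ?_⟩
  all_goals simp only [hx, hy, hu, hv, map_neg, Derivation.leibniz, smul_eq_mul, c1, c2, c3, c4, c5, c6]
  · refine double_cancel (double_cancel ?_)
    linear_combination -O * e_xx
  · refine double_cancel (double_cancel ?_)
    linear_combination -O * e_xy
  · refine double_cancel (double_cancel ?_)
    linear_combination -O * e_yy
  · refine double_cancel ?_
    clear * - hh e_M0
    grind
  · refine double_cancel ?_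
    have e_M := congrArg₂ (· + ·) e_M1 e_M1b
    clear * - hh e_M
    grind
  · refine double_cancel ?_
    clear * - hh e_M2
    grind
  · refine double_cancel ?_
    clear * - hh e_E0
    grind
  · refine double_cancel ?_
    clear * - hh e_E1
    grind
  · refine double_cancel ?_
    clear * - hh e_E2
    grind

/-- The spinor connections are recovered from the two parts of the connection, as their traces are fixed by
the Weyl 1-form. -/
theorem spinR_tens {G : Idx → Matrix Idx Idx R} {w : Idx → R} {p : Idx}
    {γ γ' : Matrix (Fin 2) (Fin 2) R} (hG : G p = tens γ 1 + tens 1 γ') (h : γ.trace = w p)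
    (h' : γ'.trace = w p) : spinR G w p = γ ∧ spinR' G w p = γ' := by
  have hh := two_mul_half (R := R)
  rw [Matrix.trace_fin_two] at h h'
  constructor
  · have key : ∀ B C, spinR G w p B C = γ B C := by
      simp only [spinR, hG, Matrix.add_apply, tens]
      simp only [Fin.forall_fin_two]
      constructorm* _ ∧ _ <;> simp <;> grind
    exact Matrix.ext key
  · have key : ∀ B C, spinR' G w p B C = γ' B C := by
      simp only [spinR', hG, Matrix.add_apply, tens]
      simp only [Fin.forall_fin_two]
      constructorm* _ ∧ _ <;> simp <;> grind
    exact Matrix.ext key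

theorem spinR_nfS (p : Idx) :
    spinR (wcR (nfS (nfE x y u v a b c) (nfQ a b c)) 0) 0 p
        = nfSpin (nfE x y u v a b c) (nfQ a b c) 0 p ∧
      spinR' (wcR (nfS (nfE x y u v a b c) (nfQ a b c)) 0) 0 p
        = nfSpin' (nfE x y u v a b c) (nfQ a b c) 0 p := by
  have hh := two_mul_half (R := R)
  refine spinR_tens (wcR_nfS x y u v a b c 0 p) ?_ ?_
  · revert p
    simp only [Prod.forall, Fin.forall_fin_two]
    constructorm* _ ∧ _ <;> simp [Matrix.trace_fin_two, nfSpin]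
  · revert p
    simp only [Prod.forall, Fin.forall_fin_two]
    constructorm* _ ∧ _ <;> simp [Matrix.trace_fin_two, nfSpin', nfP, nfQ] <;> grind

theorem spinR'_nfS_zero (B : Fin 2) :
    spinR' (wcR (nfS (nfE x y u v a b c) (nfQ a b c)) 0) 0 (0, B) = 0 := by
  rw [(spinR_nfS x y u v a b c _).2]
  have key : ∀ B C D, nfSpin' (nfE x y u v a b c) (nfQ a b c) 0 (0, B) C D = 0 := by
    simp only [Fin.forall_fin_two]
    constructorm* _ ∧ _ <;> simp [nfSpin']
  exact Matrix.ext (key B)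

/-- The normal metric has vanishing Lee form, so the Lee form with respect to a Weyl connection is `-w`. -/
theorem leeR_nfS (w : Idx → R) (p : Idx) : leeR (nfE x y u v a b c)
    (wcR (nfS (nfE x y u v a b c) (nfQ a b c)) w) ![1, 0] ![0, 1] p = -w p := by
  rw [SpinChange.leeR_adapted]
  simp only [wcR_nfS, Matrix.add_apply, tens]
  revert p
  simp only [Prod.forall, Fin.forall_fin_two]
  constructorm* _ ∧ _ <;> simp [nfSpin, nfSpin', nfQ, nfP]

theorem scalR_nfS (comm_yx : ∀ f, y (x f) = x (y f)) :
    scalR (curvR (nfE x y u v a b c) (strR (nfS (nfE x y u v a b c) (nfQ a b c)))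
      (wcR (nfS (nfE x y u v a b c) (nfQ a b c)) 0))
      = -4 * x (y a) - 2 * y (y b) + 2 * x (x c) := by
  have hh := two_mul_half (R := R)
  have h : ∀ p q, ricciR (curvR (nfE x y u v a b c) (nfStr (nfE x y u v a b c) (nfQ a b c))
    (wcR (nfS (nfE x y u v a b c) (nfQ a b c)) 0)) p q = _ := ricNF_eq x y u v a b c 0
  simp only [scalR, strR_nfS, h]
  simp [spinCurvR, Matrix.mul_apply, sum_idx, nfSpin, nfSpin', nfStr, nfQ, nfP, nfE, der_half,
    etaR_apply, comm_yx]
  grind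

/-- The hyper-heavenly operator in the normal frame. -/
theorem hh_nfS (comm_yx : ∀ f, y (x f) = x (y f)) (comm_ux : ∀ f, u (x f) = x (u f))
    (comm_uy : ∀ f, u (y f) = y (u f)) (comm_vx : ∀ f, v (x f) = x (v f))
    (comm_vy : ∀ f, v (y f) = y (v f)) (F O : R) :
    (∑ p, ∑ q, etaR R p q * (nfE x y u v a b c p (nfE x y u v a b c q F + ((-4 : ℤ) : R)
          * ![0, -nfP (nfE x y u v a b c) (nfQ a b c) q.2] q.1 * F)
        - (∑ d, wcR (nfS (nfE x y u v a b c) (nfQ a b c)) 0 p q d * (nfE x y u v a b c d F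
          + ((-4 : ℤ) : R) * ![0, -nfP (nfE x y u v a b c) (nfQ a b c) d.2] d.1 * F))
        + ((-4 : ℤ) : R) * ![0, -nfP (nfE x y u v a b c) (nfQ a b c) p.2] p.1
          * (nfE x y u v a b c q F + ((-4 : ℤ) : R)
            * ![0, -nfP (nfE x y u v a b c) (nfQ a b c) q.2] q.1 * F)))
      + 3 * half R * (-4 * x (y a) - 2 * y (y b) + 2 * x (x c)) * F
      + O * (∑ A : Fin 2, ∑ B : Fin 2, ![x, y] A (![x, y] B F)
        * ∑ C, ∑ D, epsR R A C * epsR R B D * ![x, y] C (![x, y] D F))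
      - 4 * (∑ A : Fin 2, ∑ B : Fin 2, (∑ C, epsR R A C * ![x, y] C O)
        * (∑ C, epsR R B C * ![x, y] C F) * ![x, y] A (![x, y] B F))
      = hhExpr x y u v a b c F O := by
  have hh := two_mul_half (R := R)
  simp only [wcR_nfS, Matrix.add_apply, tens]
  simp [sum_idx, nfSpin, nfSpin', nfQ, nfP, nfE, der_half, etaR_apply, comm_yx, comm_ux, comm_uy,
    comm_vx, comm_vy, hhExpr, der_ofNat, -forall_const]
  clear comm_yx comm_ux comm_uy comm_vx comm_vy
  grind

end NormalFrame
end ConformalHH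

namespace ConformalHH

/-! ### Weyl spinor of the normal frame -/

section WeylNormalFrame

variable {R : Type*} [CommRing R] [Algebra ℂ R]

/-- The SD part of a curvature which is split into unprimed and primed parts. The unprimed part enters
through its trace, and drops out on symmetrization. -/
theorem four_sdPartR (F F' : Idx → Idx → Matrix (Fin 2) (Fin 2) R) (J : Fin 4 → Fin 2) :
    4 * sdPartR (fun a b => tens (F a b) 1 + tens 1 (F' a b)) J
      = ((F (0, J 0) (1, J 1)).trace - (F (1, J 0) (0, J 1)).trace) * epsR R (J 2) (J 3)
        + 2 * ∑ m, (F' (0, J 0) (1, J 1) (J 2) m - F' (1, J 0) (0, J 1) (J 2) m)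
          * epsR R m (J 3) := by
  have h4 : (4 : R) * algebraMap ℂ R (1 / 4) = 1 := by
    rw [show (4 : R) = algebraMap ℂ R 4 from (map_ofNat _ 4).symm, ← map_mul]; norm_num
  rw [sdPartR, ← mul_assoc, h4, one_mul]
  generalize J 0 = i
  generalize J 1 = j
  generalize J 2 = k
  generalize J 3 = l
  simp only [Fin.sum_univ_two, epsR_00, epsR_01, epsR_10, epsR_11, Matrix.mul_apply, sum_idx,
    etaR_apply, Matrix.add_apply, tens, Matrix.trace_fin_two]
  revert k l
  simp only [Fin.forall_fin_two]
  constructorm* _ ∧ _ <;> simp <;> ring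

theorem symR_eq_of {T : (Fin 4 → Fin 2) → R} {I : Fin 4 → Fin 2} {W : R}
    (h : 24 * W = ∑ σ : Equiv.Perm (Fin 4), T (I ∘ σ)) : symR T I = W := by
  rw [symR, ← h, ← mul_assoc, show (24 : R) = algebraMap ℂ R 24 from (map_ofNat _ 24).symm,
    ← map_mul]
  norm_num

theorem sum_perm_four (f : Fin 4 → Fin 4 → Fin 4 → Fin 4 → R) :
    ∑ σ : Equiv.Perm (Fin 4), f (σ 0) (σ 1) (σ 2) (σ 3) =
      f 0 1 2 3 + f 0 1 3 2 + f 0 2 1 3 + f 0 2 3 1 + f 0 3 1 2 + f 0 3 2 1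
      + f 1 0 2 3 + f 1 0 3 2 + f 1 2 0 3 + f 1 2 3 0 + f 1 3 0 2 + f 1 3 2 0
      + f 2 0 1 3 + f 2 0 3 1 + f 2 1 0 3 + f 2 1 3 0 + f 2 3 0 1 + f 2 3 1 0
      + f 3 0 1 2 + f 3 0 2 1 + f 3 1 0 2 + f 3 1 2 0 + f 3 2 0 1 + f 3 2 1 0 := by
  have h : (Finset.univ : Finset (Equiv.Perm (Fin 4))).val.map (fun σ => (σ 0, σ 1, σ 2, σ 3)) =
      {(0, 1, 2, 3), (0, 1, 3, 2), (0, 2, 1, 3), (0, 2, 3, 1), (0, 3, 1, 2), (0, 3, 2, 1),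
        (1, 0, 2, 3), (1, 0, 3, 2), (1, 2, 0, 3), (1, 2, 3, 0), (1, 3, 0, 2), (1, 3, 2, 0),
        (2, 0, 1, 3), (2, 0, 3, 1), (2, 1, 0, 3), (2, 1, 3, 0), (2, 3, 0, 1), (2, 3, 1, 0),
        (3, 0, 1, 2), (3, 0, 2, 1), (3, 1, 0, 2), (3, 1, 2, 0), (3, 2, 0, 1), (3, 2, 1, 0)} := by decide
  calc _ = (((Finset.univ : Finset (Equiv.Perm (Fin 4))).val.map
        (fun σ => (σ 0, σ 1, σ 2, σ 3))).map fun p => f p.1 p.2.1 p.2.2.1 p.2.2.2).sum := by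
        rw [Multiset.map_map]; rfl
    _ = _ := by
        rw [h]
        simp only [Multiset.insert_eq_cons, Multiset.map_cons, Multiset.sum_cons,
          Multiset.map_singleton, Multiset.sum_singleton]
        ring

set_option maxHeartbeats 4000000 in
/-- The SD Weyl spinor of the normal frame, by a potential `F`. The Weyl 1-form is
arbitrary, because it does not contribute to the Weyl spinor. -/
theorem weyl_nfS {x y u v : Derivation ℂ R R} {a b c F O : R} (h : IsJet x y u v a b c F O)
    {wx wy wu wv : R} (I : Fin 4 → Fin 2) :
    symR (sdPartR (curvR (nfE x y u v a b c) (strR (nfS (nfE x y u v a b c) (nfQ a b c)))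
      (wcR (nfS (nfE x y u v a b c) (nfQ a b c)) (nfW a b c wx wy wu wv)))) I
      = O * ![x, y] (I 0) (![x, y] (I 1) (![x, y] (I 2) (![x, y] (I 3) F))) := by
  have hh := two_mul_half (R := R)
  have comm_yx := h.comm_yx
  have comm_ux := h.comm_ux
  have comm_uy := h.comm_uy
  have comm_vx := h.comm_vx
  have comm_vy := h.comm_vy
  have hT := four_sdPartR
    (spinCurvR (nfE x y u v a b c) (nfStr (nfE x y u v a b c) (nfQ a b c))
      (nfSpin (nfE x y u v a b c) (nfQ a b c) (nfW a b c wx wy wu wv)))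
    (spinCurvR (nfE x y u v a b c) (nfStr (nfE x y u v a b c) (nfQ a b c))
      (nfSpin' (nfE x y u v a b c) (nfQ a b c) (nfW a b c wx wy wu wv)))
  have hC : curvR (nfE x y u v a b c) (strR (nfS (nfE x y u v a b c) (nfQ a b c)))
      (wcR (nfS (nfE x y u v a b c) (nfQ a b c)) (nfW a b c wx wy wu wv)) = fun p q =>
      tens (spinCurvR (nfE x y u v a b c) (nfStr (nfE x y u v a b c) (nfQ a b c))
        (nfSpin (nfE x y u v a b c) (nfQ a b c) (nfW a b c wx wy wu wv)) p q) 1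
      + tens 1 (spinCurvR (nfE x y u v a b c) (nfStr (nfE x y u v a b c) (nfQ a b c))
        (nfSpin' (nfE x y u v a b c) (nfQ a b c) (nfW a b c wx wy wu wv)) p q) := by
    rw [strR_nfS]
    funext p q
    exact curvR_tens _ _ (wcR_nfS x y u v a b c _) p q
  rw [hC]
  refine symR_eq_of (double_cancel (double_cancel ?_))
  simp only [← mul_assoc, show (2 : R) * 2 = 4 by norm_num]
  rw [Finset.mul_sum]
  simp only [hT]
  generalize hγ : spinCurvR (nfE x y u v a b c) (nfStr (nfE x y u v a b c) (nfQ a b c))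
    (nfSpin (nfE x y u v a b c) (nfQ a b c) (nfW a b c wx wy wu wv)) = γ
  clear hγ hT hC
  refine Eq.trans ?_ (sum_perm_four fun i j k l =>
    ((γ (0, I i) (1, I j)).trace - (γ (1, I i) (0, I j)).trace) * epsR R (I k) (I l)
      + 2 * ∑ m, (spinCurvR (nfE x y u v a b c) (nfStr (nfE x y u v a b c) (nfQ a b c))
        (nfSpin' (nfE x y u v a b c) (nfQ a b c) (nfW a b c wx wy wu wv)) (0, I i) (1, I j) (I k) m
        - spinCurvR (nfE x y u v a b c) (nfStr (nfE x y u v a b c) (nfQ a b c))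
        (nfSpin' (nfE x y u v a b c) (nfQ a b c) (nfW a b c wx wy wu wv)) (1, I i) (0, I j) (I k) m)
          * epsR R m (I l)).symm
  obtain ⟨d, hd⟩ : ∃ d : Idx → Idx → Matrix (Fin 2) (Fin 2) R, d = spinCurvR
    (nfE x y u v a b c) (nfStr (nfE x y u v a b c) (nfQ a b c))
      (nfSpin' (nfE x y u v a b c) (nfQ a b c) (nfW a b c wx wy wu wv)) := ⟨_, rfl⟩
  rw [← hd]
  have hd' : ∀ i j k l : Fin 2, d (0, i) (1, j) k l = spinCurvR
    (nfE x y u v a b c) (nfStr (nfE x y u v a b c) (nfQ a b c))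
      (nfSpin' (nfE x y u v a b c) (nfQ a b c) (nfW a b c wx wy wu wv)) (0, i) (1, j) k l ∧
      d (1, i) (0, j) k l = spinCurvR
    (nfE x y u v a b c) (nfStr (nfE x y u v a b c) (nfQ a b c))
      (nfSpin' (nfE x y u v a b c) (nfQ a b c) (nfW a b c wx wy wu wv)) (1, i) (0, j) k l :=
    fun i j k l => by rw [hd]; exact ⟨rfl, rfl⟩
  clear hd
  simp only [Fin.forall_fin_two] at hd'
  simp [spinCurvR, sum_idx, nfSpin', nfStr, nfQ, nfP, nfE, nfW, der_half, comm_yx] at hd'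
  generalize I 0 = i
  generalize I 1 = j
  generalize I 2 = k
  generalize I 3 = l
  revert i j k l
  simp only [Fin.forall_fin_two, Fin.sum_univ_two, epsR_00, epsR_01, epsR_10, epsR_11, mul_zero,
    zero_add, add_zero, mul_one, mul_neg]
  refine ⟨⟨⟨⟨?_, ?_⟩, ?_, ?_⟩, ⟨?_, ?_⟩, ?_, ?_⟩, ⟨⟨?_, ?_⟩, ?_, ?_⟩, ⟨?_, ?_⟩, ?_, ?_⟩
  all_goals simp only [hd', Matrix.cons_val_zero, Matrix.cons_val_one, comm_yx]
  · linear_combination -96 * h.W0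
  · linear_combination -48 * h.W1
  · linear_combination -48 * h.W1
  · linear_combination -16 * h.W2
  · linear_combination -48 * h.W1
  · linear_combination -16 * h.W2
  · linear_combination -16 * h.W2
  · linear_combination 48 * h.W3
  · linear_combination -48 * h.W1
  · linear_combination -16 * h.W2
  · linear_combination -16 * h.W2
  · linear_combination 48 * h.W3
  · linear_combination -16 * h.W2
  · linear_combination 48 * h.W3
  · linear_combination 48 * h.W3
  · linear_combination 96 * h.W4

end WeylNormalFrame
end ConformalHH

namespace ConformalHH

/-! ### Covariance of the potential equations -/

section Potential

variable {R : Type*} [CommRing R] [Algebra ℂ R]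

/-- The Lee form of the metric with frame `e` and lowered structure functions `s`. -/
def leeForm (e : Idx → Derivation ℂ R R) (s : Idx → Idx → Idx → R) (o ι : Fin 2 → R) : Idx → R :=
  leeR e (wcR s 0) o ι

/-- The 1-form `P`. -/
def pForm (e : Idx → Derivation ℂ R R) (s : Idx → Idx → Idx → R) (o ι : Fin 2 → R) : Idx → R :=
  pR e (spinR (wcR s (leeForm e s o ι)) (leeForm e s o ι)) o ι

/-- The operator `𝒞̃` of a frame. -/
def cT (e : Idx → Derivation ℂ R R) (s : Idx → Idx → Idx → R) (o ι : Fin 2 → R) (p w : ℤ) {n : ℕ}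
    (ψ : (Fin n → Fin 2) → R) : (Fin (n + 1) → Fin 2) → R :=
  connTR e (spinR' (wcR s (leeForm e s o ι)) (leeForm e s o ι)) (leeForm e s o ι) (pForm e s o ι) o
    p w ψ

/-- The analogue of `SpinGeometry.IsHHPotentialOn` in a `ℂ`-algebra with derivations. -/
structure IsHHPotentialR (e : Idx → Derivation ℂ R R) (s : Idx → Idx → Idx → R) (o ι : Fin 2 → R)
    (Ω₀ Φ K : R) : Prop where
  weyl_eq : ∀ I, symR (sdPartR (curvR e (strR s) (wcR s 0))) I
    = Ω₀ * cT e s o ι (-4 + 3) (-1) (cT e s o ι (-4 + 2) (-1) (cT e s o ι (-4 + 1) (-1)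
      (cT e s o ι (-4) (-1) fun _ : Fin 0 → Fin 2 => Φ))) I
  hh_eq : boxR e (spinR (wcR s (leeForm e s o ι)) (leeForm e s o ι))
      (spinR' (wcR s (leeForm e s o ι)) (leeForm e s o ι)) (leeForm e s o ι) (pForm e s o ι)
      (-4) (-1) Φ
    + 3 * half R * scalR (curvR e (strR s) (wcR s (leeForm e s o ι))) * Φ
    + Ω₀ * (∑ A, ∑ B,
      cT e s o ι (-4 + 1) (-1) (cT e s o ι (-4) (-1) fun _ : Fin 0 → Fin 2 => Φ) ![A, B]
      * ∑ C, ∑ D, epsR R A C * epsR R B D *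
        cT e s o ι (-4 + 1) (-1) (cT e s o ι (-4) (-1) fun _ : Fin 0 → Fin 2 => Φ) ![C, D])
    - 4 * (∑ A, ∑ B, (∑ C, epsR R A C * cT e s o ι 0 1 (fun _ : Fin 0 → Fin 2 => Ω₀) ![C])
      * (∑ C, epsR R B C * cT e s o ι (-4) (-1) (fun _ : Fin 0 → Fin 2 => Φ) ![C])
      * cT e s o ι (-4 + 1) (-1) (cT e s o ι (-4) (-1) fun _ : Fin 0 → Fin 2 => Φ) ![A, B])
    = 2 * K
  const_eq : ∀ I, cT e s o ι (-4 + 2) (-3) (cT e s o ι (-4 + 1) (-3)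
      (cT e s o ι (-4) (-3) fun _ : Fin 0 → Fin 2 => K)) I = 0

/-- A frame with spinors `o`, `ι` is related by a change of spin frame and a conformal rescaling to the
normal frame given by the commuting derivations `x`, `y`, `u`, `v` and the functions `a`, `b`, `c`. -/
abbrev NormalChange (e : Idx → Derivation ℂ R R) (s : Idx → Idx → Idx → R) (o ι : Fin 2 → R)
    (m : Matrix (Fin 2) (Fin 2) R) (α β Ω : Rˣ) (x y u v : Derivation ℂ R R) (a b c : R) : Prop :=
  SpinChange e (nfE x y u v a b c) s (nfS (nfE x y u v a b c) (nfQ a b c)) o ι m α β Ω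

namespace NormalChange

variable {e : Idx → Derivation ℂ R R} {s : Idx → Idx → Idx → R} {o ι : Fin 2 → R}
  {m : Matrix (Fin 2) (Fin 2) R} {α β Ω : Rˣ} {x y u v : Derivation ℂ R R} {a b c : R}

/-- The components of `-d log Ω` in the normal frame, as the 1-form of the Levi-Civita connection of the
original metric. -/
theorem weyl_form (h : NormalChange e s o ι m α β Ω x y u v a b c) (p : Idx) :
    (0 : Idx → R) p = ∑ d, tens (spinMat o ι α β) m p d * nfW a b c (-ld x Ω) (-ld y Ω) (-ld u Ω)
      (-ld v Ω) d + ld (e p) Ω := by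
  have hd := h.der p Ω
  have hE : ∀ d, ld (nfE x y u v a b c d) Ω
      = -nfW a b c (-ld x Ω) (-ld y Ω) (-ld u Ω) (-ld v Ω) d := by
    rw [forall_idx]
    constructorm* _ ∧ _ <;> simp [nfE, nfW, ld] <;> ring
  simp only [der_unit _ Ω, hE] at hd
  refine Ω.isUnit.mul_right_cancel ?_
  rw [add_mul, hd, Finset.sum_mul, ← Finset.sum_add_distrib, Pi.zero_apply, zero_mul]
  exact (Finset.sum_eq_zero fun d _ => by ring).symm

/-- The Lee form is `d log Ω`. -/
theorem leeR_eq_ld (h : NormalChange e s o ι m α β Ω x y u v a b c) (p : Idx) :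
    leeR e (wcR s 0) o ι p = ld (e p) Ω := by
  rw [SpinChange.leeR_eq h h.weyl_form]
  simp only [leeR_nfS, mul_neg, Finset.sum_neg_distrib]
  have := h.weyl_form p
  rw [Pi.zero_apply] at this
  linear_combination this

variable {lee : Idx → R}

theorem lee_form (h : NormalChange e s o ι m α β Ω x y u v a b c) (hl : lee = leeR e (wcR s 0) o ι)
    (p : Idx) : lee p = ∑ d, tens (spinMat o ι α β) m p d * (0 : Idx → R) d + ld (e p) Ω := by
  simp [hl, h.leeR_eq_ld]

/-- The 1-form `P` of the Lee connection, in terms of the normal frame. -/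
theorem pR_eq (h : NormalChange e s o ι m α β Ω x y u v a b c) (hl : lee = leeR e (wcR s 0) o ι)
    (p : Idx) : pR e (spinR (wcR s lee) lee) o ι p = half R * ld (e p) (β * α⁻¹ * Ω⁻¹)
      + ∑ d, tens (spinMat o ι α β) m p d
        * ![0, -nfP (nfE x y u v a b c) (nfQ a b c) d.2] d.1 := by
  rw [SpinChange.pR_eq h (h.lee_form hl), ld_mul, ld_mul, ld_inv, ld_inv, sub_eq_add_neg _ (∑ d, _),
    ← Finset.sum_neg_distrib]
  congr 1
  · ring
  · refine Finset.sum_congr rfl fun d _ => ?_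
    rw [(spinR_nfS x y u v a b c d).1]
    obtain ⟨A, B⟩ := d
    revert A B
    simp only [Fin.forall_fin_two]
    constructorm* _ ∧ _ <;> simp [nfSpin]

/-- The operator `𝒞̃` on fields of the form `κ b ⋯ b ψ`, with `κ` of the right weights. -/
theorem connTR_step (h : NormalChange e s o ι m α β Ω x y u v a b c)
    (hl : lee = leeR e (wcR s 0) o ι) {n : ℕ} {κ : Rˣ} {p w : ℤ}
    (hκ : ∀ d : Derivation ℂ R R, ld d κ + (w : R) * ld d Ω + p * (half R * ld d (β * α⁻¹ * Ω⁻¹))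
      + n * traceShift d α β Ω = 0) (ψ : (Fin n → Fin 2) → R) :
    connTR e (spinR' (wcR s lee) lee) lee (pR e (spinR (wcR s lee) lee) o ι) o p w
      ((κ : R) • actR m ψ)
      = ((κ * α : Rˣ) : R) • actR m (fun K => ![x, y] (K 0) (ψ (Fin.tail K))) := by
  have hE : ∀ B, nfE x y u v a b c (0, B) = ![x, y] B := fun B => by simp [nfE]
  rw [SpinChange.connTR_actR h (fun p => by rw [hl]; exact h.leeR_eq_ld p)
    (spinR'_nfS_zero x y u v a b c), Units.val_mul]
  · simp only [hE]
  · intro A'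
    have h1 := SpinChange.sum_o_tens h A'
      (fun d => ![0, -nfP (nfE x y u v a b c) (nfQ a b c) d.2] d.1)
    simp only [Matrix.cons_val_zero, mul_zero, Finset.sum_const_zero] at h1
    have h2 : ∀ A, e (A, A') (κ : R) + ((w : R) * lee (A, A')
        + p * pR e (spinR (wcR s lee) lee) o ι (A, A')) * κ
        + n * traceShift (e (A, A')) α β Ω * κ = (p : R) * (κ : R) * ∑ d, tens (spinMat o ι α β) m (A, A') d
        * ![0, -nfP (nfE x y u v a b c) (nfQ a b c) d.2] d.1 := by
      intro A
      rw [h.pR_eq hl, hl, h.leeR_eq_ld, der_unit]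
      linear_combination (κ : R) * hκ (e (A, A'))
    simp only [h2]
    calc _ = (p : R) * (κ : R) * ∑ A, o A * ∑ d, tens (spinMat o ι α β) m (A, A') d
        * ![0, -nfP (nfE x y u v a b c) (nfQ a b c) d.2] d.1 := by
          rw [Finset.mul_sum]
          exact Finset.sum_congr rfl fun A _ => by ring
      _ = 0 := by rw [h1, mul_zero]

/-- The operator `𝒞̃` on scalars. -/
theorem connTR_scalar (h : NormalChange e s o ι m α β Ω x y u v a b c)
    (hl : lee = leeR e (wcR s 0) o ι) {κ : Rˣ} {p w : ℤ}
    (hκ : ∀ d : Derivation ℂ R R, ld d κ + (w : R) * ld d Ω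
      + p * (half R * ld d (β * α⁻¹ * Ω⁻¹)) = 0) (f : R) :
    connTR e (spinR' (wcR s lee) lee) lee (pR e (spinR (wcR s lee) lee) o ι) o p w
      (fun _ : Fin 0 → Fin 2 => κ * f)
      = ((κ * α : Rˣ) : R) • actR m (fun K => ![x, y] (K 0) f) := by
  rw [← h.connTR_step hl (n := 0) (κ := κ) (p := p) (w := w) (fun d => by rw [← hκ d]; simp) (fun _ => f)]
  congr 1
  funext K
  simp [actR_zero]

/-- The weight factor of `n` derivatives `𝒞̃` of a field of weights `(-4, w)`. -/
theorem ld_weight (d : Derivation ℂ R R) (n k : ℕ) :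
    ld d ((β * α⁻¹ * Ω⁻¹) ^ 2 * Ω ^ k * α ^ n) + ((-k : ℤ) : R) * ld d Ω
      + ((-4 + n : ℤ) : R) * (half R * ld d (β * α⁻¹ * Ω⁻¹)) + n * traceShift d α β Ω = 0 := by
  simp only [ld_mul, ld_pow, ld_inv, traceShift]
  push_cast
  linear_combination (-2 * (ld d β - ld d α - ld d Ω) - n * ld d α) * two_mul_half (R := R)

/-- The first four derivatives `𝒞̃` of a field of weights `(-4, w)`. -/
theorem connTR_pow (h : NormalChange e s o ι m α β Ω x y u v a b c)
    (hl : lee = leeR e (wcR s 0) o ι) (n k : ℕ) (p w : ℤ) (hp : p = -4 + n) (hw : w = -k)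
    (ψ : (Fin n → Fin 2) → R) :
    connTR e (spinR' (wcR s lee) lee) lee (pR e (spinR (wcR s lee) lee) o ι) o p w
      ((((β * α⁻¹ * Ω⁻¹) ^ 2 * Ω ^ k * α ^ n : Rˣ) : R) • actR m ψ)
      = (((β * α⁻¹ * Ω⁻¹) ^ 2 * Ω ^ k * α ^ (n + 1) : Rˣ) : R)
        • actR m (fun K => ![x, y] (K 0) (ψ (Fin.tail K))) := by
  subst hp hw
  rw [h.connTR_step hl (fun d => ld_weight d n k) ψ, mul_assoc _ (α ^ n), ← pow_succ]

/-- Iterated derivatives `𝒞̃` of a scalar of weights `(-4, w)`. -/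
theorem cT_iterate (h : NormalChange e s o ι m α β Ω x y u v a b c) (k : ℕ) (w : ℤ) (hw : w = -k)
    (f Φ : R) (hΦ : Φ = ((β * α⁻¹ * Ω⁻¹) ^ 2 * Ω ^ k : Rˣ) * f) :
    cT e s o ι (-4) w (fun _ : Fin 0 → Fin 2 => Φ)
        = (((β * α⁻¹ * Ω⁻¹) ^ 2 * Ω ^ k * α ^ 1 : Rˣ) : R) • actR m (fun K => ![x, y] (K 0) f) ∧
      cT e s o ι (-4 + 1) w (cT e s o ι (-4) w (fun _ : Fin 0 → Fin 2 => Φ))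
        = (((β * α⁻¹ * Ω⁻¹) ^ 2 * Ω ^ k * α ^ 2 : Rˣ) : R)
          • actR m (fun K => ![x, y] (K 0) (![x, y] (K 1) f)) ∧
      cT e s o ι (-4 + 2) w (cT e s o ι (-4 + 1) w (cT e s o ι (-4) w
        (fun _ : Fin 0 → Fin 2 => Φ)))
        = (((β * α⁻¹ * Ω⁻¹) ^ 2 * Ω ^ k * α ^ 3 : Rˣ) : R)
          • actR m (fun K => ![x, y] (K 0) (![x, y] (K 1) (![x, y] (K 2) f))) ∧
      cT e s o ι (-4 + 3) w (cT e s o ι (-4 + 2) w (cT e s o ι (-4 + 1) w (cT e s o ι (-4) w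
        (fun _ : Fin 0 → Fin 2 => Φ))))
        = (((β * α⁻¹ * Ω⁻¹) ^ 2 * Ω ^ k * α ^ 4 : Rˣ) : R)
          • actR m (fun K => ![x, y] (K 0) (![x, y] (K 1) (![x, y] (K 2) (![x, y] (K 3) f)))) := by
  have h0 : (fun _ : Fin 0 → Fin 2 => Φ)
      = (((β * α⁻¹ * Ω⁻¹) ^ 2 * Ω ^ k * α ^ 0 : Rˣ) : R) • actR m (fun _ : Fin 0 → Fin 2 => f) := by
    funext K
    rw [Pi.smul_apply, actR_zero, hΦ, pow_zero, mul_one, smul_eq_mul]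
  have h1 := h.connTR_pow rfl 0 k (-4) w rfl hw (fun _ => f)
  have h2 := h.connTR_pow rfl 1 k (-4 + 1) w rfl hw (fun K => ![x, y] (K 0) f)
  have h3 := h.connTR_pow rfl 2 k (-4 + 2) w rfl hw (fun K => ![x, y] (K 0) (![x, y] (K 1) f))
  have h4 := h.connTR_pow rfl 3 k (-4 + 3) w rfl hw
    (fun K => ![x, y] (K 0) (![x, y] (K 1) (![x, y] (K 2) f)))
  have e1 : cT e s o ι (-4) w (fun _ : Fin 0 → Fin 2 => Φ)
        = (((β * α⁻¹ * Ω⁻¹) ^ 2 * Ω ^ k * α ^ 1 : Rˣ) : R) • actR m (fun K => ![x, y] (K 0) f) := by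
    rw [h0]; exact h1
  rw [e1]
  refine ⟨rfl, ?_⟩
  have e2 : cT e s o ι (-4 + 1) w ((((β * α⁻¹ * Ω⁻¹) ^ 2 * Ω ^ k * α ^ 1 : Rˣ) : R)
      • actR m (fun K => ![x, y] (K 0) f)) = (((β * α⁻¹ * Ω⁻¹) ^ 2 * Ω ^ k * α ^ 2 : Rˣ) : R)
          • actR m (fun K => ![x, y] (K 0) (![x, y] (K 1) f)) := h2
  rw [e2]
  refine ⟨rfl, ?_⟩
  have e3 : cT e s o ι (-4 + 2) w ((((β * α⁻¹ * Ω⁻¹) ^ 2 * Ω ^ k * α ^ 2 : Rˣ) : R)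
      • actR m (fun K => ![x, y] (K 0) (![x, y] (K 1) f)))
      = (((β * α⁻¹ * Ω⁻¹) ^ 2 * Ω ^ k * α ^ 3 : Rˣ) : R)
          • actR m (fun K => ![x, y] (K 0) (![x, y] (K 1) (![x, y] (K 2) f))) := h3
  exact ⟨e3, (congrArg (cT e s o ι (-4 + 3) w) e3).trans h4⟩

/-- The quadratic terms of the hyper-heavenly equation under a change of primed spin frame. -/
theorem hh_algebra (m : Matrix (Fin 2) (Fin 2) R) (κ₁ κ₂ : R) (p q : Fin 2 → R)
    (T : Fin 2 → Fin 2 → R) :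
    (∑ A, ∑ B, (κ₁ * ∑ i, ∑ j, m A i * m B j * T i j) * ∑ C, ∑ D, epsR R A C * epsR R B D *
        (κ₁ * ∑ i, ∑ j, m C i * m D j * T i j))
      = κ₁ ^ 2 * m.det ^ 2 * ∑ A, ∑ B, T A B * ∑ C, ∑ D, epsR R A C * epsR R B D * T C D ∧
    (∑ A, ∑ B, (∑ C, epsR R A C * ∑ i, m C i * p i) * (∑ C, epsR R B C * ∑ i, m C i * q i)
        * (κ₂ * ∑ i, ∑ j, m A i * m B j * T i j))
      = κ₂ * m.det ^ 2 * ∑ A, ∑ B, (∑ C, epsR R A C * p C) * (∑ C, epsR R B C * q C) * T A B := by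
  simp only [Fin.sum_univ_two, epsR_00, epsR_01, epsR_10, epsR_11, Matrix.det_fin_two]
  constructor <;> ring

/-- The fields determined by a solution of the field equations in the normal frame. -/
theorem isHHPotentialR (h : NormalChange e s o ι m α β Ω x y u v a b c) {F O : R}
    (hJ : IsJet x y u v a b c F O) (hO : IsUnit O) :
    IsHHPotentialR e s o ι (O * (Ω⁻¹ : Rˣ)) (((β * α⁻¹ * Ω⁻¹) ^ 2 * Ω : Rˣ) * F)
      (((β * α⁻¹ * Ω⁻¹) ^ 2 * Ω ^ 3 : Rˣ) * (half R * hhExpr x y u v a b c F O)) := by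
  have hE : ∀ B, nfE x y u v a b c (0, B) = ![x, y] B := fun B => by simp [nfE]
  obtain ⟨hΦ1, hΦ2, -, hΦ4⟩ := h.cT_iterate 1 (-1) rfl F _ (by rw [pow_one])
  obtain ⟨-, -, hK, -⟩ := h.cT_iterate 3 (-3) rfl (half R * hhExpr x y u v a b c F O) _ rfl
  have hO1 : cT e s o ι 0 1 (fun _ : Fin 0 → Fin 2 => O * ((Ω⁻¹ : Rˣ) : R))
      = ((Ω⁻¹ * α : Rˣ) : R) • actR m (fun K => ![x, y] (K 0) O) := by
    rw [← h.connTR_scalar rfl (κ := Ω⁻¹) (p := 0) (w := 1) (fun d => by rw [ld_inv]; simp) O]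
    simp only [cT, leeForm, pForm, mul_comm O]
  have hdet := h.det_b
  refine ⟨fun I => ?_, ?_, fun I => ?_⟩
  · rw [SpinChange.weylR_eq h h.weyl_form, hΦ4]
    simp only [Pi.smul_apply, smul_eq_mul]
    have : symR (sdPartR (curvR (nfE x y u v a b c)
        (strR (nfS (nfE x y u v a b c) (nfQ a b c)))
        (wcR (nfS (nfE x y u v a b c) (nfQ a b c)) (nfW a b c (-ld x Ω) (-ld y Ω) (-ld u Ω)
          (-ld v Ω))))) = fun K => O * ![x, y] (K 0) (![x, y] (K 1) (![x, y] (K 2)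
            (![x, y] (K 3) F))) := funext fun I => weyl_nfS hJ I
    rw [this]
    have h2 : ∀ f : (Fin 4 → Fin 2) → R, actR m (fun K => O * f K) I = O * actR m f I := fun f => by
      simp only [actR, Finset.mul_sum]
      exact Finset.sum_congr rfl fun K _ => by ring
    rw [h2]
    have h3 : ((Ω⁻¹ : Rˣ) : R) ^ 2 * (α * β) ^ 2
        = (Ω⁻¹ : Rˣ) * ((β * α⁻¹ * Ω⁻¹) ^ 2 * Ω ^ 1 * α ^ 4 : Rˣ) := by
      simp only [← Units.val_mul, ← Units.val_pow_eq_pow_val]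
      exact congrArg _ (Additive.ofMul.injective
        (by simp only [ofMul_mul, ofMul_pow, ofMul_inv]; abel))
    linear_combination (O * actR m (fun K => ![x, y] (K 0) (![x, y] (K 1) (![x, y] (K 2)
            (![x, y] (K 3) F)))) I) * h3
  · rw [hΦ2, hΦ1, hO1, SpinChange.scalR_eq h (w := leeForm e s o ι) (w₀ := 0) (h.lee_form rfl), scalR_nfS _ _ _ _ _ _ _ hJ.comm_yx]
    have hbox := SpinChange.boxR_eq h (lee := leeForm e s o ι) (P := pForm e s o ι)
      (P₀ := fun d => ![0, -nfP (nfE x y u v a b c) (nfQ a b c) d.2] d.1) (p := -4) (w := -1)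
      (κ := (((β * α⁻¹ * Ω⁻¹) ^ 2 * Ω : Rˣ) : R)) (fun p => h.leeR_eq_ld p) ?_ F
    · rw [hbox]
      have hnf := hh_nfS x y u v a b c hJ.comm_yx hJ.comm_ux hJ.comm_uy hJ.comm_vx hJ.comm_vy F O
      have ha1 : ∀ (f : Fin 2 → R) (A : Fin 2), actR m (fun K : Fin 1 → Fin 2 => f (K 0)) ![A]
          = ∑ i, m A i * f i := fun f A => by simp [actR_succ, actR_zero]
      have ha2 : ∀ (f : Fin 2 → Fin 2 → R) (A B : Fin 2),
          actR m (fun K : Fin 2 → Fin 2 => f (K 0) (K 1)) ![A, B]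
          = ∑ i, ∑ j, m A i * m B j * f i j := fun f A B => by
        simp [actR_succ, actR_zero]; ring
      simp only [Pi.smul_apply, smul_eq_mul, ha1 (fun i => ![x, y] i O), ha1 (fun i => ![x, y] i F),
        ha2 (fun i j => ![x, y] i (![x, y] j F))]
      have hl : ∀ (k₁ k₂ k₃ : R) (p q : Fin 2 → R) (T : Fin 2 → Fin 2 → R),
          ∑ A : Fin 2, ∑ B : Fin 2, (∑ C, epsR R A C * (k₁ * p C)) * (∑ C, epsR R B C * (k₂ * q C))
            * (k₃ * T A B) = ∑ A : Fin 2, ∑ B : Fin 2, (∑ C, epsR R A C * p C)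
              * (∑ C, epsR R B C * q C) * (k₁ * k₂ * k₃ * T A B) := fun k₁ k₂ k₃ p q T => by
        simp only [Fin.sum_univ_two]; ring
      rw [hl, (hh_algebra m _ 0 (fun i => ![x, y] i O) (fun i => ![x, y] i F)
        (fun i j => ![x, y] i (![x, y] j F))).1, (hh_algebra m 0 _ (fun i => ![x, y] i O)
        (fun i => ![x, y] i F) (fun i j => ![x, y] i (![x, y] j F))).2]
      have hD : m.det = ((Ω ^ 2 * α⁻¹ * β⁻¹ : Rˣ) : R) := by
        refine (α * β).isUnit.mul_left_cancel ?_
        rw [Units.val_mul, hdet, ← Units.val_mul, ← Units.val_mul, ← Units.val_pow_eq_pow_val]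
        exact congrArg _ (Additive.ofMul.injective
          (by simp only [ofMul_mul, ofMul_pow, ofMul_inv]; abel))
      have h3 : ((Ω⁻¹ : Rˣ) : R) * (((β * α⁻¹ * Ω⁻¹) ^ 2 * Ω ^ 1 * α ^ 2 : Rˣ) ^ 2 * m.det ^ 2)
          = ((β * α⁻¹ * Ω⁻¹) ^ 2 * Ω : Rˣ) * (Ω : R) ^ 2 := by
        rw [hD]
        simp only [← Units.val_mul, ← Units.val_pow_eq_pow_val]
        exact congrArg _ (Additive.ofMul.injective
          (by simp only [ofMul_mul, ofMul_pow, ofMul_inv]; abel))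
      have h4 : ((Ω⁻¹ * α : Rˣ) : R) * ((β * α⁻¹ * Ω⁻¹) ^ 2 * Ω ^ 1 * α ^ 1 : Rˣ)
          * ((β * α⁻¹ * Ω⁻¹) ^ 2 * Ω ^ 1 * α ^ 2 : Rˣ) * m.det ^ 2
          = ((β * α⁻¹ * Ω⁻¹) ^ 2 * Ω : Rˣ) * (Ω : R) ^ 2 := by
        rw [hD]
        simp only [← Units.val_mul, ← Units.val_pow_eq_pow_val]
        exact congrArg _ (Additive.ofMul.injective
          (by simp only [ofMul_mul, ofMul_pow, ofMul_inv]; abel))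
      have h5 : (((β * α⁻¹ * Ω⁻¹) ^ 2 * Ω ^ 3 : Rˣ) : R)
          = ((β * α⁻¹ * Ω⁻¹) ^ 2 * Ω : Rˣ) * (Ω : R) ^ 2 := by push_cast; ring
      rw [h4, h5, mul_left_comm (2 : R), ← mul_assoc 2 (half R), two_mul_half, one_mul, ← hnf]
      linear_combination (O * ∑ A, ∑ B, ![x, y] A (![x, y] B F) * ∑ C, ∑ D, epsR R A C * epsR R B D
        * ![x, y] C (![x, y] D F)) * h3
    · intro p
      have h1 := h.pR_eq rfl p
      have h2 := ld_weight (α := α) (β := β) (Ω := Ω) (e p) 0 1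
      have h3 : leeForm e s o ι p = ld (e p) Ω := h.leeR_eq_ld p
      have h4 : ∑ d, tens (spinMat o ι α β) m p d * (((-4 : ℤ) : R)
          * ![0, -nfP (nfE x y u v a b c) (nfQ a b c) d.2] d.1)
          = ((-4 : ℤ) : R) * ∑ d, tens (spinMat o ι α β) m p d
          * ![0, -nfP (nfE x y u v a b c) (nfQ a b c) d.2] d.1 := by
        rw [Finset.mul_sum]
        exact Finset.sum_congr rfl fun d _ => by ring
      have h5 : pForm e s o ι p = _ := h1
      rw [h4, h3, h5, der_unit]
      simp only [pow_zero, mul_one, pow_one] at h2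
      generalize (β * α⁻¹ * Ω⁻¹) ^ 2 * Ω = κ at h2 ⊢
      push_cast at h2 ⊢
      simp only [add_zero, zero_mul] at h2
      linear_combination (κ : R) * h2
  · rw [hK]
    have hK0 : ∀ K : Fin 3 → Fin 2, ![x, y] (K 0) (![x, y] (K 1) (![x, y] (K 2)
        (half R * hhExpr x y u v a b c F O))) = 0 := by
      obtain ⟨k0, k1, k2, k3⟩ := hJ.der_hhExpr hO
      intro K
      generalize K 0 = i
      generalize K 1 = j
      generalize K 2 = k
      revert i j k
      simp only [Fin.forall_fin_two, Matrix.cons_val_zero, Matrix.cons_val_one, Derivation.leibniz,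
        der_half, smul_eq_mul, mul_zero, add_zero, hJ.comm_yx, k0, k1, k2, k3, and_self]
    simp only [hK0, actR, mul_zero, Finset.sum_const_zero, Pi.smul_apply, smul_zero]

end NormalChange

end Potential
end ConformalHH

namespace ConformalHH

/-! ### The Frobenius theorem -/

section Frobenius

variable {R : Type*} [CommRing R] [Algebra ℂ R]

theorem sum_der_apply {ι : Type*} (s : Finset ι) (Z : ι → Derivation ℂ R R) (f : R) :
    (∑ i ∈ s, Z i) f = ∑ i ∈ s, Z i f := by
  rw [← Finset.sum_apply]
  exact congrFun (map_sum Derivation.coeFnAddMonoidHom Z s) f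

/-- What is used of the ring of germs of analytic functions at the origin of a four-dimensional space:
the coordinate derivations `pd`, the coordinates `t`, the value `ev` at the origin, and the solution of
a single linear equation `Z u = h`, where `Z ℓ = 1` for a linear function `ℓ`, by the Lie series of `Z`. -/
structure LocalModel (R : Type*) [CommRing R] [Algebra ℂ R] where
  /-- The coordinate derivations. -/
  pd : Fin 4 → Derivation ℂ R R
  /-- The coordinates. -/
  t : Fin 4 → R
  pd_t : ∀ i j, pd i (t j) = if i = j then 1 else 0
  pd_comm : ∀ i j f, pd i (pd j f) = pd j (pd i f)
  /-- The value at the origin. -/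
  ev : R →ₐ[ℂ] ℂ
  /-- A germ which does not vanish at the origin is invertible. -/
  isUnit_of_ev : ∀ r, ev r ≠ 0 → IsUnit r
  /-- For `Z = ∑ a_i ∂_i` and a linear function `ℓ` of coefficients `c` with `Z ℓ = 1`, the Lie series `u`
  solves `Z u = h`; its differential at the origin is `h` times that of `ℓ`, and it is annihilated by the
  fields which commute with `Z` and annihilate `ℓ` and `h`. -/
  lie : ∀ (a : Fin 4 → R) (h : R) (c : Fin 4 → ℂ), ∑ i, a i * algebraMap ℂ R (c i) = 1 →
    ∃ u, ∑ i, a i * pd i u = h ∧ (∀ j, ev (pd j u) = ev h * c j) ∧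
      ∀ a' : Fin 4 → R, (∀ i, ∑ j, a j * pd j (a' i) = ∑ j, a' j * pd j (a i)) →
        ∑ i, a' i * algebraMap ℂ R (c i) = 0 → ∑ j, a' j * pd j h = 0 → ∑ j, a' j * pd j u = 0

namespace LocalModel

variable (L : LocalModel R)

/-- A derivation which is a combination of the coordinate derivations. -/
def Mem (Z : Derivation ℂ R R) : Prop := ∀ f, Z f = ∑ i, Z (L.t i) * L.pd i f

/-- The linear function with coefficients `c`. -/
def lin (c : Fin 4 → ℂ) : R := ∑ i, algebraMap ℂ R (c i) * L.t i

theorem der_lin (Z : Derivation ℂ R R) (c : Fin 4 → ℂ) :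
    Z (L.lin c) = ∑ i, Z (L.t i) * algebraMap ℂ R (c i) := by
  simp only [lin, map_sum, Derivation.leibniz, Derivation.map_algebraMap, smul_eq_mul]
  exact Finset.sum_congr rfl fun i _ => by ring

variable {L}

theorem Mem.smul {Z : Derivation ℂ R R} (h : L.Mem Z) (r : R) : L.Mem (r • Z) := fun f => by
  simp only [Derivation.smul_apply, smul_eq_mul, h f, Finset.mul_sum, mul_assoc]

theorem Mem.add {Z Z' : Derivation ℂ R R} (h : L.Mem Z) (h' : L.Mem Z') : L.Mem (Z + Z') := fun f => by
  simp only [Derivation.add_apply, h f, h' f, add_mul, Finset.sum_add_distrib]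

theorem Mem.sum {ι : Type*} {s : Finset ι} {Z : ι → Derivation ℂ R R} (h : ∀ i ∈ s, L.Mem (Z i)) :
    L.Mem (∑ i ∈ s, Z i) := by
  classical
  induction s using Finset.induction_on with
  | empty => intro f; simp
  | insert a s ha ih =>
    rw [Finset.sum_insert ha]
    exact (h a (Finset.mem_insert_self a s)).add (ih fun i hi => h i (Finset.mem_insert_of_mem hi))

theorem Mem.bracket {Z Z' : Derivation ℂ R R} (h : L.Mem Z) (h' : L.Mem Z') : L.Mem ⁅Z, Z'⁆ := by
  intro f
  simp only [Derivation.commutator_apply]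
  rw [h' f, h f]
  simp only [map_sum, Derivation.leibniz, smul_eq_mul, sub_mul, Finset.sum_add_distrib,
    Finset.sum_sub_distrib]
  have h1 : ∑ i, Z' (L.t i) * Z (L.pd i f) = ∑ i, Z (L.t i) * Z' (L.pd i f) := by
    simp only [h (L.pd _ f), h' (L.pd _ f), Finset.mul_sum]
    rw [Finset.sum_comm]
    exact Finset.sum_congr rfl fun i _ => Finset.sum_congr rfl fun j _ => by rw [L.pd_comm]; ring
  rw [h1]
  simp only [mul_comm (L.pd _ f)]
  ring

/-- Solution of `Z u = h` along a vector field transverse to the levels of a linear function. -/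
theorem Mem.exists_primitive {Z : Derivation ℂ R R} (hZ : L.Mem Z) {c : Fin 4 → ℂ}
    (hc : Z (L.lin c) = 1) (h : R) : ∃ u, Z u = h ∧
      (∀ Z', L.Mem Z' → L.ev (Z' u) = L.ev h * L.ev (Z' (L.lin c))) ∧
      ∀ Z', L.Mem Z' → (∀ f, Z (Z' f) = Z' (Z f)) → Z' (L.lin c) = 0 → Z' h = 0 → Z' u = 0 := by
  rw [L.der_lin] at hc
  obtain ⟨u, hu, hev, hu'⟩ := L.lie (fun i => Z (L.t i)) h c hc
  refine ⟨u, by rw [hZ u, hu], fun Z' hZ' => ?_, fun Z' hZ' hcomm h0 hh => ?_⟩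
  · rw [hZ' u, L.der_lin, map_sum, map_sum, Finset.mul_sum]
    refine Finset.sum_congr rfl fun i _ => ?_
    rw [map_mul, map_mul, hev, AlgHom.commutes]
    change _ = _ * (_ * c i)
    ring
  · rw [hZ' u]
    refine hu' _ (fun i => ?_) (by rw [← L.der_lin, h0]) (by rw [← hZ', hh])
    rw [← hZ, ← hZ', hcomm]

variable {k : ℕ}

/-- Integration of a closed system `Z_p u = h_p` for commuting vector fields. -/
theorem exists_primitive_of_commute {Z : Fin k → Derivation ℂ R R} (hZ : ∀ p, L.Mem (Z p))
    (hcomm : ∀ p q f, Z p (Z q f) = Z q (Z p f)) {c : Fin k → Fin 4 → ℂ}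
    (hc : ∀ p q, Z p (L.lin (c q)) = if p = q then 1 else 0) {h : Fin k → R}
    (hh : ∀ p q, Z p (h q) = Z q (h p)) :
    ∃ u, (∀ p, Z p u = h p) ∧ ((∀ p, L.ev (h p) = 0) → ∀ Z', L.Mem Z' → L.ev (Z' u) = 0) := by
  have key : ∀ j ≤ k, ∃ u, (∀ p : Fin k, (p : ℕ) < j → Z p u = h p) ∧
      ((∀ p, L.ev (h p) = 0) → ∀ Z', L.Mem Z' → L.ev (Z' u) = 0) := by
    intro j
    induction j with
    | zero => exact fun _ => ⟨0, fun p hp => absurd hp (Nat.not_lt_zero _), fun _ _ _ => by simp⟩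
    | succ j ih =>
      intro hj
      obtain ⟨u, hu, hev⟩ := ih (by omega)
      set J : Fin k := ⟨j, by omega⟩ with hJ
      obtain ⟨u', hu', hev', hcom'⟩ := (hZ J).exists_primitive (c := c J) (by simp [hc])
        (h J - Z J u)
      refine ⟨u + u', fun p hp => ?_, fun h0 Z' hZ' => ?_⟩
      · rw [map_add]
        rcases Nat.lt_succ_iff_lt_or_eq.1 hp with hp | hp
        · have hne : p ≠ J := fun e => by rw [e] at hp; exact lt_irrefl _ hp
          rw [hu p hp, hcom' (Z p) (hZ p) (fun f => hcomm J p f) (by rw [hc, if_neg hne]), add_zero]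
          rw [map_sub, hcomm p J, hu p hp, hh, sub_self]
        · have : p = J := Fin.ext hp
          rw [this, hu']; ring
      · rw [map_add, map_add, hev h0 Z' hZ', hev' Z' hZ', map_sub, h0, hev h0 _ (hZ J)]
        ring
  obtain ⟨u, hu, hev⟩ := key k le_rfl
  exact ⟨u, fun p => hu p p.2, hev⟩

/-- The Frobenius theorem: integration of a compatible system `Z_p u = h_p` for an involutive family of
independent vector fields. -/
theorem exists_primitive_of_involutive {Z : Fin k → Derivation ℂ R R} (hZ : ∀ p, L.Mem (Z p))
    {C : Fin k → Fin k → Fin k → R}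
    (hcomm : ∀ p q f, Z p (Z q f) - Z q (Z p f) = ∑ r, C p q r * Z r f) {c : Fin k → Fin 4 → ℂ}
    (hc : (Matrix.of fun p q => L.ev (Z p (L.lin (c q)))).det ≠ 0) {h : Fin k → R}
    (hh : ∀ p q, Z p (h q) - Z q (h p) = ∑ r, C p q r * h r) :
    ∃ u, (∀ p, Z p u = h p) ∧ ((∀ p, L.ev (h p) = 0) → ∀ Z', L.Mem Z' → L.ev (Z' u) = 0) := by
  set M : Matrix (Fin k) (Fin k) R := Matrix.of fun p q => Z p (L.lin (c q)) with hM
  have hdet : IsUnit M.det := by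
    refine L.isUnit_of_ev _ ?_
    rw [show L.ev M.det = (Matrix.of fun p q => L.ev (Z p (L.lin (c q)))).det from
      L.ev.toRingHom.map_det M]
    exact hc
  set N := M⁻¹
  have hNM : N * M = 1 := Matrix.nonsing_inv_mul M hdet
  have hMN : M * N = 1 := Matrix.mul_nonsing_inv M hdet
  -- the fields with `Zt p (ℓ_q) = δ_pq`
  set Zt : Fin k → Derivation ℂ R R := fun p => ∑ q, N p q • Z q with hZt
  have hZt' : ∀ p f, Zt p f = ∑ q, N p q * Z q f := fun p f => by
    simp [hZt, sum_der_apply]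
  have hdual : ∀ p q, Zt p (L.lin (c q)) = if p = q then 1 else 0 := fun p q => by
    rw [hZt', ← Matrix.one_apply, ← hNM, Matrix.mul_apply]
    rfl
  set K : Fin k → Fin k → Fin k → R := fun p q r =>
    Zt p (N q r) - Zt q (N p r) + ∑ a, ∑ b, N p a * N q b * C a b r with hK
  have hKey : ∀ G : Fin k → R, (∀ p q, Z p (G q) - Z q (G p) = ∑ r, C p q r * G r) → ∀ p q,
      Zt p (∑ b, N q b * G b) - Zt q (∑ b, N p b * G b) = ∑ r, K p q r * G r := by
    intro G hG p q
    have h1 : ∑ b, N q b * Zt p (G b) - ∑ a, N p a * Zt q (G a)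
        = ∑ a, ∑ b, N p a * N q b * (Z a (G b) - Z b (G a)) := by
      simp only [hZt', Finset.mul_sum]
      rw [Finset.sum_comm, ← Finset.sum_sub_distrib]
      refine Finset.sum_congr rfl fun a _ => ?_
      rw [← Finset.sum_sub_distrib]
      exact Finset.sum_congr rfl fun b _ => by ring
    have h2 : ∑ r, (∑ a, ∑ b, N p a * N q b * C a b r) * G r
        = ∑ a, ∑ b, N p a * N q b * (Z a (G b) - Z b (G a)) := by
      simp only [hG, Finset.mul_sum, Finset.sum_mul]
      rw [Finset.sum_comm]
      refine Finset.sum_congr rfl fun a _ => ?_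
      rw [Finset.sum_comm]
      exact Finset.sum_congr rfl fun b _ => Finset.sum_congr rfl fun r _ => by ring
    simp only [map_sum, Derivation.leibniz, smul_eq_mul, Finset.sum_add_distrib, hK, add_mul, sub_mul,
      Finset.sum_sub_distrib, h2, ← h1, mul_comm (G _)]
    ring
  have hK0 : ∀ p q r, K p q r = 0 := by
    intro p q
    have h1 : ∀ s, ∑ r, K p q r * M r s = 0 := fun s => by
      have := hKey (fun b => Z b (L.lin (c s))) (fun p q => hcomm p q _) p q
      simp only [← hZt', hdual] at this
      rw [show ∑ r, K p q r * M r s = ∑ r, K p q r * Z r (L.lin (c s)) from rfl, ← this]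
      split_ifs <;> simp
    have h2 : Matrix.vecMul (K p q) M = 0 := funext fun s => h1 s
    have h3 : K p q = 0 := by
      rw [← Matrix.vecMul_one (K p q), ← hMN, ← Matrix.vecMul_vecMul, h2, Matrix.zero_vecMul]
    exact fun r => congrFun h3 r
  obtain ⟨u, hu, hev⟩ := exists_primitive_of_commute (L := L) (Z := Zt)
    (fun p => Mem.sum fun q _ => (hZ q).smul _)
    (fun p q f => by
      have := hKey (fun b => Z b f) (fun p q => hcomm p q f) p q
      simp only [hK0, zero_mul, Finset.sum_const_zero, ← hZt'] at this
      exact sub_eq_zero.1 this) hdual (h := fun p => ∑ q, N p q * h q)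
    (fun p q => by
      have := hKey h hh p q
      simp only [hK0, zero_mul, Finset.sum_const_zero] at this
      exact sub_eq_zero.1 this)
  refine ⟨u, fun p => ?_, fun h0 => hev fun p => ?_⟩
  · have h1 : ∀ g : Fin k → R, ∑ a, M p a * ∑ b, N a b * g b = g p := fun g => by
      have : (M.mulVec (N.mulVec g)) p = g p := by
        rw [Matrix.mulVec_mulVec, hMN, Matrix.one_mulVec]
      exact this
    rw [← h1 (fun b => Z b u), ← h1 h]
    simp only [← hZt', hu]
  · rw [map_sum]
    exact Finset.sum_eq_zero fun q _ => by rw [map_mul, h0, mul_zero]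

end LocalModel

end Frobenius
end ConformalHH

namespace ConformalHH

/-! ### Frames adapted to a pair of spinors -/

section AdaptedFrame

variable {R : Type*} [CommRing R] [Algebra ℂ R]

/-- The derivations `o^A e_{AA'}`. -/
def zD (e : Idx → Derivation ℂ R R) (o : Fin 2 → R) (A' : Fin 2) : Derivation ℂ R R :=
  ∑ A, o A • e (A, A')

/-- The frame made of the combinations of the `o^A e_{AA'}` with coefficients `m`, and of the
`ι^A e_{AA'}` with coefficients `β⁻¹ m`. -/
def adE (e : Idx → Derivation ℂ R R) (o ι : Fin 2 → R) (m : Matrix (Fin 2) (Fin 2) R) (β : Rˣ)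
    (a : Idx) : Derivation ℂ R R :=
  ![∑ B', m a.2 B' • zD e o B', ((β⁻¹ : Rˣ) : R) • ∑ B', m a.2 B' • zD e ι B'] a.1

variable {e : Idx → Derivation ℂ R R} {s : Idx → Idx → Idx → R} {o ι : Fin 2 → R}
  {m b : Matrix (Fin 2) (Fin 2) R} {β Ω : Rˣ}

theorem adE_apply (a : Idx) (f : R) : adE e o ι m β a f
    = ![m a.2 0 * (o 0 * e (0, 0) f + o 1 * e (1, 0) f)
        + m a.2 1 * (o 0 * e (0, 1) f + o 1 * e (1, 1) f),
      ((β⁻¹ : Rˣ) : R) * (m a.2 0 * (ι 0 * e (0, 0) f + ι 1 * e (1, 0) f)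
        + m a.2 1 * (ι 0 * e (0, 1) f + ι 1 * e (1, 1) f))] a.1 := by
  obtain ⟨A, A'⟩ := a
  revert A
  simp only [Fin.forall_fin_two]
  constructor <;> simp [adE, zD] <;> ring

theorem der_eq_adE (hn : o 0 * ι 1 - o 1 * ι 0 = 1) (hbm : b * m = 1) (a : Idx) (f : R) :
    e a f = ∑ c, tens (spinMat o ι (1 : Rˣ) β) b a c * adE e o ι m β c f := by
  have h := fun i j => congrFun (congrFun hbm i) j
  simp only [Matrix.mul_apply, Fin.sum_univ_two] at h
  have hβ := β.mul_inv
  have h0 := h a.2 0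
  have h1 := h a.2 1
  obtain ⟨A, A'⟩ := a
  simp only [sum_idx, tens, adE_apply, spinMat]
  generalize ((β⁻¹ : Rˣ) : R) = w at *
  revert A A'
  simp only [Fin.forall_fin_two]
  constructorm* _ ∧ _ <;> intro h0 h1 <;> simp at h0 h1 ⊢ <;> grind

/-- The structure functions of a transformed frame. -/
theorem SpinChange.of_comm (hs : ∀ a b c, s a b c = -s b a c)
    (hcomm : ∀ a b f, e a (e b f) - e b (e a f) = ∑ c, strR s a b c * e c f)
    (hn : o 0 * ι 1 - o 1 * ι 0 = 1) (hbm : b * m = 1) (hdet : (β : R) * b.det = Ω ^ 2) :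
    ∃ s₀, SpinChange e (adE e o ι m β) s s₀ o ι b 1 β Ω ∧
      ∀ d g f, adE e o ι m β d (adE e o ι m β g f) - adE e o ι m β g (adE e o ι m β d f)
        = ∑ c, strR s₀ d g c * adE e o ι m β c f := by
  have hder := fun a f => der_eq_adE (e := e) (β := β) hn hbm a f
  set E := adE e o ι m β with hE
  set A := tens (spinMat o ι (1 : Rˣ) β) b with hA
  obtain ⟨B, hAB, hBA⟩ : ∃ B, A * B = 1 ∧ B * A = 1 := by
    have h1 : IsUnit (spinMat o ι ((1 : Rˣ) : R) β).det := by
      have : (spinMat o ι ((1 : Rˣ) : R) β).det = β := by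
        simp [spinMat, Matrix.det_fin_two]; linear_combination (β : R) * hn
      rw [this]; exact β.isUnit
    refine ⟨tens (spinMat o ι (1 : Rˣ) β)⁻¹ m, ?_, ?_⟩
    · rw [hA, tens_mul, hbm, Matrix.mul_nonsing_inv _ h1, tens_one_one]
    · rw [hA, tens_mul, mul_eq_one_comm.1 hbm, Matrix.nonsing_inv_mul _ h1, tens_one_one]
  have hE' : ∀ d f, E d f = ∑ a, B d a * e a f := by
    intro d f
    simp only [hder, Finset.mul_sum]
    rw [Finset.sum_comm]
    simp only [← mul_assoc, ← Finset.sum_mul]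
    have : ∀ c, ∑ a, B d a * A a c = (1 : Matrix Idx Idx R) d c := fun c => by
      rw [← hBA, Matrix.mul_apply]
    simp [this, Matrix.one_apply]
  set T : Idx → Idx → Idx → R := fun a c f =>
    (∑ k, strR s a c k * A k f) - e a (A c f) + e c (A a f) with hT
  set S : Idx → Idx → Idx → R := fun d g f => ∑ a, ∑ c, B d a * B g c * T a c f with hS
  have hTanti : ∀ a c f, T a c f = -T c a f := by
    intro a c f
    have : ∀ k, strR s a c k = -strR s c a k := fun k => by
      simp only [strR, hs a c, mul_neg, Finset.sum_neg_distrib]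
    simp only [hT, this, neg_mul, Finset.sum_neg_distrib]
    ring
  have hSanti : ∀ d g f, S d g f = -S g d f := by
    intro d g f
    simp only [hS]
    rw [Finset.sum_comm, ← Finset.sum_neg_distrib]
    refine Finset.sum_congr rfl fun a _ => ?_
    rw [← Finset.sum_neg_distrib]
    exact Finset.sum_congr rfl fun c _ => by rw [hTanti]; ring
  have hstr : strR (fun d g f => ∑ k, S d g k * etaR R k f) = S := by
    funext p q r; exact strR_lower S p q r
  refine ⟨fun d g f => ∑ k, S d g k * etaR R k f, ⟨hder, hs, fun d g f => ?_, fun a c f => ?_, hcomm,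
    hn, by rw [← hdet]; simp⟩, fun d g f => ?_⟩
  · simp only [hSanti d g, neg_mul, Finset.sum_neg_distrib]
  · rw [hstr, ← hA]
    have h1 : ∑ d, ∑ g, A a d * A c g * S d g f = T a c f := by
      have h2 : ∑ d, ∑ g, A a d * A c g * S d g f
          = (A * (B * (Matrix.of fun a c => T a c f) * B.transpose) * A.transpose) a c := by
        simp only [Matrix.mul_apply, Matrix.transpose_apply, hS, Matrix.of_apply, Finset.mul_sum,
          Finset.sum_mul]
        rw [Finset.sum_comm]
        refine Finset.sum_congr rfl fun d _ => Finset.sum_congr rfl fun g _ => ?_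
        rw [Finset.sum_comm]
        exact Finset.sum_congr rfl fun i _ => Finset.sum_congr rfl fun j _ => by ring
      have h3 : B.transpose * A.transpose = 1 := by
        rw [← Matrix.transpose_mul, hAB, Matrix.transpose_one]
      rw [h2, ← Matrix.mul_assoc, ← Matrix.mul_assoc, hAB, Matrix.one_mul, Matrix.mul_assoc, h3,
        Matrix.mul_one]
      rfl
    rw [h1]
    simp only [hT]; ring
  · rw [hstr]
    have hTE : ∀ a c, ∑ k, T a c k * E k f
        = ∑ k, A c k * e a (E k f) - ∑ k, A a k * e c (E k f) := by
      intro a c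
      have h1 := hcomm a c f
      have h2 : ∑ k, strR s a c k * e k f = ∑ k, (∑ l, strR s a c l * A l k) * E k f := by
        simp only [hder _ f, Finset.mul_sum, Finset.sum_mul, mul_assoc]
        rw [Finset.sum_comm]
      rw [h2, hder c f, hder a f] at h1
      simp only [map_sum, Derivation.leibniz, smul_eq_mul, Finset.sum_add_distrib] at h1
      simp only [hT, sub_mul, add_mul, Finset.sum_add_distrib, Finset.sum_sub_distrib]
      rw [← h1]
      simp only [mul_comm (E _ f)]
      ring
    have h1 : ∑ c, S d g c * E c f = ∑ a, ∑ c, B d a * B g c * ∑ k, T a c k * E k f := by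
      simp only [hS, Finset.sum_mul, Finset.mul_sum]
      rw [Finset.sum_comm]
      refine Finset.sum_congr rfl fun a _ => ?_
      rw [Finset.sum_comm]
      exact Finset.sum_congr rfl fun c _ => Finset.sum_congr rfl fun k _ => by ring
    have h2 : ∀ g k, ∑ c, B g c * A c k = (1 : Matrix Idx Idx R) g k := fun g k => by
      rw [← hBA, Matrix.mul_apply]
    have h3 : ∀ d g, ∑ a, ∑ c, B d a * B g c * ∑ k, A c k * e a (E k f) = E d (E g f) := by
      intro d g
      rw [hE' d]
      refine Finset.sum_congr rfl fun a _ => ?_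
      have : ∑ c, B g c * ∑ k, A c k * e a (E k f) = ∑ k, (∑ c, B g c * A c k) * e a (E k f) := by
        simp only [Finset.mul_sum, Finset.sum_mul]
        rw [Finset.sum_comm]
        exact Finset.sum_congr rfl fun _ _ => Finset.sum_congr rfl fun _ _ => by ring
      simp only [mul_assoc, ← Finset.mul_sum, this, h2]
      simp [Matrix.one_apply]
    rw [h1, ← h3 d g, ← h3 g d]
    conv_rhs => simp only [hTE, mul_sub, Finset.sum_sub_distrib]
    congr 1
    rw [Finset.sum_comm]
    exact Finset.sum_congr rfl fun a _ => Finset.sum_congr rfl fun c _ => by ring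

end AdaptedFrame
end ConformalHH

namespace ConformalHH

/-! ### Normal coordinates -/

section NormalCoordinates

variable {R : Type*} [CommRing R] [Algebra ℂ R]

/-- Functions `p`, `q` which are coordinates adapted to the frame `E`: the `q`s are constant along
`E_{0A}`, the `p`s are coordinates along `E_{0A}`, and `E_{1A} = ∂/∂q^A + Q_A^B ∂/∂p^B` with a
trace-free matrix `Q`. -/
structure NormalCoords (E : Idx → Derivation ℂ R R) (p q : Fin 2 → R) : Prop where
  p0 : ∀ A B, E (0, A) (p B) = if A = B then 1 else 0
  q0 : ∀ A B, E (0, A) (q B) = 0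
  q1 : ∀ A B, E (1, A) (q B) = if A = B then 1 else 0
  trace : E (1, 0) (p 0) + E (1, 1) (p 1) = 0

/-- The coordinate field `∂/∂q^0`. -/
def nfU (E : Idx → Derivation ℂ R R) (p : Fin 2 → R) : Derivation ℂ R R :=
  E (1, 0) - E (1, 0) (p 0) • E (0, 0) - E (1, 0) (p 1) • E (0, 1)

/-- The coordinate field `∂/∂q^1`. -/
def nfV (E : Idx → Derivation ℂ R R) (p : Fin 2 → R) : Derivation ℂ R R :=
  E (1, 1) - E (1, 1) (p 0) • E (0, 0) + E (1, 0) (p 0) • E (0, 1)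

/-- `d` is a combination of the frame vectors. -/
def InSpan (E : Idx → Derivation ℂ R R) (d : Derivation ℂ R R) : Prop :=
  ∃ k : Idx → R, ∀ f, d f = ∑ c, k c * E c f

variable {E : Idx → Derivation ℂ R R} {p q : Fin 2 → R}

theorem InSpan.frame (a : Idx) : InSpan E (E a) :=
  ⟨fun c => if c = a then 1 else 0, fun f => by simp⟩

theorem InSpan.add {d d' : Derivation ℂ R R} (h : InSpan E d) (h' : InSpan E d') :
    InSpan E (d + d') := by
  obtain ⟨k, hk⟩ := h
  obtain ⟨k', hk'⟩ := h'
  exact ⟨k + k', fun f => by simp [hk, hk', add_mul, Finset.sum_add_distrib]⟩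

theorem InSpan.smul {d : Derivation ℂ R R} (h : InSpan E d) (r : R) : InSpan E (r • d) := by
  obtain ⟨k, hk⟩ := h
  exact ⟨r • k, fun f => by simp [hk, Finset.mul_sum, mul_assoc]⟩

theorem InSpan.sub {d d' : Derivation ℂ R R} (h : InSpan E d) (h' : InSpan E d') :
    InSpan E (d - d') := by
  obtain ⟨k, hk⟩ := h
  obtain ⟨k', hk'⟩ := h'
  exact ⟨k - k', fun f => by simp [hk, hk', sub_mul, Finset.sum_sub_distrib]⟩

theorem InSpan.bracket {C : Idx → Idx → Idx → R}
    (hC : ∀ d g f, E d (E g f) - E g (E d f) = ∑ c, C d g c * E c f) {d d' : Derivation ℂ R R}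
    (h : InSpan E d) (h' : InSpan E d') : InSpan E ⁅d, d'⁆ := by
  obtain ⟨k, hk⟩ := h
  obtain ⟨k', hk'⟩ := h'
  refine ⟨fun c => d (k' c) - d' (k c) + ∑ a, ∑ g, k a * k' g * C a g c, fun f => ?_⟩
  have h1 : ∑ c, (∑ a, ∑ g, k a * k' g * C a g c) * E c f
      = ∑ a, ∑ g, k a * k' g * (E a (E g f) - E g (E a f)) := by
    simp only [hC, Finset.mul_sum, Finset.sum_mul]
    rw [Finset.sum_comm]
    refine Finset.sum_congr rfl fun a _ => ?_
    rw [Finset.sum_comm]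
    exact Finset.sum_congr rfl fun b _ => Finset.sum_congr rfl fun r _ => by ring
  have h2 : ∑ g, k' g * d (E g f) = ∑ a, ∑ g, k a * k' g * E a (E g f) := by
    simp only [hk, Finset.mul_sum]
    rw [Finset.sum_comm]
    exact Finset.sum_congr rfl fun b _ => Finset.sum_congr rfl fun r _ => by ring
  have h3 : ∑ a, k a * d' (E a f) = ∑ a, ∑ g, k a * k' g * E g (E a f) := by
    simp only [hk', Finset.mul_sum]
    exact Finset.sum_congr rfl fun b _ => Finset.sum_congr rfl fun r _ => by ring
  have h4 : d (d' f) = ∑ g, k' g * d (E g f) + ∑ g, d (k' g) * E g f := by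
    rw [hk' f, map_sum, ← Finset.sum_add_distrib]
    exact Finset.sum_congr rfl fun b _ => by rw [Derivation.leibniz, smul_eq_mul, smul_eq_mul]; ring
  have h5 : d' (d f) = ∑ g, k g * d' (E g f) + ∑ g, d' (k g) * E g f := by
    rw [hk f, map_sum, ← Finset.sum_add_distrib]
    exact Finset.sum_congr rfl fun b _ => by rw [Derivation.leibniz, smul_eq_mul, smul_eq_mul]; ring
  rw [Derivation.commutator_apply, h4, h5, h2, h3]
  simp only [add_mul, sub_mul, Finset.sum_add_distrib, Finset.sum_sub_distrib, h1, mul_sub]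
  ring

theorem nfE_nfU_nfV : nfE (E (0, 0)) (E (0, 1)) (nfU E p) (nfV E p) (E (1, 0) (p 0)) (E (1, 0) (p 1))
    (E (1, 1) (p 0)) = E := by
  funext a
  revert a
  rw [forall_idx]
  refine ⟨⟨by simp [nfE], by simp [nfE]⟩, ?_, ?_⟩ <;> ext f <;> simp [nfE, nfU, nfV] <;> ring

namespace NormalCoords

variable (h : NormalCoords E p q)
include h

/-- A vector field is determined by its values on the coordinates. -/
theorem coeff_eq_zero {k : Idx → R} (h0 : ∀ B, ∑ c, k c * E c (p B) = 0)
    (h1 : ∀ B, ∑ c, k c * E c (q B) = 0) (c : Idx) : k c = 0 := by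
  simp only [sum_idx, h.p0, h.q0, h.q1] at h0 h1
  have e0 := h0 0
  have e1 := h0 1
  have e2 := h1 0
  have e3 := h1 1
  simp at e0 e1 e2 e3
  rw [e2, e3] at e0 e1
  revert c
  rw [forall_idx]
  refine ⟨⟨by simpa using e0, by simpa using e1⟩, e2, e3⟩

theorem eq_zero {d : Derivation ℂ R R} (hd : InSpan E d) (h0 : ∀ B, d (p B) = 0)
    (h1 : ∀ B, d (q B) = 0) (f : R) : d f = 0 := by
  obtain ⟨k, hk⟩ := hd
  have := h.coeff_eq_zero (k := k) (fun B => by rw [← hk, h0]) (fun B => by rw [← hk, h1])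
  simp [hk, this]

/-- The coordinate fields `∂/∂p^A`, `∂/∂q^A` commute, as their brackets annihilate the coordinates. -/
theorem commute {C : Idx → Idx → Idx → R}
    (hC : ∀ d g f, E d (E g f) - E g (E d f) = ∑ c, C d g c * E c f) :
    (∀ f, E (0, 1) (E (0, 0) f) = E (0, 0) (E (0, 1) f)) ∧
    (∀ f, nfU E p (E (0, 0) f) = E (0, 0) (nfU E p f)) ∧
    (∀ f, nfU E p (E (0, 1) f) = E (0, 1) (nfU E p f)) ∧
    (∀ f, nfV E p (E (0, 0) f) = E (0, 0) (nfV E p f)) ∧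
    (∀ f, nfV E p (E (0, 1) f) = E (0, 1) (nfV E p f)) ∧
    (∀ f, nfV E p (nfU E p f) = nfU E p (nfV E p f)) := by
  have ht : E (1, 1) (p 1) = -E (1, 0) (p 0) := by linear_combination h.trace
  have hU : InSpan E (nfU E p) :=
    ((InSpan.frame _).sub ((InSpan.frame _).smul _)).sub ((InSpan.frame _).smul _)
  have hV : InSpan E (nfV E p) :=
    ((InSpan.frame _).sub ((InSpan.frame _).smul _)).add ((InSpan.frame _).smul _)
  have hUp : ∀ B, nfU E p (p B) = 0 := by
    simp only [Fin.forall_fin_two]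
    simp [nfU, h.p0]
  have hVp : ∀ B, nfV E p (p B) = 0 := by
    simp only [Fin.forall_fin_two]
    simp [nfV, h.p0, ht]
  have hUq : ∀ B, nfU E p (q B) = if 0 = B then 1 else 0 := fun B => by simp [nfU, h.q0, h.q1]
  have hVq : ∀ B, nfV E p (q B) = if 1 = B then 1 else 0 := fun B => by simp [nfV, h.q0, h.q1]
  have hz : ∀ (d : Derivation ℂ R R) (P : Prop) [Decidable P], d (if P then 1 else 0) = 0 := by
    intro d P _
    split_ifs <;> simp
  have key : ∀ {d d' : Derivation ℂ R R}, InSpan E d → InSpan E d' →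
      (∀ B, d (d' (p B)) = 0 ∧ d' (d (p B)) = 0) → (∀ B, d (d' (q B)) = 0 ∧ d' (d (q B)) = 0) →
      ∀ f, d (d' f) = d' (d f) := by
    intro d d' hd hd' h0 h1 f
    have := h.eq_zero (hd.bracket hC hd') (fun B => by simp [Derivation.commutator_apply, h0])
      (fun B => by simp [Derivation.commutator_apply, h1]) f
    rw [Derivation.commutator_apply] at this
    exact sub_eq_zero.1 this
  have hX := fun a : Idx => InSpan.frame (E := E) a
  refine ⟨key (hX _) (hX _) ?_ ?_, key hU (hX _) ?_ ?_, key hU (hX _) ?_ ?_, key hV (hX _) ?_ ?_,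
    key hV (hX _) ?_ ?_, key hV hU ?_ ?_⟩ <;> intro B <;>
    simp only [h.p0, h.q0, hUp, hVp, hUq, hVq, hz, map_zero, and_self]

/-- The structure functions of a frame with normal coordinates are those of a normal frame. -/
theorem strR_eq {s₀ : Idx → Idx → Idx → R}
    (hC : ∀ d g f, E d (E g f) - E g (E d f) = ∑ c, strR s₀ d g c * E c f) :
    s₀ = nfS E (nfQ (E (1, 0) (p 0)) (E (1, 0) (p 1)) (E (1, 1) (p 0))) := by
  have ht : E (1, 1) (p 1) = -E (1, 0) (p 0) := by linear_combination h.trace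
  have hz : ∀ (d : Derivation ℂ R R) (P : Prop) [Decidable P], d (if P then 1 else 0) = 0 := by
    intro d P _
    split_ifs <;> simp
  have hq : ∀ a B, E a (q B) = if a = (1, B) then 1 else 0 := by
    intro a B
    obtain ⟨A, A'⟩ := a
    revert A
    simp only [Fin.forall_fin_two]
    simp [h.q0, h.q1]
  have hQ : ∀ a B, E a (p B) = if a.1 = 0 then (if a.2 = B then 1 else 0)
      else nfQ (E (1, 0) (p 0)) (E (1, 0) (p 1)) (E (1, 1) (p 0)) a.2 B := by
    intro a B
    obtain ⟨A, A'⟩ := a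
    revert A A' B
    simp only [Fin.forall_fin_two]
    simp [h.p0, nfQ, ht]
  set Q := nfQ (E (1, 0) (p 0)) (E (1, 0) (p 1)) (E (1, 1) (p 0))
  have h1 : ∀ d g C, strR s₀ d g (1, C) = 0 := by
    intro d g C
    have := hC d g (q C)
    simp only [hq, hz, sub_zero] at this
    simpa using this.symm
  have h0 : ∀ d g C, strR s₀ d g (0, C) = E d (E g (p C)) - E g (E d (p C)) := by
    intro d g C
    rw [hC d g (p C)]
    simp only [sum_idx, h1, h.p0]
    revert C
    simp only [Fin.forall_fin_two]
    simp
  have hstr : strR s₀ = nfStr E Q := by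
    funext d g r
    obtain ⟨C, C'⟩ := r
    obtain ⟨A, A'⟩ := d
    obtain ⟨B, B'⟩ := g
    revert C A B
    simp only [Fin.forall_fin_two]
    simp [h1, h0, hQ, nfStr, hz]
  funext a b c
  rw [nfS, ← hstr, strR_mul_eta]

end NormalCoords

section Frame

variable {e : Idx → Derivation ℂ R R} {s : Idx → Idx → Idx → R} {o ι : Fin 2 → R}
  {m b : Matrix (Fin 2) (Fin 2) R} {β Ω : Rˣ}

/-- The change to a frame with adapted coordinates. -/
theorem NormalCoords.normalChange (h : NormalCoords (adE e o ι m β) p q)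
    (hs : ∀ a b c, s a b c = -s b a c)
    (hcomm : ∀ a b f, e a (e b f) - e b (e a f) = ∑ c, strR s a b c * e c f)
    (hn : o 0 * ι 1 - o 1 * ι 0 = 1) (hbm : b * m = 1) (hdet : (β : R) * b.det = Ω ^ 2)
    (hE : adE e o ι m β = E) :
    NormalChange e s o ι b 1 β Ω (E (0, 0)) (E (0, 1)) (nfU E p) (nfV E p) (E (1, 0) (p 0))
        (E (1, 0) (p 1)) (E (1, 1) (p 0)) ∧
      ∃ C : Idx → Idx → Idx → R, ∀ d g f, E d (E g f) - E g (E d f) = ∑ c, C d g c * E c f := by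
  obtain ⟨s₀, hch, hC⟩ := SpinChange.of_comm hs hcomm hn hbm hdet
  rw [hE] at h hch hC
  refine ⟨?_, _, hC⟩
  rw [NormalChange, nfE_nfU_nfV, ← h.strR_eq hC]
  exact hch

namespace NormalChange

variable {α : Rˣ} {x y u v : Derivation ℂ R R} {a b' c : R}

/-- The Einstein–Weyl equations in a normal frame. -/
theorem isEWJet (h : NormalChange e s o ι b α β Ω x y u v a b' c)
    (comm_yx : ∀ f, y (x f) = x (y f)) (comm_ux : ∀ f, u (x f) = x (u f))
    (comm_uy : ∀ f, u (y f) = y (u f)) (comm_vx : ∀ f, v (x f) = x (v f))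
    (comm_vy : ∀ f, v (y f) = y (v f)) (comm_vu : ∀ f, v (u f) = u (v f)) (Ω₀ : Rˣ) {Λ : R}
    (hR : ∀ p q, ricciR (curvR e (strR s) (wcR s fun a => -ld (e a) Ω₀)) p q
      + ricciR (curvR e (strR s) (wcR s fun a => -ld (e a) Ω₀)) q p = Λ * etaR R p q) :
    IsEWJet x y u v a b' c (Ω₀ * Ω : R) := by
  set O := Ω₀ * Ω with hO
  have hw : ∀ p, -ld (e p) Ω₀ = ∑ d, tens (spinMat o ι α β) b p d *
      nfW a b' c (-ld x O) (-ld y O) (-ld u O) (-ld v O) d + ld (e p) Ω := by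
    intro p
    have hd := h.der p O
    have hE : ∀ d, ld (nfE x y u v a b' c d) O
        = -nfW a b' c (-ld x O) (-ld y O) (-ld u O) (-ld v O) d := by
      rw [forall_idx]
      constructorm* _ ∧ _ <;> simp [nfE, nfW, ld] <;> ring
    simp only [der_unit _ O, hE] at hd
    have h1 : ld (e p) O = ld (e p) Ω₀ + ld (e p) Ω := ld_mul ..
    have h2 : ld (e p) O = -∑ d, tens (spinMat o ι α β) b p d *
      nfW a b' c (-ld x O) (-ld y O) (-ld u O) (-ld v O) d := by
      refine O.isUnit.mul_right_cancel ?_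
      rw [hd, neg_mul, Finset.sum_mul, ← Finset.sum_neg_distrib]
      exact Finset.sum_congr rfl fun d _ => by ring
    linear_combination h1 - h2
  have hF := SpinChange.frameChange h
  obtain ⟨B, hAB, hBA⟩ := hF.exists_inv
  have hric := SpinChange.ricciR_eq h hw
  have hη := hF.conf
  set A := tens (spinMat o ι α β) b
  set N := ricciR (curvR (nfE x y u v a b' c) (strR (nfS (nfE x y u v a b' c) (nfQ a b' c)))
    (wcR (nfS (nfE x y u v a b' c) (nfQ a b' c))
      (nfW a b' c (-ld x O) (-ld y O) (-ld u O) (-ld v O)))) with hN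
  have h1 : A * (N + N.transpose) * A.transpose = Λ • etaR R := by
    have : A * (N + N.transpose) * A.transpose
        = A * N * A.transpose + (A * N * A.transpose).transpose := by
      simp only [Matrix.transpose_mul, Matrix.transpose_transpose, Matrix.mul_add, Matrix.add_mul,
        Matrix.mul_assoc]
    rw [this, ← hric]
    exact Matrix.ext fun p q => hR p q
  have h2 : N + N.transpose = (Λ * ((Ω⁻¹ : Rˣ) : R) ^ 2) • etaR R := by
    have hBA' : A.transpose * B.transpose = 1 := by
      rw [← Matrix.transpose_mul, hBA, Matrix.transpose_one]
    have h3 : ∀ X : Matrix Idx Idx R, X = B * (A * X * A.transpose) * B.transpose := by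
      intro X
      simp only [Matrix.mul_assoc, hBA', Matrix.mul_one]
      rw [← Matrix.mul_assoc, hBA, Matrix.one_mul]
    rw [h3 (N + N.transpose), h1, h3 ((Λ * ((Ω⁻¹ : Rˣ) : R) ^ 2) • etaR R)]
    congr 2
    rw [Matrix.mul_smul, Matrix.smul_mul, hη, smul_smul]
    congr 1
    linear_combination (-Λ * (1 + Ω * ((Ω⁻¹ : Rˣ) : R))) * Ω.mul_inv
  have hd : ∀ d : Derivation ℂ R R, d (O : R) = -((O : R) * -ld d O) := fun d => by
    rw [der_unit]; ring
  rw [← Units.val_mul]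
  refine isEWJet_of_ricci comm_yx comm_ux comm_uy comm_vx comm_vy comm_vu O.isUnit (hd x) (hd y)
    (hd u) (hd v) (Λ := Λ * ((Ω⁻¹ : Rˣ) : R) ^ 2) fun p q => ?_
  have h4 := congrFun (congrFun h2 p) q
  rw [strR_nfS] at hN
  simpa [ricNF, hN] using h4

end NormalChange
end Frame
end NormalCoordinates
end ConformalHH

namespace ConformalHH

/-! ### Existence of normal coordinates and of the potential -/

section Existence

variable {R : Type*} [CommRing R] [Algebra ℂ R] {L : LocalModel R}

theorem adE_mem {e : Idx → Derivation ℂ R R} (he : ∀ a, L.Mem (e a)) (o ι : Fin 2 → R)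
    (m : Matrix (Fin 2) (Fin 2) R) (β : Rˣ) (a : Idx) : L.Mem (adE e o ι m β a) := by
  have hz : ∀ o : Fin 2 → R, ∀ B, L.Mem (∑ B', m B B' • zD e o B') := fun o B =>
    LocalModel.Mem.sum fun B' _ => LocalModel.Mem.smul (LocalModel.Mem.sum fun A _ =>
      LocalModel.Mem.smul (he _) _) _
  obtain ⟨A, A'⟩ := a
  revert A
  simp only [Fin.forall_fin_two]
  exact ⟨hz o A', (hz ι A').smul _⟩

/-- Linear functions dual to the frame at the origin. -/
def IsDualAt (L : LocalModel R) {k : Type*} [DecidableEq k] (E : k → Derivation ℂ R R)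
    (c : k → Fin 4 → ℂ) : Prop :=
  ∀ a b, L.ev (E a (L.lin (c b))) = if a = b then 1 else 0

theorem lin_sum {k : Type*} [Fintype k] (r : k → ℂ) (c : k → Fin 4 → ℂ) :
    L.lin (∑ i, r i • c i) = ∑ i, algebraMap ℂ R (r i) * L.lin (c i) := by
  simp only [LocalModel.lin, Finset.sum_apply, Pi.smul_apply, smul_eq_mul, map_sum, map_mul,
    Finset.sum_mul, Finset.mul_sum, mul_assoc]
  exact Finset.sum_comm

theorem IsDualAt.comp {k : Type*} [DecidableEq k] {E : k → Derivation ℂ R R} {c : k → Fin 4 → ℂ}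
    (h : IsDualAt L E c) {j : Type*} [DecidableEq j] {g : j → k} (hg : Function.Injective g) :
    IsDualAt L (E ∘ g) (c ∘ g) := fun a b => by
  simp [h (g a) (g b), hg.eq_iff]

/-- Dual linear functions of a transformed frame. -/
theorem IsDualAt.exists_of_frame {e E : Idx → Derivation ℂ R R} {c : Idx → Fin 4 → ℂ}
    (h : IsDualAt L e c) {A : Matrix Idx Idx R} (hA : ∀ a f, e a f = ∑ d, A a d * E d f)
    (hu : IsUnit A.det) : ∃ c', IsDualAt L E c' := by
  refine ⟨fun b => ∑ i, L.ev (A i b) • c i, fun a b => ?_⟩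
  have hE : ∀ f, E a f = ∑ d, A⁻¹ a d * e d f := by
    intro f
    have h1 : (fun d => e d f) = A.mulVec (fun d => E d f) := funext fun d => hA d f
    have h2 : A⁻¹.mulVec (fun d => e d f) = fun d => E d f := by
      rw [h1, Matrix.mulVec_mulVec, Matrix.nonsing_inv_mul _ hu, Matrix.one_mulVec]
    exact (congrFun h2 a).symm
  have h3 : ∀ d, L.ev (e d (L.lin (∑ i, L.ev (A i b) • c i))) = L.ev (A d b) := by
    intro d
    simp only [lin_sum, map_sum, Derivation.leibniz, Derivation.map_algebraMap, smul_eq_mul, mul_zero,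
      add_zero, map_mul, AlgHom.commutes, h d]
    simp
  rw [hE, map_sum]
  simp only [map_mul, h3]
  rw [← Matrix.one_apply]
  have h4 : ∑ x, L.ev (A⁻¹ a x) * L.ev (A x b) = L.ev ((A⁻¹ * A) a b) := by
    simp [Matrix.mul_apply]
  rw [h4, Matrix.nonsing_inv_mul _ hu, Matrix.one_apply, Matrix.one_apply]
  split_ifs <;> simp

theorem IsDualAt.det_ne {k : ℕ} {E : Fin k → Derivation ℂ R R} {c : Fin k → Fin 4 → ℂ}
    (h : IsDualAt L E c) : (Matrix.of fun p q => L.ev (E p (L.lin (c q)))).det ≠ 0 := by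
  have : (Matrix.of fun p q => L.ev (E p (L.lin (c q)))) = 1 := by
    ext p q
    rw [Matrix.of_apply, h p q, Matrix.one_apply]
  rw [this, Matrix.det_one]
  exact one_ne_zero

/-- Prescribed derivatives of order `n` along two commuting vector fields. -/
theorem exists_iterated_primitive {x y : Derivation ℂ R R} (hx : L.Mem x) (hy : L.Mem y)
    (hxy : ∀ f, y (x f) = x (y f)) {c : Fin 2 → Fin 4 → ℂ} (hc : IsDualAt L ![x, y] c) (n : ℕ) :
    ∀ g : ℕ → R, (∀ k < n, y (g k) = x (g (k + 1))) →
      ∃ F, ∀ k ≤ n, x^[n - k] (y^[k] F) = g k := by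
  induction n with
  | zero => exact fun g _ => ⟨g 0, fun k hk => by
      obtain rfl := Nat.le_zero.1 hk
      rfl⟩
  | succ n ih =>
    intro g hg
    have h1 : ∀ k, ∃ u, k ≤ n → x u = g k ∧ y u = g (k + 1) := by
      intro k
      by_cases hk : k ≤ n
      · obtain ⟨u, hu, -⟩ := L.exists_primitive_of_involutive (Z := ![x, y]) (C := 0)
          (by simp [Fin.forall_fin_two, hx, hy]) (by simp [Fin.forall_fin_two, hxy]) hc.det_ne
          (h := ![g k, g (k + 1)])
          (by simp [Fin.forall_fin_two, hg k (by omega)])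
        exact ⟨u, fun _ => ⟨hu 0, hu 1⟩⟩
      · exact ⟨0, fun h => absurd h hk⟩
    choose u hu using h1
    obtain ⟨F, hF⟩ := ih u fun k hk => by rw [(hu k (by omega)).2, (hu (k + 1) (by omega)).1]
    refine ⟨F, fun k hk => ?_⟩
    rcases Nat.lt_or_ge n k with h | h
    · obtain rfl : k = n + 1 := by omega
      have := hF n le_rfl
      rw [Nat.sub_self, Function.iterate_zero, id] at this ⊢
      rw [Function.iterate_succ_apply', this, (hu n le_rfl).2]
    · rw [show n + 1 - k = (n - k) + 1 by omega, Function.iterate_succ_apply', hF k h, (hu k h).1]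

/-- The potential of the SD Weyl spinor. -/
theorem IsEWJet.exists_potential {x y u v : Derivation ℂ R R} {a b c O : R}
    (h : IsEWJet x y u v a b c O) (hO : IsUnit O) (hx : L.Mem x) (hy : L.Mem y)
    {ℓ : Fin 2 → Fin 4 → ℂ} (hℓ : IsDualAt L ![x, y] ℓ) : ∃ F, IsJet x y u v a b c F O := by
  obtain ⟨O, rfl⟩ := hO
  have hh := two_mul_half (R := R)
  obtain ⟨r, hr⟩ : ∃ r : R, 3 * r = 1 := ⟨algebraMap ℂ R (1 / 3), by
    rw [show (3 : R) = algebraMap ℂ R 3 from (map_ofNat _ 3).symm, ← map_mul]; norm_num⟩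
  have hr0 : ∀ d : Derivation ℂ R R, d r = 0 := fun d => by
    have := congrArg d hr
    simp only [Derivation.leibniz, der_ofNat, smul_eq_mul, mul_zero, add_zero,
      Derivation.map_one_eq_zero] at this
    linear_combination r * this - d r * hr
  have hu := O.mul_inv
  have hOi : ∀ d : Derivation ℂ R R, d ((O⁻¹ : Rˣ) : R)
      = -(((O⁻¹ : Rˣ) : R) ^ 2 * d O) := fun d => by
    have := congrArg d hu
    simp only [Derivation.leibniz, smul_eq_mul, Derivation.map_one_eq_zero] at this
    linear_combination ((O⁻¹ : Rˣ) : R) * this - d ((O⁻¹ : Rˣ) : R) * hu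
  have c0 := h.compat0
  have c1 := h.compat1
  have c2 := h.compat2
  have c3 := h.compat3
  -- the fourth derivatives of `F` are prescribed as the Weyl spinor divided by `O`
  obtain ⟨F, hF⟩ := exists_iterated_primitive hx hy h.comm_yx hℓ 4
    (fun k => if k = 0 then x (x b) * (O⁻¹ : Rˣ)
      else if k = 1 then half R * (x (y b) - x (x a)) * (O⁻¹ : Rˣ)
      else if k = 2 then half R * r * (y (y b) - x (x c) - 4 * x (y a)) * (O⁻¹ : Rˣ)
      else if k = 3 then half R * (-y (y a) - x (y c)) * (O⁻¹ : Rˣ)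
      else -y (y c) * (O⁻¹ : Rˣ)) (by
    have key : ∀ {s s' w w' : R}, (∀ d : Derivation ℂ R R, d s = 0) →
        (∀ d : Derivation ℂ R R, d s' = 0) →
        s * (O * y w - y O * w) = s' * (O * x w' - x O * w') →
        y (s * w * (O⁻¹ : Rˣ)) = x (s' * w' * (O⁻¹ : Rˣ)) := by
      intro s s' w w' h1 h2 h3
      simp only [Derivation.leibniz, smul_eq_mul, h1, h2, hOi]
      linear_combination ((O⁻¹ : Rˣ) : R) ^ 2 * h3 + (-s * y w + s' * x w') * ((O⁻¹ : Rˣ) : R) * hu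
    intro k hk
    interval_cases k
    · have := key (s := 1) (s' := half R) (by simp) der_half (w := x (x b))
        (w' := x (y b) - x (x a)) (by linear_combination half R * c0 - (O * y (x (x b)) - y O * x (x b)) * hh)
      simpa using this
    · have := key (s := half R) (s' := half R * r) der_half (by simp [der_half, hr0])
        (w := x (y b) - x (x a)) (w' := y (y b) - x (x c) - 4 * x (y a)) (by
          linear_combination half R * r * c1 - half R * (O * y (x (y b) - x (x a)) - y O * (x (y b) - x (x a))) * hr)
      simpa using this
    · have := key (s := half R * r) (s' := half R) (by simp [der_half, hr0]) der_half
        (w := y (y b) - x (x c) - 4 * x (y a)) (w' := -y (y a) - x (y c)) (by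
          linear_combination half R * r * c2 + half R * (O * x (-y (y a) - x (y c)) - x O * (-y (y a) - x (y c))) * hr)
      simpa using this
    · have := key (s := half R) (s' := 1) der_half (by simp)
        (w := -y (y a) - x (y c)) (w' := -y (y c)) (by
          linear_combination half R * c3 + (O * x (-y (y c)) - x O * (-y (y c))) * hh)
      simpa using this)
  have f0 := hF 0 (by norm_num)
  have f1 := hF 1 (by norm_num)
  have f2 := hF 2 (by norm_num)
  have f3 := hF 3 (by norm_num)
  have f4 := hF 4 (by norm_num)
  simp at f0 f1 f2 f3 f4
  refine ⟨F, h, ?_, ?_, ?_, ?_, ?_⟩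
  · rw [f0]; linear_combination (-x (x b)) * hu
  · rw [f1]
    linear_combination (-(x (y b) - x (x a)) * 2 * half R) * hu - (x (y b) - x (x a)) * hh
  · rw [f2]
    linear_combination (-(y (y b) - x (x c) - 4 * x (y a)) * (6 * half R * r)) * hu
      - (y (y b) - x (x c) - 4 * x (y a)) * (3 * r) * hh - (y (y b) - x (x c) - 4 * x (y a)) * hr
  · rw [f3]
    linear_combination ((-y (y a) - x (y c)) * 2 * half R) * hu + (-y (y a) - x (y c)) * hh
  · rw [f4]; linear_combination (-y (y c)) * hu

section Coordinates

variable {e : Idx → Derivation ℂ R R} {s : Idx → Idx → Idx → R} {o ι : Fin 2 → R}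

/-- If `o` is shear-free, then the fields `o^A e_{AA'}` span an involutive distribution. -/
theorem strR_eq_zero_of_shearFree {E : Idx → Derivation ℂ R R} {s₁ : Idx → Idx → Idx → R}
    (h : SpinChange e E s s₁ o ι 1 1 1 1)
    (hshear : ∀ A', ∑ A, ∑ B, o A * o B * (e (A, A') (∑ C, o C * epsR R C B)
      - ∑ C, spinR (wcR s 0) 0 (A, A') B C * ∑ D, o D * epsR R D C) = 0) (A' B' C' : Fin 2) :
    strR s₁ (0, A') (0, B') (1, C') = 0 := by
  have hn := h.norm
  have h1 : ∀ a, spinR (wcR s 0) 0 a * spinMat o ι ((1 : Rˣ) : R) (1 : Rˣ)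
      = (spinMat o ι ((1 : Rˣ) : R) (1 : Rˣ)).map (e a)
        + spinMat o ι ((1 : Rˣ) : R) (1 : Rˣ) * (∑ d, tens (spinMat o ι ((1 : Rˣ) : R) (1 : Rˣ)) 1 a d
          • spinR (wcR s₁ 0) 0 d) := fun a => by
    have := (h.spinR_mul (w := 0) (w₀ := 0) (fun a => by simp) a).1
    simpa [traceShift] using this
  have h2 : ∀ A', spinR (wcR s₁ 0) 0 (0, A') 0 1 = 0 := by
    intro A'
    have h3 := hshear A'
    have h4 := fun A B => congrFun (congrFun (h1 (A, A')) B) 1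
    have hs1 : ∀ A (f : Idx → R), ∑ d, tens (spinMat o ι 1 1) 1 (A, A') d * f d
        = spinMat o ι 1 1 A 0 * f (0, A') + spinMat o ι 1 1 A 1 * f (1, A') := by
      intro A f
      simp only [sum_idx, tens]
      revert A'
      simp only [Fin.forall_fin_two]
      constructor <;> intros <;> simp
    simp only [Matrix.mul_apply, Matrix.add_apply, Matrix.map_apply, Fin.sum_univ_two,
      Matrix.sum_apply, Matrix.smul_apply, smul_eq_mul, Units.val_one, hs1] at h4
    simp only [Fin.sum_univ_two, epsR_00, epsR_01, epsR_10, epsR_11] at h3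
    have g00 := h4 0 0
    have g01 := h4 0 1
    have g10 := h4 1 0
    have g11 := h4 1 1
    simp [spinMat] at g00 g01 g10 g11 h3
    generalize spinR (wcR s 0) 0 = γ at *
    generalize spinR (wcR s₁ 0) 0 = γ₁ at *
    linear_combination -h3 - o 0 * o 0 * g00 - o 0 * o 1 * g01 - o 1 * o 0 * g10 - o 1 * o 1 * g11
      - γ₁ (0, A') 0 1 * (1 + o 0 * ι 1 - o 1 * ι 0) * hn
  have hsplit : ∀ d, wcR s₁ 0 d = tens (spinR (wcR s₁ 0) 0 d) 1 + tens 1 (spinR' (wcR s₁ 0) 0 d) :=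
    fun d => conformal_split (wcR_metric h.anti₀ 0 d)
  rw [← wcR_torsion h.anti₀ 0, hsplit, hsplit]
  simp [tens, h2]

/-- In a frame `E` adapted to `o`, `ι`, for which the covectors dual to `E_{1A}` are closed: if the Lee form
is `d log φ` and the conformal factor is `φ`, then the fields `E_{0A}` commute, and their brackets with
`E_{1B}` are trace-free, which is what allows a coordinate `p^1` with trace-free `Q`. -/
theorem strR_of_leeR_eq {E : Idx → Derivation ℂ R R} {s₂ : Idx → Idx → Idx → R}
    {b : Matrix (Fin 2) (Fin 2) R} {β φ : Rˣ} (h : SpinChange e E s s₂ o ι b 1 β φ)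
    (hlee : ∀ a, leeR e (wcR s 0) o ι a = ld (e a) φ)
    (hS : ∀ d g C, strR s₂ d g (1, C) = 0) :
    (∀ C, strR s₂ (0, 0) (0, 1) (0, C) = 0) ∧
      ∀ A, strR s₂ (0, A) (1, 0) (0, 0) + strR s₂ (0, A) (1, 1) (0, 1) = 0 := by
  set w₀ : Idx → R := fun d => -ld (E d) φ with hw₀
  set A := tens (spinMat o ι ((1 : Rˣ) : R) β) b with hA
  have hld : ∀ a, ld (e a) φ = ∑ d, A a d * ld (E d) φ := fun a => by
    simp only [ld, h.der a (φ : R), Finset.mul_sum]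
    exact Finset.sum_congr rfl fun _ _ => by ring
  have hw : ∀ a, (0 : Idx → R) a = ∑ d, A a d * w₀ d + ld (e a) φ := fun a => by
    rw [hld]; simp [hw₀]
  have hl := fun a => h.leeR_eq hw a
  obtain ⟨B, hAB, hBA⟩ := h.frameChange.exists_inv
  have h1 : ∀ d, leeR E (wcR s₂ w₀) ![1, 0] ![0, 1] d = -w₀ d := by
    have h2 : A.mulVec (leeR E (wcR s₂ w₀) ![1, 0] ![0, 1]) = A.mulVec (-w₀) := by
      funext a
      have := hl a
      rw [hlee, hld] at this
      simp only [Matrix.mulVec, dotProduct, Pi.neg_apply]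
      simp [hw₀]
      exact this.symm
    have h3 := congrArg B.mulVec h2
    rw [Matrix.mulVec_mulVec, Matrix.mulVec_mulVec, hBA, Matrix.one_mulVec, Matrix.one_mulVec] at h3
    exact fun d => congrFun h3 d
  simp only [SpinChange.leeR_adapted] at h1
  have hanti : ∀ d g c, strR s₂ d g c = -strR s₂ g d c := fun d g c => by
    simp only [strR, h.anti₀ d g, mul_neg, Finset.sum_neg_distrib]
  have hs : ∀ a b c, s₂ a b c = ∑ e, strR s₂ a b e * etaR R e c := fun a b c =>
    (strR_mul_eta s₂ a b c).symm
  have hh := two_mul_half (R := R)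
  have g00 := h1 (0, 0)
  have g01 := h1 (0, 1)
  have g10 := h1 (1, 0)
  have g11 := h1 (1, 1)
  clear h1 hl hw hld
  generalize hT : strR s₂ = T at *
  simp only [wcR, lcR, hs] at g00 g01 g10 g11
  clear_value w₀
  simp [sum_idx, etaR_apply, hS] at g00 g01 g10 g11
  have a1 := hanti (0, 0) (0, 1) (0, 0)
  have a3 := hanti (0, 0) (0, 0) (0, 0)
  have a4 := hanti (0, 1) (0, 1) (0, 1)
  have a6 := hanti (0, 0) (1, 1) (0, 1)
  have a7 := hanti (0, 1) (1, 0) (0, 0)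
  have a9 := hanti (0, 1) (1, 0) (0, 1)
  have a10 := hanti (0, 0) (1, 1) (0, 0)
  simp only [Fin.forall_fin_two]
  refine ⟨⟨?_, ?_⟩, ?_, ?_⟩
  · linear_combination a1 - 2 * g01 + half R * a4 + T (0, 1) (0, 0) (0, 0) * hh
  · linear_combination 2 * g00 - half R * a3 - T (0, 0) (0, 1) (0, 1) * hh
  · linear_combination -2 * g10 - (T (0, 0) (1, 0) (0, 0) + T (0, 0) (1, 1) (0, 1)) * hh
      + 2 * half R * a6 - 2 * half R * a9
  · linear_combination -2 * g11 - (T (0, 1) (1, 0) (0, 0) + T (0, 1) (1, 1) (0, 1)) * hh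
      + 2 * half R * a7 - 2 * half R * a10

/-- Existence of coordinates adapted to a shear-free spinor with exact Lee form. -/
theorem exists_normalCoords (he : ∀ a, L.Mem (e a)) {c : Idx → Fin 4 → ℂ} (hc : IsDualAt L e c)
    (hs : ∀ a b c, s a b c = -s b a c)
    (hcomm : ∀ a b f, e a (e b f) - e b (e a f) = ∑ c, strR s a b c * e c f)
    (hn : o 0 * ι 1 - o 1 * ι 0 = 1)
    (hshear : ∀ A', ∑ A, ∑ B, o A * o B * (e (A, A') (∑ C, o C * epsR R C B)
      - ∑ C, spinR (wcR s 0) 0 (A, A') B C * ∑ D, o D * epsR R D C) = 0)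
    (φ : Rˣ) (hlee : ∀ a, leeR e (wcR s 0) o ι a = ld (e a) φ) :
    ∃ (m b : Matrix (Fin 2) (Fin 2) R) (β : Rˣ) (p q : Fin 2 → R), b * m = 1 ∧
      (β : R) * b.det = φ ^ 2 ∧ NormalCoords (adE e o ι m β) p q ∧
      ∃ c', IsDualAt L (adE e o ι m β) c' := by
  have hunit : ∀ (b : Matrix (Fin 2) (Fin 2) R) (β Ω : Rˣ) (E s₂), SpinChange e E s s₂ o ι b 1 β Ω →
      ∃ c', IsDualAt L E c' := fun b β Ω E s₂ h => by
    obtain ⟨B, hAB, -⟩ := h.frameChange.exists_inv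
    exact hc.exists_of_frame h.der (Matrix.isUnit_det_of_right_inverse hAB)
  -- the functions constant along the distribution
  obtain ⟨s₁, h1, hC1⟩ := SpinChange.of_comm (m := 1) (b := 1) (β := 1) (Ω := 1) hs hcomm hn
    (by simp) (by simp)
  obtain ⟨c₁, hc₁⟩ := hunit _ _ _ _ _ h1
  have hinv := strR_eq_zero_of_shearFree h1 hshear
  set E₁ := adE e o ι 1 1 with hE₁
  have hE₁mem : ∀ a, L.Mem (E₁ a) := adE_mem he _ _ _ _
  have hq : ∀ B, ∃ q : R, (∀ A, E₁ (0, A) q = 0) ∧ ∀ A, L.ev (E₁ (1, A) q) = if A = B then 1 else 0 := by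
    intro B
    have hcm : ∀ (p q : Fin 2) f, E₁ (0, p) (E₁ (0, q) f) - E₁ (0, q) (E₁ (0, p) f)
        = ∑ r, strR s₁ (0, p) (0, q) (0, r) * E₁ (0, r) f := fun p q f => by
      rw [hC1, Fintype.sum_prod_type, Fin.sum_univ_two]
      simp [hinv]
    obtain ⟨u, hu, hu0⟩ := L.exists_primitive_of_involutive (Z := fun A => E₁ (0, A))
      (fun A => hE₁mem _) (C := fun p q r => strR s₁ (0, p) (0, q) (0, r)) hcm
      (c := fun A => c₁ (0, A))
      (hc₁.comp (g := fun A : Fin 2 => ((0, A) : Idx)) (fun A B h => by simpa using h)).det_ne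
      (h := fun A => E₁ (0, A) (L.lin (c₁ (1, B)))) (fun p q => hcm p q _)
    refine ⟨L.lin (c₁ (1, B)) - u, fun A => by rw [map_sub, hu, sub_self], fun A => ?_⟩
    rw [map_sub, map_sub, hc₁, hu0 (fun p => by rw [hc₁]; simp) _ (hE₁mem _)]
    simp
  choose q hq0 hq1 using hq
  -- `m` is chosen such that `E_{1A} q^B = δ_A^B`, and `β` such that `E` is a null tetrad of `φ² g`
  set H : Matrix (Fin 2) (Fin 2) R := Matrix.of fun A B => E₁ (1, A) (q B) with hH
  have hHu : IsUnit H.det := by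
    refine L.isUnit_of_ev _ ?_
    have : L.ev H.det = 1 := by simp [Matrix.det_fin_two, hH, hq1]
    rw [this]; exact one_ne_zero
  set β : Rˣ := hHu.unit * φ⁻¹ ^ 2 with hβ
  have hβval : (β : R) * φ ^ 2 = H.det := by
    have : β * φ ^ 2 = hHu.unit := by rw [hβ, inv_pow, inv_mul_cancel_right]
    rw [← Units.val_pow_eq_pow_val, ← Units.val_mul, this, IsUnit.unit_spec]
  set m : Matrix (Fin 2) (Fin 2) R := (β : R) • H⁻¹ with hm
  set b : Matrix (Fin 2) (Fin 2) R := ((β⁻¹ : Rˣ) : R) • H with hb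
  have hHH := Matrix.mul_nonsing_inv H hHu
  have hHH' := Matrix.nonsing_inv_mul H hHu
  have hbm : b * m = 1 := by
    rw [hm, hb, Matrix.smul_mul, Matrix.mul_smul, smul_smul, hHH, β.inv_mul, one_smul]
  have hdet : (β : R) * b.det = φ ^ 2 := by
    rw [hb, Matrix.det_smul, Fintype.card_fin, ← hβval]
    linear_combination (φ : R) ^ 2 * (1 + (β : R) * ((β⁻¹ : Rˣ) : R)) * β.mul_inv
  obtain ⟨s₂, h2, hC2⟩ := SpinChange.of_comm hs hcomm hn hbm hdet
  obtain ⟨c₂, hc₂⟩ := hunit _ _ _ _ _ h2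
  have hE0 : ∀ A f, adE e o ι m β (0, A) f = ∑ B, m A B * E₁ (0, B) f := fun A f => by
    rw [hE₁]; simp [adE_apply, Fin.sum_univ_two, Matrix.one_apply]
  have hE1 : ∀ A f, adE e o ι m β (1, A) f = ((β⁻¹ : Rˣ) : R) * ∑ B, m A B * E₁ (1, B) f := by
    intro A f
    rw [hE₁]; simp [adE_apply, Fin.sum_univ_two, Matrix.one_apply]
  set E := adE e o ι m β with hE
  have hEmem : ∀ a, L.Mem (E a) := adE_mem he _ _ _ _
  have hEq0 : ∀ A B, E (0, A) (q B) = 0 := fun A B => by simp [hE0, hq0]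
  have hEq1 : ∀ A B, E (1, A) (q B) = if A = B then 1 else 0 := fun A B => by
    rw [hE1, ← Matrix.one_apply, ← hHH', Matrix.mul_apply, Finset.mul_sum]
    refine Finset.sum_congr rfl fun C _ => ?_
    simp only [hm, Matrix.smul_apply, smul_eq_mul, hH, Matrix.of_apply]
    linear_combination H⁻¹ A C * E₁ (1, C) (q B) * β.inv_mul
  have hz : ∀ (d : Derivation ℂ R R) (P : Prop) [Decidable P], d (if P then 1 else 0) = 0 := by
    intro d P _
    split_ifs <;> simp
  have hS : ∀ d g C, strR s₂ d g (1, C) = 0 := by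
    intro d g C
    have h3 : ∀ a, E a (q C) = if a = (1, C) then 1 else 0 := by
      intro a
      obtain ⟨A, A'⟩ := a
      revert A
      simp only [Fin.forall_fin_two]
      simp [hEq0, hEq1]
    have := hC2 d g (q C)
    simp only [h3, hz, sub_zero] at this
    simpa using this.symm
  obtain ⟨hS1, hS2⟩ := strR_of_leeR_eq h2 hlee hS
  have hS3 := hS2 0
  have hS4 := hS2 1
  have hbr : ∀ d g f, E d (E g f) - E g (E d f)
      = strR s₂ d g (0, 0) * E (0, 0) f + strR s₂ d g (0, 1) * E (0, 1) f := fun d g f => by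
    rw [hC2, sum_idx]; simp [hS]
  have hanti : ∀ d g c, strR s₂ d g c = -strR s₂ g d c := fun d g c => by
    simp only [strR, h2.anti₀ d g, mul_neg, Finset.sum_neg_distrib]
  have hdiag : ∀ d c, strR s₂ d d c = 0 := fun d c => by
    have := hanti d d c
    exact double_cancel (by linear_combination this)
  have hS5 : ∀ C, strR s₂ (0, 1) (0, 0) (0, C) = 0 := fun C => by rw [hanti, hS1, neg_zero]
  -- the first of the remaining coordinates
  obtain ⟨p₀, hp₀, -⟩ := L.exists_primitive_of_involutive (Z := fun A => E (0, A))
    (fun A => hEmem _) (C := 0) (by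
      simp only [Fin.forall_fin_two]
      simp [hbr, hS1, hS5])
    (c := fun A => c₂ (0, A))
    (hc₂.comp (g := fun A : Fin 2 => ((0, A) : Idx)) (fun A B h => by simpa using h)).det_ne
    (h := ![1, 0]) (by simp [Fin.forall_fin_two])
  have hp00 : E (0, 0) p₀ = 1 := hp₀ 0
  have hp01 : E (0, 1) p₀ = 0 := hp₀ 1
  -- the second one, with the prescribed derivative along `E_{11}`
  set j : Fin 3 → Idx := ![(0, 0), (0, 1), (1, 1)] with hj
  have hja : ∀ i, E (0, i) (E (1, 0) p₀) = strR s₂ (0, i) (1, 0) (0, 0) := fun i => by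
    have := hbr (0, i) (1, 0) p₀
    rw [hp00, hp01, mul_one, mul_zero, add_zero] at this
    rw [← this]
    revert i
    simp only [Fin.forall_fin_two]
    simp [hp00, hp01]
  obtain ⟨p₁, hp₁, -⟩ := L.exists_primitive_of_involutive (Z := fun i => E (j i))
    (fun A => hEmem _) (C := fun i k r => ![strR s₂ (j i) (j k) (0, 0), strR s₂ (j i) (j k) (0, 1), 0] r)
    (fun i k f => by rw [hbr]; simp [Fin.sum_univ_three, hj])
    (c := fun i => c₂ (j i))
    (hc₂.comp (g := j) (by
      intro a b
      fin_cases a <;> fin_cases b <;> simp [hj])).det_ne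
    (h := ![0, 1, -E (1, 0) p₀]) (by
      have hj1 := hja 0
      have hj2 := hja 1
      have ha := hanti (1, 1) (0, 0) (0, 1)
      have ha' := hanti (1, 1) (0, 1) (0, 1)
      have hf : ∀ {P : Fin 3 → Prop}, (∀ i, P i) ↔ P 0 ∧ P 1 ∧ P 2 := by
        intro P
        simp [Fin.forall_fin_succ]
      simp only [hf]
      simp [hj, Fin.sum_univ_three, hS1, hS5, hdiag, hj1, hj2, ha, ha']
      refine ⟨?_, ?_, ?_, ?_⟩
      · linear_combination -hS3
      · linear_combination -hS4
      · linear_combination hS3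
      · linear_combination hS4)
  have hp10 : E (0, 0) p₁ = 0 := hp₁ 0
  have hp11 : E (0, 1) p₁ = 1 := hp₁ 1
  have hp12 : E (1, 1) p₁ = -E (1, 0) p₀ := hp₁ 2
  refine ⟨m, b, β, ![p₀, p₁], q, hbm, hdet, ⟨?_, hEq0, hEq1, ?_⟩, c₂, hc₂⟩
  · change ∀ A B, E (0, A) (![p₀, p₁] B) = _
    simp only [Fin.forall_fin_two]
    simp [hp00, hp01, hp10, hp11]
  · change E (1, 0) p₀ + E (1, 1) p₁ = 0
    rw [hp12, add_neg_cancel]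

/-- Existence of normal coordinates and of the potential, at the level of germs. -/
theorem exists_isJet (he : ∀ a, L.Mem (e a)) {c : Idx → Fin 4 → ℂ} (hc : IsDualAt L e c)
    (hs : ∀ a b c, s a b c = -s b a c)
    (hcomm : ∀ a b f, e a (e b f) - e b (e a f) = ∑ c, strR s a b c * e c f)
    (hn : o 0 * ι 1 - o 1 * ι 0 = 1)
    (hshear : ∀ A', ∑ A, ∑ B, o A * o B * (e (A, A') (∑ C, o C * epsR R C B)
      - ∑ C, spinR (wcR s 0) 0 (A, A') B C * ∑ D, o D * epsR R D C) = 0)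
    (φ : Rˣ) (hlee : ∀ a, leeR e (wcR s 0) o ι a = ld (e a) φ) (Ω₀ : Rˣ) {Λ : R}
    (hR : ∀ p q, ricciR (curvR e (strR s) (wcR s fun a => -ld (e a) Ω₀)) p q
      + ricciR (curvR e (strR s) (wcR s fun a => -ld (e a) Ω₀)) q p = Λ * etaR R p q) :
    ∃ (m b : Matrix (Fin 2) (Fin 2) R) (β : Rˣ) (p q : Fin 2 → R) (F : R), b * m = 1 ∧
      (β : R) * b.det = φ ^ 2 ∧ NormalCoords (adE e o ι m β) p q ∧
      IsJet (adE e o ι m β (0, 0)) (adE e o ι m β (0, 1)) (nfU (adE e o ι m β) p)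
        (nfV (adE e o ι m β) p) (adE e o ι m β (1, 0) (p 0)) (adE e o ι m β (1, 0) (p 1))
        (adE e o ι m β (1, 1) (p 0)) F (Ω₀ * φ : R) := by
  obtain ⟨m, b, β, p, q, hbm, hdet, hN, c', hc'⟩ := exists_normalCoords he hc hs hcomm hn hshear φ hlee
  obtain ⟨hch, C, hC⟩ := hN.normalChange hs hcomm hn hbm hdet rfl
  obtain ⟨k1, k2, k3, k4, k5, k6⟩ := hN.commute hC
  have hEW := hch.isEWJet k1 k2 k3 k4 k5 k6 Ω₀ hR
  obtain ⟨F, hF⟩ := hEW.exists_potential (L := L) (by exact (Ω₀ * φ).isUnit)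
    (adE_mem he _ _ _ _ _) (adE_mem he _ _ _ _ _) (ℓ := fun i => c' (0, i)) (by
      have := hc'.comp (g := fun A : Fin 2 => ((0, A) : Idx)) (fun A B h => by simpa using h)
      have h2 : (adE e o ι m β ∘ fun A : Fin 2 => ((0, A) : Idx))
          = ![adE e o ι m β (0, 0), adE e o ι m β (0, 1)] := by
        funext i; fin_cases i <;> rfl
      rw [h2] at this
      exact this)
  exact ⟨m, b, β, p, q, F, hbm, hdet, hN, hF⟩

end Coordinates
end Existence
end ConformalHH

namespace ConformalHH

/-! ### Rings of germs of analytic functions -/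

section LocalRings

set_option linter.unusedSectionVars false

open Filter Topology

variable {𝕜 : Type*} [RCLike 𝕜] [NormedAlgebra 𝕜 ℂ] {M : Type*} [TopologicalSpace M]
  [ChartedSpace (Fin 4 → 𝕜) M]

variable (𝕜) in
/-- `f` is `C^ω` at `x`. -/
abbrev IsAn (f : M → ℂ) (x : M) : Prop := ContMDiffAt 𝓘(𝕜, Fin 4 → 𝕜) 𝓘(𝕜, ℂ) ω f x

theorem isAn_const (c : ℂ) (x : M) : IsAn 𝕜 (fun _ => c) x := contMDiffAt_const

theorem isAn_comp₂ {F : ℂ × ℂ → ℂ} {f g : M → ℂ} {x : M} (hf : IsAn 𝕜 f x) (hg : IsAn 𝕜 g x)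
    (hF : ContDiffAt 𝕜 ω F (f x, g x)) : IsAn 𝕜 (fun y => F (f y, g y)) x :=
  ContMDiffAt.comp (g := F) x (hF.contMDiffAt) (hf.prodMk_space hg)

theorem IsAn.add {f g : M → ℂ} {x : M} (hf : IsAn 𝕜 f x) (hg : IsAn 𝕜 g x) :
    IsAn 𝕜 (fun y => f y + g y) x :=
  isAn_comp₂ hf hg (contDiffAt_fst.add contDiffAt_snd)

theorem IsAn.mul {f g : M → ℂ} {x : M} (hf : IsAn 𝕜 f x) (hg : IsAn 𝕜 g x) :
    IsAn 𝕜 (fun y => f y * g y) x :=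
  isAn_comp₂ hf hg (contDiffAt_fst.mul contDiffAt_snd)

theorem IsAn.neg {f : M → ℂ} {x : M} (hf : IsAn 𝕜 f x) : IsAn 𝕜 (fun y => -f y) x :=
  ContMDiffAt.comp (g := fun z : ℂ => -z) x (contDiffAt_id.neg.contMDiffAt) hf

theorem IsAn.inv {f : M → ℂ} {x : M} (hf : IsAn 𝕜 f x) (h0 : f x ≠ 0) :
    IsAn 𝕜 (fun y => (f y)⁻¹) x :=
  ContMDiffAt.comp (g := Inv.inv) x ((contDiffAt_inv 𝕜 h0).contMDiffAt) hf

theorem IsAn.sum {ι : Type*} {s : Finset ι} {f : ι → M → ℂ} {x : M} (hf : ∀ i ∈ s, IsAn 𝕜 (f i) x) :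
    IsAn 𝕜 (fun y => ∑ i ∈ s, f i y) x := by
  classical
  induction s using Finset.induction_on with
  | empty => simpa using isAn_const 0 x
  | insert a s ha ih =>
    simp only [Finset.sum_insert ha]
    exact (hf a (Finset.mem_insert_self a s)).add (ih fun i hi => hf i (Finset.mem_insert_of_mem hi))

theorem isAn_congr {f g : M → ℂ} {x : M} (h : f =ᶠ[𝓝 x] g) (hf : IsAn 𝕜 f x) : IsAn 𝕜 g x :=
  hf.congr_of_eventuallyEq h.symm

/-- A filter which is generated by open sets. -/
class IsOpenFilter (l : Filter M) : Prop where
  eventually : ∀ {p : M → Prop}, (∀ᶠ x in l, p x) → ∀ᶠ x in l, ∀ᶠ y in 𝓝 x, p y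

instance (x : M) : IsOpenFilter (𝓝 x) := ⟨fun h => eventually_eventually_nhds.2 h⟩

instance (V : TopologicalSpace.Opens M) : IsOpenFilter (𝓟 (V : Set M)) :=
  ⟨fun h => eventually_principal.2 fun x hx =>
    mem_of_superset (V.2.mem_nhds hx) (eventually_principal.1 h)⟩

variable (𝕜) in
/-- Germs of analytic functions along the filter `l`. -/
def anSubring (l : Filter M) : Subring (l.Germ ℂ) where
  carrier := {g | ∃ f : M → ℂ, (f : l.Germ ℂ) = g ∧ ∀ᶠ x in l, IsAn 𝕜 f x}
  mul_mem' := by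
    rintro _ _ ⟨f, rfl, hf⟩ ⟨g, rfl, hg⟩
    exact ⟨f * g, rfl, by filter_upwards [hf, hg] with x h1 h2 using h1.mul h2⟩
  one_mem' := ⟨1, rfl, .of_forall fun x => isAn_const 1 x⟩
  add_mem' := by
    rintro _ _ ⟨f, rfl, hf⟩ ⟨g, rfl, hg⟩
    exact ⟨f + g, rfl, by filter_upwards [hf, hg] with x h1 h2 using h1.add h2⟩
  zero_mem' := ⟨0, rfl, .of_forall fun x => isAn_const 0 x⟩
  neg_mem' := by
    rintro _ ⟨f, rfl, hf⟩
    exact ⟨-f, rfl, by filter_upwards [hf] with x h1 using h1.neg⟩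

variable (𝕜) in
/-- The ring of germs of analytic functions along the filter `l`: the ring of germs at a point `x` if
`l = 𝓝 x`, the ring of analytic functions on `V` if `l` is the principal filter of the open set `V`. -/
def AnR (l : Filter M) : Type _ := anSubring 𝕜 l

instance (l : Filter M) : CommRing (AnR 𝕜 l) := inferInstanceAs (CommRing (anSubring 𝕜 l))

/-- The constants. -/
def anConst (l : Filter M) : ℂ →+* AnR 𝕜 l where
  toFun c := ⟨((fun _ => c : M → ℂ) : l.Germ ℂ), _, rfl, .of_forall fun x => isAn_const c x⟩
  map_one' := rfl
  map_mul' _ _ := rfl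
  map_zero' := rfl
  map_add' _ _ := rfl

instance (l : Filter M) : Algebra ℂ (AnR 𝕜 l) := (anConst l).toAlgebra

variable {l : Filter M}

/-- The germ `a` is represented by the function `f`. -/
def Rep (a : AnR 𝕜 l) (f : M → ℂ) : Prop := a.1 = (f : l.Germ ℂ)

namespace Rep

variable {a b : AnR 𝕜 l} {f g : M → ℂ}

theorem ext (ha : Rep a f) (hb : Rep b g) (h : f =ᶠ[l] g) : a = b :=
  Subtype.ext (by rw [ha, hb]; exact Germ.coe_eq.2 h)

theorem eventuallyEq (ha : Rep a f) (hb : Rep a g) : f =ᶠ[l] g :=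
  Germ.coe_eq.1 (ha.symm.trans hb)

theorem congr (ha : Rep a f) (h : f =ᶠ[l] g) : Rep a g := ha.trans (Germ.coe_eq.2 h)

theorem add (ha : Rep a f) (hb : Rep b g) : Rep (a + b) (fun x => f x + g x) :=
  show a.1 + b.1 = _ by rw [ha, hb]; rfl

theorem mul (ha : Rep a f) (hb : Rep b g) : Rep (a * b) (fun x => f x * g x) :=
  show a.1 * b.1 = _ by rw [ha, hb]; rfl

theorem neg (ha : Rep a f) : Rep (-a) (fun x => -f x) := show -a.1 = _ by rw [ha]; rfl

theorem sub (ha : Rep a f) (hb : Rep b g) : Rep (a - b) (fun x => f x - g x) :=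
  show a.1 - b.1 = _ by rw [ha, hb]; rfl

theorem const (c : ℂ) : Rep (algebraMap ℂ (AnR 𝕜 l) c) (fun _ => c) := rfl

theorem zero : Rep (0 : AnR 𝕜 l) (fun _ => 0) := rfl

theorem one : Rep (1 : AnR 𝕜 l) (fun _ => 1) := rfl

theorem sum {ι : Type*} {s : Finset ι} {a : ι → AnR 𝕜 l} {f : ι → M → ℂ}
    (h : ∀ i, Rep (a i) (f i)) : Rep (∑ i ∈ s, a i) (fun x => ∑ i ∈ s, f i x) := by
  classical
  induction s using Finset.induction_on with
  | empty => simpa using zero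
  | insert i s hi ih =>
    simp only [Finset.sum_insert hi]
    exact (h i).add ih

theorem isAn [IsOpenFilter l] (ha : Rep a f) : ∀ᶠ x in l, IsAn 𝕜 f x := by
  obtain ⟨g, hg, hga⟩ := a.2
  have h : g =ᶠ[l] f := Germ.coe_eq.1 (hg.trans ha)
  filter_upwards [IsOpenFilter.eventually h, hga] with x h1 h2 using isAn_congr h1 h2

end Rep

theorem exists_rep (a : AnR 𝕜 l) : ∃ f, Rep a f := by
  obtain ⟨g, hg, -⟩ := a.2
  exact ⟨g, hg.symm⟩

/-- The germ of an analytic function. -/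
def toAn (f : M → ℂ) (h : ∀ᶠ x in l, IsAn 𝕜 f x) : AnR 𝕜 l := ⟨f, f, rfl, h⟩

theorem rep_toAn (f : M → ℂ) (h : ∀ᶠ x in l, IsAn 𝕜 f x) : Rep (toAn f h) f := rfl

theorem Rep.isUnit [IsOpenFilter l] {a : AnR 𝕜 l} {f : M → ℂ} (ha : Rep a f)
    (h0 : ∀ᶠ x in l, f x ≠ 0) : IsUnit a := by
  have hinv : ∀ᶠ x in l, IsAn 𝕜 (fun y => (f y)⁻¹) x := by
    filter_upwards [ha.isAn, h0] with x h1 h2 using h1.inv h2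
  refine IsUnit.of_mul_eq_one (toAn _ hinv) ((ha.mul (rep_toAn _ hinv)).ext .one ?_)
  filter_upwards [h0] with x hx using mul_inv_cancel₀ hx

theorem Rep.ne_zero {u : (AnR 𝕜 l)ˣ} {f : M → ℂ} (ha : Rep (u : AnR 𝕜 l) f) :
    ∀ᶠ x in l, f x ≠ 0 := by
  obtain ⟨g, hg⟩ := exists_rep ((u⁻¹ : (AnR 𝕜 l)ˣ) : AnR 𝕜 l)
  have := ha.mul hg
  rw [u.mul_inv] at this
  filter_upwards [this.eventuallyEq .one] with x hx h0
  simp [h0] at hx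

theorem Rep.inv {u : (AnR 𝕜 l)ˣ} {f : M → ℂ} (ha : Rep (u : AnR 𝕜 l) f) :
    Rep ((u⁻¹ : (AnR 𝕜 l)ˣ) : AnR 𝕜 l) (fun x => (f x)⁻¹) := by
  obtain ⟨g, hg⟩ := exists_rep ((u⁻¹ : (AnR 𝕜 l)ˣ) : AnR 𝕜 l)
  have := ha.mul hg
  rw [u.mul_inv] at this
  refine hg.congr ?_
  filter_upwards [this.eventuallyEq .one] with x hx using eq_inv_of_mul_eq_one_right hx

/-! #### Restriction -/

variable (𝕜) in
/-- Restriction of germs to a finer filter. -/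
def anRes {l l' : Filter M} (h : l' ≤ l) : AnR 𝕜 l →ₐ[ℂ] AnR 𝕜 l' where
  toFun a := ⟨Quotient.map' (s₁ := germSetoid l ℂ) (s₂ := germSetoid l' ℂ) id (fun _ _ hfg => h hfg) a.1, by
    obtain ⟨_, f, rfl, hf⟩ := a
    exact ⟨f, rfl, h hf⟩⟩
  map_one' := rfl
  map_mul' := by
    rintro ⟨_, f, rfl, hf⟩ ⟨_, g, rfl, hg⟩
    rfl
  map_zero' := rfl
  map_add' := by
    rintro ⟨_, f, rfl, hf⟩ ⟨_, g, rfl, hg⟩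
    rfl
  commutes' _ := rfl

theorem Rep.res {l l' : Filter M} (h : l' ≤ l) {a : AnR 𝕜 l} {f : M → ℂ} (ha : Rep a f) :
    Rep (anRes 𝕜 h a) f := by
  obtain ⟨_, g, rfl, hg⟩ := a
  have : (g : l.Germ ℂ) = f := ha
  have h1 : Rep (anRes 𝕜 h (⟨g, g, rfl, hg⟩ : AnR 𝕜 l)) g := rfl
  exact h1.congr (h (Germ.coe_eq.1 this))

/-! #### Local coordinates -/

variable (𝕜) in
/-- The preferred chart at `x₀`, centred at `x₀`. -/
def loc (x₀ y : M) : Fin 4 → 𝕜 :=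
  extChartAt 𝓘(𝕜, Fin 4 → 𝕜) x₀ y - extChartAt 𝓘(𝕜, Fin 4 → 𝕜) x₀ x₀

variable (𝕜) in
/-- The inverse of `loc x₀`. -/
def unloc (x₀ : M) (z : Fin 4 → 𝕜) : M :=
  (extChartAt 𝓘(𝕜, Fin 4 → 𝕜) x₀).symm (z + extChartAt 𝓘(𝕜, Fin 4 → 𝕜) x₀ x₀)

variable (𝕜) in
/-- The coordinate derivative `∂_i f` in the preferred chart at `x₀`. -/
def pdv (x₀ : M) (i : Fin 4) (f : M → ℂ) (y : M) : ℂ :=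
  fderiv 𝕜 (f ∘ unloc 𝕜 x₀) (loc 𝕜 x₀ y) (Pi.single i 1)

variable {x₀ y : M}

@[simp] theorem loc_self : loc 𝕜 x₀ x₀ = 0 := sub_self _

theorem unloc_loc (hy : y ∈ (chartAt (Fin 4 → 𝕜) x₀).source) : unloc 𝕜 x₀ (loc 𝕜 x₀ y) = y := by
  rw [unloc, loc, sub_add_cancel]
  exact (extChartAt 𝓘(𝕜, Fin 4 → 𝕜) x₀).left_inv (by rwa [extChartAt_source])

theorem tendsto_loc (hy : y ∈ (chartAt (Fin 4 → 𝕜) x₀).source) :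
    Tendsto (loc 𝕜 x₀) (𝓝 y) (𝓝 (loc 𝕜 x₀ y)) :=
  ((continuousAt_extChartAt' (I := 𝓘(𝕜, Fin 4 → 𝕜)) (by rwa [extChartAt_source])).sub
    continuousAt_const)

theorem tendsto_unloc (hy : y ∈ (chartAt (Fin 4 → 𝕜) x₀).source) :
    Tendsto (unloc 𝕜 x₀) (𝓝 (loc 𝕜 x₀ y)) (𝓝 y) := by
  have h1 := continuousAt_extChartAt_symm' (I := 𝓘(𝕜, Fin 4 → 𝕜)) (x := x₀) (x' := y)
    (by rwa [extChartAt_source])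
  have h2 : Tendsto (fun z => z + extChartAt 𝓘(𝕜, Fin 4 → 𝕜) x₀ x₀) (𝓝 (loc 𝕜 x₀ y))
      (𝓝 (extChartAt 𝓘(𝕜, Fin 4 → 𝕜) x₀ y)) := by
    have := (continuous_add_const (extChartAt 𝓘(𝕜, Fin 4 → 𝕜) x₀ x₀)).tendsto (loc 𝕜 x₀ y)
    rwa [loc, sub_add_cancel] at this
  have h3 := h1.tendsto.comp h2
  rwa [(extChartAt 𝓘(𝕜, Fin 4 → 𝕜) x₀).left_inv (by rwa [extChartAt_source])] at h3

theorem eventually_source (hy : y ∈ (chartAt (Fin 4 → 𝕜) x₀).source) :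
    ∀ᶠ z in 𝓝 y, z ∈ (chartAt (Fin 4 → 𝕜) x₀).source :=
  (chartAt (Fin 4 → 𝕜) x₀).open_source.mem_nhds hy

theorem eventually_loc_unloc (hy : y ∈ (chartAt (Fin 4 → 𝕜) x₀).source) :
    ∀ᶠ z in 𝓝 (loc 𝕜 x₀ y), loc 𝕜 x₀ (unloc 𝕜 x₀ z) = z := by
  have h2 : Tendsto (fun z => z + extChartAt 𝓘(𝕜, Fin 4 → 𝕜) x₀ x₀) (𝓝 (loc 𝕜 x₀ y))
      (𝓝 (extChartAt 𝓘(𝕜, Fin 4 → 𝕜) x₀ y)) := by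
    have := (continuous_add_const (extChartAt 𝓘(𝕜, Fin 4 → 𝕜) x₀ x₀)).tendsto (loc 𝕜 x₀ y)
    rwa [loc, sub_add_cancel] at this
  have h3 : (extChartAt 𝓘(𝕜, Fin 4 → 𝕜) x₀).target ∈ 𝓝 (extChartAt 𝓘(𝕜, Fin 4 → 𝕜) x₀ y) :=
    extChartAt_target_mem_nhds' ((extChartAt 𝓘(𝕜, Fin 4 → 𝕜) x₀).map_source
      (by rwa [extChartAt_source]))
  filter_upwards [h2 h3] with z hz
  rw [loc, unloc, (extChartAt 𝓘(𝕜, Fin 4 → 𝕜) x₀).right_inv hz, add_sub_cancel_right]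

variable [IsManifold 𝓘(𝕜, Fin 4 → 𝕜) ω M]

theorem contMDiffAt_loc (hy : y ∈ (chartAt (Fin 4 → 𝕜) x₀).source) :
    ContMDiffAt 𝓘(𝕜, Fin 4 → 𝕜) 𝓘(𝕜, Fin 4 → 𝕜) ω (loc 𝕜 x₀) y := by
  have h1 : ContMDiffAt 𝓘(𝕜, Fin 4 → 𝕜) 𝓘(𝕜, Fin 4 → 𝕜) ω (extChartAt 𝓘(𝕜, Fin 4 → 𝕜) x₀) y :=
    contMDiffAt_extChartAt' hy
  exact ContMDiffAt.comp (g := fun z => z - extChartAt 𝓘(𝕜, Fin 4 → 𝕜) x₀ x₀) y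
    ((contDiffAt_id.sub contDiffAt_const).contMDiffAt) h1

theorem contMDiffAt_unloc (hy : y ∈ (chartAt (Fin 4 → 𝕜) x₀).source) :
    ContMDiffAt 𝓘(𝕜, Fin 4 → 𝕜) 𝓘(𝕜, Fin 4 → 𝕜) ω (unloc 𝕜 x₀) (loc 𝕜 x₀ y) := by
  have h1 : ContMDiffAt 𝓘(𝕜, Fin 4 → 𝕜) 𝓘(𝕜, Fin 4 → 𝕜) ω (extChartAt 𝓘(𝕜, Fin 4 → 𝕜) x₀).symm
      (loc 𝕜 x₀ y + extChartAt 𝓘(𝕜, Fin 4 → 𝕜) x₀ x₀) := by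
    rw [loc, sub_add_cancel]
    exact (contMDiffOn_extChartAt_symm x₀).contMDiffAt
      (extChartAt_target_mem_nhds' ((extChartAt 𝓘(𝕜, Fin 4 → 𝕜) x₀).map_source
      (by rwa [extChartAt_source])))
  exact ContMDiffAt.comp (f := fun z => z + extChartAt 𝓘(𝕜, Fin 4 → 𝕜) x₀ x₀) (loc 𝕜 x₀ y) h1
    ((contDiffAt_id.add contDiffAt_const).contMDiffAt)

theorem IsAn.pull {f : M → ℂ} (hf : IsAn 𝕜 f y) (hy : y ∈ (chartAt (Fin 4 → 𝕜) x₀).source) :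
    AnalyticAt 𝕜 (f ∘ unloc 𝕜 x₀) (loc 𝕜 x₀ y) := by
  have hf' : ContMDiffAt 𝓘(𝕜, Fin 4 → 𝕜) 𝓘(𝕜, ℂ) ω f (unloc 𝕜 x₀ (loc 𝕜 x₀ y)) := by
    rwa [unloc_loc hy]
  have h := hf'.comp (loc 𝕜 x₀ y) (contMDiffAt_unloc hy)
  exact (contMDiffAt_iff_contDiffAt.1 h).analyticAt

theorem isAn_push {h : (Fin 4 → 𝕜) → ℂ} (hy : y ∈ (chartAt (Fin 4 → 𝕜) x₀).source)
    (hh : AnalyticAt 𝕜 h (loc 𝕜 x₀ y)) : IsAn 𝕜 (h ∘ loc 𝕜 x₀) y :=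
  ContMDiffAt.comp (g := h) y (hh.contDiffAt.contMDiffAt) (contMDiffAt_loc hy)

theorem push_pull (hy : y ∈ (chartAt (Fin 4 → 𝕜) x₀).source) (f : M → ℂ) :
    (f ∘ unloc 𝕜 x₀) ∘ loc 𝕜 x₀ =ᶠ[𝓝 y] f := by
  filter_upwards [eventually_source hy] with z hz
  simp [unloc_loc hz]

theorem pull_push (hy : y ∈ (chartAt (Fin 4 → 𝕜) x₀).source) (h : (Fin 4 → 𝕜) → ℂ) :
    (h ∘ loc 𝕜 x₀) ∘ unloc 𝕜 x₀ =ᶠ[𝓝 (loc 𝕜 x₀ y)] h := by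
  filter_upwards [eventually_loc_unloc hy] with z hz
  simp [hz]

theorem pdv_isAn {f : M → ℂ} (hf : IsAn 𝕜 f y) (hy : y ∈ (chartAt (Fin 4 → 𝕜) x₀).source)
    (i : Fin 4) : IsAn 𝕜 (pdv 𝕜 x₀ i f) y :=
  isAn_push (h := fun z => fderiv 𝕜 (f ∘ unloc 𝕜 x₀) z (Pi.single i 1)) hy
    ((ContinuousLinearMap.apply 𝕜 ℂ (Pi.single i (1 : 𝕜) : Fin 4 → 𝕜)).analyticAt _ |>.comp
      (hf.pull hy).fderiv)

theorem pdv_congr {f g : M → ℂ} (hy : y ∈ (chartAt (Fin 4 → 𝕜) x₀).source) (h : f =ᶠ[𝓝 y] g)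
    (i : Fin 4) : pdv 𝕜 x₀ i f =ᶠ[𝓝 y] pdv 𝕜 x₀ i g := by
  filter_upwards [eventually_source hy, h.eventually_nhds] with z hz hfg
  have : f ∘ unloc 𝕜 x₀ =ᶠ[𝓝 (loc 𝕜 x₀ z)] g ∘ unloc 𝕜 x₀ := tendsto_unloc hz hfg
  simp only [pdv, this.fderiv_eq]

theorem pdv_add {f g : M → ℂ} (hy : y ∈ (chartAt (Fin 4 → 𝕜) x₀).source) (hf : IsAn 𝕜 f y)
    (hg : IsAn 𝕜 g y) (i : Fin 4) :
    pdv 𝕜 x₀ i (fun z => f z + g z) y = pdv 𝕜 x₀ i f y + pdv 𝕜 x₀ i g y := by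
  have := fderiv_fun_add (hf.pull hy).differentiableAt (hg.pull hy).differentiableAt
  simp only [pdv]
  change fderiv 𝕜 (fun z => (f ∘ unloc 𝕜 x₀) z + (g ∘ unloc 𝕜 x₀) z) _ _ = _
  rw [this, add_apply]

theorem pdv_mul {f g : M → ℂ} (hy : y ∈ (chartAt (Fin 4 → 𝕜) x₀).source) (hf : IsAn 𝕜 f y)
    (hg : IsAn 𝕜 g y) (i : Fin 4) :
    pdv 𝕜 x₀ i (fun z => f z * g z) y = f y * pdv 𝕜 x₀ i g y + g y * pdv 𝕜 x₀ i f y := by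
  have := fderiv_fun_mul (hf.pull hy).differentiableAt (hg.pull hy).differentiableAt
  simp only [pdv]
  change fderiv 𝕜 (fun z => (f ∘ unloc 𝕜 x₀) z * (g ∘ unloc 𝕜 x₀) z) _ _ = _
  rw [this]
  simp [unloc_loc hy]

theorem pdv_const (c : ℂ) (i : Fin 4) : pdv 𝕜 x₀ i (fun _ => c) y = 0 := by
  have : (fun _ : M => c) ∘ unloc 𝕜 x₀ = fun _ => c := rfl
  simp [pdv, this]

theorem pdv_comm {f : M → ℂ} (hf : IsAn 𝕜 f y) (hy : y ∈ (chartAt (Fin 4 → 𝕜) x₀).source)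
    (i j : Fin 4) : pdv 𝕜 x₀ i (pdv 𝕜 x₀ j f) y = pdv 𝕜 x₀ j (pdv 𝕜 x₀ i f) y := by
  have h1 : ∀ j, pdv 𝕜 x₀ j f ∘ unloc 𝕜 x₀ =ᶠ[𝓝 (loc 𝕜 x₀ y)]
      fun z => fderiv 𝕜 (f ∘ unloc 𝕜 x₀) z (Pi.single j 1) := fun j => pull_push hy
    (fun z => fderiv 𝕜 (f ∘ unloc 𝕜 x₀) z (Pi.single j 1))
  have hd : DifferentiableAt 𝕜 (fderiv 𝕜 (f ∘ unloc 𝕜 x₀)) (loc 𝕜 x₀ y) :=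
    (hf.pull hy).fderiv.differentiableAt
  have h2 : ∀ i j, pdv 𝕜 x₀ i (pdv 𝕜 x₀ j f) y
      = fderiv 𝕜 (fderiv 𝕜 (f ∘ unloc 𝕜 x₀)) (loc 𝕜 x₀ y) (Pi.single i 1) (Pi.single j 1) := by
    intro i j
    rw [pdv, (h1 j).fderiv_eq, fderiv_clm_apply hd (differentiableAt_const _)]
    simp
  rw [h2, h2]
  exact ((hf.pull hy).contDiffAt.isSymmSndFDerivAt (n := ω) (by simp)) _ _

/-- The operator `𝒟` is near `x` a vector field with analytic components in some chart. -/
def IsVF (𝒟 : (M → ℂ) → M → ℂ) (x : M) : Prop :=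
  ∃ x₀ : M, x ∈ (chartAt (Fin 4 → 𝕜) x₀).source ∧ ∃ c : Fin 4 → M → ℂ, (∀ i, IsAn 𝕜 (c i) x) ∧
    ∀ f, IsAn 𝕜 f x → 𝒟 f =ᶠ[𝓝 x] fun y => ∑ i, c i y * pdv 𝕜 x₀ i f y

namespace IsVF

variable {𝒟 : (M → ℂ) → M → ℂ} {x : M} {f g : M → ℂ}

theorem isAn (h : IsVF (𝕜 := 𝕜) 𝒟 x) (hf : IsAn 𝕜 f x) : IsAn 𝕜 (𝒟 f) x := by
  obtain ⟨x₀, hx, c, hc, hD⟩ := h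
  exact isAn_congr (hD f hf).symm (IsAn.sum fun i _ => (hc i).mul (pdv_isAn hf hx i))

theorem congr (h : IsVF (𝕜 := 𝕜) 𝒟 x) (hf : IsAn 𝕜 f x) (hfg : f =ᶠ[𝓝 x] g) : 𝒟 f x = 𝒟 g x := by
  obtain ⟨x₀, hx, c, -, hD⟩ := h
  rw [(hD f hf).eq_of_nhds, (hD g (isAn_congr hfg hf)).eq_of_nhds]
  exact Finset.sum_congr rfl fun i _ => by rw [(pdv_congr hx hfg i).eq_of_nhds]

theorem add (h : IsVF (𝕜 := 𝕜) 𝒟 x) (hf : IsAn 𝕜 f x) (hg : IsAn 𝕜 g x) :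
    𝒟 (fun z => f z + g z) x = 𝒟 f x + 𝒟 g x := by
  obtain ⟨x₀, hx, c, -, hD⟩ := h
  rw [(hD f hf).eq_of_nhds, (hD g hg).eq_of_nhds, (hD _ (hf.add hg)).eq_of_nhds]
  simp only [pdv_add hx hf hg, mul_add, Finset.sum_add_distrib]

theorem mul (h : IsVF (𝕜 := 𝕜) 𝒟 x) (hf : IsAn 𝕜 f x) (hg : IsAn 𝕜 g x) :
    𝒟 (fun z => f z * g z) x = f x * 𝒟 g x + g x * 𝒟 f x := by
  obtain ⟨x₀, hx, c, -, hD⟩ := h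
  rw [(hD f hf).eq_of_nhds, (hD g hg).eq_of_nhds, (hD _ (hf.mul hg)).eq_of_nhds]
  simp only [pdv_mul hx hf hg, mul_add, Finset.sum_add_distrib, Finset.mul_sum]
  congr 1 <;> exact Finset.sum_congr rfl fun i _ => by ring

theorem const (h : IsVF (𝕜 := 𝕜) 𝒟 x) (c : ℂ) : 𝒟 (fun _ => c) x = 0 := by
  obtain ⟨x₀, hx, c, -, hD⟩ := h
  rw [(hD _ (isAn_const _ x)).eq_of_nhds]
  simp [pdv_const]

end IsVF

/-- The operator on germs given by a vector field. -/
def anOp [IsOpenFilter l] (𝒟 : (M → ℂ) → M → ℂ) (h : ∀ᶠ x in l, IsVF (𝕜 := 𝕜) 𝒟 x) (a : AnR 𝕜 l) :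
    AnR 𝕜 l :=
  toAn (𝒟 (exists_rep a).choose) (by
    filter_upwards [h, (exists_rep a).choose_spec.isAn] with x h1 h2 using h1.isAn h2)

theorem Rep.anOp [IsOpenFilter l] {𝒟 : (M → ℂ) → M → ℂ} (h : ∀ᶠ x in l, IsVF (𝕜 := 𝕜) 𝒟 x)
    {a : AnR 𝕜 l} {f : M → ℂ} (ha : Rep a f) : Rep (anOp 𝒟 h a) (𝒟 f) := by
  refine Rep.congr (rep_toAn _ _) ?_
  have h1 := (exists_rep a).choose_spec
  filter_upwards [h, h1.isAn, IsOpenFilter.eventually (h1.eventuallyEq ha)] with x h2 h3 h4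
    using h2.congr h3 h4

/-- The derivation of the ring of germs given by a vector field. -/
def anDer [IsOpenFilter l] (𝒟 : (M → ℂ) → M → ℂ) (h : ∀ᶠ x in l, IsVF (𝕜 := 𝕜) 𝒟 x) :
    Derivation ℂ (AnR 𝕜 l) (AnR 𝕜 l) :=
  have hmul : ∀ a b, anOp 𝒟 h (a * b) = a * anOp 𝒟 h b + b * anOp 𝒟 h a := fun a b => by
    obtain ⟨f, hf⟩ := exists_rep a
    obtain ⟨g, hg⟩ := exists_rep b
    refine ((hf.mul hg).anOp h).ext ((hf.mul (hg.anOp h)).add (hg.mul (hf.anOp h))) ?_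
    filter_upwards [h, hf.isAn, hg.isAn] with x h1 h2 h3 using h1.mul h2 h3
  Derivation.mk'
    { toFun := anOp 𝒟 h
      map_add' := fun a b => by
        obtain ⟨f, hf⟩ := exists_rep a
        obtain ⟨g, hg⟩ := exists_rep b
        refine ((hf.add hg).anOp h).ext ((hf.anOp h).add (hg.anOp h)) ?_
        filter_upwards [h, hf.isAn, hg.isAn] with x h1 h2 h3 using h1.add h2 h3
      map_smul' := fun c a => by
        rw [Algebra.smul_def, hmul, RingHom.id_apply, Algebra.smul_def]
        have : anOp 𝒟 h (algebraMap ℂ (AnR 𝕜 l) c) = 0 := by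
          refine ((Rep.const c).anOp h).ext .zero ?_
          filter_upwards [h] with x h1 using h1.const c
        rw [this, mul_zero, add_zero] }
    hmul

theorem Rep.anDer [IsOpenFilter l] {𝒟 : (M → ℂ) → M → ℂ} (h : ∀ᶠ x in l, IsVF (𝕜 := 𝕜) 𝒟 x)
    {a : AnR 𝕜 l} {f : M → ℂ} (ha : Rep a f) : Rep (anDer 𝒟 h a) (𝒟 f) := ha.anOp h

theorem anRes_anDer {l l' : Filter M} [IsOpenFilter l] [IsOpenFilter l'] (hl : l' ≤ l)
    {𝒟 : (M → ℂ) → M → ℂ} (h : ∀ᶠ x in l, IsVF (𝕜 := 𝕜) 𝒟 x) (a : AnR 𝕜 l) :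
    anRes 𝕜 hl (anDer 𝒟 h a) = anDer 𝒟 (hl h) (anRes 𝕜 hl a) := by
  obtain ⟨f, hf⟩ := exists_rep a
  exact ((hf.anDer h).res hl).ext ((hf.res hl).anDer (hl h)) (.refl _ _)

end LocalRings
end ConformalHH

namespace ConformalHH

/-! ### Germs at a point as a local model -/

section GermModel

set_option linter.unusedSectionVars false

open Filter Topology

variable {𝕜 : Type*} [RCLike 𝕜] [NormedAlgebra 𝕜 ℂ] {M : Type*} [TopologicalSpace M]
  [ChartedSpace (Fin 4 → 𝕜) M] [IsManifold 𝓘(𝕜, Fin 4 → 𝕜) ω M] {x₀ y : M}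

theorem isVF_pdv (i : Fin 4) (hy : y ∈ (chartAt (Fin 4 → 𝕜) x₀).source) :
    IsVF (𝕜 := 𝕜) (pdv 𝕜 x₀ i) y :=
  ⟨x₀, hy, fun j _ => if j = i then 1 else 0, fun _ => isAn_const _ _, fun f _ => by
    simp⟩

theorem eventually_isVF_pdv (x₀ : M) (i : Fin 4) :
    ∀ᶠ x in 𝓝 x₀, IsVF (𝕜 := 𝕜) (pdv 𝕜 x₀ i) x := by
  filter_upwards [eventually_source (mem_chart_source (Fin 4 → 𝕜) x₀)] with x hx using isVF_pdv i hx

/-- The value of a germ at the base point. -/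
def anEv (x₀ : M) : AnR 𝕜 (𝓝 x₀) →ₐ[ℂ] ℂ where
  toFun a := a.1.value
  map_one' := rfl
  map_mul' := by
    rintro ⟨_, f, rfl, hf⟩ ⟨_, g, rfl, hg⟩
    rfl
  map_zero' := rfl
  map_add' := by
    rintro ⟨_, f, rfl, hf⟩ ⟨_, g, rfl, hg⟩
    rfl
  commutes' _ := rfl

theorem Rep.anEv {a : AnR 𝕜 (𝓝 x₀)} {f : M → ℂ} (h : Rep a f) : anEv x₀ a = f x₀ := by
  change a.1.value = _
  rw [h]; rfl

theorem isAn_cproj_loc (i : Fin 4) (hy : y ∈ (chartAt (Fin 4 → 𝕜) x₀).source) :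
    IsAn 𝕜 (fun z => cproj 𝕜 i (loc 𝕜 x₀ z)) y :=
  isAn_push (h := fun z => cproj 𝕜 i z) hy ((cproj 𝕜 i).analyticAt _)

theorem pdv_push (h : (Fin 4 → 𝕜) → ℂ) (j : Fin 4) (hy : y ∈ (chartAt (Fin 4 → 𝕜) x₀).source) :
    pdv 𝕜 x₀ j (fun z => h (loc 𝕜 x₀ z)) y = fderiv 𝕜 h (loc 𝕜 x₀ y) (Pi.single j 1) := by
  rw [pdv]
  have := pull_push hy h
  change fderiv 𝕜 ((h ∘ loc 𝕜 x₀) ∘ unloc 𝕜 x₀) _ _ = _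
  rw [this.fderiv_eq]

theorem tendsto_unloc_zero (x₀ : M) : Tendsto (unloc 𝕜 x₀) (𝓝 0) (𝓝 x₀) := by
  have := tendsto_unloc (𝕜 := 𝕜) (mem_chart_source (Fin 4 → 𝕜) x₀)
  rwa [loc_self] at this

theorem tendsto_loc_zero (x₀ : M) : Tendsto (loc 𝕜 x₀) (𝓝 x₀) (𝓝 0) := by
  have := tendsto_loc (𝕜 := 𝕜) (mem_chart_source (Fin 4 → 𝕜) x₀)
  rwa [loc_self] at this

/-- Transport of an equation between functions near `x₀` to the coordinate space. -/
theorem eventually_pull {p : M → (Fin 4 → 𝕜) → Prop} (h : ∀ᶠ y in 𝓝 x₀, p y (loc 𝕜 x₀ y)) :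
    ∀ᶠ z in 𝓝 0, p (unloc 𝕜 x₀ z) z := by
  have h1 := eventually_loc_unloc (𝕜 := 𝕜) (mem_chart_source (Fin 4 → 𝕜) x₀)
  rw [loc_self] at h1
  filter_upwards [tendsto_unloc_zero x₀ h, h1] with z hz hz'
  have hz : p (unloc 𝕜 x₀ z) (loc 𝕜 x₀ (unloc 𝕜 x₀ z)) := hz
  rwa [hz'] at hz

/-- Germs of analytic functions at a point of the manifold form a local model. -/
def germModel (x₀ : M) : LocalModel (AnR 𝕜 (𝓝 x₀)) where
  pd i := anDer (pdv 𝕜 x₀ i) (eventually_isVF_pdv x₀ i)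
  t i := toAn (fun z => cproj 𝕜 i (loc 𝕜 x₀ z)) (by
    filter_upwards [eventually_source (mem_chart_source (Fin 4 → 𝕜) x₀)] with x hx
      using isAn_cproj_loc i hx)
  pd_t i j := by
    have h1 : Rep (if i = j then 1 else 0 : AnR 𝕜 (𝓝 x₀)) (fun _ => if i = j then 1 else 0) := by
      split_ifs
      exacts [.one, .zero]
    refine ((rep_toAn _ _).anDer _).ext h1 ?_
    filter_upwards [eventually_source (mem_chart_source (Fin 4 → 𝕜) x₀)] with x hx
    rw [pdv_push (fun z => cproj 𝕜 j z) i hx]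
    have : fderiv 𝕜 (fun z => cproj 𝕜 j z) (loc 𝕜 x₀ x) = cproj 𝕜 j := (cproj 𝕜 j).fderiv
    rw [this, cproj_apply, Pi.single_apply, apply_ite (algebraMap 𝕜 ℂ), map_one, map_zero]
    simp only [eq_comm]
  pd_comm i j a := by
    obtain ⟨f, hf⟩ := exists_rep a
    refine ((hf.anDer _).anDer _).ext ((hf.anDer _).anDer _) ?_
    filter_upwards [eventually_source (mem_chart_source (Fin 4 → 𝕜) x₀), hf.isAn] with x hx h1
      using pdv_comm h1 hx i j
  ev := anEv x₀
  isUnit_of_ev a h := by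
    obtain ⟨f, hf⟩ := exists_rep a
    rw [hf.anEv] at h
    exact hf.isUnit (hf.isAn.self_of_nhds.continuousAt.eventually_ne h)
  lie a h c hc := by
    choose f hf using fun i => exists_rep (a i)
    obtain ⟨g, hg⟩ := exists_rep h
    have hx₀ := mem_chart_source (Fin 4 → 𝕜) x₀
    have hpull : ∀ {b : AnR 𝕜 (𝓝 x₀)} {k : M → ℂ}, Rep b k → AnalyticAt 𝕜 (k ∘ unloc 𝕜 x₀) 0 := by
      intro b k hk
      have := hk.isAn.self_of_nhds.pull hx₀
      rwa [loc_self] at this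
    have hun : unloc 𝕜 x₀ 0 = x₀ := by
      have := unloc_loc (𝕜 := 𝕜) hx₀
      rwa [loc_self] at this
    have hc' := Rep.sum (s := Finset.univ) fun i => (hf i).mul (Rep.const (c i))
    rw [hc] at hc'
    obtain ⟨u, hu, hu1, hu2, hu3⟩ := exists_lieSeries (fun i => hpull (hf i)) (hpull hg) c
      (tendsto_unloc_zero x₀ (hc'.eventuallyEq .one))
    have huan : ∀ᶠ x in 𝓝 x₀, IsAn 𝕜 (fun z => u (loc 𝕜 x₀ z)) x := by
      filter_upwards [eventually_source hx₀, tendsto_loc_zero x₀ hu.eventually_analyticAt]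
        with x hx h1 using isAn_push hx h1
    have hvf : ∀ (b : Fin 4 → AnR 𝕜 (𝓝 x₀)) (k : Fin 4 → M → ℂ) (r : AnR 𝕜 (𝓝 x₀)) (m : M → ℂ),
        (∀ i, Rep (b i) (k i)) → Rep r m →
        (∀ᶠ z in 𝓝 0, vf (fun i => k i ∘ unloc 𝕜 x₀) u z = (m ∘ unloc 𝕜 x₀) z) →
        ∑ i, b i * anDer (pdv 𝕜 x₀ i) (eventually_isVF_pdv x₀ i) (toAn _ huan) = r := by
      intro b k r m hb hr h1
      refine (Rep.sum fun i => (hb i).mul ((rep_toAn _ huan).anDer _)).ext hr ?_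
      filter_upwards [eventually_source hx₀, tendsto_loc_zero x₀ h1] with x hx h1
      have h1 : vf (fun i => k i ∘ unloc 𝕜 x₀) u (loc 𝕜 x₀ x) = (m ∘ unloc 𝕜 x₀) (loc 𝕜 x₀ x) := h1
      simp only [vf, Function.comp, unloc_loc hx] at h1
      rw [← h1]
      exact Finset.sum_congr rfl fun i _ => by rw [pdv_push u i hx]
    have hvf' : ∀ (b : Fin 4 → AnR 𝕜 (𝓝 x₀)) (k : Fin 4 → M → ℂ) (r : AnR 𝕜 (𝓝 x₀)) (m : M → ℂ),
        (∀ i, Rep (b i) (k i)) → Rep r m →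
        Rep (∑ i, b i * anDer (pdv 𝕜 x₀ i) (eventually_isVF_pdv x₀ i) r)
          (fun y => vf (fun i => k i ∘ unloc 𝕜 x₀) (m ∘ unloc 𝕜 x₀) (loc 𝕜 x₀ y)) := by
      intro b k r m hb hr
      refine (Rep.sum fun i => (hb i).mul (hr.anDer (eventually_isVF_pdv x₀ i))).congr ?_
      filter_upwards [eventually_source hx₀] with x hx
      simp only [vf, Function.comp, unloc_loc hx, pdv]
    refine ⟨toAn _ huan, hvf a f h g hf hg hu1, fun j => ?_, fun a' h1 h2 h3 => ?_⟩
    · rw [((rep_toAn _ huan).anDer (eventually_isVF_pdv x₀ j)).anEv, hg.anEv, pdv_push u j hx₀, loc_self]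
      have := hu2 (fun i _ => if i = j then 1 else 0)
      rw [vf_single] at this
      rw [this, Function.comp, hun]
      simp
    · choose f' hf' using fun i => exists_rep (a' i)
      refine hvf a' f' 0 (fun _ => 0) hf' .zero ?_
      refine hu3 _ (fun i => hpull (hf' i)) (fun i => ?_) ?_ ?_
      · have h4 := hvf' a f _ _ hf (hf' i)
        rw [h1 i] at h4
        exact eventually_pull (p := fun _ z => vf (fun i => f i ∘ unloc 𝕜 x₀) (f' i ∘ unloc 𝕜 x₀) z
          = vf (fun i => f' i ∘ unloc 𝕜 x₀) (f i ∘ unloc 𝕜 x₀) z)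
          (h4.eventuallyEq (hvf' a' f' _ _ hf' (hf i)))
      · have h4 := Rep.sum (s := Finset.univ) fun i => (hf' i).mul (Rep.const (c i))
        rw [h2] at h4
        exact tendsto_unloc_zero x₀ (h4.eventuallyEq .zero)
      · have h4 := hvf' a' f' _ _ hf' hg
        rw [h3] at h4
        exact eventually_pull (p := fun _ z => vf (fun i => f' i ∘ unloc 𝕜 x₀) (g ∘ unloc 𝕜 x₀) z = 0)
          (h4.eventuallyEq .zero)

/-! #### Vector fields on the manifold -/

theorem liftBaseChange_eq_sum {E : Type*} [AddCommGroup E] [Module 𝕜 E] {ℓ : E →ₗ[𝕜] ℂ}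
    {c : Fin 4 → ℂ} {m : Fin 4 → E →ₗ[𝕜] ℂ} (h : ∀ v, ℓ v = ∑ i, c i * m i v) (X : ℂ ⊗[𝕜] E) :
    ℓ.liftBaseChange ℂ X = ∑ i, (m i).liftBaseChange ℂ X * c i := by
  induction X using TensorProduct.induction_on with
  | zero => simp
  | tmul a v =>
    simp only [LinearMap.liftBaseChange_tmul, h, smul_eq_mul, Finset.mul_sum]
    exact Finset.sum_congr rfl fun i _ => by ring
  | add X Y hX hY => simp only [map_add, hX, hY, add_mul, Finset.sum_add_distrib]

theorem fderiv_eq_sum (F : (Fin 4 → 𝕜) → ℂ) (z v : Fin 4 → 𝕜) :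
    fderiv 𝕜 F z v = ∑ i, fderiv 𝕜 F z (Pi.single i 1) * algebraMap 𝕜 ℂ (v i) := by
  conv_lhs => rw [← Finset.univ_sum_single v]
  rw [map_sum]
  refine Finset.sum_congr rfl fun i _ => ?_
  have : (Pi.single i (v i) : Fin 4 → 𝕜) = v i • Pi.single i (1 : 𝕜) := by
    ext j; simp [Pi.single_apply]
  rw [this, map_smul, Algebra.smul_def, mul_comm]

theorem diff_eq_sum {f : M → ℂ} (hf : IsAn 𝕜 f y) (hy : y ∈ (chartAt (Fin 4 → 𝕜) x₀).source)
    (v : T 𝕜 y) : diff 𝕜 f y v = ∑ i, pdv 𝕜 x₀ i f y * diff 𝕜 (coord 𝕜 x₀ i) y v := by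
  have hloc : MDifferentiableAt 𝓘(𝕜, Fin 4 → 𝕜) 𝓘(𝕜, Fin 4 → 𝕜) (loc 𝕜 x₀) y :=
    (contMDiffAt_loc hy).mdifferentiableAt (by simp)
  have key : ∀ {F : (Fin 4 → 𝕜) → ℂ} {g : M → ℂ}, DifferentiableAt 𝕜 F (loc 𝕜 x₀ y) →
      F ∘ loc 𝕜 x₀ =ᶠ[𝓝 y] g → ∀ v : T 𝕜 y, diff 𝕜 g y v = fderiv 𝕜 F (loc 𝕜 x₀ y)
        (mfderiv 𝓘(𝕜, Fin 4 → 𝕜) 𝓘(𝕜, Fin 4 → 𝕜) (loc 𝕜 x₀) y v) := by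
    intro F g hF hg v
    have h1 : mfderiv 𝓘(𝕜, Fin 4 → 𝕜) 𝓘(𝕜, ℂ) g y
        = mfderiv 𝓘(𝕜, Fin 4 → 𝕜) 𝓘(𝕜, ℂ) (F ∘ loc 𝕜 x₀) y := hg.symm.mfderiv_eq
    change mfderiv 𝓘(𝕜, Fin 4 → 𝕜) 𝓘(𝕜, ℂ) g y v = _
    rw [h1, mfderiv_comp y hF.mdifferentiableAt hloc, mfderiv_eq_fderiv]
    rfl
  rw [key (hf.pull hy).differentiableAt (push_pull hy f) v]
  refine (fderiv_eq_sum _ _ _).trans ?_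
  refine Finset.sum_congr rfl fun i _ => ?_
  have hc : (fun z => cproj 𝕜 i z + algebraMap 𝕜 ℂ (extChartAt 𝓘(𝕜, Fin 4 → 𝕜) x₀ x₀ i)) ∘ loc 𝕜 x₀
      = coord 𝕜 x₀ i := by
    funext z
    simp [cproj_apply, loc, coord]
  rw [key (F := fun z => cproj 𝕜 i z + algebraMap 𝕜 ℂ (extChartAt 𝓘(𝕜, Fin 4 → 𝕜) x₀ x₀ i))
    (by fun_prop) (by rw [hc]) v, fderiv_add_const]
  have : fderiv 𝕜 (fun z => cproj 𝕜 i z) (loc 𝕜 x₀ y) = cproj 𝕜 i := (cproj 𝕜 i).fderiv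
  rw [this]
  rfl

theorem dirDeriv_eq_sum (V : ∀ x : M, CT 𝕜 x) {f : M → ℂ} (hf : IsAn 𝕜 f y)
    (hy : y ∈ (chartAt (Fin 4 → 𝕜) x₀).source) :
    dirDeriv V f y = ∑ i, dirDeriv V (coord 𝕜 x₀ i) y * pdv 𝕜 x₀ i f y :=
  liftBaseChange_eq_sum (diff_eq_sum hf hy) (V y)

theorem IsAn.eventually {f : M → ℂ} (hf : IsAn 𝕜 f y) : ∀ᶠ z in 𝓝 y, IsAn 𝕜 f z :=
  have hy := mem_chart_source (Fin 4 → 𝕜) y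
  by
    filter_upwards [eventually_source hy, tendsto_loc hy (hf.pull hy).eventually_analyticAt]
      with z hz h1 using isAn_congr (push_pull hz f) (isAn_push hz h1)

theorem isVF_dirDeriv {V : ∀ x : M, CT 𝕜 x} {x : M}
    (hV : ∀ i, IsAn 𝕜 (dirDeriv V (coord 𝕜 x i)) x) : IsVF (𝕜 := 𝕜) (dirDeriv V) x :=
  ⟨x, mem_chart_source _ x, fun i => dirDeriv V (coord 𝕜 x i), hV, fun f hf => by
    filter_upwards [hf.eventually, eventually_source (mem_chart_source (Fin 4 → 𝕜) x)] with y h1 h2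
      using dirDeriv_eq_sum V h1 h2⟩

theorem isAn_coord (i : Fin 4) (hy : y ∈ (chartAt (Fin 4 → 𝕜) x₀).source) :
    IsAn 𝕜 (coord 𝕜 x₀ i) y := by
  have h1 := (isAn_cproj_loc (𝕜 := 𝕜) i hy).add
    (isAn_const (algebraMap 𝕜 ℂ (extChartAt 𝓘(𝕜, Fin 4 → 𝕜) x₀ x₀ i)) y)
  refine isAn_congr (.of_forall fun z => ?_) h1
  simp [cproj_apply, loc, coord]

theorem diff_coord_self (x : M) (i : Fin 4) (v : T 𝕜 x) :
    diff 𝕜 (coord 𝕜 x i) x v = algebraMap 𝕜 ℂ ((v : Fin 4 → 𝕜) i) := by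
  have hd : MDifferentiableAt 𝓘(𝕜, Fin 4 → 𝕜) 𝓘(𝕜, ℂ) (coord 𝕜 x i) x :=
    (isAn_coord i (mem_chart_source _ x)).mdifferentiableAt (by simp)
  refine (congrArg (fun L : (Fin 4 → 𝕜) →L[𝕜] ℂ => L v) hd.mfderiv).trans ?_
  have h1 : writtenInExtChartAt 𝓘(𝕜, Fin 4 → 𝕜) 𝓘(𝕜, ℂ) x (coord 𝕜 x i)
      =ᶠ[𝓝 (extChartAt 𝓘(𝕜, Fin 4 → 𝕜) x x)] fun z => cproj 𝕜 i z := by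
    filter_upwards [extChartAt_target_mem_nhds (I := 𝓘(𝕜, Fin 4 → 𝕜)) x] with z hz
    simp only [writtenInExtChartAt, extChartAt_model_space_eq_id, PartialEquiv.refl_coe, Function.comp,
      id, coord, cproj_apply]
    rw [(extChartAt 𝓘(𝕜, Fin 4 → 𝕜) x).right_inv hz]
  have h2 : Set.range 𝓘(𝕜, Fin 4 → 𝕜) = Set.univ := by simp
  have h3 : fderiv 𝕜 (fun z => cproj 𝕜 i z) (extChartAt 𝓘(𝕜, Fin 4 → 𝕜) x x) = cproj 𝕜 i :=
    (cproj 𝕜 i).fderiv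
  have h4 : fderivWithin 𝕜 (writtenInExtChartAt 𝓘(𝕜, Fin 4 → 𝕜) 𝓘(𝕜, ℂ) x (coord 𝕜 x i))
      (Set.range 𝓘(𝕜, Fin 4 → 𝕜)) (extChartAt 𝓘(𝕜, Fin 4 → 𝕜) x x) = cproj 𝕜 i := by
    rw [h2, fderivWithin_univ, h1.fderiv_eq, h3]
  exact congrArg (fun L : (Fin 4 → 𝕜) →L[𝕜] ℂ => L v) h4

/-- Expansion of a complex tangent vector in the coordinate vectors. -/
theorem ct_eq_sum (x : M) (X : CT 𝕜 x) :
    X = ∑ i, (diff 𝕜 (coord 𝕜 x i) x).liftBaseChange ℂ X ⊗ₜ[𝕜] coordVec x i := by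
  induction X using TensorProduct.induction_on with
  | zero => simp
  | tmul a v =>
    simp only [LinearMap.liftBaseChange_tmul, diff_coord_self, smul_eq_mul]
    have hv : v = ∑ i, (v : Fin 4 → 𝕜) i • (coordVec x i : T 𝕜 x) := by
      refine (Finset.univ_sum_single (v : Fin 4 → 𝕜)).symm.trans ?_
      refine Finset.sum_congr rfl fun i _ => ?_
      change (Pi.single i ((v : Fin 4 → 𝕜) i) : Fin 4 → 𝕜)
        = (v : Fin 4 → 𝕜) i • (Pi.single i (1 : 𝕜) : Fin 4 → 𝕜)
      ext j; simp [Pi.single_apply]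
    conv_lhs => rw [hv, TensorProduct.tmul_sum]
    refine Finset.sum_congr rfl fun i _ => ?_
    rw [TensorProduct.tmul_smul, TensorProduct.smul_tmul', Algebra.smul_def, mul_comm]
  | add X Y hX hY =>
    conv_lhs => rw [hX, hY]
    simp only [map_add, TensorProduct.add_tmul, Finset.sum_add_distrib]

end GermModel
end ConformalHH

namespace ConformalHH

/-! ### Regular points of a spin geometry -/

section RegularPoints

set_option linter.unusedSectionVars false

open Filter Topology

variable {𝕜 : Type*} [RCLike 𝕜] [NormedAlgebra 𝕜 ℂ] {M : Type*} [TopologicalSpace M]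
  [ChartedSpace (Fin 4 → 𝕜) M]

theorem sum_eta_mul_eta (f : Idx → ℂ) (c : Idx) : ∑ d, eta c d * ∑ k, eta d k * f k = f c := by
  revert c
  rw [forall_idx]
  simp [sum_idx, eta, eps]

theorem lieBracket_swap (V W : ∀ x : M, CT 𝕜 x) (x : M) : lieBracket V W x = -lieBracket W V x := by
  simp only [lieBracket, ← Finset.sum_neg_distrib, ← TensorProduct.neg_tmul, neg_sub]

namespace SpinGeometry

/-- `D` is regular in a neighbourhood of `x`. -/
def IsRegularAt (D : SpinGeometry 𝕜 M) (x : M) : Prop := ∃ U, IsOpen U ∧ x ∈ U ∧ D.IsRegularOn U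

variable {D : SpinGeometry 𝕜 M} {x : M}

theorem IsRegularAt.eventually (h : D.IsRegularAt x) : ∀ᶠ y in 𝓝 x, D.IsRegularAt y := by
  obtain ⟨U, hU, hx, hD⟩ := h
  filter_upwards [hU.mem_nhds hx] with y hy using ⟨U, hU, hy, hD⟩

theorem IsRegularAt.isAn_frame (h : D.IsRegularAt x) (a : Idx) (i : Fin 4) :
    IsAn 𝕜 (dirDeriv (D.frame a) (coord 𝕜 x i)) x := by
  obtain ⟨U, hU, hx, hD⟩ := h
  exact hD.analytic_frame a x hx i

theorem IsRegularAt.isAn_o (h : D.IsRegularAt x) (A : Fin 2) : IsAn 𝕜 (D.o A) x := by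
  obtain ⟨U, hU, hx, hD⟩ := h
  exact (hD.analytic_o A).contMDiffAt (hU.mem_nhds hx)

theorem IsRegularAt.isAn_iota (h : D.IsRegularAt x) (A : Fin 2) : IsAn 𝕜 (D.iota A) x := by
  obtain ⟨U, hU, hx, hD⟩ := h
  exact (hD.analytic_iota A).contMDiffAt (hU.mem_nhds hx)

theorem IsRegularAt.null_tetrad (h : D.IsRegularAt x) (a b : Idx) :
    D.metricC x (D.frame a x) (D.frame b x) = eta a b := by
  obtain ⟨U, hU, hx, hD⟩ := h
  exact hD.null_tetrad x hx a b

theorem IsRegularAt.normalised (h : D.IsRegularAt x) :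
    D.o 0 x * D.iota 1 x - D.o 1 x * D.iota 0 x = 1 := by
  obtain ⟨U, hU, hx, hD⟩ := h
  have := hD.normalised x hx
  simp [Fin.sum_univ_two, eps] at this
  linear_combination this

variable [IsManifold 𝓘(𝕜, Fin 4 → 𝕜) ω M]

theorem IsRegularAt.isVF (h : D.IsRegularAt x) (a : Idx) : IsVF (𝕜 := 𝕜) (D.der a) x :=
  isVF_dirDeriv (h.isAn_frame a)

/-- The components of the frame in the preferred chart. -/
def frameMat (D : SpinGeometry 𝕜 M) (x y : M) : Matrix Idx (Fin 4) ℂ :=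
  fun a i => dirDeriv (D.frame a) (coord 𝕜 x i) y

theorem frame_eq_sum (D : SpinGeometry 𝕜 M) (x : M) (a : Idx) :
    D.frame a x = ∑ i, frameMat D x x a i • ((1 : ℂ) ⊗ₜ[𝕜] coordVec x i) := by
  conv_lhs => rw [ct_eq_sum x (D.frame a x)]
  refine Finset.sum_congr rfl fun i _ => ?_
  rw [TensorProduct.smul_tmul', smul_eq_mul, mul_one]
  rfl

theorem IsRegularAt.exists_inv (h : D.IsRegularAt x) : ∃ B : Matrix (Fin 4) Idx ℂ,
    frameMat D x x * B = 1 ∧ B * frameMat D x x = 1 := by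
  set E := frameMat D x x
  set G : Matrix (Fin 4) (Fin 4) ℂ := fun i j => D.metricC x ((1 : ℂ) ⊗ₜ[𝕜] coordVec x i)
    ((1 : ℂ) ⊗ₜ[𝕜] coordVec x j) with hG
  have h1 : E * G * E.transpose = Matrix.of eta := by
    ext a b
    rw [Matrix.of_apply, ← h.null_tetrad a b, frame_eq_sum D x a, frame_eq_sum D x b]
    have h2 : D.metricC x (∑ i, E a i • ((1 : ℂ) ⊗ₜ[𝕜] coordVec x i))
        (∑ i, E b i • ((1 : ℂ) ⊗ₜ[𝕜] coordVec x i)) = ∑ i, ∑ j, E a i * G i j * E b j := by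
      simp only [map_sum, map_smul, LinearMap.sum_apply, LinearMap.smul_apply, smul_eq_mul, hG,
        Finset.mul_sum]
      rw [Finset.sum_comm]
      exact Finset.sum_congr rfl fun i _ => Finset.sum_congr rfl fun j _ => by ring
    refine Eq.trans ?_ h2.symm
    rw [Matrix.mul_apply, Finset.sum_comm]
    refine Finset.sum_congr rfl fun j _ => ?_
    rw [Matrix.mul_apply, Finset.sum_mul]
    rfl
  have h2 : (Matrix.of eta : Matrix Idx Idx ℂ) * Matrix.of eta = 1 := by
    ext a b
    have := sum_eta_mul_eta (fun k => if k = b then 1 else 0) a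
    simp only [mul_ite, mul_one, mul_zero, Finset.sum_ite_eq', Finset.mem_univ, if_true] at this
    rw [Matrix.mul_apply, Matrix.one_apply]
    exact this
  refine ⟨G * E.transpose * Matrix.of eta, ?_, ?_⟩
  · rw [← Matrix.mul_assoc, ← Matrix.mul_assoc, h1, h2]
  · refine (Matrix.mul_eq_one_comm_of_card_eq Idx (Fin 4) ℂ rfl).1 ?_
    rw [← Matrix.mul_assoc, ← Matrix.mul_assoc, h1, h2]

/-- Expansion of a vector in the null tetrad. -/
theorem IsRegularAt.eq_sum (h : D.IsRegularAt x) (X : CT 𝕜 x) :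
    X = ∑ c, (∑ d, eta c d * D.metricC x X (D.frame d x)) • D.frame c x := by
  obtain ⟨B, -, hB⟩ := h.exists_inv
  have h1 : ∃ k : Idx → ℂ, X = ∑ c, k c • D.frame c x := by
    refine ⟨fun c => ∑ i, (diff 𝕜 (coord 𝕜 x i) x).liftBaseChange ℂ X * B i c, ?_⟩
    have h2 : ∀ c, (∑ i, (diff 𝕜 (coord 𝕜 x i) x).liftBaseChange ℂ X * B i c) • D.frame c x
        = ∑ i, ∑ j, ((diff 𝕜 (coord 𝕜 x i) x).liftBaseChange ℂ X * (B i c * frameMat D x x c j)) •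
          ((1 : ℂ) ⊗ₜ[𝕜] coordVec x j) := by
      intro c
      rw [frame_eq_sum D x c, Finset.sum_smul]
      refine Finset.sum_congr rfl fun i _ => ?_
      rw [Finset.smul_sum]
      exact Finset.sum_congr rfl fun j _ => by rw [smul_smul, mul_assoc]
    simp only [h2]
    rw [Finset.sum_comm]
    conv_lhs => rw [ct_eq_sum x X]
    refine Finset.sum_congr rfl fun i _ => ?_
    rw [Finset.sum_comm]
    simp only [← Finset.sum_smul, ← Finset.mul_sum]
    have h3 : ∀ j, ∑ c, B i c * frameMat D x x c j = (1 : Matrix (Fin 4) (Fin 4) ℂ) i j := fun j => by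
      rw [← hB, Matrix.mul_apply]
    simp only [h3, Matrix.one_apply, mul_ite, mul_one, mul_zero, ite_smul, zero_smul,
      Finset.sum_ite_eq, Finset.mem_univ, if_true]
    rw [TensorProduct.smul_tmul', smul_eq_mul, mul_one]
  obtain ⟨k, hk⟩ := h1
  have h2 : ∀ d, D.metricC x X (D.frame d x) = ∑ c, eta d c * k c := by
    intro d
    rw [hk]
    simp only [map_sum, map_smul, LinearMap.sum_apply, LinearMap.smul_apply, h.null_tetrad, smul_eq_mul]
    refine Finset.sum_congr rfl fun c _ => ?_
    have : eta c d = eta d c := by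
      simpa [etaR] using etaR_symm (R := ℂ) c d
    rw [this, mul_comm]
  simp only [h2, sum_eta_mul_eta]
  exact hk

end SpinGeometry

variable [IsManifold 𝓘(𝕜, Fin 4 → 𝕜) ω M] {x : M}

theorem germModel_der_t {V : ∀ x : M, CT 𝕜 x} (hV : ∀ᶠ y in 𝓝 x, IsVF (𝕜 := 𝕜) (dirDeriv V) y)
    (i : Fin 4) : Rep (anDer (dirDeriv V) hV ((germModel x).t i)) (dirDeriv V (coord 𝕜 x i)) := by
  have h1 : Rep ((germModel x).t i) (fun z => cproj 𝕜 i (loc 𝕜 x z)) := rfl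
  refine (h1.anDer hV).congr ?_
  filter_upwards [hV, eventually_source (mem_chart_source (Fin 4 → 𝕜) x)] with y hy hs
  have h2 : coord 𝕜 x i = fun z => cproj 𝕜 i (loc 𝕜 x z)
      + algebraMap 𝕜 ℂ (extChartAt 𝓘(𝕜, Fin 4 → 𝕜) x x i) := by
    funext z
    simp [cproj_apply, loc, coord]
  rw [h2, hy.add (isAn_cproj_loc i hs) (isAn_const _ _), hy.const, add_zero]

theorem germModel_mem {V : ∀ x : M, CT 𝕜 x} (hV : ∀ᶠ y in 𝓝 x, IsVF (𝕜 := 𝕜) (dirDeriv V) y) :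
    (germModel x).Mem (anDer (dirDeriv V) hV) := by
  intro a
  obtain ⟨f, hf⟩ := exists_rep a
  refine (hf.anDer hV).ext (Rep.sum fun i => (germModel_der_t hV i).mul
    (hf.anDer (eventually_isVF_pdv x i))) ?_
  filter_upwards [hf.isAn, eventually_source (mem_chart_source (Fin 4 → 𝕜) x)] with y h1 h2
    using dirDeriv_eq_sum V h1 h2

/-- The commutator of two vector fields is the derivative along the Lie bracket. -/
theorem dirDeriv_lieBracket {V W : ∀ x : M, CT 𝕜 x}
    (hV : ∀ᶠ y in 𝓝 x, IsVF (𝕜 := 𝕜) (dirDeriv V) y)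
    (hW : ∀ᶠ y in 𝓝 x, IsVF (𝕜 := 𝕜) (dirDeriv W) y) {f : M → ℂ} (hf : IsAn 𝕜 f x) :
    dirDeriv V (dirDeriv W f) x - dirDeriv W (dirDeriv V f) x = dirDeriv (lieBracket V W) f x := by
  have ha : Rep (toAn f hf.eventually : AnR 𝕜 (𝓝 x)) f := rep_toAn _ _
  set v := anDer (dirDeriv V) hV
  set w := anDer (dirDeriv W) hW
  have h1 := (germModel_mem hV).bracket (germModel_mem hW) (toAn f hf.eventually)
  simp only [Derivation.commutator_apply] at h1
  have h2 := ((ha.anDer hW).anDer hV).sub ((ha.anDer hV).anDer hW)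
  have h3 := Rep.sum (s := Finset.univ) fun i =>
    ((((germModel_der_t hW i).anDer hV).sub ((germModel_der_t hV i).anDer hW)).mul
      (ha.anDer (eventually_isVF_pdv x i)))
  have h4 : Rep _ _ := h3
  rw [show ∑ i, (v (w ((germModel x).t i)) - w (v ((germModel x).t i)))
      * anDer (pdv 𝕜 x i) (eventually_isVF_pdv x i) (toAn f hf.eventually)
      = v (w (toAn f hf.eventually)) - w (v (toAn f hf.eventually)) from h1.symm] at h4
  have h5 := (h2.eventuallyEq h4).self_of_nhds
  refine h5.trans ?_
  rw [dirDeriv, lieBracket, map_sum]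
  refine Finset.sum_congr rfl fun i _ => ?_
  rw [LinearMap.liftBaseChange_tmul, smul_eq_mul]
  congr 1
  rw [diff_eq_sum hf (mem_chart_source _ x)]
  have hδ : ∀ j, diff 𝕜 (coord 𝕜 x j) x (coordVec x i) = if j = i then 1 else 0 := fun j => by
    refine (diff_coord_self x j _).trans ?_
    change algebraMap 𝕜 ℂ ((Pi.single i 1 : Fin 4 → 𝕜) j) = _
    rw [Pi.single_apply, apply_ite (algebraMap 𝕜 ℂ), map_one, map_zero]
  simp [hδ]

namespace SpinGeometry

variable {D : SpinGeometry 𝕜 M}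

theorem IsRegularAt.comm (h : D.IsRegularAt x) (a b : Idx) {f : M → ℂ} (hf : IsAn 𝕜 f x) :
    D.der a (D.der b f) x - D.der b (D.der a f) x = ∑ c, D.struct a b c x * D.der c f x := by
  have hV : ∀ a, ∀ᶠ y in 𝓝 x, IsVF (𝕜 := 𝕜) (dirDeriv (D.frame a)) y := fun a => by
    filter_upwards [h.eventually] with y hy using hy.isVF a
  refine (dirDeriv_lieBracket (hV a) (hV b) hf).trans ?_
  rw [dirDeriv, h.eq_sum (lieBracket (D.frame a) (D.frame b) x), map_sum]
  exact Finset.sum_congr rfl fun c _ => by rw [map_smul]; rfl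

theorem structLow_swap (D : SpinGeometry 𝕜 M) (a b c : Idx) (x : M) :
    D.structLow a b c x = -D.structLow b a c x := by
  rw [structLow, structLow, lieBracket_swap, map_neg, LinearMap.neg_apply]

/-- The structure functions are analytic. -/
theorem IsRegularAt.isAn_structLow (h : D.IsRegularAt x) (a b c : Idx) :
    IsAn 𝕜 (D.structLow a b c) x := by
  have hx := mem_chart_source (Fin 4 → 𝕜) x
  have hE : ∀ a i, ∀ᶠ y in 𝓝 x, IsAn 𝕜 (dirDeriv (D.frame a) (coord 𝕜 x i)) y := fun a i =>
    (h.isAn_frame a i).eventually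
  set E : Matrix Idx (Fin 4) (AnR 𝕜 (𝓝 x)) := fun a i => toAn _ (hE a i) with hEdef
  obtain ⟨B, hB, hB'⟩ := h.exists_inv
  set B' : Matrix (Fin 4) Idx (AnR 𝕜 (𝓝 x)) := B.map (algebraMap ℂ _) with hB'def
  have hu : IsUnit (E * B').det := by
    refine (germModel x).isUnit_of_ev _ ?_
    have h1 : (germModel (𝕜 := 𝕜) x).ev (E * B').det
        = ((E * B').map (germModel (𝕜 := 𝕜) x).ev).det :=
      (germModel (𝕜 := 𝕜) x).ev.toRingHom.map_det (E * B')
    have h2 : (E * B').map (germModel (𝕜 := 𝕜) x).ev = frameMat D x x * B := by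
      ext a c
      simp only [Matrix.map_apply, Matrix.mul_apply, map_sum, map_mul, hB'def, AlgHom.commutes]
      rfl
    rw [h1, h2, hB, Matrix.det_one]
    exact one_ne_zero
  set N := B' * (E * B')⁻¹ with hN
  have hEN : E * N = 1 := by
    rw [hN, ← Matrix.mul_assoc, Matrix.mul_nonsing_inv _ hu]
  choose n hn using fun i c => exists_rep (N i c)
  have hEn : ∀ k c, ∀ᶠ y in 𝓝 x, ∑ i, dirDeriv (D.frame k) (coord 𝕜 x i) y * n i c y
      = if k = c then 1 else 0 := by
    intro k c
    have h1 := Rep.sum (s := Finset.univ) fun i => (rep_toAn _ (hE k i)).mul (hn i c)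
    have h2 : Rep (if k = c then 1 else 0 : AnR 𝕜 (𝓝 x)) (fun _ => if k = c then 1 else 0) := by
      split_ifs
      exacts [.one, .zero]
    have h3 : ∑ i, toAn _ (hE k i) * N i c = if k = c then 1 else 0 := by
      rw [← Matrix.one_apply, ← hEN, Matrix.mul_apply]
    rw [h3] at h1
    exact h1.eventuallyEq h2
  have hstr : ∀ c, IsAn 𝕜 (D.struct a b c) x := by
    intro c
    have h1 : IsAn 𝕜 (fun y => ∑ i, (D.der a (D.der b (coord 𝕜 x i)) y
        + -D.der b (D.der a (coord 𝕜 x i)) y) * n i c y) x :=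
      IsAn.sum fun i _ => (((h.isVF a).isAn ((h.isVF b).isAn (isAn_coord i hx))).add
        ((h.isVF b).isAn ((h.isVF a).isAn (isAn_coord i hx))).neg).mul (hn i c).isAn.self_of_nhds
    refine isAn_congr ?_ h1
    filter_upwards [h.eventually, eventually_source hx, eventually_all.2 fun k => hEn k c] with y hy hs he
    have h2 : ∀ i, D.der a (D.der b (coord 𝕜 x i)) y + -D.der b (D.der a (coord 𝕜 x i)) y
        = ∑ k, D.struct a b k y * dirDeriv (D.frame k) (coord 𝕜 x i) y := fun i => by
      rw [← sub_eq_add_neg]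
      exact hy.comm a b (isAn_coord i hs)
    simp only [h2, Finset.sum_mul]
    rw [Finset.sum_comm]
    simp only [mul_assoc, ← Finset.mul_sum, he]
    simp
  have h1 : D.structLow a b c = fun y => ∑ d, eta c d * D.struct a b d y := by
    funext y
    exact (sum_eta_mul_eta (fun k => D.structLow a b k y) c).symm
  rw [h1]
  exact IsAn.sum fun d _ => (isAn_const _ _).mul (hstr d)

end SpinGeometry
end RegularPoints
end ConformalHH

namespace ConformalHH

/-! ### Geometric operators on germs -/

section Translation

set_option linter.unusedSectionVars false

open Filter Topology

section Rep

variable {𝕜 : Type*} [RCLike 𝕜] [NormedAlgebra 𝕜 ℂ] {M : Type*} [TopologicalSpace M]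
  [ChartedSpace (Fin 4 → 𝕜) M] {l : Filter M}

theorem Rep.of_eq {a : AnR 𝕜 l} {f g : M → ℂ} (ha : Rep a f) (h : ∀ x, f x = g x) : Rep a g :=
  ha.congr (.of_forall h)

theorem Rep.of_ring_eq {a b : AnR 𝕜 l} {f : M → ℂ} (ha : Rep a f) (h : b = a) : Rep b f := h ▸ ha

theorem Rep.delta {I : Type} [DecidableEq I] (i j : I) :
    Rep ((1 : Matrix I I (AnR 𝕜 l)) i j) (fun _ => delta i j) := by
  rw [Matrix.one_apply]
  unfold ConformalHH.delta
  split_ifs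
  exacts [.one, .zero]

theorem Rep.intCast (n : ℤ) : Rep (n : AnR 𝕜 l) (fun _ => (n : ℂ)) := by
  rw [← map_intCast (algebraMap ℂ (AnR 𝕜 l))]
  exact .const _

theorem Rep.ofNat (n : ℕ) [n.AtLeastTwo] :
    Rep (OfNat.ofNat n : AnR 𝕜 l) (fun _ => (OfNat.ofNat n : ℂ)) := by
  rw [← map_ofNat (algebraMap ℂ (AnR 𝕜 l))]
  exact .const _

end Rep

theorem curvR_apply {R : Type*} [CommRing R] [Algebra ℂ R] (e : Idx → Derivation ℂ R R)
    (c : Idx → Idx → Idx → R) (G : Idx → Matrix Idx Idx R) (a b i j : Idx) :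
    curvR e c G a b i j = e a (G b i j) - e b (G a i j)
      + ∑ k, (G a k j * G b i k - G b k j * G a i k - c a b k * G k i j) := by
  simp only [curvR, Matrix.sub_apply, Matrix.add_apply, Matrix.mul_apply, Matrix.map_apply,
    Matrix.sum_apply, Matrix.smul_apply, smul_eq_mul, Finset.sum_sub_distrib]
  simp only [mul_comm (G a _ j), mul_comm (G b _ j)]
  ring

namespace SpinGeometry

variable {𝕜 : Type*} [RCLike 𝕜] [NormedAlgebra 𝕜 ℂ] {M : Type*} [TopologicalSpace M]
  [ChartedSpace (Fin 4 → 𝕜) M]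

theorem weylConn_zero (D : SpinGeometry 𝕜 M) (a b c : Idx) :
    D.weylConn (fun _ _ => 0) a b c = D.leviCivita a b c := by
  funext x
  simp [weylConn]

variable [IsManifold 𝓘(𝕜, Fin 4 → 𝕜) ω M] {l : Filter M} [IsOpenFilter l] {D : SpinGeometry 𝕜 M}
  (h : ∀ᶠ x in l, D.IsRegularAt x)

/-- The null tetrad, as derivations of the ring of germs along `l`. -/
def derR (a : Idx) : Derivation ℂ (AnR 𝕜 l) (AnR 𝕜 l) := anDer (D.der a) (h.mono fun _ hx => hx.isVF a)

/-- The germs of the structure functions with lowered indices. -/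
def strLowR (a b c : Idx) : AnR 𝕜 l := toAn (D.structLow a b c) (h.mono fun _ hx => hx.isAn_structLow a b c)

/-- The germs of the components of `o`. -/
def oR (A : Fin 2) : AnR 𝕜 l := toAn (D.o A) (h.mono fun _ hx => hx.isAn_o A)

/-- The germs of the components of `ι`. -/
def iotaR (A : Fin 2) : AnR 𝕜 l := toAn (D.iota A) (h.mono fun _ hx => hx.isAn_iota A)

theorem rep_derR {f : AnR 𝕜 l} {g : M → ℂ} (hf : Rep f g) (a : Idx) : Rep (derR h a f) (D.der a g) :=
  hf.anDer _

theorem rep_strLowR (a b c : Idx) : Rep (strLowR h a b c) (D.structLow a b c) := rep_toAn _ _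

theorem rep_oR (A : Fin 2) : Rep (oR h A) (D.o A) := rep_toAn _ _

theorem rep_iotaR (A : Fin 2) : Rep (iotaR h A) (D.iota A) := rep_toAn _ _

theorem rep_strR (a b c : Idx) : Rep (strR (strLowR h) a b c) (D.struct a b c) :=
  Rep.sum fun d => (Rep.const _).mul (rep_strLowR h a b d)

theorem strLowR_swap (a b c : Idx) : strLowR h a b c = -strLowR h b a c :=
  (rep_strLowR h a b c).ext (rep_strLowR h b a c).neg (.of_forall (D.structLow_swap a b c))

theorem derR_comm (a b : Idx) (f : AnR 𝕜 l) : derR h a (derR h b f) - derR h b (derR h a f)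
    = ∑ c, strR (strLowR h) a b c * derR h c f := by
  obtain ⟨g, hg⟩ := exists_rep f
  refine ((rep_derR h (rep_derR h hg b) a).sub (rep_derR h (rep_derR h hg a) b)).ext
    (Rep.sum fun c => (rep_strR h a b c).mul (rep_derR h hg c)) ?_
  filter_upwards [h, hg.isAn] with x h1 h2 using h1.comm a b h2

theorem oR_mul_iotaR : oR h 0 * iotaR h 1 - oR h 1 * iotaR h 0 = 1 :=
  (((rep_oR h 0).mul (rep_iotaR h 1)).sub ((rep_oR h 1).mul (rep_iotaR h 0))).ext .one
    (h.mono fun _ hx => hx.normalised)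

/-! #### Connections and curvature -/

theorem rep_lcR (a b c : Idx) : Rep (lcR (strLowR h) a b c) (D.leviCivita a b c) :=
  Rep.sum fun d => (Rep.const _).mul ((Rep.const _).mul
    (((rep_strLowR h a b d).sub (rep_strLowR h b d a)).add (rep_strLowR h d a b)))

variable {w : Idx → AnR 𝕜 l} {v : Idx → M → ℂ} (hw : ∀ a, Rep (w a) (v a))

include hw in
theorem rep_wcR (a b c : Idx) : Rep (wcR (strLowR h) w a b c) (D.weylConn v a b c) :=
  ((((rep_lcR h a b c).add ((hw a).mul (.delta b c))).add ((hw b).mul (.delta a c))).sub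
    ((Rep.sum fun d => (Rep.const _).mul (hw d)).mul (Rep.const _)))

include hw in
theorem rep_curvR (a b c d : Idx) :
    Rep (curvR (derR h) (strR (strLowR h)) (wcR (strLowR h) w) a b c d) (D.curv v a b c d) := by
  rw [curvR_apply]
  exact ((rep_derR h (rep_wcR h hw b c d) a).sub (rep_derR h (rep_wcR h hw a c d) b)).add
    (Rep.sum fun k => ((((rep_wcR h hw a k d).mul (rep_wcR h hw b c k))).sub
      ((rep_wcR h hw b k d).mul (rep_wcR h hw a c k))).sub
      ((rep_strR h a b k).mul (rep_wcR h hw k c d)))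

include hw in
theorem rep_ricciR (a c : Idx) :
    Rep (ricciR (curvR (derR h) (strR (strLowR h)) (wcR (strLowR h) w)) a c) (D.ricci v a c) :=
  Rep.sum fun b => rep_curvR h hw a b c b

include hw in
theorem rep_scalR :
    Rep (scalR (curvR (derR h) (strR (strLowR h)) (wcR (strLowR h) w))) (D.scalarCurv v) :=
  Rep.sum fun a => Rep.sum fun c => (Rep.const _).mul (rep_ricciR h hw a c)

theorem rep_symR_sdPartR (I : Fin 4 → Fin 2) :
    Rep (symR (sdPartR (curvR (derR h) (strR (strLowR h)) (wcR (strLowR h) 0))) I) (D.weylSD I) := by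
  refine (Rep.const _).mul (Rep.sum fun σ => (Rep.const _).mul (Rep.sum fun A => Rep.sum fun B =>
    Rep.sum fun C => Rep.sum fun E => ((Rep.const _).mul (Rep.const _)).mul ?_))
  rw [Matrix.mul_apply]
  exact Rep.sum fun k => (rep_curvR h (fun _ => .zero) _ _ _ _).mul (Rep.const _)

include hw in
theorem rep_spinR (a : Idx) (B C : Fin 2) :
    Rep (spinR (wcR (strLowR h) w) w a B C) (D.spinConn v a B C) :=
  (Rep.const _).mul ((Rep.sum fun _ => rep_wcR h hw _ _ _).sub ((hw a).mul (.delta B C)))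

include hw in
theorem rep_spinR' (a : Idx) (B C : Fin 2) :
    Rep (spinR' (wcR (strLowR h) w) w a B C) (D.spinConn' v a B C) :=
  (Rep.const _).mul ((Rep.sum fun _ => rep_wcR h hw _ _ _).sub ((hw a).mul (.delta B C)))

/-! #### The almost-complex structure -/

theorem rep_oLow (B : Fin 2) : Rep (∑ A, oR h A * epsR (AnR 𝕜 l) A B) (D.oLow B) :=
  Rep.sum fun A => (rep_oR h A).mul (.const _)

theorem rep_iotaLow (B : Fin 2) : Rep (∑ A, iotaR h A * epsR (AnR 𝕜 l) A B) (D.iotaLow B) :=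
  Rep.sum fun A => (rep_iotaR h A).mul (.const _)

theorem rep_jR (a b : Idx) : Rep (jR (oR h) (iotaR h) b a) (D.J a b) := by
  refine Rep.of_eq (((Rep.const _).mul (((rep_oR h a.1).mul (rep_iotaLow h b.1)).add
    ((rep_iotaR h a.1).mul (rep_oLow h b.1)))).mul (.delta b.2 a.2)) fun x => ?_
  have : delta b.2 a.2 = delta a.2 b.2 := by simp [delta, eq_comm]
  rw [this]
  rfl

theorem rep_leeForm (a : Idx) :
    Rep (leeForm (derR h) (strLowR h) (oR h) (iotaR h) a) (D.lee a) := by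
  have hG : ∀ a b c, Rep (wcR (strLowR h) 0 a b c) (D.leviCivita a b c) := fun a b c => by
    rw [← weylConn_zero]
    exact rep_wcR h (fun _ => .zero) a b c
  exact (Rep.const _).neg.mul (Rep.sum fun b => Rep.sum fun c => (rep_jR h b c).mul
    ((rep_derR h (rep_jR h c a) b).add (Rep.sum fun d =>
      ((hG b d c).mul (rep_jR h d a)).sub ((hG b a d).mul (rep_jR h c d)))))

theorem rep_pForm (a : Idx) :
    Rep (pForm (derR h) (strLowR h) (oR h) (iotaR h) a) (D.P a) :=
  Rep.sum fun B => (rep_iotaLow h B).mul ((rep_derR h (rep_oR h B) a).add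
    (Rep.sum fun C => (rep_spinR h (rep_leeForm h) a C B).mul (rep_oR h C)))

/-! #### The operators of the connection `𝒞` -/

theorem rep_weight (p q : ℤ) (a : Idx) :
    Rep ((q : AnR 𝕜 l) * leeForm (derR h) (strLowR h) (oR h) (iotaR h) a
      + (p : AnR 𝕜 l) * pForm (derR h) (strLowR h) (oR h) (iotaR h) a)
      (fun x => (q : ℂ) * D.lee a x + (p : ℂ) * D.P a x) :=
  ((Rep.intCast q).mul (rep_leeForm h a)).add ((Rep.intCast p).mul (rep_pForm h a))

theorem rep_cT (p q : ℤ) {n : ℕ} {ψ : (Fin n → Fin 2) → AnR 𝕜 l} {χ : Spinor M 0 n}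
    (hψ : ∀ J, Rep (ψ J) (χ ![] J)) (J : Fin (n + 1) → Fin 2) :
    Rep (cT (derR h) (strLowR h) (oR h) (iotaR h) p q ψ J) (D.connT p q χ ![] J) := by
  refine Rep.of_eq (Rep.sum fun A => (rep_oR h A).mul (((rep_derR h (hψ (Fin.tail J)) (A, J 0)).sub
    (Rep.sum fun k => Rep.sum fun B => (rep_spinR' h (rep_leeForm h) (A, J 0) (Fin.tail J k) B).mul
      (hψ (Function.update (Fin.tail J) k B)))).add
    ((rep_weight h p q (A, J 0)).mul (hψ (Fin.tail J))))) fun x => ?_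
  simp [connT, conn, nabla]

theorem rep_cT_scalar (p q : ℤ) {f : AnR 𝕜 l} {g : M → ℂ} (hf : Rep f g) (J : Fin 1 → Fin 2) :
    Rep (cT (derR h) (strLowR h) (oR h) (iotaR h) p q (fun _ : Fin 0 → Fin 2 => f) J)
      (D.connT1 p q g ![] J) :=
  rep_cT h p q (χ := scalar g) (fun _ => hf) J

theorem rep_boxR (p q : ℤ) {f : AnR 𝕜 l} {g : M → ℂ} (hf : Rep f g) :
    Rep (boxR (derR h)
      (spinR (wcR (strLowR h) (leeForm (derR h) (strLowR h) (oR h) (iotaR h)))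
        (leeForm (derR h) (strLowR h) (oR h) (iotaR h)))
      (spinR' (wcR (strLowR h) (leeForm (derR h) (strLowR h) (oR h) (iotaR h)))
        (leeForm (derR h) (strLowR h) (oR h) (iotaR h)))
      (leeForm (derR h) (strLowR h) (oR h) (iotaR h)) (pForm (derR h) (strLowR h) (oR h) (iotaR h))
      p q f) (D.box p q g) := by
  have h1 : ∀ a, Rep (derR h a f + ((q : AnR 𝕜 l) * leeForm (derR h) (strLowR h) (oR h) (iotaR h) a
      + (p : AnR 𝕜 l) * pForm (derR h) (strLowR h) (oR h) (iotaR h) a) * f)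
      (D.conn p q a (scalar g) ![] ![]) := fun a => by
    refine Rep.of_eq ((rep_derR h hf a).add ((rep_weight h p q a).mul hf)) fun x => ?_
    simp [conn, nabla, scalar]
  refine Rep.of_eq (Rep.sum fun a => Rep.sum fun b => (Rep.const (eta a b)).mul
    ((((rep_derR h (h1 b) a).sub (Rep.sum fun B => (rep_spinR h (rep_leeForm h) a b.1 B).mul
      (h1 (B, b.2)))).sub (Rep.sum fun B => (rep_spinR' h (rep_leeForm h) a b.2 B).mul
      (h1 (b.1, B)))).add ((rep_weight h p q a).mul (h1 b)))) fun x => ?_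
  refine Finset.sum_congr rfl fun a _ => Finset.sum_congr rfl fun b _ => ?_
  conv_rhs => rw [conn, nabla]
  simp

/-- The conclusion, translated from the ring of analytic functions on an open set. -/
theorem isHHPotentialOn_of_ring (V : TopologicalSpace.Opens M)
    (h : ∀ᶠ x in 𝓟 (V : Set M), D.IsRegularAt x) {a b c : AnR 𝕜 (𝓟 (V : Set M))} {Ω Φ K : M → ℂ}
    (ha : Rep a Ω) (hb : Rep b Φ) (hc : Rep c K)
    (H : IsHHPotentialR (derR h) (strLowR h) (oR h) (iotaR h) a b c) : D.IsHHPotentialOn Ω Φ K V := by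
  have r2 : ∀ {f : AnR 𝕜 (𝓟 (V : Set M))} {g : M → ℂ} (_ : Rep f g) (q : ℤ) (J), Rep
      (cT (derR h) (strLowR h) (oR h) (iotaR h) (-4 + 1) q
        (cT (derR h) (strLowR h) (oR h) (iotaR h) (-4) q fun _ : Fin 0 → Fin 2 => f) J)
      (D.connT2 (-4) q g ![] J) := fun hf q J =>
    rep_cT h (-4 + 1) q (rep_cT_scalar h (-4) q hf) J
  have r3 : ∀ {f : AnR 𝕜 (𝓟 (V : Set M))} {g : M → ℂ} (_ : Rep f g) (q : ℤ) (J), Rep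
      (cT (derR h) (strLowR h) (oR h) (iotaR h) (-4 + 2) q
        (cT (derR h) (strLowR h) (oR h) (iotaR h) (-4 + 1) q
        (cT (derR h) (strLowR h) (oR h) (iotaR h) (-4) q fun _ : Fin 0 → Fin 2 => f)) J)
      (D.connT3 (-4) q g ![] J) := fun hf q J => rep_cT h (-4 + 2) q (r2 hf q) J
  refine ⟨fun x hx I => ?_, fun x hx => ?_, fun x hx I => ?_⟩
  · have h1 := rep_symR_sdPartR h I
    rw [H.weyl_eq I] at h1
    exact ((ha.mul (rep_cT h (-4 + 3) (-1) (r3 hb (-1)) I)).eventuallyEq h1).symm hx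
  · have h1 := (((rep_boxR h (-4) (-1) hb).add ((((Rep.ofNat 3).mul (Rep.const (1 / 2))).mul
      (rep_scalR h (rep_leeForm h))).mul hb)).add (ha.mul (Rep.sum (s := Finset.univ) fun A =>
      Rep.sum (s := Finset.univ) fun B => (r2 hb (-1) ![A, B]).mul (Rep.sum (s := Finset.univ) fun C =>
      Rep.sum (s := Finset.univ) fun E =>
      ((Rep.const (eps A C)).mul (Rep.const (eps B E))).mul (r2 hb (-1) ![C, E]))))).sub
      ((Rep.ofNat 4).mul (Rep.sum (s := Finset.univ) fun A => Rep.sum (s := Finset.univ) fun B =>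
        ((Rep.sum (s := Finset.univ) fun C => (Rep.const (eps A C)).mul (rep_cT_scalar h 0 1 ha ![C])).mul
        (Rep.sum (s := Finset.univ) fun C => (Rep.const (eps B C)).mul
          (rep_cT_scalar h (-4) (-1) hb ![C]))).mul (r2 hb (-1) ![A, B])))
    have h3 : Rep (2 * c) _ := H.hh_eq ▸ h1
    have h4 := h3.eventuallyEq ((Rep.ofNat 2).mul hc) hx
    rw [← show _ = 2 * K x from h4]
    simp only [raise1, raise2]
    ring
  · have h1 := r3 hc (-3) I
    rw [H.const_eq I] at h1
    exact (h1.eventuallyEq .zero) hx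

end SpinGeometry
end Translation
end ConformalHH

namespace ConformalHH

/-! ### Gauge changes and hypotheses on germs -/

open Filter Topology

/-- The ring of analytic functions on an open set. -/
abbrev FnR (𝕜 : Type*) [RCLike 𝕜] [NormedAlgebra 𝕜 ℂ] {M : Type*} [TopologicalSpace M]
    [ChartedSpace (Fin 4 → 𝕜) M] (V : TopologicalSpace.Opens M) : Type _ := AnR 𝕜 (𝓟 (V : Set M))

namespace SpinGeometry

variable {𝕜 : Type*} [RCLike 𝕜] [NormedAlgebra 𝕜 ℂ] {M : Type*} [TopologicalSpace M]
  [ChartedSpace (Fin 4 → 𝕜) M]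

/-! #### Change of gauge -/

theorem der_gauge (D : SpinGeometry 𝕜 M) (lam s : M → ℂ) (a : Idx) (f : M → ℂ) (x : M) :
    (D.gauge lam s).der a f x = (s x ^ 2)⁻¹ * D.der a f x := by
  simp only [der, dirDeriv, gauge, map_smul, smul_eq_mul]

theorem metricC_gauge (D : SpinGeometry 𝕜 M) (lam s : M → ℂ) (x : M) (X Y : CT 𝕜 x) :
    (D.gauge lam s).metricC x X Y = s x ^ 4 * D.metricC x X Y := by
  induction X using TensorProduct.induction_on with
  | zero => simp
  | add X X' h h' => simp [h, h', mul_add]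
  | tmul c v =>
    induction Y using TensorProduct.induction_on with
    | zero => simp
    | add Y Y' h h' => simp only [map_add, h, h', mul_add]
    | tmul d u =>
      simp [metricC, gauge, LinearMap.liftBaseChange_tmul]
      ring

theorem IsRegularOn.gauge {D : SpinGeometry 𝕜 M} {V : Set M} (hV : IsOpen V) (hD : D.IsRegularOn V)
    {lam s : M → ℂ} (hlam : ContMDiffOn 𝓘(𝕜, Fin 4 → 𝕜) 𝓘(𝕜, ℂ) ω lam V)
    (hs : ContMDiffOn 𝓘(𝕜, Fin 4 → 𝕜) 𝓘(𝕜, ℂ) ω s V) (h0 : ∀ x ∈ V, lam x ≠ 0 ∧ s x ≠ 0) :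
    (D.gauge lam s).IsRegularOn V := by
  have hs' : ∀ x ∈ V, IsAn 𝕜 s x := fun x hx => hs.contMDiffAt (hV.mem_nhds hx)
  have hl' : ∀ x ∈ V, IsAn 𝕜 lam x := fun x hx => hlam.contMDiffAt (hV.mem_nhds hx)
  have hinv : ∀ x ∈ V, IsAn 𝕜 (fun x => (s x ^ 2)⁻¹) x := fun x hx => by
    simp only [pow_two]
    exact ((hs' x hx).mul (hs' x hx)).inv (mul_ne_zero (h0 x hx).2 (h0 x hx).2)
  refine ⟨fun a x hx i => ?_, fun x hx a b => ?_, fun A x hx => ?_, fun A x hx => ?_, fun x hx => ?_⟩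
  · have h1 : dirDeriv ((D.gauge lam s).frame a) (coord 𝕜 x i)
        = fun y => (s y ^ 2)⁻¹ * dirDeriv (D.frame a) (coord 𝕜 x i) y :=
      funext fun y => der_gauge D lam s a _ y
    rw [h1]
    exact (hinv x hx).mul (hD.analytic_frame a x hx i)
  · rw [metricC_gauge]
    simp only [SpinGeometry.gauge, map_smul, LinearMap.smul_apply, smul_eq_mul, hD.null_tetrad x hx a b]
    have := (h0 x hx).2
    field_simp
  · have ho : IsAn 𝕜 (D.o A) x := (hD.analytic_o A).contMDiffAt (hV.mem_nhds hx)
    exact (((hl' x hx).mul (hs' x hx)).mul ho).contMDiffWithinAt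
  · have hi : IsAn 𝕜 (D.iota A) x := (hD.analytic_iota A).contMDiffAt (hV.mem_nhds hx)
    exact (((((hl' x hx).inv (h0 x hx).1).mul (hinv x hx)).mul (hs' x hx)).mul hi).contMDiffWithinAt
  · have h1 := hD.normalised x hx
    obtain ⟨h2, h3⟩ := h0 x hx
    simp only [SpinGeometry.gauge, Fin.sum_univ_two] at h1 ⊢
    field_simp
    linear_combination h1

variable [IsManifold 𝓘(𝕜, Fin 4 → 𝕜) ω M] {D : SpinGeometry 𝕜 M}

/-! #### The hypotheses in rings of germs -/

section Hypotheses

variable {l : Filter M} [IsOpenFilter l] (h : ∀ᶠ x in l, D.IsRegularAt x)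

theorem leeR_eq_ld {φ : (AnR 𝕜 l)ˣ} {f : M → ℂ} (hφ : Rep (φ : AnR 𝕜 l) f)
    (hf : ∀ᶠ x in l, ∀ a, f x * D.lee a x = D.der a f x) (a : Idx) :
    leeR (derR h) (wcR (strLowR h) 0) (oR h) (iotaR h) a = ld (derR h a) φ := by
  have h1 : (φ : AnR 𝕜 l) * leeForm (derR h) (strLowR h) (oR h) (iotaR h) a = derR h a φ :=
    (hφ.mul (rep_leeForm h a)).ext (rep_derR h hφ a) (hf.mono fun x hx => hx a)
  rw [ld, ← h1, ← mul_assoc, φ.inv_mul, one_mul]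
  rfl

theorem shear_eq_zero (hf : ∀ᶠ x in l, ∀ A' : Fin 2, ∑ A, ∑ B, D.o A x * D.o B x *
      D.nabla (fun _ _ => 0) (A, A')
        (fun (I : Fin 1 → Fin 2) (_ : Fin 0 → Fin 2) => D.oLow (I 0)) ![B] ![] x = 0) (A' : Fin 2) :
    ∑ A, ∑ B, oR h A * oR h B * (derR h (A, A') (∑ C, oR h C * epsR (AnR 𝕜 l) C B)
      - ∑ C, spinR (wcR (strLowR h) 0) 0 (A, A') B C * ∑ E, oR h E * epsR (AnR 𝕜 l) E C) = 0 := by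
  refine (Rep.sum fun A => Rep.sum fun B => ((rep_oR h A).mul (rep_oR h B)).mul
    ((rep_derR h (rep_oLow h B) (A, A')).sub (Rep.sum fun C =>
      (rep_spinR h (v := fun _ _ => 0) (fun _ => .zero) (A, A') B C).mul (rep_oLow h C)))).ext .zero ?_
  filter_upwards [hf] with x hx
  refine Eq.trans ?_ (hx A')
  refine Finset.sum_congr rfl fun A _ => Finset.sum_congr rfl fun B _ => ?_
  simp [nabla]

theorem rep_comp {w : ∀ x : M, T 𝕜 x →ₗ[𝕜] ℂ} {u : (AnR 𝕜 l)ˣ} {f : M → ℂ} (hu : Rep (u : AnR 𝕜 l) f)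
    (hw : ∀ᶠ x in l, w x = -((f x)⁻¹ • diff 𝕜 f x)) (a : Idx) :
    Rep (-ld (derR h a) u) (D.comp w a) := by
  refine (hu.inv.mul (rep_derR h hu a)).neg.congr ?_
  filter_upwards [hw] with x hx
  rw [comp, hx, der, dirDeriv]
  induction D.frame a x using TensorProduct.induction_on with
  | zero => simp
  | add X Y h1 h2 => simp only [map_add, ← h1, ← h2]; ring
  | tmul c v => simp [LinearMap.liftBaseChange_tmul]

theorem exists_einsteinWeyl {w : ∀ x : M, T 𝕜 x →ₗ[𝕜] ℂ} {u : (AnR 𝕜 l)ˣ} {f : M → ℂ}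
    (hu : Rep (u : AnR 𝕜 l) f) (hw : ∀ᶠ x in l, w x = -((f x)⁻¹ • diff 𝕜 f x)) {Λ : M → ℂ}
    (hEW : ∀ᶠ x in l, ∀ a c, D.ricci (D.comp w) a c x + D.ricci (D.comp w) c a x = Λ x * eta a c) :
    ∃ Λ' : AnR 𝕜 l, ∀ p q,
      ricciR (curvR (derR h) (strR (strLowR h)) (wcR (strLowR h) fun a => -ld (derR h a) u)) p q
      + ricciR (curvR (derR h) (strR (strLowR h)) (wcR (strLowR h) fun a => -ld (derR h a) u)) q p
      = Λ' * etaR (AnR 𝕜 l) p q := by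
  have h1 := rep_ricciR h (rep_comp h hu hw)
  -- `η_{ab} = 1` for `a = 00'`, `b = 11'`, so this component of the equation recovers the factor
  have h2 := (h1 (0, 0) (1, 1)).add (h1 (1, 1) (0, 0))
  refine ⟨_, fun p q => ((h1 p q).add (h1 q p)).ext (h2.mul (.const _)) ?_⟩
  filter_upwards [hEW] with x hx
  rw [hx, hx (0, 0) (1, 1)]
  simp [eta, eps]

end Hypotheses

theorem exists_isDualAt {x : M} (hx : D.IsRegularAt x) (h : ∀ᶠ y in 𝓝 x, D.IsRegularAt y) :
    ∃ c : Idx → Fin 4 → ℂ, IsDualAt (germModel x) (derR h) c := by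
  obtain ⟨B, hB, -⟩ := hx.exists_inv
  refine ⟨fun b i => B i b, fun a b => ?_⟩
  rw [LocalModel.der_lin, ← Matrix.one_apply, ← hB, Matrix.mul_apply]
  have h1 := Rep.sum (s := Finset.univ) fun i => (germModel_der_t
    (h.mono fun _ hx => hx.isVF a) i).mul (Rep.const (B i b))
  exact h1.anEv

theorem der_mem {x : M} (h : ∀ᶠ y in 𝓝 x, D.IsRegularAt y) (a : Idx) : (germModel x).Mem (derR h a) :=
  germModel_mem _

/-! #### Normal coordinates on an open set -/

/-- The conclusion on an open set, from normal coordinates and a potential there. -/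
theorem isHHPotentialOn_of_isJet (V : TopologicalSpace.Opens M)
    (h : ∀ᶠ x in 𝓟 (V : Set M), D.IsRegularAt x) {m b : Matrix (Fin 2) (Fin 2) (FnR 𝕜 V)}
    {β Ω : (FnR 𝕜 V)ˣ} {p q : Fin 2 → FnR 𝕜 V}
    {E : Idx → Derivation ℂ (FnR 𝕜 V) (FnR 𝕜 V)}
    {F O : FnR 𝕜 V} (hO : IsUnit O) (hbm : b * m = 1) (hdet : (β : FnR 𝕜 V) * b.det = (Ω : FnR 𝕜 V) ^ 2)
    (hE : adE (derR h) (oR h) (iotaR h) m β = E) (hN : NormalCoords E p q)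
    (hJ : IsJet (E (0, 0)) (E (0, 1)) (nfU E p) (nfV E p) (E (1, 0) (p 0)) (E (1, 0) (p 1))
      (E (1, 1) (p 0)) F O) {Ω' Φ K : M → ℂ} (hΩ : Rep (O * ((Ω⁻¹ : (FnR 𝕜 V)ˣ) : FnR 𝕜 V)) Ω')
    (hΦ : Rep ((((β * Ω⁻¹) ^ 2 * Ω : (FnR 𝕜 V)ˣ) : FnR 𝕜 V) * F) Φ)
    (hK : Rep ((((β * Ω⁻¹) ^ 2 * Ω ^ 3 : (FnR 𝕜 V)ˣ) : FnR 𝕜 V) * (half (FnR 𝕜 V) * hhExpr (E (0, 0)) (E (0, 1)) (nfU E p)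
      (nfV E p) (E (1, 0) (p 0)) (E (1, 0) (p 1)) (E (1, 1) (p 0)) F O)) K) :
    D.IsHHPotentialOn Ω' Φ K V := by
  have hch := (NormalCoords.normalChange (hE.symm ▸ hN) (strLowR_swap h) (derR_comm h)
    (oR_mul_iotaR h) hbm hdet hE).1
  have := hch.isHHPotentialR hJ hO
  simp only [inv_one, mul_one] at this
  exact isHHPotentialOn_of_ring V h hΩ hΦ hK this

end SpinGeometry
end ConformalHH

namespace ConformalHH

/-! ### Spreading of equations from a point to a neighbourhood -/

section Defects

variable {R : Type*} [CommRing R] [Algebra ℂ R] {S : Type*} [CommRing S] [Algebra ℂ S]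

/-- The finitely many expressions which vanish if and only if `p`, `q` are normal coordinates for the
frame `adE e o ι m β` with `b m = 1`, `β det b = φ²`, and `F` is a potential for the SD Weyl spinor. -/
def jetDefect (e : Idx → Derivation ℂ R R) (o ι : Fin 2 → R) (φ O : R) (m b : Matrix (Fin 2) (Fin 2) R)
    (β : Rˣ) (p q : Fin 2 → R) (F : R) : (Fin 4 × Fin 2 × Fin 2) ⊕ Fin 7 → R :=
  let E := adE e o ι m β
  let x := E (0, 0)
  let y := E (0, 1)
  let a := E (1, 0) (p 0)
  let b' := E (1, 0) (p 1)
  let c := E (1, 1) (p 0)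
  Sum.elim
    (fun k => ![(b * m) k.2.1 k.2.2 - (1 : Matrix (Fin 2) (Fin 2) R) k.2.1 k.2.2,
      E (0, k.2.1) (p k.2.2) - (1 : Matrix (Fin 2) (Fin 2) R) k.2.1 k.2.2, E (0, k.2.1) (q k.2.2),
      E (1, k.2.1) (q k.2.2) - (1 : Matrix (Fin 2) (Fin 2) R) k.2.1 k.2.2] k.1)
    ![(β : R) * b.det - φ ^ 2, E (1, 0) (p 0) + E (1, 1) (p 1),
      - x (x (x (x F))) * O + x (x b'),
      - 2 * x (x (x (y F))) * O - x (x a) + x (y b'),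
      - 6 * x (x (y (y F))) * O - 4 * x (y a) + y (y b') - x (x c),
      2 * x (y (y (y F))) * O + y (y a) + x (y c),
      y (y (y (y F))) * O + y (y c)]

theorem map_adE {e : Idx → Derivation ℂ R R} {e' : Idx → Derivation ℂ S S} (r : R →ₐ[ℂ] S)
    (hr : ∀ a f, r (e a f) = e' a (r f)) (o ι : Fin 2 → R) (m : Matrix (Fin 2) (Fin 2) R) (β : Rˣ)
    (a : Idx) (f : R) : r (adE e o ι m β a f)
      = adE e' (r ∘ o) (r ∘ ι) (m.map r) (Units.map (r : R →* S) β) a (r f) := by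
  rw [adE_apply, adE_apply]
  obtain ⟨A, A'⟩ := a
  revert A
  simp only [Fin.forall_fin_two]
  constructor <;> simp [hr, ← map_inv]

theorem map_jetDefect {e : Idx → Derivation ℂ R R} {e' : Idx → Derivation ℂ S S} (r : R →ₐ[ℂ] S)
    (hr : ∀ a f, r (e a f) = e' a (r f)) (o ι : Fin 2 → R) (φ O : R) (m b : Matrix (Fin 2) (Fin 2) R)
    (β : Rˣ) (p q : Fin 2 → R) (F : R) (j) : r (jetDefect e o ι φ O m b β p q F j)
      = jetDefect e' (r ∘ o) (r ∘ ι) (r φ) (r O) (m.map r) (b.map r) (Units.map (r : R →* S) β)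
        (r ∘ p) (r ∘ q) (r F) j := by
  have hE := map_adE r hr o ι m β
  have h1 : ∀ A B, r ((1 : Matrix (Fin 2) (Fin 2) R) A B) = (1 : Matrix (Fin 2) (Fin 2) S) A B :=
    fun A B => by simp only [Matrix.one_apply]; split_ifs <;> simp
  match j with
  | .inl (i, A, B) =>
    fin_cases i <;> simp [jetDefect, hE, h1, Matrix.mul_apply]
  | .inr i =>
    have h2 : r 2 = 2 := map_ofNat r 2
    have h4 : r 4 = 4 := map_ofNat r 4
    have h6 : r 6 = 6 := map_ofNat r 6
    fin_cases i <;> simp [jetDefect, hE, Matrix.det_fin_two, h2, h4, h6]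

variable {e : Idx → Derivation ℂ R R} {o ι : Fin 2 → R} {φ O : R} {m b : Matrix (Fin 2) (Fin 2) R}
    {β : Rˣ} {p q : Fin 2 → R} {F : R}

theorem jetDefect_eq_zero (hbm : b * m = 1) (hdet : (β : R) * b.det = φ ^ 2)
    (hN : NormalCoords (adE e o ι m β) p q)
    (hJ : IsJet (adE e o ι m β (0, 0)) (adE e o ι m β (0, 1)) (nfU (adE e o ι m β) p)
        (nfV (adE e o ι m β) p) (adE e o ι m β (1, 0) (p 0)) (adE e o ι m β (1, 0) (p 1))
        (adE e o ι m β (1, 1) (p 0)) F O) (j) : jetDefect e o ι φ O m b β p q F j = 0 := by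
  match j with
  | .inl (i, A, B) =>
    fin_cases i
    · simp [jetDefect, hbm]
    · simp [jetDefect, hN.p0, Matrix.one_apply]
    · simp [jetDefect, hN.q0]
    · simp [jetDefect, hN.q1, Matrix.one_apply]
  | .inr i =>
    fin_cases i
    exacts [sub_eq_zero.2 hdet, hN.trace, hJ.W0, hJ.W1, hJ.W2, hJ.W3, hJ.W4]

theorem of_jetDefect_eq_zero (h : ∀ j, jetDefect e o ι φ O m b β p q F j = 0) :
    b * m = 1 ∧ (β : R) * b.det = φ ^ 2 ∧ NormalCoords (adE e o ι m β) p q ∧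
      (IsEWJet (adE e o ι m β (0, 0)) (adE e o ι m β (0, 1)) (nfU (adE e o ι m β) p)
        (nfV (adE e o ι m β) p) (adE e o ι m β (1, 0) (p 0)) (adE e o ι m β (1, 0) (p 1))
        (adE e o ι m β (1, 1) (p 0)) O → IsJet (adE e o ι m β (0, 0)) (adE e o ι m β (0, 1))
        (nfU (adE e o ι m β) p) (nfV (adE e o ι m β) p) (adE e o ι m β (1, 0) (p 0))
        (adE e o ι m β (1, 0) (p 1)) (adE e o ι m β (1, 1) (p 0)) F O) := by
  refine ⟨?_, sub_eq_zero.1 (h (.inr 0)), ⟨fun A B => ?_, fun A B => h (.inl (2, A, B)),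
    fun A B => ?_, h (.inr 1)⟩, fun H => ⟨H, h (.inr 2), h (.inr 3), h (.inr 4), h (.inr 5),
    h (.inr 6)⟩⟩
  · ext A B
    exact sub_eq_zero.1 (h (.inl (0, A, B)))
  · rw [← Matrix.one_apply]
    exact sub_eq_zero.1 (h (.inl (1, A, B)))
  · rw [← Matrix.one_apply]
    exact sub_eq_zero.1 (h (.inl (3, A, B)))

end Defects

section Spreading

open Filter Topology

variable {𝕜 : Type*} [RCLike 𝕜] [NormedAlgebra 𝕜 ℂ] {M : Type*} [TopologicalSpace M]
  [ChartedSpace (Fin 4 → 𝕜) M] {x₀ : M}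

theorem nhds_le_principal {W : TopologicalSpace.Opens M} (hx : x₀ ∈ W) : 𝓝 x₀ ≤ 𝓟 (W : Set M) :=
  le_principal_iff.2 (W.2.mem_nhds hx)

theorem exists_opens_of_eventually {P : M → Prop} (h : ∀ᶠ x in 𝓝 x₀, P x) :
    ∃ W : TopologicalSpace.Opens M, x₀ ∈ W ∧ ∀ x ∈ W, P x := by
  obtain ⟨t, h1, h2, h3⟩ := eventually_nhds_iff.1 h
  exact ⟨⟨t, h2⟩, h3, h1⟩

/-- Finitely many germs, and a unit, extend to a common neighbourhood. -/
theorem exists_lift {J : Type*} [Finite J] (a : J → AnR 𝕜 (𝓝 x₀)) (u : (AnR 𝕜 (𝓝 x₀))ˣ) {U : Set M}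
    (hU : U ∈ 𝓝 x₀) : ∃ (W : TopologicalSpace.Opens M) (hx : x₀ ∈ W) (a' : J → FnR 𝕜 W)
      (u' : (FnR 𝕜 W)ˣ), (W : Set M) ⊆ U ∧ (∀ j, anRes 𝕜 (nhds_le_principal hx) (a' j) = a j) ∧
      Units.map (anRes 𝕜 (nhds_le_principal hx) : FnR 𝕜 W →* AnR 𝕜 (𝓝 x₀)) u' = u := by
  choose f hf using fun j => exists_rep (a j)
  obtain ⟨g, hg⟩ := exists_rep (u : AnR 𝕜 (𝓝 x₀))
  obtain ⟨W, hx, hW⟩ := exists_opens_of_eventually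
    (((eventually_all.2 fun j => (hf j).isAn).and (hg.isAn.and hg.ne_zero)).and hU)
  have h1 : ∀ j, ∀ᶠ x in 𝓟 (W : Set M), IsAn 𝕜 (f j) x := fun j x hx => (hW x hx).1.1 j
  have h2 : ∀ᶠ x in 𝓟 (W : Set M), IsAn 𝕜 g x := fun x hx => (hW x hx).1.2.1
  have h3 : IsUnit (toAn g h2 : FnR 𝕜 W) := (rep_toAn g h2).isUnit fun x hx => (hW x hx).1.2.2
  refine ⟨W, hx, fun j => toAn (f j) (h1 j), h3.unit, fun x hx => (hW x hx).2,
    fun j => ((rep_toAn _ _).res _).ext (hf j) (.refl _ _), Units.ext ?_⟩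
  exact ((rep_toAn g h2).res (nhds_le_principal hx)).ext hg (.refl _ _)

/-- Finitely many functions with vanishing germs at `x₀` vanish on a neighbourhood. -/
theorem exists_res_eq_zero {J : Type*} [Finite J] {W : TopologicalSpace.Opens M} (hx : x₀ ∈ W)
    (a : J → FnR 𝕜 W) (ha : ∀ j, anRes 𝕜 (nhds_le_principal hx) (a j) = 0) :
    ∃ (V : TopologicalSpace.Opens M) (_ : x₀ ∈ V) (hV : 𝓟 (V : Set M) ≤ 𝓟 (W : Set M)),
      ∀ j, anRes 𝕜 hV (a j) = 0 := by
  choose f hf using fun j => exists_rep (a j)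
  have h1 : ∀ j, ∀ᶠ x in 𝓝 x₀, f j x = 0 := fun j => by
    have h2 := (hf j).res (nhds_le_principal hx)
    rw [ha j] at h2
    exact h2.eventuallyEq .zero
  obtain ⟨V, hxV, hV⟩ := exists_opens_of_eventually ((eventually_all.2 h1).and (W.2.mem_nhds hx))
  exact ⟨V, hxV, principal_mono.2 fun x hx => (hV x hx).2,
    fun j => ((hf j).res _).ext .zero (eventually_principal.2 fun x hx => (hV x hx).1 j)⟩

end Spreading
end ConformalHH

namespace ConformalHH

/-! ### Normal coordinates near a point and all gauges -/

namespace SpinGeometry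

open Filter Topology

variable {𝕜 : Type*} [RCLike 𝕜] [NormedAlgebra 𝕜 ℂ] {M : Type*} [TopologicalSpace M]
  [ChartedSpace (Fin 4 → 𝕜) M]

theorem exists_unit_rep {U : Set M} (hU : IsOpen U) {l : Filter M} [IsOpenFilter l] (hl : l ≤ 𝓟 U)
    {f : M → ℂ} (hf : ContMDiffOn 𝓘(𝕜, Fin 4 → 𝕜) 𝓘(𝕜, ℂ) ω f U) (h0 : ∀ x ∈ U, f x ≠ 0) :
    ∃ u : (AnR 𝕜 l)ˣ, Rep (u : AnR 𝕜 l) f := by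
  have h1 : ∀ᶠ x in l, x ∈ U := hl (mem_principal_self U)
  have h2 : ∀ᶠ x in l, IsAn 𝕜 f x := h1.mono fun x hx => hf.contMDiffAt (hU.mem_nhds hx)
  have h3 : IsUnit (toAn f h2 : AnR 𝕜 l) := (rep_toAn f h2).isUnit (h1.mono fun x hx => h0 x hx)
  exact ⟨h3.unit, rep_toAn f h2⟩

theorem rep_rescale {V : TopologicalSpace.Opens M} {lam s : M → ℂ} {L S : (FnR 𝕜 V)ˣ}
    (hL : Rep (L : FnR 𝕜 V) lam) (hS : Rep (S : FnR 𝕜 V) s) (p q : ℤ) {a : FnR 𝕜 V} {f : M → ℂ}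
    (ha : Rep a f) : Rep (((L ^ p * (S ^ 2) ^ q : (FnR 𝕜 V)ˣ) : FnR 𝕜 V) * a) (rescale lam s p q f) := by
  have hpow : ∀ {u : (FnR 𝕜 V)ˣ} {g : M → ℂ}, Rep (u : FnR 𝕜 V) g → ∀ n : ℕ,
      Rep ((u ^ n : (FnR 𝕜 V)ˣ) : FnR 𝕜 V) (fun x => g x ^ n) := fun {u g} hu n => by
    induction n with
    | zero => simpa using Rep.one
    | succ n ih =>
      rw [pow_succ, Units.val_mul]
      exact (ih.mul hu).of_eq fun x => (pow_succ _ _).symm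
  have hzpow : ∀ {u : (FnR 𝕜 V)ˣ} {g : M → ℂ}, Rep (u : FnR 𝕜 V) g → ∀ n : ℤ,
      Rep ((u ^ n : (FnR 𝕜 V)ˣ) : FnR 𝕜 V) (fun x => g x ^ n) := fun {u g} hu n => by
    cases n with
    | ofNat n => simpa using hpow hu n
    | negSucc n => simpa only [zpow_negSucc] using (hpow hu (n + 1)).inv
  exact ((hzpow hL p).mul (hzpow (hpow hS 2) q)).mul ha

variable [IsManifold 𝓘(𝕜, Fin 4 → 𝕜) ω M] {D : SpinGeometry 𝕜 M}

theorem anRes_derR {l l' : Filter M} [IsOpenFilter l] [IsOpenFilter l'] (hl : l' ≤ l)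
    (h : ∀ᶠ x in l, D.IsRegularAt x) (a : Idx) (f : AnR 𝕜 l) :
    anRes 𝕜 hl (derR h a f) = derR (hl h) a (anRes 𝕜 hl f) := anRes_anDer _ _ _

theorem anRes_oR {l l' : Filter M} [IsOpenFilter l] [IsOpenFilter l'] (hl : l' ≤ l)
    (h : ∀ᶠ x in l, D.IsRegularAt x) : anRes 𝕜 hl ∘ oR h = oR (hl h) :=
  funext fun A => ((rep_oR h A).res hl).ext (rep_oR (hl h) A) (.refl _ _)

theorem anRes_iotaR {l l' : Filter M} [IsOpenFilter l] [IsOpenFilter l'] (hl : l' ≤ l)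
    (h : ∀ᶠ x in l, D.IsRegularAt x) : anRes 𝕜 hl ∘ iotaR h = iotaR (hl h) :=
  funext fun A => ((rep_iotaR h A).res hl).ext (rep_iotaR (hl h) A) (.refl _ _)

/-- Normal coordinates and a potential in a neighbourhood of a point: they exist at the level of
germs, and the finitely many equations which they satisfy persist in a neighbourhood. -/
theorem exists_isJet_nhds {U : Set M} (hU : IsOpen U) (hD : D.IsRegularOn U)
    {w : ∀ x : M, T 𝕜 x →ₗ[𝕜] ℂ} {Ω₀ : M → ℂ}
    (hΩ₀ : ContMDiffOn 𝓘(𝕜, Fin 4 → 𝕜) 𝓘(𝕜, ℂ) ω Ω₀ U) (hΩ₀_ne : ∀ x ∈ U, Ω₀ x ≠ 0)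
    (hw : ∀ x ∈ U, w x = -((Ω₀ x)⁻¹ • diff 𝕜 Ω₀ x)) (hEW : D.IsEinsteinWeylOn w U)
    (hSF : D.IsShearFreeOn U) (hLee : D.HasGradientLeeFormOn U) {x₀ : M} (hx₀ : x₀ ∈ U) :
    ∃ (V : TopologicalSpace.Opens M) (_ : x₀ ∈ V) (_ : (V : Set M) ⊆ U)
      (h : ∀ᶠ x in 𝓟 (V : Set M), D.IsRegularAt x) (φ u : (FnR 𝕜 V)ˣ)
      (m b : Matrix (Fin 2) (Fin 2) (FnR 𝕜 V)) (β : (FnR 𝕜 V)ˣ) (p q : Fin 2 → FnR 𝕜 V)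
      (F : FnR 𝕜 V) (E : Idx → Derivation ℂ (FnR 𝕜 V) (FnR 𝕜 V)), Rep (u : FnR 𝕜 V) Ω₀ ∧ b * m = 1 ∧
      (β : FnR 𝕜 V) * b.det = (φ : FnR 𝕜 V) ^ 2 ∧ adE (derR h) (oR h) (iotaR h) m β = E ∧
      NormalCoords E p q ∧ IsJet (E (0, 0)) (E (0, 1)) (nfU E p) (nfV E p) (E (1, 0) (p 0))
        (E (1, 0) (p 1)) (E (1, 1) (p 0)) F (u * φ : FnR 𝕜 V) := by
  obtain ⟨f, hf, hf'⟩ := hLee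
  obtain ⟨Λ, hΛ⟩ := hEW
  have hreg : ∀ {l : Filter M}, l ≤ 𝓟 U → ∀ᶠ x in l, D.IsRegularAt x := fun hl =>
    hl fun x hx => ⟨U, hU, hx, hD⟩
  have hl₀ : 𝓝 x₀ ≤ 𝓟 U := le_principal_iff.2 (hU.mem_nhds hx₀)
  obtain ⟨φ₀, hφ₀⟩ := exists_unit_rep hU hl₀ hf fun x hx => (hf' x hx).1
  obtain ⟨u₀, hu₀⟩ := exists_unit_rep hU hl₀ hΩ₀ hΩ₀_ne
  obtain ⟨c, hc⟩ := exists_isDualAt ⟨U, hU, hx₀, hD⟩ (hreg hl₀)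
  obtain ⟨Λ₀, hΛ₀⟩ := exists_einsteinWeyl (hreg hl₀) hu₀ (hl₀ hw) (hl₀ hΛ)
  obtain ⟨m, b, β, p, q, F, hbm, hdet, hN, hJ⟩ := exists_isJet (der_mem (hreg hl₀)) hc
    (strLowR_swap _) (derR_comm _) (oR_mul_iotaR _) (shear_eq_zero _ (hl₀ hSF)) φ₀
    (leeR_eq_ld _ hφ₀ (hl₀ fun x hx => (hf' x hx).2)) u₀ hΛ₀
  -- all the germs are represented by functions on one neighbourhood `W`
  obtain ⟨W, hxW, a, β', hWU, ha, hβ⟩ := exists_lift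
    (J := (Fin 2 × Fin 2) ⊕ (Fin 2 × Fin 2) ⊕ Fin 2 ⊕ Fin 2 ⊕ Unit)
    (Sum.elim (fun k => m k.1 k.2) (Sum.elim (fun k => b k.1 k.2) (Sum.elim p (Sum.elim q fun _ => F))))
    β (hU.mem_nhds hx₀)
  have hlW : 𝓟 (W : Set M) ≤ 𝓟 U := principal_mono.2 hWU
  obtain ⟨φW, hφW⟩ := exists_unit_rep hU hlW hf fun x hx => (hf' x hx).1
  obtain ⟨uW, huW⟩ := exists_unit_rep hU hlW hΩ₀ hΩ₀_ne
  have hm : (Matrix.of fun i j => a (.inl (i, j))).map (anRes 𝕜 (nhds_le_principal hxW)) = m :=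
    Matrix.ext fun i j => ha (.inl (i, j))
  have hb : (Matrix.of fun i j => a (.inr (.inl (i, j)))).map (anRes 𝕜 (nhds_le_principal hxW)) = b :=
    Matrix.ext fun i j => ha (.inr (.inl (i, j)))
  have hp : (anRes 𝕜 (nhds_le_principal hxW)) ∘ (fun i => a (.inr (.inr (.inl i)))) = p :=
    funext fun i => ha (.inr (.inr (.inl i)))
  have hq : (anRes 𝕜 (nhds_le_principal hxW)) ∘ (fun i => a (.inr (.inr (.inr (.inl i))))) = q :=
    funext fun i => ha (.inr (.inr (.inr (.inl i))))
  have hF : anRes 𝕜 (nhds_le_principal hxW) (a (.inr (.inr (.inr (.inr ()))))) = F := ha _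
  have hφr : anRes 𝕜 (nhds_le_principal hxW) (φW : FnR 𝕜 W) = φ₀ :=
    (hφW.res (nhds_le_principal hxW)).ext hφ₀ (.refl _ _)
  have hur : anRes 𝕜 (nhds_le_principal hxW) (uW : FnR 𝕜 W) = u₀ :=
    (huW.res (nhds_le_principal hxW)).ext hu₀ (.refl _ _)
  -- on a smaller neighbourhood `V` their equations hold as well
  obtain ⟨V, hxV, hVW, hV⟩ := exists_res_eq_zero hxW
    (jetDefect (derR (hreg hlW)) (oR (hreg hlW)) (iotaR (hreg hlW)) (φW : FnR 𝕜 W) (uW * φW : FnR 𝕜 W)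
      (Matrix.of fun i j => a (.inl (i, j))) (Matrix.of fun i j => a (.inr (.inl (i, j)))) β'
      (fun i => a (.inr (.inr (.inl i)))) (fun i => a (.inr (.inr (.inr (.inl i)))))
      (a (.inr (.inr (.inr (.inr ())))))) (fun j => by
    rw [map_jetDefect _ (anRes_derR _ _), anRes_oR, anRes_iotaR, map_mul, hφr, hur, hm, hb, hβ, hp,
      hq, hF]
    exact jetDefect_eq_zero hbm hdet hN hJ j)
  have hlV : 𝓟 (V : Set M) ≤ 𝓟 U := hVW.trans hlW
  obtain ⟨φ, hφ⟩ := exists_unit_rep hU hlV hf fun x hx => (hf' x hx).1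
  obtain ⟨u, hu⟩ := exists_unit_rep hU hlV hΩ₀ hΩ₀_ne
  have hφr' : anRes 𝕜 hVW (φW : FnR 𝕜 W) = φ := (hφW.res hVW).ext hφ (.refl _ _)
  have hur' : anRes 𝕜 hVW (uW : FnR 𝕜 W) = u := (huW.res hVW).ext hu (.refl _ _)
  simp only [map_jetDefect _ (anRes_derR hVW _), anRes_oR, anRes_iotaR, map_mul, hφr', hur'] at hV
  obtain ⟨hbm', hdet', hN', hJ'⟩ := of_jetDefect_eq_zero hV
  refine ⟨V, hxV, principal_mono.1 hlV, hreg hlV, φ, u, _, _, _, _, _, _, _, hu, hbm', hdet', rfl, hN',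
    hJ' ?_⟩
  obtain ⟨hch, C, hC⟩ := hN'.normalChange (strLowR_swap (hreg hlV)) (derR_comm _) (oR_mul_iotaR _) hbm'
    hdet' rfl
  obtain ⟨k1, k2, k3, k4, k5, k6⟩ := hN'.commute hC
  obtain ⟨Λ₁, hΛ₁⟩ := exists_einsteinWeyl (hreg hlV) hu (hlV hw) (hlV hΛ)
  exact hch.isEWJet k1 k2 k3 k4 k5 k6 u hΛ₁

/-- The frame of normal coordinates, written in another gauge. -/
theorem adE_gauge {V : TopologicalSpace.Opens M} {lam s : M → ℂ}
    (h : ∀ᶠ x in 𝓟 (V : Set M), D.IsRegularAt x)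
    (h' : ∀ᶠ x in 𝓟 (V : Set M), (D.gauge lam s).IsRegularAt x) {L S : (FnR 𝕜 V)ˣ}
    (hL : Rep (L : FnR 𝕜 V) lam) (hS : Rep (S : FnR 𝕜 V) s) (m : Matrix (Fin 2) (Fin 2) (FnR 𝕜 V))
    (β : (FnR 𝕜 V)ˣ) : adE (derR h') (oR h') (iotaR h')
      (((S * L⁻¹ : (FnR 𝕜 V)ˣ) : FnR 𝕜 V) • m) (β * (L⁻¹ * S⁻¹) ^ 2) = adE (derR h) (oR h) (iotaR h) m β := by
  have hsq : Rep (((S⁻¹ : (FnR 𝕜 V)ˣ) : FnR 𝕜 V) ^ 2) (fun x => (s x ^ 2)⁻¹) := by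
    rw [pow_two]
    exact (hS.inv.mul hS.inv).of_eq fun x => by rw [pow_two, mul_inv]
  have h1 : ∀ a f, derR h' a f = ((S⁻¹ : (FnR 𝕜 V)ˣ) : FnR 𝕜 V) ^ 2 * derR h a f := fun a f => by
    obtain ⟨g, hg⟩ := exists_rep f
    exact (rep_derR h' hg a).ext (hsq.mul (rep_derR h hg a)) (.of_forall fun x => der_gauge D lam s a g x)
  have h2 : ∀ A, oR h' A = (L : FnR 𝕜 V) * S * oR h A := fun A =>
    (rep_oR h' A).ext ((hL.mul hS).mul (rep_oR h A)) (.refl _ _)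
  have h3 : ∀ A, iotaR h' A = ((L⁻¹ : (FnR 𝕜 V)ˣ) : FnR 𝕜 V) * ((S⁻¹ : (FnR 𝕜 V)ˣ) : FnR 𝕜 V) ^ 2 * S
      * iotaR h A := fun A =>
    (rep_iotaR h' A).ext (((hL.inv.mul hsq).mul hS).mul (rep_iotaR h A)) (.refl _ _)
  have hLi := L.mul_inv
  have hSi := S.mul_inv
  funext a
  refine Derivation.ext fun f => ?_
  rw [adE_apply, adE_apply]
  obtain ⟨A, A'⟩ := a
  revert A
  simp only [Fin.forall_fin_two, h1, h2, h3, Matrix.smul_apply, smul_eq_mul, mul_inv, Units.val_mul,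
    Units.val_pow_eq_pow_val, inv_inv, mul_pow, inv_pow, Matrix.cons_val_zero, Matrix.cons_val_one]
  generalize ((L⁻¹ : (FnR 𝕜 V)ˣ) : FnR 𝕜 V) = Li at *
  generalize ((S⁻¹ : (FnR 𝕜 V)ˣ) : FnR 𝕜 V) = Si at *
  have e1 : (L : FnR 𝕜 V) * Li * (S * Si) ^ 2 = 1 := by rw [hLi, hSi]; ring
  have e2 : ((L : FnR 𝕜 V) * Li) ^ 2 * (S * Si) ^ 4 = 1 := by rw [hLi, hSi]; ring
  refine ⟨?_, ?_⟩
  · refine Eq.trans (b := (L * Li * (S * Si) ^ 2) * (m A' 0 * (oR h 0 * derR h (0, 0) f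
      + oR h 1 * derR h (1, 0) f) + m A' 1 * (oR h 0 * derR h (0, 1) f + oR h 1 * derR h (1, 1) f)))
      (by ring) (by rw [e1, one_mul])
  · refine Eq.trans (b := ((L * Li) ^ 2 * (S * Si) ^ 4) * (((β⁻¹ : (FnR 𝕜 V)ˣ) : FnR 𝕜 V)
      * (m A' 0 * (iotaR h 0 * derR h (0, 0) f + iotaR h 1 * derR h (1, 0) f)
        + m A' 1 * (iotaR h 0 * derR h (0, 1) f + iotaR h 1 * derR h (1, 1) f))))
      (by ring) (by rw [e2, one_mul])

end SpinGeometry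
end ConformalHH

end

open ConformalHH ConformalHH.SpinGeometry in
theorem mainTheorem1 {𝕜 : Type*} [RCLike 𝕜] [NormedAlgebra 𝕜 ℂ] {M : Type*} [TopologicalSpace M]
    [ChartedSpace (Fin 4 → 𝕜) M] [IsManifold 𝓘(𝕜, Fin 4 → 𝕜) ω M]
    (U : Set M) (hU : IsOpen U)
    (D : ConformalHH.SpinGeometry 𝕜 M) (hD : D.IsRegularOn U)
    (w : ∀ x : M, ConformalHH.T 𝕜 x →ₗ[𝕜] ℂ) (Ω₀ : M → ℂ)
    (hΩ₀ : ContMDiffOn 𝓘(𝕜, Fin 4 → 𝕜) 𝓘(𝕜, ℂ) ω Ω₀ U) (hΩ₀_ne : ∀ x ∈ U, Ω₀ x ≠ 0)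
    (hw : ∀ x ∈ U, w x = -((Ω₀ x)⁻¹ • ConformalHH.diff 𝕜 Ω₀ x))
    (hEW : D.IsEinsteinWeylOn w U)
    (hSF : D.IsShearFreeOn U) (hPS : D.IsRepeatedPrincipalOn U)
    (hLee : D.HasGradientLeeFormOn U) :
    ∀ x₀ ∈ U, ∃ V : Set M, IsOpen V ∧ x₀ ∈ V ∧ V ⊆ U ∧ ∃ Φ K : M → ℂ,
      ContMDiffOn 𝓘(𝕜, Fin 4 → 𝕜) 𝓘(𝕜, ℂ) ω Φ V ∧
      ContMDiffOn 𝓘(𝕜, Fin 4 → 𝕜) 𝓘(𝕜, ℂ) ω K V ∧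
      D.IsHHPotentialOn Ω₀ Φ K V ∧
      ∀ lam s : M → ℂ,
        ContMDiffOn 𝓘(𝕜, Fin 4 → 𝕜) 𝓘(𝕜, ℂ) ω lam V →
        ContMDiffOn 𝓘(𝕜, Fin 4 → 𝕜) 𝓘(𝕜, ℂ) ω s V →
        (∀ x ∈ V, lam x ≠ 0 ∧ s x ≠ 0) →
        (D.gauge lam s).IsHHPotentialOn (ConformalHH.rescale lam s 0 1 Ω₀)
          (ConformalHH.rescale lam s (-4) (-1) Φ) (ConformalHH.rescale lam s (-4) (-3) K) V := by
  intro x₀ hx₀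
  obtain ⟨V, hxV, hVU, h, φ, u, m, b, β, p, q, F, E, hu, hbm, hdet, hE, hN, hJ⟩ :=
    exists_isJet_nhds hU hD hΩ₀ hΩ₀_ne hw hEW hSF hLee hx₀
  obtain ⟨Φ, hΦ⟩ := exists_rep ((((β * φ⁻¹) ^ 2 * φ : (FnR 𝕜 V)ˣ) : FnR 𝕜 V) * F)
  obtain ⟨K, hK⟩ := exists_rep ((((β * φ⁻¹) ^ 2 * φ ^ 3 : (FnR 𝕜 V)ˣ) : FnR 𝕜 V)
    * (half (FnR 𝕜 V) * hhExpr (E (0, 0)) (E (0, 1)) (nfU E p) (nfV E p) (E (1, 0) (p 0))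
      (E (1, 0) (p 1)) (E (1, 1) (p 0)) F (u * φ : FnR 𝕜 V)))
  have hO : IsUnit (u * φ : FnR 𝕜 V) := (u * φ).isUnit
  have hcont : ∀ {a : FnR 𝕜 V} {f : M → ℂ}, Rep a f → ContMDiffOn 𝓘(𝕜, Fin 4 → 𝕜) 𝓘(𝕜, ℂ) ω f V :=
    fun ha x hx => (ha.isAn hx).contMDiffWithinAt
  refine ⟨V, V.2, hxV, hVU, Φ, K, hcont hΦ, hcont hK,
    isHHPotentialOn_of_isJet V h hO hbm hdet hE hN hJ (by rwa [φ.mul_inv_cancel_right]) hΦ hK,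
    fun lam s hlam hs h0 => ?_⟩
  have h' : ∀ᶠ x in Filter.principal (V : Set M), (D.gauge lam s).IsRegularAt x := fun x hx =>
    ⟨V, V.2, hx, (⟨fun a x hx => hD.analytic_frame a x (hVU hx), fun x hx => hD.null_tetrad x (hVU hx),
      fun A => (hD.analytic_o A).mono hVU, fun A => (hD.analytic_iota A).mono hVU,
      fun x hx => hD.normalised x (hVU hx)⟩ : D.IsRegularOn V).gauge V.2 hlam hs h0⟩
  obtain ⟨L, hL⟩ := exists_unit_rep V.2 (l := Filter.principal (V : Set M)) le_rfl hlam
    fun x hx => (h0 x hx).1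
  obtain ⟨S, hS⟩ := exists_unit_rep V.2 (l := Filter.principal (V : Set M)) le_rfl hs
    fun x hx => (h0 x hx).2
  have hL4 : (L⁻¹ ^ 2) ^ 2 = L ^ (-4 : ℤ) := by
    rw [← pow_mul, zpow_neg, inv_pow]
    rfl
  have hβ : β * (L⁻¹ * S⁻¹) ^ 2 * (φ * (S ^ 2)⁻¹)⁻¹ = L⁻¹ ^ 2 * (β * φ⁻¹) := by
    rw [mul_inv, inv_inv, mul_pow, inv_pow S, mul_mul_mul_comm, inv_mul_cancel_right, mul_comm]
  -- the same normal frame `E`, reached from the rescaled spin frame: only `b`, `β` and `Ω` change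
  refine isHHPotentialOn_of_isJet V h' (b := ((L * S⁻¹ : (FnR 𝕜 V)ˣ) : FnR 𝕜 V) • b)
    (Ω := φ * (S ^ 2)⁻¹) hO ?_ ?_ ((adE_gauge h h' hL hS m β).trans hE) hN hJ
    ((rep_rescale hL hS 0 1 hu).of_ring_eq ?_) ((rep_rescale hL hS (-4) (-1) hΦ).of_ring_eq ?_)
    ((rep_rescale hL hS (-4) (-3) hK).of_ring_eq ?_)
  · rw [Matrix.smul_mul, Matrix.mul_smul, hbm, smul_smul, ← Units.val_mul,
      show L * S⁻¹ * (S * L⁻¹) = 1 by group, Units.val_one, one_smul]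
  · rw [Matrix.det_smul, Fintype.card_fin]
    have h1 : (β * (L⁻¹ * S⁻¹) ^ 2) * (L * S⁻¹) ^ 2 = (S ^ 2)⁻¹ ^ 2 * β := by
      have : (L⁻¹ * S⁻¹) * (L * S⁻¹) = (S ^ 2)⁻¹ := by
        rw [mul_mul_mul_comm, inv_mul_cancel, one_mul, pow_two, mul_inv]
      rw [mul_assoc, ← mul_pow, this, mul_comm]
    rw [← mul_assoc, ← Units.val_pow_eq_pow_val, ← Units.val_mul, h1, Units.val_mul, mul_assoc, hdet,
      Units.val_pow_eq_pow_val, Units.val_mul]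
    ring
  · rw [← Units.val_mul, ← Units.val_mul, ← Units.val_mul, zpow_zero, one_mul, zpow_one, mul_inv, inv_inv,
      mul_assoc u, mul_inv_cancel_left, mul_comm u]
  · have h2 : (β * (L⁻¹ * S⁻¹) ^ 2 * (φ * (S ^ 2)⁻¹)⁻¹) ^ 2 * (φ * (S ^ 2)⁻¹)
        = L ^ (-4 : ℤ) * (S ^ 2) ^ (-1 : ℤ) * ((β * φ⁻¹) ^ 2 * φ) := by
      rw [hβ, mul_pow, mul_comm φ, mul_mul_mul_comm, hL4, zpow_neg_one]
    rw [h2, Units.val_mul, mul_assoc]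
  · have h3 : (S ^ 2)⁻¹ ^ 3 = (S ^ 2) ^ (-3 : ℤ) := by
      rw [zpow_neg, inv_pow]
      rfl
    have h2 : (β * (L⁻¹ * S⁻¹) ^ 2 * (φ * (S ^ 2)⁻¹)⁻¹) ^ 2 * (φ * (S ^ 2)⁻¹) ^ 3
        = L ^ (-4 : ℤ) * (S ^ 2) ^ (-3 : ℤ) * ((β * φ⁻¹) ^ 2 * φ ^ 3) := by
      rw [hβ, mul_pow, mul_pow φ, mul_comm (φ ^ 3), mul_mul_mul_comm, hL4, h3]
    rw [h2, Units.val_mul, mul_assoc]
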